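/- **Gluing lemma for manifolds.** Conventions. $M_K$ is the two-dimensional Lorentzian model space of constant curvature $K\in\mathbb R$ (scaled de Sitter space for $K>0$, the Minkowski plane for $K=0$, scaled anti-de Sitter space for $K<0$), with time separation $\bar\tau$. For points $a,b$ in a (convex) normal neighbourhood $N$ of a spacetime with metric $g$, let $\gamma_{ab}:[0,1]\to N$ be the unique geodesic in $N$ from $a$ to $b$, and let $|ab|_\pm$ be the signed length of $v=\gamma_{ab}'(0)$, that is, $\sqrt{g(v,v)}$ if $g(v,v)\ge 0$ and $-\sqrt{-g(v,v)}$ if $g(v,v)<0$; signed distances in $M_K$ are defined in the same way. Let $X$ be a Lorentzian pre-length space and let $X_1,X_2$ be smooth strongly causal spacetimes with time separation functions $\tau_1,\tau_2$. Let $U\subseteq X$ and $U_i\subseteq X_i$ ($i=1,2$) be subsets such that the respective time separation is finite and continuous on $U\times U$ (on $U_i\times U_i$) and any two points of the set with $a\ll b$ are joined by a causal curve in the set that realizes the time separation from $a$ to $b$. Let $U_i$ be contained in a normal neighbourhood $N_i$ of $X_i$, with respect to which signed distances are measured. Let $T_3=\Delta(x,y,z)$ be a timelike triangle in $U$: $x\ll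 y\ll z$, with $\tau$-realizing sides $[x,y],[y,z],[x,z]$ in $U$, satisfying the size bounds for $M_K$ (if $K<0$, then $\tau(x,z)<\pi/\sqrt{-K}$). Let $p\in[x,z]$ with $x\ll p\ll z$, dividing $[x,z]$ into $[x,p]$ and $[p,z]$. Let $T_1=\Delta(x^1,p^1,y^1)$ in $U_1$ and $T_2=\Delta(p^2,y^2,z^2)$ in $U_2$ be geodesic triangles whose sides $[x^1,p^1]$, $[x^1,y^1]$, $[p^2,z^2]$, $[y^2,z^2]$ are future-directed timelike geodesics that realize the time separation of their endpoints, while $[p^1,y^1]$ and $[p^2,y^2]$ are geodesics of arbitrary causal character. Assume $$\tau_1(x^1,p^1)=\tau(x,p),\quad \tau_1(x^1,y^1)=\tau(x,y),\quad \tau_2(p^2,z^2)=\tau(p,z),\quad \tau_2(y^2,z^2)=\tau(y,z),\quad |p^1y^1|_\pm=|p^2y^2|_\pm .$$ Assume that $T_3$ is glued from $T_1$ and $T_2$ in the following sense: there are maps $\varphi_i$ from (the points of) $T_i$ to $X$ such that, for all $a,b\in T_i$, $a\le b$ implies $\varphi_i(a)\le\varphi_i(b)$, and $\tau_i(a,b)\le\tau(\varphi_i(a),\varphi_i(b))$;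 $\varphi_1$ sends $x^1,p^1,y^1$ to $x,p,y$ and $\varphi_2$ sends $p^2,y^2,z^2$ to $p,y,z$; $\varphi_1$ maps the sides $[x^1,p^1],[x^1,y^1]$ onto $[x,p],[x,y]$ and $\varphi_2$ maps $[p^2,z^2],[y^2,z^2]$ onto $[p,z],[y,z]$; and $\varphi_1(\gamma_{p^1y^1}(s))=\varphi_2(\gamma_{p^2y^2}(s))$ for all $s\in[0,1]$. Suppose that $T_1$ and $T_2$ satisfy the upper curvature bound $K$ in the sense of Alexander and Bishop: $T_i$ has a comparison triangle $\bar T_i$ in $M_K$ with the same signed side lengths, and $|ab|_\pm\le|\bar a\bar b|_\pm$ for all points $a,b$ of $T_i$ and the corresponding points $\bar a,\bar b$ of $\bar T_i$ (same affine parameter on the corresponding side). Then $T_3$ has timelike curvature bounded above by $K$: for every comparison triangle $\bar T_3=\Delta(\bar x,\bar y,\bar z)$ of $T_3$ in $M_K$, all points $a,b$ on the sides of $T_3$ and the corresponding points $\bar a,\bar b$ on the sides of $\bar T_3$, one has $\tau(a,b)\ge\bar\tau(\bar a,\bar b)$. -/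

import Mathlib

open Set Filter Topology MeasureTheory Manifold Bundle
open scoped ENNReal NNReal ContDiff

noncomputable section

/-! ### Lorentzian pre-length spaces -/

/-- A Lorentzian pre-length space on the metric space `X`. -/
structure LorentzianPreLengthSpace (X : Type*) [MetricSpace X] where
  /-- the chronological relation -/
  ll : X → X → Prop
  /-- the causal relation -/
  le : X → X → Prop
  /-- the time separation function -/
  tau : X → X → ℝ≥0∞
  le_refl : ∀ x, le x x
  le_trans : ∀ x y z, le x y → le y z → le x z
  ll_trans : ∀ x y z, ll x y → ll y z → ll x z
  le_of_ll : ∀ x y, ll x y → le x y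
  lowerSemicontinuous_tau : LowerSemicontinuous fun q : X × X => tau q.1 q.2
  reverse_triangle : ∀ x y z, le x y → le y z → tau x y + tau y z ≤ tau x z
  tau_pos_iff : ∀ x y, 0 < tau x y ↔ ll x y

namespace LorentzianPreLengthSpace

variable {X : Type*} [MetricSpace X] (L : LorentzianPreLengthSpace X)

/-- A future-directed causal curve, parametrized on `[0, 1]`. -/
def IsCausalCurve (γ : ℝ → X) : Prop :=
  LocallyLipschitzOn (Icc 0 1) γ ∧
    ∀ s ∈ Icc (0 : ℝ) 1, ∀ t ∈ Icc (0 : ℝ) 1, s < t → L.le (γ s) (γ t)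

/-- The `τ`-length of a curve parametrized on `[0, 1]`: the infimum, over all partitions
`0 = t 0 < t 1 < ⋯ < t (n + 1) = 1`, of the sum of the time separations. -/
def tauLength (γ : ℝ → X) : ℝ≥0∞ :=
  ⨅ (n : ℕ) (t : ℕ → ℝ) (_ : t 0 = 0 ∧ t (n + 1) = 1 ∧ StrictMonoOn t (Iic (n + 1))),
    ∑ i ∈ Finset.range (n + 1), L.tau (γ (t i)) (γ (t (i + 1)))

/-- `γ` is a `τ`-realizing causal curve from `x` to `y` that is contained in `U`; its image is a
geodesic segment `[x, y]`. -/
def IsRealizingCurve (U : Set X) (γ : ℝ → X) (x y : X) : Prop :=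
  L.IsCausalCurve γ ∧ MapsTo γ (Icc 0 1) U ∧ γ 0 = x ∧ γ 1 = y ∧ L.tauLength γ = L.tau x y

/-- The first two requirements on a comparison neighbourhood: `τ` is finite and continuous on
`U × U`, and any two timelike related points of `U` are joined by a `τ`-realizing curve in `U`. -/
def IsTimelikeGeodesicSet (U : Set X) : Prop :=
  (∀ x ∈ U, ∀ y ∈ U, L.tau x y ≠ ⊤) ∧
  ContinuousOn (fun q : X × X => L.tau q.1 q.2) (U ×ˢ U) ∧
  ∀ x ∈ U, ∀ y ∈ U, L.ll x y → ∃ γ, L.IsRealizingCurve U γ x y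

/-- A timelike triangle in `U`: points `x ≪ y ≪ z` and `τ`-realizing curves from `x` to `y`,
from `y` to `z` and from `x` to `z`, all contained in `U`. -/
def IsTimelikeTriangle (U : Set X) (x y z : X) (γxy γyz γxz : ℝ → X) : Prop :=
  L.ll x y ∧ L.ll y z ∧ L.IsRealizingCurve U γxy x y ∧ L.IsRealizingCurve U γyz y z ∧
    L.IsRealizingCurve U γxz x z

end LorentzianPreLengthSpace

/-! ### The Lorentzian model surfaces

`M_K` is the surface `K (-t² + x²) + w² = 1` in `ℝ³` (for `K = 0` its component `w = 1`) with the
metric induced by `-dt² + dx² + K⁻¹ dw²`. This is de Sitter space with radius `1 / √K` for `K > 0`,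
the Minkowski plane for `K = 0` (where `K⁻¹ = 0` and `dw = 0`), and anti-de Sitter space for
`K < 0`. -/

namespace LorentzModel

/-- The points of `M_K`, with ambient coordinates `(t, x, w)`. -/
def points (K : ℝ) : Set (ℝ × ℝ × ℝ) :=
  {p | K * (-p.1 ^ 2 + p.2.1 ^ 2) + p.2.2 ^ 2 = 1 ∧ (K = 0 → p.2.2 = 1)}

/-- `v` is tangent to `M_K` at `p`. -/
def IsTangent (K : ℝ) (p v : ℝ × ℝ × ℝ) : Prop :=
  K * (-(p.1 * v.1) + p.2.1 * v.2.1) + p.2.2 * v.2.2 = 0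

/-- The Lorentzian quadratic form `⟨v, v⟩` on tangent vectors of `M_K`. -/
def energy (K : ℝ) (v : ℝ × ℝ × ℝ) : ℝ :=
  -v.1 ^ 2 + v.2.1 ^ 2 + K⁻¹ * v.2.2 ^ 2

/-- The time orientation of `M_K`: whether a timelike tangent vector `v` at `p` points to the
future (the increasing time coordinate `t` if `0 ≤ K`, the increasing angle in the `(w, t)`-plane
if `K < 0`). -/
def IsFuture (K : ℝ) (p v : ℝ × ℝ × ℝ) : Prop :=
  if K < 0 then 0 < p.2.2 * v.1 - p.1 * v.2.2 else 0 < v.1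

/-- `cos √κ`, extended analytically to all real `κ`. -/
def genCos (κ : ℝ) : ℝ :=
  if 0 ≤ κ then Real.cos √κ else Real.cosh √(-κ)

/-- `sin √κ / √κ`, extended analytically to all real `κ`. -/
def genSinc (κ : ℝ) : ℝ :=
  if 0 < κ then Real.sin √κ / √κ else if κ < 0 then Real.sinh √(-κ) / √(-κ) else 1

/-- The exponential map of `M_K`: `s ↦ exp K p (s • v)` is the geodesic with initial point `p` and
initial velocity `v`. -/
def exp (K : ℝ) (p v : ℝ × ℝ × ℝ) : ℝ × ℝ × ℝ :=
  genCos (K * energy K v) • p + genSinc (K * energy K v) • v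

/-- `v` is the initial velocity of the geodesic `[0, 1] → M_K` from `p` to `q`; the bound keeps the
geodesic before the first conjugate point, and within it `v` is unique. -/
def IsLog (K : ℝ) (p q v : ℝ × ℝ × ℝ) : Prop :=
  IsTangent K p v ∧ K * energy K v < Real.pi ^ 2 ∧ exp K p v = q

/-- `p` and `q` are joined by a geodesic of `M_K` without conjugate points. -/
def Joined (K : ℝ) (p q : ℝ × ℝ × ℝ) : Prop := ∃ v, IsLog K p q v

open Classical in
/-- The initial velocity of the geodesic `[0, 1] → M_K` from `p` to `q`, if there is one. -/
def log (K : ℝ) (p q : ℝ × ℝ × ℝ) : ℝ × ℝ × ℝ :=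
  if h : Joined K p q then h.choose else 0

/-- The point with parameter `s ∈ [0, 1]` on the geodesic from `p` to `q`. -/
def seg (K : ℝ) (p q : ℝ × ℝ × ℝ) (s : ℝ) : ℝ × ℝ × ℝ := exp K p (s • log K p q)

end LorentzModel

/-- `sgn(e) √|e|`: the signed length of a vector `v` with `⟨v, v⟩ = e`. -/
def signedRoot (e : ℝ) : ℝ := if 0 ≤ e then √e else -√(-e)

namespace LorentzModel

/-- The signed distance of two points of `M_K`. -/
def signedDist (K : ℝ) (p q : ℝ × ℝ × ℝ) : ℝ := signedRoot (energy K (log K p q))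

open Classical in
/-- The time separation of two points of `M_K`: the length of the future-directed timelike geodesic
from `p` to `q` if there is one, and `0` otherwise. -/
def tau (K : ℝ) (p q : ℝ × ℝ × ℝ) : ℝ :=
  if Joined K p q ∧ energy K (log K p q) < 0 ∧ IsFuture K p (log K p q) then
    √(-energy K (log K p q)) else 0

end LorentzModel

/-! ### Timelike curvature bounds for a single triangle -/

namespace LorentzianPreLengthSpace

variable {X : Type*} [MetricSpace X] (L : LorentzianPreLengthSpace X)

/-- `Δ(x', y', z')` is a comparison triangle in `M_K` for the timelike triangle `Δ(x, y, z)`. -/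
def IsComparisonTriangle (K : ℝ) (x y z : X) (x' y' z' : ℝ × ℝ × ℝ) : Prop :=
  x' ∈ LorentzModel.points K ∧ y' ∈ LorentzModel.points K ∧ z' ∈ LorentzModel.points K ∧
  ENNReal.ofReal (LorentzModel.tau K x' y') = L.tau x y ∧
  ENNReal.ofReal (LorentzModel.tau K y' z') = L.tau y z ∧
  ENNReal.ofReal (LorentzModel.tau K x' z') = L.tau x z

/-- `a'` on the side `[x', y']` of a comparison triangle is the comparison point of `a` on the side
`[x, y] = γ([0, 1])`. -/
def IsComparisonPoint (K : ℝ) (γ : ℝ → X) (x' y' : ℝ × ℝ × ℝ) (a : X) (a' : ℝ × ℝ × ℝ) :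
    Prop :=
  a ∈ γ '' Icc 0 1 ∧ a' ∈ LorentzModel.seg K x' y' '' Icc 0 1 ∧
    ENNReal.ofReal (LorentzModel.tau K x' a') = L.tau (γ 0) a

/-- The timelike triangle with the given sides has timelike curvature bounded above by `K`:
`τ(a, b) ≥ τ'(a', b')` for all points `a, b` on its sides and their comparison points `a', b'`. -/
def TriangleCurvatureBoundedAbove (K : ℝ) (x y z : X) (γxy γyz γxz : ℝ → X) : Prop :=
  ∀ x' y' z', L.IsComparisonTriangle K x y z x' y' z' →
    ∀ (a b : X) (a' b' : ℝ × ℝ × ℝ),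
      (L.IsComparisonPoint K γxy x' y' a a' ∨ L.IsComparisonPoint K γyz y' z' a a' ∨
        L.IsComparisonPoint K γxz x' z' a a') →
      (L.IsComparisonPoint K γxy x' y' b b' ∨ L.IsComparisonPoint K γyz y' z' b b' ∨
        L.IsComparisonPoint K γxz x' z' b b') →
      ENNReal.ofReal (LorentzModel.tau K a' b') ≤ L.tau a b

end LorentzianPreLengthSpace

/-! ### Spacetimes -/

/-- A smooth spacetime structure on the manifold `M` (of dimension at least two): a smooth
Lorentzian metric of signature `(-, +, …, +)` and a time orientation, given by a continuous timelike
vector field. -/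
structure Spacetime (E : Type*) [NormedAddCommGroup E] [NormedSpace ℝ E] [FiniteDimensional ℝ E]
    (M : Type*) [TopologicalSpace M] [ChartedSpace E M] [IsManifold 𝓘(ℝ, E) ∞ M] where
  /-- the Lorentzian metric -/
  metric (p : M) :
    TangentSpace 𝓘(ℝ, E) p →L[ℝ] TangentSpace 𝓘(ℝ, E) p →L[ℝ] ℝ
  /-- the vector field that defines the future -/
  timeField (p : M) : TangentSpace 𝓘(ℝ, E) p
  two_le_dim : 2 ≤ Module.finrank ℝ E
  symm : ∀ (p : M) (v w : TangentSpace 𝓘(ℝ, E) p), metric p v w = metric p w v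
  contMDiff_metric : ContMDiff 𝓘(ℝ, E) (𝓘(ℝ, E).prod 𝓘(ℝ, E →L[ℝ] E →L[ℝ] ℝ)) ∞
    (fun p => TotalSpace.mk' (E →L[ℝ] E →L[ℝ] ℝ)
      (E := fun p : M => TangentSpace 𝓘(ℝ, E) p →L[ℝ] TangentSpace 𝓘(ℝ, E) p →L[ℝ] ℝ)
      p (metric p))
  timeField_timelike : ∀ p : M, metric p (timeField p) (timeField p) < 0
  pos_of_orthogonal : ∀ (p : M) (w : TangentSpace 𝓘(ℝ, E) p),
    metric p (timeField p) w = 0 → w ≠ 0 → 0 < metric p w w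
  continuous_timeField : Continuous fun p => (⟨p, timeField p⟩ : TangentBundle 𝓘(ℝ, E) M)

namespace Spacetime

variable {E : Type*} [NormedAddCommGroup E] [NormedSpace ℝ E] [FiniteDimensional ℝ E]
  {M : Type*} [TopologicalSpace M] [ChartedSpace E M] [IsManifold 𝓘(ℝ, E) ∞ M]
  (S : Spacetime E M)

/-- The velocity at the parameter `t ∈ [0, 1]` of a curve on `[0, 1]`. -/
def velocity (γ : ℝ → M) (t : ℝ) : TangentSpace 𝓘(ℝ, E) (γ t) :=
  mfderivWithin 𝓘(ℝ, ℝ) 𝓘(ℝ, E) γ (Icc 0 1) t (1 : ℝ)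

/-- `⟨v, v⟩` for a tangent vector `v` at `p`. -/
def energy (p : M) (v : TangentSpace 𝓘(ℝ, E) p) : ℝ := S.metric p v v

/-- `v` is a future-directed timelike vector. -/
def IsFutureTimelike (p : M) (v : TangentSpace 𝓘(ℝ, E) p) : Prop :=
  S.metric p v v < 0 ∧ S.metric p v (S.timeField p) < 0

/-- `v` is a future-directed causal vector. -/
def IsFutureCausal (p : M) (v : TangentSpace 𝓘(ℝ, E) p) : Prop :=
  S.metric p v v ≤ 0 ∧ v ≠ 0 ∧ S.metric p v (S.timeField p) < 0

/-- A `C¹` future-directed causal curve on `[0, 1]`. -/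
def IsCausalCurve (γ : ℝ → M) : Prop :=
  ContMDiffOn 𝓘(ℝ, ℝ) 𝓘(ℝ, E) 1 γ (Icc 0 1) ∧
    ∀ t ∈ Icc (0 : ℝ) 1, S.IsFutureCausal (γ t) (velocity γ t)

/-- A `C¹` future-directed timelike curve on `[0, 1]`. -/
def IsTimelikeCurve (γ : ℝ → M) : Prop :=
  ContMDiffOn 𝓘(ℝ, ℝ) 𝓘(ℝ, E) 1 γ (Icc 0 1) ∧
    ∀ t ∈ Icc (0 : ℝ) 1, S.IsFutureTimelike (γ t) (velocity γ t)

/-- The Lorentzian length of a `C¹` causal curve. -/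
def curveLength (γ : ℝ → M) : ℝ :=
  ∫ t in (0 : ℝ)..1, √(-S.energy (γ t) (velocity γ t))

/-- `S.CausalPath U p q ℓ`: there is a piecewise `C¹` future-directed causal curve (possibly
constant) from `p` to `q` that is contained in `U` and has Lorentzian length `ℓ`. -/
inductive CausalPath (U : Set M) : M → M → ℝ → Prop
  | refl (p : M) (hp : p ∈ U) : CausalPath U p p 0
  | cons (γ : ℝ → M) (r : M) (ℓ : ℝ) (hγ : S.IsCausalCurve γ) (hU : MapsTo γ (Icc 0 1) U)
      (h : CausalPath U (γ 1) r ℓ) : CausalPath U (γ 0) r (S.curveLength γ + ℓ)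

/-- The causal relation of a spacetime. -/
def le (p q : M) : Prop := ∃ ℓ, S.CausalPath univ p q ℓ

/-- The chronological relation of a spacetime: there is a piecewise `C¹` future-directed timelike
curve from `p` to `q`. -/
def ll (p q : M) : Prop :=
  Relation.TransGen (fun a b => ∃ γ : ℝ → M, S.IsTimelikeCurve γ ∧ γ 0 = a ∧ γ 1 = b) p q

/-- The time separation function of a spacetime. -/
def tau (p q : M) : ℝ≥0∞ :=
  ⨆ (ℓ : ℝ) (_ : S.CausalPath univ p q ℓ), ENNReal.ofReal ℓ

/-- Strong causality: every neighbourhood `W` of a point contains a neighbourhood `V` of it such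
that causal curves with endpoints in `V` do not leave `W`. -/
def IsStronglyCausal : Prop :=
  ∀ p : M, ∀ W ∈ 𝓝 p, ∃ V ∈ 𝓝 p, V ⊆ W ∧
    ∀ a ∈ V, ∀ b ∈ V, ∀ c, S.le a c → S.le c b → c ∈ W

/-- The first two requirements on a comparison neighbourhood, in a spacetime: `τ` is finite and
continuous on `U × U`, and any `p ≪ q` in `U` are joined by a causal curve in `U` with length
`τ(p, q)`. -/
def IsTimelikeGeodesicSet (U : Set M) : Prop :=
  (∀ p ∈ U, ∀ q ∈ U, S.tau p q ≠ ⊤) ∧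
  ContinuousOn (fun r : M × M => S.tau r.1 r.2) (U ×ˢ U) ∧
  ∀ p ∈ U, ∀ q ∈ U, S.ll p q → ∃ ℓ, S.CausalPath U p q ℓ ∧ ENNReal.ofReal ℓ = S.tau p q

/-- The metric in the preferred chart at `c`: `g_u(v, w)` for `u` in the target of the chart. -/
def coordMetric (c : M) (u v w : E) : ℝ :=
  S.metric ((extChartAt 𝓘(ℝ, E) c).symm u)
    (mfderiv 𝓘(ℝ, E) 𝓘(ℝ, E) (extChartAt 𝓘(ℝ, E) c).symm u v)
    (mfderiv 𝓘(ℝ, E) 𝓘(ℝ, E) (extChartAt 𝓘(ℝ, E) c).symm u w)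

/-- The curve `γ` on `[0, 1]` is a geodesic. At each `t`, in the chart at `γ t`, the coordinate
representation `u` of `γ` satisfies the geodesic equation with lowered index:
`g(u'', w) + (∂_{u'} g)(u', w) - ½ (∂_w g)(u', u') = 0` for all `w`. -/
def IsGeodesic (γ : ℝ → M) : Prop :=
  ContMDiffOn 𝓘(ℝ, ℝ) 𝓘(ℝ, E) ∞ γ (Icc 0 1) ∧
  ∀ t ∈ Icc (0 : ℝ) 1, ∀ w : E,
    let u : ℝ → E := fun s => extChartAt 𝓘(ℝ, E) (γ t) (γ s)
    let u₁ : E := derivWithin u (Icc 0 1) t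
    let u₂ : E := derivWithin (derivWithin u (Icc 0 1)) (Icc 0 1) t
    S.coordMetric (γ t) (u t) u₂ w + fderiv ℝ (fun y => S.coordMetric (γ t) y u₁ w) (u t) u₁
      - (1 / 2) * fderiv ℝ (fun y => S.coordMetric (γ t) y u₁ u₁) (u t) w = 0

/-- `γ` is a geodesic `[0, 1] → U` from `p` to `q`. -/
def IsGeodesicIn (U : Set M) (γ : ℝ → M) (p q : M) : Prop :=
  S.IsGeodesic γ ∧ MapsTo γ (Icc 0 1) U ∧ γ 0 = p ∧ γ 1 = q

/-- A (convex) normal neighbourhood: an open set `N` that is, for each of its points `p`, the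
diffeomorphic image under the exponential map at `p` of an open subset of the tangent space which is
star-shaped with respect to `0`, and in which any two points are joined by exactly one geodesic.
Here `e v` is the endpoint of the geodesic with initial point `p` and initial velocity `v`. -/
def IsNormalNeighbourhood (N : Set M) : Prop :=
  IsOpen N ∧
  (∀ p ∈ N, ∃ (V : Set E) (e : E → M), IsOpen V ∧ 0 ∈ V ∧ StarConvex ℝ 0 V ∧
    ContMDiffOn 𝓘(ℝ, E) 𝓘(ℝ, E) ∞ e V ∧ InjOn e V ∧ e '' V = N ∧
    (∀ v ∈ V, Function.Bijective (mfderiv 𝓘(ℝ, E) 𝓘(ℝ, E) e v)) ∧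
    ∀ v ∈ V, S.IsGeodesicIn N (fun t : ℝ => e (t • v)) p (e v) ∧
      (velocity (fun t : ℝ => e (t • v)) 0 : E) = v) ∧
  ∀ p ∈ N, ∀ q ∈ N, ∀ γ₁ γ₂ : ℝ → M, S.IsGeodesicIn N γ₁ p q → S.IsGeodesicIn N γ₂ p q →
    EqOn γ₁ γ₂ (Icc 0 1)

open Classical in
/-- The signed distance of `p` and `q` in the normal neighbourhood `N`: the signed length of the
initial velocity of the geodesic `[0, 1] → N` from `p` to `q`. -/
def signedDist (N : Set M) (p q : M) : ℝ :=
  if h : ∃ γ : ℝ → M, S.IsGeodesicIn N γ p q then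
    signedRoot (S.energy (h.choose 0) (velocity h.choose 0))
  else 0

/-- The points `p` and `q` are the endpoints of a `τ`-realizing future-directed timelike geodesic
in `U`. -/
def JoinedByTimelikeSegment (U : Set M) (p q : M) : Prop :=
  ∃ γ : ℝ → M, S.IsGeodesicIn U γ p q ∧ S.IsFutureTimelike (γ 0) (velocity γ 0) ∧
    S.tau p q = ENNReal.ofReal √(-S.energy (γ 0) (velocity γ 0))

/-- A geodesic triangle in `U` with vertices `p q r`, in this order: its sides are geodesics
`σ 0` from `p` to `q`, `σ 1` from `q` to `r` and `σ 2` from `r` to `p` in `U`, of any causal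
character. -/
def IsGeodesicTriangle (U : Set M) (p q r : M) (σ : Fin 3 → ℝ → M) : Prop :=
  S.IsGeodesicIn U (σ 0) p q ∧ S.IsGeodesicIn U (σ 1) q r ∧ S.IsGeodesicIn U (σ 2) r p

/-- The set of points of a triangle with sides `σ 0`, `σ 1`, `σ 2`. -/
def trianglePoints (σ : Fin 3 → ℝ → M) : Set M := ⋃ i, σ i '' Icc 0 1

/-- The geodesic triangle with sides `σ` in the normal neighbourhood `N` satisfies the curvature
bound above by `K` in the sense of Alexander and Bishop: it has a comparison triangle in `M_K`, with
vertices `v 0`, `v 1`, `v 2` and the same signed side lengths, and `|ab|_± ≤ |a'b'|_±` for all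
points `a, b` of the triangle and the corresponding points `a', b'` of the comparison triangle. -/
def SatisfiesCurvatureBoundAbove (K : ℝ) (N : Set M) (σ : Fin 3 → ℝ → M) : Prop :=
  ∃ v : Fin 3 → ℝ × ℝ × ℝ,
    (∀ i, v i ∈ LorentzModel.points K ∧ LorentzModel.Joined K (v i) (v (i + 1)) ∧
      S.signedDist N (σ i 0) (σ i 1) = LorentzModel.signedDist K (v i) (v (i + 1))) ∧
    ∀ i j, ∀ s ∈ Icc (0 : ℝ) 1, ∀ t ∈ Icc (0 : ℝ) 1,
      S.signedDist N (σ i s) (σ j t) ≤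
        LorentzModel.signedDist K (LorentzModel.seg K (v i) (v (i + 1)) s)
          (LorentzModel.seg K (v j) (v (j + 1)) t)

end Spacetime

end

/-! All comparisons are made with the chord of two points of the model surface, half of their
squared distance in the ambient space. It makes sense for every causal character, it determines the
energy of the joining geodesic, and for timelike pairs it is a strictly decreasing function of the
time separation (`chord_le_iff`). Along a geodesic it obeys a linear cosine law (`chord_line`).
Eliminating the initial slope gives Stewart's formula, so the chord from a point to a point of a
side is monotone in the chords to the ends of that side (`chord_seg_le`).

The hypotheses on the two small triangles are used as follows. A geodesic has constant energy, so a
negative signed distance is the negative length of a timelike geodesic and bounds the time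
separation from below in one of the two directions. With the Alexander-Bishop inequality, timelike
related comparison points yield points of the triangle that are related for at least as long, and
the gluing maps carry this into `X`. The direction of time is not part of the signed distance. It is
recovered by connectedness and by the impossibility of timelike detours that are longer than a
realizing side (`Comparable`, then `Oriented`).

The two comparison triangles contain copies of the common side with the same chord and time
orientation, but lie in two separate planes. A broken geodesic from a in one plane through the
common side to b in the other corresponds to a broken path in `X`, so the reverse triangle
inequality of `X` makes its length a lower bound for the time separation. It remains to prove that
the supremum of the broken lengths is at least the separation of the corresponding points in the
comparison triangle of the large triangle (`CrossLE`).

The tool for this is `Crossing.exists_unfolding`. If no broken length exceeds T, then b has a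
substitute b' in the plane of a, at time at most T from a, whose chords to the common side are at
most those of b. It is found by straightening the broken geodesic at a parameter where the first
variation of length vanishes, or at an end of the side where it has the favourable sign.

Unfolding z as seen from x, with T the separation of x' and z', forces equality in the reverse
triangle inequality, so p lies on the straight segment from x to the substitute of z. Monotonicity
then bounds the chord of p and y by the chord of the corresponding points (`Glued.chord_le`). This
plays the role of Alexandrov's lemma and settles pairs in the same small triangle. For pairs in
different triangles, a supremum that is too small would give a substitute too close to a,
contradicting monotonicity along a timelike side. That some crossing exists at all is propagated by
connectedness from a vertex (`crossSet_nonempty`). A relation leading from the second triangle back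
to the first forces p to precede y and excludes crossings at the ends, and then the substitute is an
exact copy. -/

set_option linter.unusedSectionVars false

noncomputable section

namespace Spacetime

/-! ### Smoothness of the metric along maps and in charts -/

section Geodesics

variable {E : Type*} [NormedAddCommGroup E] [NormedSpace ℝ E] [FiniteDimensional ℝ E]
  {M : Type*} [TopologicalSpace M] [ChartedSpace E M] [IsManifold 𝓘(ℝ, E) ∞ M]
  (S : Spacetime E M)

/-- The metric applied to two smooth vector fields along a smooth map is smooth. -/
lemma contMDiffWithinAt_metric {F : Type*} [NormedAddCommGroup F] [NormedSpace ℝ F] {n : ℕ∞}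
    {b : F → M} {v w : ∀ x, TangentSpace 𝓘(ℝ, E) (b x)} {s : Set F} {x : F}
    (hb : ContMDiffWithinAt 𝓘(ℝ, F) 𝓘(ℝ, E) n b s x)
    (hv : ContMDiffWithinAt 𝓘(ℝ, F) (𝓘(ℝ, E).prod 𝓘(ℝ, E)) n
      (fun m => (⟨b m, v m⟩ : TangentBundle 𝓘(ℝ, E) M)) s x)
    (hw : ContMDiffWithinAt 𝓘(ℝ, F) (𝓘(ℝ, E).prod 𝓘(ℝ, E)) n
      (fun m => (⟨b m, w m⟩ : TangentBundle 𝓘(ℝ, E) M)) s x) :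
    ContDiffWithinAt ℝ n (fun m => S.metric (b m) (v m) (w m)) s x := by
  have : ContMDiffWithinAt 𝓘(ℝ, F) (𝓘(ℝ, E).prod 𝓘(ℝ)) n
      (fun m ↦ TotalSpace.mk' ℝ (E := Bundle.Trivial M ℝ) (b m) (S.metric (b m) (v m) (w m)))
      s x := by
    apply ContMDiffWithinAt.clm_bundle_apply₂ (F₁ := E) (F₂ := E)
      (E₁ := fun p : M => TangentSpace 𝓘(ℝ, E) p) (E₂ := fun p : M => TangentSpace 𝓘(ℝ, E) p)
    · exact ContMDiffAt.comp_contMDiffWithinAt x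
        ((S.contMDiff_metric.of_le (by exact_mod_cast le_top)).contMDiffAt) hb
    · exact hv
    · exact hw
  simp only [contMDiffWithinAt_totalSpace] at this
  exact contMDiffWithinAt_iff_contDiffWithinAt.1 this.2

lemma continuousOn_metric {Y : Type*} [TopologicalSpace Y]
    {b : Y → M} {v w : ∀ x, TangentSpace 𝓘(ℝ, E) (b x)} {s : Set Y}
    (hb : ContinuousOn b s)
    (hv : ContinuousOn (fun m => (⟨b m, v m⟩ : TangentBundle 𝓘(ℝ, E) M)) s)
    (hw : ContinuousOn (fun m => (⟨b m, w m⟩ : TangentBundle 𝓘(ℝ, E) M)) s) :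
    ContinuousOn (fun m => S.metric (b m) (v m) (w m)) s := by
  have : ContinuousOn
      (fun m ↦ TotalSpace.mk' ℝ (E := Bundle.Trivial M ℝ) (b m) (S.metric (b m) (v m) (w m)))
      s := by
    apply ContinuousOn.clm_bundle_apply₂ (F₁ := E) (F₂ := E)
      (E₁ := fun p : M => TangentSpace 𝓘(ℝ, E) p) (E₂ := fun p : M => TangentSpace 𝓘(ℝ, E) p)
    · exact S.contMDiff_metric.continuous.comp_continuousOn hb
    · exact hv
    · exact hw
  intro x hx
  have := (this x hx)
  rw [FiberBundle.continuousWithinAt_totalSpace] at this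
  exact this.2

/-- The velocity field of a curve on `[0, 1]`, as a map to the tangent bundle. -/
lemma continuousOn_velocity {γ : ℝ → M} (hγ : ContMDiffOn 𝓘(ℝ, ℝ) 𝓘(ℝ, E) 1 γ (Icc 0 1)) :
    ContinuousOn (fun t => (⟨γ t, velocity γ t⟩ : TangentBundle 𝓘(ℝ, E) M)) (Icc 0 1) := by
  have h := hγ.continuousOn_tangentMapWithin le_rfl
    (uniqueMDiffOn_iff_uniqueDiffOn.2 (uniqueDiffOn_Icc zero_lt_one))
  have h1 : Continuous (fun t : ℝ => (⟨t, (1 : ℝ)⟩ : TangentBundle 𝓘(ℝ, ℝ) ℝ)) := by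
    have : ContMDiff 𝓘(ℝ, ℝ) (𝓘(ℝ, ℝ).prod 𝓘(ℝ, ℝ)) 0
      (fun t : ℝ => (⟨t, (1 : ℝ)⟩ : TangentBundle 𝓘(ℝ, ℝ) ℝ)) := by
      intro t
      rw [contMDiffAt_totalSpace]
      refine ⟨contMDiffAt_id, ?_⟩
      simp only [TangentBundle.trivializationAt_apply]
      simp [chartAt_self_eq]
      exact contMDiffAt_const
    exact this.continuous
  exact h.comp h1.continuousOn (fun t ht => ht)

/-- The tangent map of the inverse chart is smooth, so this is the metric applied to two smooth
vector fields along it. Joint differentiability in the base point and both vectors is what the chain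
rule for the energy of a geodesic requires. -/
lemma coordMetric_differentiableAt (c : M) {u : E} (hu : u ∈ (extChartAt 𝓘(ℝ, E) c).target)
    (v w : E) :
    DifferentiableAt ℝ (fun x : E × E × E => S.coordMetric c x.1 x.2.1 x.2.2) (u, v, w) := by
  have ho : IsOpen (extChartAt 𝓘(ℝ, E) c).target := isOpen_extChartAt_target c
  have hs : ContMDiffOn 𝓘(ℝ, E) 𝓘(ℝ, E) ∞ (extChartAt 𝓘(ℝ, E) c).symm
    (extChartAt 𝓘(ℝ, E) c).target := contMDiffOn_extChartAt_symm c
  have ht := hs.contMDiffOn_tangentMapWithin (m := 1) (by norm_cast)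
    (uniqueMDiffOn_iff_uniqueDiffOn.2 ho.uniqueDiffOn)
  have key : ∀ g : E × E × E → E, ContDiff ℝ ∞ g →
      ContMDiffWithinAt 𝓘(ℝ, E × E × E) (𝓘(ℝ, E).prod 𝓘(ℝ, E)) 1
      (fun x : E × E × E => (⟨(extChartAt 𝓘(ℝ, E) c).symm x.1,
        mfderivWithin 𝓘(ℝ, E) 𝓘(ℝ, E) (extChartAt 𝓘(ℝ, E) c).symm
          (extChartAt 𝓘(ℝ, E) c).target x.1 (g x)⟩ :
        TangentBundle 𝓘(ℝ, E) M)) ((extChartAt 𝓘(ℝ, E) c).target ×ˢ univ) (u, v, w) := by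
    intro g hg
    have h2 : ContMDiffWithinAt 𝓘(ℝ, E × E × E) (𝓘(ℝ, E).prod 𝓘(ℝ, E)) 1
      (fun x : E × E × E => (⟨x.1, g x⟩ : TangentBundle 𝓘(ℝ, E) E))
        ((extChartAt 𝓘(ℝ, E) c).target ×ˢ univ) (u, v, w) := by
      rw [contMDiffWithinAt_totalSpace]
      refine ⟨contMDiffWithinAt_iff_contDiffWithinAt.2 contDiffWithinAt_fst, ?_⟩
      simp only [TangentBundle.trivializationAt_apply]
      simp [chartAt_self_eq]
      exact (contMDiffWithinAt_iff_contDiffWithinAt.2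
        ((hg.of_le (by norm_cast)).contDiffAt.contDiffWithinAt))
    exact (ht (⟨u, g (u, v, w)⟩) hu).comp (u, v, w) h2 (fun x hx => hx.1)
  have h3 := contMDiffWithinAt_metric S (n := 1) (b := fun x : E × E × E =>
    (extChartAt 𝓘(ℝ, E) c).symm x.1)
    (((hs.of_le (by norm_cast)) u hu).comp (u, v, w)
      (contMDiffWithinAt_iff_contDiffWithinAt.2 contDiffWithinAt_fst) (fun x hx => hx.1))
    (key (fun x => x.2.1) (by fun_prop)) (key (fun x => x.2.2) (by fun_prop))
  have hn : (extChartAt 𝓘(ℝ, E) c).target ×ˢ (univ : Set (E × E)) ∈ 𝓝 (u, v, w) :=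
    prod_mem_nhds (ho.mem_nhds hu) univ_mem
  refine (((h3.contDiffAt hn).differentiableAt (by norm_num)).congr_of_eventuallyEq ?_)
  filter_upwards [hn] with x hx
  simp only [coordMetric]
  rw [mfderivWithin_of_isOpen ho hx.1]

end Geodesics

end Spacetime

namespace Spacetime

/-! ### Conservation of energy along geodesics -/

section EnergyConservation

variable {E : Type*} [NormedAddCommGroup E] [NormedSpace ℝ E] [FiniteDimensional ℝ E]
  {M : Type*} [TopologicalSpace M] [ChartedSpace E M] [IsManifold 𝓘(ℝ, E) ∞ M]
  (S : Spacetime E M)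

lemma metric_congr {p q : M} (h : p = q) (v w : E) :
    S.metric p v w = S.metric q v w := by
  subst h; rfl

/-- The coordinate representation of a velocity vector. -/
lemma mfderiv_symm_derivWithin {γ : ℝ → M} (hγ : ContMDiffOn 𝓘(ℝ, ℝ) 𝓘(ℝ, E) 1 γ (Icc 0 1))
    (c : M) {s : ℝ} (hs : s ∈ Icc (0 : ℝ) 1) (hc : γ s ∈ (chartAt E c).source) :
    (mfderiv 𝓘(ℝ, E) 𝓘(ℝ, E) (extChartAt 𝓘(ℝ, E) c).symm (extChartAt 𝓘(ℝ, E) c (γ s))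
      (derivWithin (fun r => extChartAt 𝓘(ℝ, E) c (γ r)) (Icc 0 1) s) : E) = velocity γ s := by
  have hu : MDifferentiableWithinAt 𝓘(ℝ, ℝ) 𝓘(ℝ, E) γ (Icc 0 1) s :=
    (hγ s hs).mdifferentiableWithinAt (by norm_num)
  have hU : UniqueMDiffWithinAt 𝓘(ℝ, ℝ) (Icc (0 : ℝ) 1) s :=
    (uniqueMDiffWithinAt_iff_uniqueDiffWithinAt).2 (uniqueDiffOn_Icc zero_lt_one s hs)
  have hsrc : γ s ∈ (extChartAt 𝓘(ℝ, E) c).source := by rwa [extChartAt_source]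
  have hch : MDifferentiableAt 𝓘(ℝ, E) 𝓘(ℝ, E) (extChartAt 𝓘(ℝ, E) c) (γ s) :=
    mdifferentiableAt_extChartAt hc
  have hu' : MDifferentiableWithinAt 𝓘(ℝ, ℝ) 𝓘(ℝ, E)
      (fun r => extChartAt 𝓘(ℝ, E) c (γ r)) (Icc 0 1) s :=
    hch.comp_mdifferentiableWithinAt s hu
  have hsy : MDifferentiableAt 𝓘(ℝ, E) 𝓘(ℝ, E) (extChartAt 𝓘(ℝ, E) c).symm
      (extChartAt 𝓘(ℝ, E) c (γ s)) :=
    (mdifferentiableOn_extChartAt_symm.mdifferentiableAt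
      ((isOpen_extChartAt_target c).mem_nhds ((extChartAt 𝓘(ℝ, E) c).map_source hsrc)))
  have hcomp := mfderiv_comp_mfderivWithin (x := s) hsy hu' hU
  have hev : ((extChartAt 𝓘(ℝ, E) c).symm ∘ fun r => extChartAt 𝓘(ℝ, E) c (γ r))
      =ᶠ[𝓝[Icc 0 1] s] γ := by
    have := hu.continuousWithinAt.preimage_mem_nhdsWithin
      ((isOpen_extChartAt_source c (I := 𝓘(ℝ, E))).mem_nhds hsrc)
    filter_upwards [this] with r hr
    exact (extChartAt 𝓘(ℝ, E) c).left_inv hr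
  have h2 := hev.mfderivWithin_eq (I := 𝓘(ℝ, ℝ)) (I' := 𝓘(ℝ, E))
    ((extChartAt 𝓘(ℝ, E) c).left_inv hsrc)
  have h3 : derivWithin (fun r => extChartAt 𝓘(ℝ, E) c (γ r)) (Icc 0 1) s =
      mfderivWithin 𝓘(ℝ, ℝ) 𝓘(ℝ, E) (fun r => extChartAt 𝓘(ℝ, E) c (γ r)) (Icc 0 1) s (1 : ℝ) := by
    rw [mfderivWithin_eq_fderivWithin]; rfl
  have h4 := congrArg (fun (f : ℝ →L[ℝ] E) => f 1) (hcomp.symm.trans h2)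
  exact (congrArg (fun z : E => (mfderiv 𝓘(ℝ, E) 𝓘(ℝ, E) (extChartAt 𝓘(ℝ, E) c).symm
    (extChartAt 𝓘(ℝ, E) c (γ s)) : E →L[ℝ] E) z) h3).trans h4

/-- The coordinate metric as a bilinear form. -/
lemma exists_coordMetric_eq (c : M) (u : E) :
    ∃ B : E →L[ℝ] E →L[ℝ] ℝ, ∀ v w, S.coordMetric c u v w = B v w := by
  let A : E →L[ℝ] E := mfderiv 𝓘(ℝ, E) 𝓘(ℝ, E) (extChartAt 𝓘(ℝ, E) c).symm u
  let G : E →L[ℝ] E →L[ℝ] ℝ := S.metric ((extChartAt 𝓘(ℝ, E) c).symm u)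
  exact ⟨(G.comp A).flip.comp A |>.flip, fun v w => rfl⟩

lemma energy_eq_coordMetric {γ : ℝ → M} (hγ : ContMDiffOn 𝓘(ℝ, ℝ) 𝓘(ℝ, E) 1 γ (Icc 0 1))
    (c : M) {s : ℝ} (hs : s ∈ Icc (0 : ℝ) 1) (hc : γ s ∈ (chartAt E c).source) :
    S.energy (γ s) (velocity γ s) = S.coordMetric c (extChartAt 𝓘(ℝ, E) c (γ s))
      (derivWithin (fun r => extChartAt 𝓘(ℝ, E) c (γ r)) (Icc 0 1) s)
      (derivWithin (fun r => extChartAt 𝓘(ℝ, E) c (γ r)) (Icc 0 1) s) := by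
  have hsrc : γ s ∈ (extChartAt 𝓘(ℝ, E) c).source := by rwa [extChartAt_source]
  have h := mfderiv_symm_derivWithin hγ c hs hc
  simp only [coordMetric, energy]
  have e1 := metric_congr S ((extChartAt 𝓘(ℝ, E) c).left_inv hsrc) (velocity γ s) (velocity γ s)
  rw [← e1]
  erw [h]

/-- The velocity field of a geodesic has constant energy. -/
lemma IsGeodesic.energy_eq {γ : ℝ → M} (hγ : S.IsGeodesic γ) {t : ℝ} (ht : t ∈ Icc (0 : ℝ) 1) :
    S.energy (γ t) (velocity γ t) = S.energy (γ 0) (velocity γ 0) := by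
  have h1 : ContMDiffOn 𝓘(ℝ, ℝ) 𝓘(ℝ, E) 1 γ (Icc 0 1) := hγ.1.of_le (by norm_cast)
  have key : ∀ t ∈ Icc (0 : ℝ) 1,
      HasDerivWithinAt (fun s => S.energy (γ s) (velocity γ s)) 0 (Icc 0 1) t := by
    intro t ht
    set c := γ t with hcdef
    set u : ℝ → E := fun s => extChartAt 𝓘(ℝ, E) c (γ s) with hu
    have hsrc : γ t ∈ (extChartAt 𝓘(ℝ, E) c).source := mem_extChartAt_source c
    have huC : ContDiffWithinAt ℝ ∞ u (Icc 0 1) t := by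
      rw [← contMDiffWithinAt_iff_contDiffWithinAt]
      exact (contMDiffAt_extChartAt (n := ∞)).comp_contMDiffWithinAt t (hγ.1 t ht)
    have hUD : UniqueDiffOn ℝ (Icc (0 : ℝ) 1) := uniqueDiffOn_Icc zero_lt_one
    have hd1 : HasDerivWithinAt u (derivWithin u (Icc 0 1) t) (Icc 0 1) t :=
      (huC.differentiableWithinAt (by norm_num)).hasDerivWithinAt
    have hd2 : HasDerivWithinAt (derivWithin u (Icc 0 1))
        (derivWithin (derivWithin u (Icc 0 1)) (Icc 0 1) t) (Icc 0 1) t := by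
      apply DifferentiableWithinAt.hasDerivWithinAt
      have : ContDiffWithinAt ℝ 1 (derivWithin u (Icc 0 1)) (Icc 0 1) t :=
        huC.derivWithin hUD (by norm_cast) ht
      exact this.differentiableWithinAt (by norm_num)
    set u₁ := derivWithin u (Icc 0 1) t with hu₁
    set u₂ := derivWithin (derivWithin u (Icc 0 1)) (Icc 0 1) t with hu₂
    -- The geodesic equation is tested against the velocity itself. Its two derivative terms are
    -- then multiples of the same number, with total coefficient one half, and twice the equation is
    -- the vanishing of the derivative of the energy.
    have heq := hγ.2 t ht u₁
    simp only at heq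
    have hF := (S.coordMetric_differentiableAt c
      ((extChartAt 𝓘(ℝ, E) c).map_source hsrc) u₁ u₁).hasFDerivAt
    set F : E × E × E → ℝ := fun x => S.coordMetric c x.1 x.2.1 x.2.2 with hFdef
    set D := fderiv ℝ F (extChartAt 𝓘(ℝ, E) c (γ t), u₁, u₁) with hD
    have hprod : HasDerivWithinAt (fun s => (u s, derivWithin u (Icc 0 1) s,
        derivWithin u (Icc 0 1) s)) (u₁, u₂, u₂) (Icc 0 1) t :=
      hd1.prodMk (hd2.prodMk hd2)
    have hcomp := hF.comp_hasDerivWithinAt t hprod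
    have hD1 : ∀ w, fderiv ℝ (fun y => S.coordMetric c y u₁ u₁) (u t) w = D (w, 0, 0) := by
      intro w
      have : HasFDerivAt (fun y : E => (y, u₁, u₁))
        ((ContinuousLinearMap.inl ℝ E (E × E))) (u t) := by
        exact (hasFDerivAt_id (𝕜 := ℝ) (u t)).prodMk (hasFDerivAt_const (u₁, u₁) (u t))
      have := hF.comp (u t) this
      erw [this.fderiv]
      rfl
    have hlin2 : ∀ w, D (0, w, 0) = S.coordMetric c (u t) w u₁ := by
      intro w
      have hl : HasFDerivAt (fun y : E => (u t, y, u₁))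
        ((0 : E →L[ℝ] E).prod ((ContinuousLinearMap.id ℝ E).prod 0)) u₁ :=
        (hasFDerivAt_const (u t) u₁).prodMk
          ((hasFDerivAt_id (𝕜 := ℝ) u₁).prodMk (hasFDerivAt_const u₁ u₁))
      have h5 := hF.comp u₁ hl
      obtain ⟨B, hB⟩ := S.exists_coordMetric_eq c (u t)
      have h6 : HasFDerivAt (fun y => S.coordMetric c (u t) y u₁) (B.flip u₁) u₁ := by
        simp only [hB]
        exact (B.flip u₁).hasFDerivAt
      have h7 := h5.unique h6
      have h8 := congrArg (fun (f : E →L[ℝ] ℝ) => f w) h7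
      simpa [hB] using h8
    have hsymm : ∀ a b, S.coordMetric c (u t) a b = S.coordMetric c (u t) b a := by
      intro a b; exact S.symm _ _ _
    have hlin3 : ∀ w, D (0, 0, w) = S.coordMetric c (u t) w u₁ := by
      intro w
      have hl : HasFDerivAt (fun y : E => (u t, u₁, y))
        ((0 : E →L[ℝ] E).prod ((0 : E →L[ℝ] E).prod (ContinuousLinearMap.id ℝ E))) u₁ :=
        (hasFDerivAt_const (u t) u₁).prodMk
          ((hasFDerivAt_const u₁ u₁).prodMk (hasFDerivAt_id (𝕜 := ℝ) u₁))
      have h5 := hF.comp u₁ hl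
      obtain ⟨B, hB⟩ := S.exists_coordMetric_eq c (u t)
      have h6 : HasFDerivAt (fun y => S.coordMetric c (u t) u₁ y) (B u₁) u₁ := by
        simp only [hB]
        exact (B u₁).hasFDerivAt
      have h7 := h5.unique h6
      have h8 := congrArg (fun (f : E →L[ℝ] ℝ) => f w) h7
      rw [hsymm w u₁]
      simpa [hB] using h8
    have hzero : D (u₁, u₂, u₂) = 0 := by
      have : (u₁, u₂, u₂) = (u₁, (0 : E), (0 : E)) + (0, u₂, 0) + (0, 0, u₂) := by simp
      rw [this, map_add, map_add, hlin2, hlin3, ← hD1]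
      linarith
    rw [hzero] at hcomp
    have hev : (fun s => S.energy (γ s) (velocity γ s)) =ᶠ[𝓝[Icc 0 1] t]
        (F ∘ fun s => (u s, derivWithin u (Icc 0 1) s, derivWithin u (Icc 0 1) s)) := by
      have hcont := (h1 t ht).continuousWithinAt.preimage_mem_nhdsWithin
        ((chartAt E c).open_source.mem_nhds (mem_chart_source E c))
      filter_upwards [hcont, self_mem_nhdsWithin] with r hr hr2
      exact S.energy_eq_coordMetric h1 c hr2 hr
    exact hcomp.congr_of_eventuallyEq hev (hev.self_of_nhdsWithin ht)
  exact constant_of_derivWithin_zero (fun t ht => (key t ht).differentiableWithinAt)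
    (fun t ht => (key t (Ico_subset_Icc_self ht)).derivWithin
      (uniqueDiffOn_Icc zero_lt_one t (Ico_subset_Icc_self ht))) t ht

end EnergyConservation

end Spacetime

namespace Spacetime

/-! ### Affine reparametrization and time separation along timelike geodesics -/

section CausalGeodesics

variable {E : Type*} [NormedAddCommGroup E] [NormedSpace ℝ E] [FiniteDimensional ℝ E]
  {M : Type*} [TopologicalSpace M] [ChartedSpace E M] [IsManifold 𝓘(ℝ, E) ∞ M]
  (S : Spacetime E M)

lemma velocity_comp_affine {γ : ℝ → M} (hγ : ContMDiffOn 𝓘(ℝ, ℝ) 𝓘(ℝ, E) 1 γ (Icc 0 1))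
    {a b : ℝ} (hab : MapsTo (fun r : ℝ => a + b * r) (Icc 0 1) (Icc 0 1)) {t : ℝ}
    (ht : t ∈ Icc (0 : ℝ) 1) :
    (velocity (fun r => γ (a + b * r)) t : E) = b • (velocity γ (a + b * t) : E) := by
  have hU : UniqueMDiffWithinAt 𝓘(ℝ, ℝ) (Icc (0 : ℝ) 1) t :=
    (uniqueMDiffWithinAt_iff_uniqueDiffWithinAt).2 (uniqueDiffOn_Icc zero_lt_one t ht)
  have hd : HasDerivWithinAt (fun r : ℝ => a + b * r) b (Icc 0 1) t := by
    simpa using ((hasDerivWithinAt_id t (Icc (0 : ℝ) 1)).const_mul b).const_add a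
  have hf : HasMFDerivWithinAt 𝓘(ℝ, ℝ) 𝓘(ℝ, ℝ) (fun r : ℝ => a + b * r) (Icc 0 1) t
      (ContinuousLinearMap.toSpanSingleton ℝ b : ℝ →L[ℝ] ℝ) :=
    hasMFDerivWithinAt_iff_hasFDerivWithinAt.2 hd.hasFDerivWithinAt
  have hg : HasMFDerivWithinAt 𝓘(ℝ, ℝ) 𝓘(ℝ, E) γ (Icc 0 1) (a + b * t)
      (mfderivWithin 𝓘(ℝ, ℝ) 𝓘(ℝ, E) γ (Icc 0 1) (a + b * t)) :=
    ((hγ _ (hab ht)).mdifferentiableWithinAt (by norm_num)).hasMFDerivWithinAt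
  have hc := HasMFDerivWithinAt.comp t hg hf
    (show Icc (0 : ℝ) 1 ⊆ (fun r : ℝ => a + b * r) ⁻¹' Icc 0 1 from hab)
  have h1 := hc.mfderivWithin hU
  have h2 := congrArg (fun (f : ℝ →L[ℝ] E) => f 1) h1
  refine (show (velocity (fun r => γ (a + b * r)) t : E) = _ from h2).trans ?_
  let D : ℝ →L[ℝ] E := mfderivWithin 𝓘(ℝ, ℝ) 𝓘(ℝ, E) γ (Icc 0 1) (a + b * t)
  change D ((ContinuousLinearMap.toSpanSingleton ℝ b : ℝ →L[ℝ] ℝ) 1) = b • D 1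
  have h3 : (ContinuousLinearMap.toSpanSingleton ℝ b : ℝ →L[ℝ] ℝ) 1 = b • (1 : ℝ) := by simp
  rw [h3, map_smul]

lemma contMDiffOn_comp_affine {n : WithTop ℕ∞} {γ : ℝ → M}
    (hγ : ContMDiffOn 𝓘(ℝ, ℝ) 𝓘(ℝ, E) n γ (Icc 0 1))
    {a b : ℝ} (hab : MapsTo (fun r : ℝ => a + b * r) (Icc 0 1) (Icc 0 1)) :
    ContMDiffOn 𝓘(ℝ, ℝ) 𝓘(ℝ, E) n (fun r => γ (a + b * r)) (Icc 0 1) := by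
  refine hγ.comp (t := Icc 0 1) ?_ hab
  exact contMDiffOn_iff_contDiffOn.2 (by fun_prop)

/-- Affine reparametrizations of geodesics are geodesics. -/
lemma IsGeodesic.comp_affine {γ : ℝ → M} (hγ : S.IsGeodesic γ)
    {a b : ℝ} (hab : MapsTo (fun r : ℝ => a + b * r) (Icc 0 1) (Icc 0 1)) :
    S.IsGeodesic (fun r => γ (a + b * r)) := by
  refine ⟨contMDiffOn_comp_affine hγ.1 hab, ?_⟩
  intro t ht w
  have hUD : UniqueDiffOn ℝ (Icc (0 : ℝ) 1) := uniqueDiffOn_Icc zero_lt_one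
  have h1 : ContMDiffOn 𝓘(ℝ, ℝ) 𝓘(ℝ, E) 1 γ (Icc 0 1) := hγ.1.of_le (by norm_cast)
  set c := γ (a + b * t) with hcdef
  set u : ℝ → E := fun s => extChartAt 𝓘(ℝ, E) c (γ s) with hu
  set t' := a + b * t with ht'
  have htm : t' ∈ Icc (0 : ℝ) 1 := hab ht
  have hsrc : γ t' ∈ (extChartAt 𝓘(ℝ, E) c).source := mem_extChartAt_source c
  have hd : ∀ r, HasDerivWithinAt (fun r : ℝ => a + b * r) b (Icc 0 1) r := fun r => by
    simpa using ((hasDerivWithinAt_id r (Icc (0 : ℝ) 1)).const_mul b).const_add a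
  have hudiff : ∀ s ∈ Icc (0 : ℝ) 1, γ s ∈ (chartAt E c).source →
      DifferentiableWithinAt ℝ u (Icc 0 1) s := by
    intro s hs hsc
    have : MDifferentiableWithinAt 𝓘(ℝ, ℝ) 𝓘(ℝ, E) u (Icc 0 1) s :=
      (mdifferentiableAt_extChartAt hsc).comp_mdifferentiableWithinAt s
        ((h1 s hs).mdifferentiableWithinAt (by norm_num))
    exact mdifferentiableWithinAt_iff_differentiableWithinAt.1 this
  have huC : ContDiffWithinAt ℝ ∞ u (Icc 0 1) t' := by
    rw [← contMDiffWithinAt_iff_contDiffWithinAt]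
    exact (contMDiffAt_extChartAt (n := ∞)).comp_contMDiffWithinAt t' (hγ.1 t' htm)
  have hev : derivWithin (fun s => u (a + b * s)) (Icc 0 1) =ᶠ[𝓝[Icc 0 1] t]
      fun s => b • derivWithin u (Icc 0 1) (a + b * s) := by
    have hcont := ((contMDiffOn_comp_affine h1 hab) t ht).continuousWithinAt.preimage_mem_nhdsWithin
        ((chartAt E c).open_source.mem_nhds (mem_chart_source E c))
    filter_upwards [hcont, self_mem_nhdsWithin] with r hr hr2
    exact ((hudiff _ (hab hr2) hr).hasDerivWithinAt.scomp r (hd r) hab).derivWithin (hUD r hr2)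
  have e1 : derivWithin (fun s => u (a + b * s)) (Icc 0 1) t = b • derivWithin u (Icc 0 1) t' :=
    hev.self_of_nhdsWithin ht
  have e2 : derivWithin (derivWithin (fun s => u (a + b * s)) (Icc 0 1)) (Icc 0 1) t =
      (b * b) • derivWithin (derivWithin u (Icc 0 1)) (Icc 0 1) t' := by
    rw [hev.derivWithin_eq e1]
    have h2 : DifferentiableWithinAt ℝ (derivWithin u (Icc 0 1)) (Icc 0 1) t' := by
      have : ContDiffWithinAt ℝ 1 (derivWithin u (Icc 0 1)) (Icc 0 1) t' :=
        huC.derivWithin hUD (by norm_cast) htm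
      exact this.differentiableWithinAt (by norm_num)
    have h3 := ((h2.hasDerivWithinAt.scomp t (hd t) hab).const_smul b).derivWithin (hUD t ht)
    rw [mul_smul]
    exact h3
  have heq := hγ.2 t' htm w
  simp only at heq ⊢
  change S.coordMetric c (u t') (derivWithin (derivWithin (fun s => u (a + b * s)) (Icc 0 1))
    (Icc 0 1) t) w + fderiv ℝ (fun y => S.coordMetric c y
      (derivWithin (fun s => u (a + b * s)) (Icc 0 1) t) w) (u t')
      (derivWithin (fun s => u (a + b * s)) (Icc 0 1) t) - (1 / 2) * fderiv ℝ (fun y =>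
      S.coordMetric c y (derivWithin (fun s => u (a + b * s)) (Icc 0 1) t)
      (derivWithin (fun s => u (a + b * s)) (Icc 0 1) t)) (u t') w = 0
  change S.coordMetric c (u t') (derivWithin (derivWithin u (Icc 0 1))
    (Icc 0 1) t') w + fderiv ℝ (fun y => S.coordMetric c y
      (derivWithin u (Icc 0 1) t') w) (u t')
      (derivWithin u (Icc 0 1) t') - (1 / 2) * fderiv ℝ (fun y =>
      S.coordMetric c y (derivWithin u (Icc 0 1) t')
      (derivWithin u (Icc 0 1) t')) (u t') w = 0 at heq
  rw [e1, e2]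
  set u₁ := derivWithin u (Icc 0 1) t'
  set u₂ := derivWithin (derivWithin u (Icc 0 1)) (Icc 0 1) t'
  have hs1 : ∀ y : E, ∀ v w : E, S.coordMetric c y (b • v) w = b * S.coordMetric c y v w := by
    intro y v w
    obtain ⟨B, hB⟩ := S.exists_coordMetric_eq c y
    simp [hB]
  have hs2 : ∀ y : E, ∀ v w : E, S.coordMetric c y v (b • w) = b * S.coordMetric c y v w := by
    intro y v w
    obtain ⟨B, hB⟩ := S.exists_coordMetric_eq c y
    simp [hB]
  have hs3 : ∀ y : E, ∀ v w : E,
      S.coordMetric c y ((b * b) • v) w = b * b * S.coordMetric c y v w := by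
    intro y v w
    rw [mul_smul, hs1, hs1, mul_assoc]
  have hdiff : ∀ v w, DifferentiableAt ℝ (fun y => S.coordMetric c y v w) (u t') := by
    intro v w
    have hF := S.coordMetric_differentiableAt c ((extChartAt 𝓘(ℝ, E) c).map_source hsrc) v w
    exact hF.comp (u t') (f := fun y : E => (y, v, w)) (by fun_prop)
  simp only [hs1, hs2, hs3]
  rw [fderiv_const_mul (hdiff _ _), fderiv_const_mul ((hdiff _ _).const_mul b),
    fderiv_const_mul (hdiff _ _)]
  simp only [FunLike.coe_smul, Pi.smul_apply, map_smul, smul_eq_mul]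
  linear_combination (b * b) * heq

/-- A nonzero vector orthogonal to the time field is spacelike. Hence the sign of this product, the
time direction of a timelike vector, is locally constant in continuous families. -/
lemma metric_timeField_ne_zero {p : M} {v : TangentSpace 𝓘(ℝ, E) p} (hv : S.metric p v v < 0) :
    S.metric p v (S.timeField p) ≠ 0 := by
  intro h
  rw [S.symm] at h
  by_cases h0 : v = 0
  · subst h0; simp at hv
  · linarith [S.pos_of_orthogonal p v h h0]

lemma continuousOn_metric_velocity_timeField {γ : ℝ → M}
    (hγ : ContMDiffOn 𝓘(ℝ, ℝ) 𝓘(ℝ, E) 1 γ (Icc 0 1)) :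
    ContinuousOn (fun t => S.metric (γ t) (velocity γ t) (S.timeField (γ t))) (Icc 0 1) :=
  S.continuousOn_metric hγ.continuousOn (continuousOn_velocity hγ)
    (S.continuous_timeField.comp_continuousOn hγ.continuousOn)

/-- A continuous function without zeros on an interval does not change its sign. -/
lemma neg_of_continuousOn_ne_zero {f : ℝ → ℝ} {a b : ℝ} (hf : ContinuousOn f (Icc a b))
    (h0 : ∀ t ∈ Icc a b, f t ≠ 0) {s t : ℝ} (hs : s ∈ Icc a b) (ht : t ∈ Icc a b)
    (hneg : f s < 0) : f t < 0 := by
  by_contra hcon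
  push Not at hcon
  obtain ⟨r, hr, hr0⟩ := isPreconnected_Icc.intermediate_value hs ht hf ⟨hneg.le, hcon⟩
  exact h0 r hr hr0

/-- The time separation is at least the length of a timelike geodesic. -/
lemma le_tau_of_affine {γ : ℝ → M} (hγ : S.IsGeodesic γ)
    (hE : S.energy (γ 0) (velocity γ 0) < 0)
    {a b : ℝ} (hab : MapsTo (fun r : ℝ => a + b * r) (Icc 0 1) (Icc 0 1))
    (hb : ∀ t ∈ Icc (0 : ℝ) 1, b * S.metric (γ t) (velocity γ t) (S.timeField (γ t)) < 0) :
    ENNReal.ofReal (|b| * √(-S.energy (γ 0) (velocity γ 0))) ≤ S.tau (γ a) (γ (a + b)) := by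
  have h1 : ContMDiffOn 𝓘(ℝ, ℝ) 𝓘(ℝ, E) 1 γ (Icc 0 1) := hγ.1.of_le (by norm_cast)
  have hb0 : b ≠ 0 := by
    rintro rfl
    have := hb 0 (by simp)
    simp at this
  set c : ℝ → M := fun r => γ (a + b * r) with hc
  have hv : ∀ t ∈ Icc (0 : ℝ) 1, (velocity c t : E) = b • (velocity γ (a + b * t) : E) :=
    fun t ht => velocity_comp_affine h1 hab ht
  have hen : ∀ t ∈ Icc (0 : ℝ) 1, S.energy (c t) (velocity c t) =
      b ^ 2 * S.energy (γ 0) (velocity γ 0) := by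
    intro t ht
    rw [← IsGeodesic.energy_eq S hγ (hab ht)]
    change (S.metric (γ (a + b * t)) : E →L[ℝ] E →L[ℝ] ℝ) (velocity c t : E) (velocity c t : E) = _
    rw [hv t ht, map_smul, map_smul]
    simp only [FunLike.coe_smul, Pi.smul_apply, smul_eq_mul]
    change b * (b * S.energy _ _) = _
    ring
  have hcc : S.IsCausalCurve c := by
    refine ⟨contMDiffOn_comp_affine h1 hab, fun t ht => ?_⟩
    have hneg : S.energy (c t) (velocity c t) < 0 := by
      rw [hen t ht]
      exact mul_neg_of_pos_of_neg (by positivity) hE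
    refine ⟨hneg.le, ?_, ?_⟩
    · intro h0
      have : S.energy (c t) (velocity c t) = 0 := by
        rw [energy, h0]; simp
      linarith
    · change (S.metric (γ (a + b * t)) : E →L[ℝ] E →L[ℝ] ℝ) (velocity c t : E)
        (S.timeField (γ (a + b * t)) : E) < 0
      rw [hv t ht, map_smul]
      simp only [FunLike.coe_smul, Pi.smul_apply, smul_eq_mul]
      exact hb _ (hab ht)
  have hlen : S.curveLength c = |b| * √(-S.energy (γ 0) (velocity γ 0)) := by
    have : ∀ t ∈ uIcc (0 : ℝ) 1, √(-S.energy (c t) (velocity c t)) =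
        |b| * √(-S.energy (γ 0) (velocity γ 0)) := by
      intro t ht
      rw [uIcc_of_le zero_le_one] at ht
      rw [hen t ht, ← mul_neg, Real.sqrt_mul (sq_nonneg b), Real.sqrt_sq_eq_abs]
    rw [curveLength, intervalIntegral.integral_congr this]
    simp
  have hp : S.CausalPath univ (c 0) (c 1) (S.curveLength c + 0) :=
    CausalPath.cons c (c 1) 0 hcc (mapsTo_univ _ _) (CausalPath.refl _ (mem_univ _))
  rw [add_zero, hlen] at hp
  have h0 : c 0 = γ a := by simp [hc]
  have h1' : c 1 = γ (a + b) := by simp [hc]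
  rw [h0, h1'] at hp
  exact le_iSup₂ (f := fun (ℓ : ℝ) (_ : S.CausalPath univ (γ a) (γ (a + b)) ℓ) =>
    ENNReal.ofReal ℓ) _ hp

/-- Time separations along a future-directed timelike geodesic. -/
lemma IsGeodesic.le_tau_of_future {γ : ℝ → M} (hγ : S.IsGeodesic γ)
    (hE : S.energy (γ 0) (velocity γ 0) < 0)
    (hf : S.metric (γ 0) (velocity γ 0) (S.timeField (γ 0)) < 0)
    {s t : ℝ} (hs : 0 ≤ s) (hst : s ≤ t) (ht : t ≤ 1) :
    ENNReal.ofReal ((t - s) * √(-S.energy (γ 0) (velocity γ 0))) ≤ S.tau (γ s) (γ t) := by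
  have h1 : ContMDiffOn 𝓘(ℝ, ℝ) 𝓘(ℝ, E) 1 γ (Icc 0 1) := hγ.1.of_le (by norm_cast)
  rcases hst.eq_or_lt with rfl | hlt
  · simp
  have h := S.le_tau_of_affine hγ hE (a := s) (b := t - s) ?_ ?_
  · rwa [abs_of_pos (sub_pos.2 hlt), add_sub_cancel] at h
  · intro r hr
    constructor <;> nlinarith [hr.1, hr.2]
  · intro r hr
    refine mul_neg_of_pos_of_neg (sub_pos.2 hlt) ?_
    refine neg_of_continuousOn_ne_zero (S.continuousOn_metric_velocity_timeField h1)
      (fun q hq => S.metric_timeField_ne_zero ?_) (s := 0) (by simp) hr hf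
    have := IsGeodesic.energy_eq S hγ hq
    rw [energy] at this
    rw [this]; exact hE

/-- Time separations along a past-directed timelike geodesic. -/
lemma IsGeodesic.le_tau_of_past {γ : ℝ → M} (hγ : S.IsGeodesic γ)
    (hE : S.energy (γ 0) (velocity γ 0) < 0)
    (hf : 0 < S.metric (γ 0) (velocity γ 0) (S.timeField (γ 0)))
    {s t : ℝ} (hs : 0 ≤ s) (hst : s ≤ t) (ht : t ≤ 1) :
    ENNReal.ofReal ((t - s) * √(-S.energy (γ 0) (velocity γ 0))) ≤ S.tau (γ t) (γ s) := by
  have h1 : ContMDiffOn 𝓘(ℝ, ℝ) 𝓘(ℝ, E) 1 γ (Icc 0 1) := hγ.1.of_le (by norm_cast)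
  rcases hst.eq_or_lt with rfl | hlt
  · simp
  have h := S.le_tau_of_affine hγ hE (a := t) (b := s - t) ?_ ?_
  · rwa [abs_of_neg (sub_neg.2 hlt), neg_sub, add_sub_cancel] at h
  · intro r hr
    constructor <;> nlinarith [hr.1, hr.2]
  · intro r hr
    refine mul_neg_of_neg_of_pos (sub_neg.2 hlt) ?_
    have := neg_of_continuousOn_ne_zero (S.continuousOn_metric_velocity_timeField h1).neg
      (fun q hq => neg_ne_zero.2 (S.metric_timeField_ne_zero ?_)) (s := 0) (by simp) hr
      (by simpa using hf)
    · simpa using this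
    have := IsGeodesic.energy_eq S hγ hq
    rw [energy] at this
    rw [this]; exact hE

end CausalGeodesics

end Spacetime

/-! ### The signed square root -/

lemma signedRoot_neg_iff {e : ℝ} : signedRoot e < 0 ↔ e < 0 := by
  unfold signedRoot
  split_ifs with h
  · exact ⟨fun h' => absurd h' (not_lt.2 (Real.sqrt_nonneg e)), fun h' => absurd h' (not_lt.2 h)⟩
  · push Not at h
    simp [h]

lemma neg_signedRoot_of_neg {e : ℝ} (h : e < 0) : -signedRoot e = √(-e) := by
  simp [signedRoot, not_le.2 h]

lemma signedRoot_strictMono : StrictMono signedRoot := by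
  intro a b hab
  unfold signedRoot
  split_ifs with h1 h2 h2
  · exact Real.sqrt_lt_sqrt h1 hab
  · exact absurd (h1.trans hab.le) h2
  · have : 0 < √(-a) := Real.sqrt_pos.2 (by linarith)
    linarith [Real.sqrt_nonneg b]
  · have : √(-b) < √(-a) := Real.sqrt_lt_sqrt (by linarith) (by linarith)
    linarith

namespace Spacetime

/-! ### Signed distance in normal neighbourhoods as a bound for time separation -/

section NormalNeighbourhoods

variable {E : Type*} [NormedAddCommGroup E] [NormedSpace ℝ E] [FiniteDimensional ℝ E]
  {M : Type*} [TopologicalSpace M] [ChartedSpace E M] [IsManifold 𝓘(ℝ, E) ∞ M]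
  (S : Spacetime E M)

lemma velocity_congr {γ₁ γ₂ : ℝ → M} (h : EqOn γ₁ γ₂ (Icc 0 1)) {t : ℝ}
    (ht : t ∈ Icc (0 : ℝ) 1) : (velocity γ₁ t : E) = velocity γ₂ t := by
  have h1 := mfderivWithin_congr_of_mem (I := 𝓘(ℝ, ℝ)) (I' := 𝓘(ℝ, E)) h ht
  exact congrArg (fun f : ℝ →L[ℝ] E => f 1) h1

lemma energy_congr {p q : M} (h : p = q) {v : TangentSpace 𝓘(ℝ, E) p}
    {w : TangentSpace 𝓘(ℝ, E) q} (hvw : (v : E) = w) : S.energy p v = S.energy q w := by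
  subst h; subst hvw; rfl

/-- Geodesics in the normal neighbourhood with the same endpoints agree on the unit interval, so the
geodesic chosen in the definition does not matter. -/
lemma signedDist_eq {N : Set M} (hN : S.IsNormalNeighbourhood N) {p q : M} {γ : ℝ → M}
    (hγ : S.IsGeodesicIn N γ p q) :
    S.signedDist N p q = signedRoot (S.energy (γ 0) (velocity γ 0)) := by
  have h : ∃ γ : ℝ → M, S.IsGeodesicIn N γ p q := ⟨γ, hγ⟩
  have hp : p ∈ N := by rw [← hγ.2.2.1]; exact hγ.2.1 (by simp)
  have hq : q ∈ N := by rw [← hγ.2.2.2]; exact hγ.2.1 (by simp)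
  have heq := hN.2.2 p hp q hq _ _ h.choose_spec hγ
  rw [signedDist, dif_pos h]
  congr 1
  exact S.energy_congr (heq (by simp)) (velocity_congr heq (by simp))

/-- The open mapping part of the inverse function theorem, read in a chart. It supplies the
continuity of the inverse exponential map. -/
lemma tendsto_inverse_of_bijective_mfderiv {V : Set E} (hV : IsOpen V) {e : E → M}
    (he : ContMDiffOn 𝓘(ℝ, E) 𝓘(ℝ, E) ∞ e V)
    {v : E} (hv : v ∈ V) (hb : Function.Bijective (mfderiv 𝓘(ℝ, E) 𝓘(ℝ, E) e v))
    {W : Set E} (hW : W ∈ 𝓝 v) : e '' W ∈ 𝓝 (e v) := by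
  have : CompleteSpace E := FiniteDimensional.complete ℝ E
  have heat : ContMDiffAt 𝓘(ℝ, E) 𝓘(ℝ, E) ∞ e v := he.contMDiffAt (hV.mem_nhds hv)
  set φ := extChartAt 𝓘(ℝ, E) (e v) with hφ
  have hcd : ContDiffAt ℝ ∞ (φ ∘ e) v := by
    rw [← contMDiffAt_iff_contDiffAt]
    exact (contMDiffAt_extChartAt (n := ∞)).comp v heat
  have hst := hcd.hasStrictFDerivAt (by norm_num)
  have hsurj : (fderiv ℝ (φ ∘ e) v).range = ⊤ := by
    have h1 : (fderiv ℝ (φ ∘ e) v : E →L[ℝ] E) =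
        ((mfderiv 𝓘(ℝ, E) 𝓘(ℝ, E) φ (e v) : E →L[ℝ] E)).comp
          (mfderiv 𝓘(ℝ, E) 𝓘(ℝ, E) e v : E →L[ℝ] E) := by
      rw [← mfderiv_eq_fderiv]
      exact mfderiv_comp v (mdifferentiableAt_extChartAt (mem_chart_source E (e v)))
        (heat.mdifferentiableAt (by norm_num))
    have h2 : Function.Surjective (mfderiv 𝓘(ℝ, E) 𝓘(ℝ, E) φ (e v)) := by
      have := isInvertible_mfderiv_extChartAt (I := 𝓘(ℝ, E)) (mem_extChartAt_source (I := 𝓘(ℝ, E)) (e v))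
      obtain ⟨A, hA⟩ := this
      rw [hφ, ← hA]
      exact A.surjective
    rw [h1, LinearMap.range_eq_top]
    exact h2.comp hb.2
  have hmap := hst.map_nhds_eq_of_surj hsurj
  have hW' : W ∩ e ⁻¹' φ.source ∈ 𝓝 v :=
    inter_mem hW (heat.continuousAt.preimage_mem_nhds
      ((isOpen_extChartAt_source (e v)).mem_nhds (mem_extChartAt_source (e v))))
  have h3 : (φ ∘ e) '' (W ∩ e ⁻¹' φ.source) ∈ 𝓝 ((φ ∘ e) v) := by
    rw [← hmap]; exact image_mem_map hW'
  have h4 : φ ⁻¹' ((φ ∘ e) '' (W ∩ e ⁻¹' φ.source)) ∩ φ.source ∈ 𝓝 (e v) :=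
    inter_mem ((continuousAt_extChartAt (e v)).preimage_mem_nhds h3)
      ((isOpen_extChartAt_source (e v)).mem_nhds (mem_extChartAt_source (e v)))
  refine mem_of_superset h4 ?_
  rintro x ⟨⟨w, hw, hwx⟩, hx⟩
  exact ⟨w, hw.1, φ.injOn hw.2 hx hwx⟩

/-- A continuous family of points, all at negative signed distance from a fixed point `o`, lies
either in the future or in the past of `o`. -/
lemma le_tau_or_le_tau {N : Set M} (hN : S.IsNormalNeighbourhood N) {o : M} (ho : o ∈ N)
    {q : ℝ → M} (hq : ContinuousOn q (Icc 0 1)) (hqN : MapsTo q (Icc 0 1) N)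
    (hneg : ∀ s ∈ Icc (0 : ℝ) 1, S.signedDist N o (q s) < 0) :
    (∀ s ∈ Icc (0 : ℝ) 1, ENNReal.ofReal (-S.signedDist N o (q s)) ≤ S.tau o (q s)) ∨
    (∀ s ∈ Icc (0 : ℝ) 1, ENNReal.ofReal (-S.signedDist N o (q s)) ≤ S.tau (q s) o) := by
  obtain ⟨V, e, hV, -, -, he, hinj, hVN, hbij, hgeo⟩ := hN.2.1 o ho
  have hex : ∀ s ∈ Icc (0 : ℝ) 1, ∃ v ∈ V, e v = q s := by
    intro s hs
    have := hqN hs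
    rwa [← hVN] at this
  choose! v hvV hev using hex
  -- The initial velocity depends continuously on the endpoint, since `e` is injective and maps
  -- neighbourhoods to neighbourhoods.
  have hcont : ContinuousOn v (Icc 0 1) := by
    intro s hs W hW
    have h1 : e '' (W ∩ V) ∈ 𝓝 (q s) := by
      rw [← hev s hs]
      exact tendsto_inverse_of_bijective_mfderiv hV he (hvV s hs) (hbij _ (hvV s hs))
        (inter_mem hW (hV.mem_nhds (hvV s hs)))
    have h2 := (hq s hs).preimage_mem_nhdsWithin h1
    rw [mem_map]
    filter_upwards [h2, self_mem_nhdsWithin] with r hr hr2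
    obtain ⟨w, hw, hwr⟩ := hr
    rw [← hev r hr2] at hwr
    have := hinj hw.2 (hvV r hr2) hwr
    change v r ∈ W
    rw [← this]; exact hw.1
  let G : E →L[ℝ] E →L[ℝ] ℝ := S.metric o
  have h0 : ∀ s ∈ Icc (0 : ℝ) 1, e ((0 : ℝ) • v s) = o := fun s hs => (hgeo _ (hvV s hs)).1.2.2.1
  have hvel : ∀ s ∈ Icc (0 : ℝ) 1, (velocity (fun t : ℝ => e (t • v s)) 0 : E) = v s :=
    fun s hs => (hgeo _ (hvV s hs)).2
  have hen : ∀ s ∈ Icc (0 : ℝ) 1, S.energy (e ((0 : ℝ) • v s))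
      (velocity (fun t : ℝ => e (t • v s)) 0) = G (v s) (v s) :=
    fun s hs => S.energy_congr (w := (v s : TangentSpace 𝓘(ℝ, E) o)) (h0 s hs) (hvel s hs)
  have hsd : ∀ s ∈ Icc (0 : ℝ) 1, S.signedDist N o (q s) = signedRoot (G (v s) (v s)) := by
    intro s hs
    rw [← hen s hs, ← hev s hs]
    exact S.signedDist_eq hN (hgeo _ (hvV s hs)).1
  have hG : ∀ s ∈ Icc (0 : ℝ) 1, G (v s) (v s) < 0 := by
    intro s hs
    have := hneg s hs
    rwa [hsd s hs, signedRoot_neg_iff] at this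
  have hm : ∀ s ∈ Icc (0 : ℝ) 1, S.metric (e ((0 : ℝ) • v s))
      (velocity (fun t : ℝ => e (t • v s)) 0) (S.timeField (e ((0 : ℝ) • v s))) =
      G (v s) (S.timeField o) := by
    intro s hs
    have : ∀ p : M, p = o → ∀ w : E, w = v s →
        (S.metric p : E →L[ℝ] E →L[ℝ] ℝ) w (S.timeField p) = G (v s) (S.timeField o) := by
      rintro p rfl w rfl; rfl
    exact this _ (h0 s hs) _ (hvel s hs)
  have hcm : ContinuousOn (fun s => G (v s) (S.timeField o)) (Icc 0 1) :=
    ((G.flip (S.timeField o)).continuous.comp_continuousOn hcont)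
  have hne : ∀ s ∈ Icc (0 : ℝ) 1, G (v s) (S.timeField o) ≠ 0 :=
    fun s hs => S.metric_timeField_ne_zero (hG s hs)
  have hpt : ∀ s ∈ Icc (0 : ℝ) 1, e ((1 : ℝ) • v s) = q s := fun s hs => by
    rw [one_smul, hev s hs]
  -- The product with the time field is continuous and has no zero, so its sign at parameter 0
  -- decides the direction of time for the whole family.
  rcases lt_or_gt_of_ne (hne 0 (by simp)) with h | h
  · left
    intro s hs
    have hneg' := neg_of_continuousOn_ne_zero hcm hne (by simp) hs h
    have := IsGeodesic.le_tau_of_future S (hgeo _ (hvV s hs)).1.1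
      (by simpa only [hen s hs] using hG s hs) (by simpa only [hm s hs] using hneg')
      le_rfl zero_le_one le_rfl
    rw [hen s hs, h0 s hs, hpt s hs, sub_zero, one_mul] at this
    rwa [hsd s hs, neg_signedRoot_of_neg (hG s hs)]
  · right
    intro s hs
    have hpos' := neg_of_continuousOn_ne_zero (s := 0) hcm.neg (fun t ht => neg_ne_zero.2 (hne t ht))
      (by simp) hs (by simpa using h)
    have hpos'' : 0 < G (v s) (S.timeField o) := by simpa using hpos'
    have := IsGeodesic.le_tau_of_past S (hgeo _ (hvV s hs)).1.1
      (by simpa only [hen s hs] using hG s hs) (by simpa only [hm s hs] using hpos'')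
      le_rfl zero_le_one le_rfl
    rw [hen s hs, h0 s hs, hpt s hs, sub_zero, one_mul] at this
    rwa [hsd s hs, neg_signedRoot_of_neg (hG s hs)]

/-- A geodesic of negative signed length is timelike, future-directed or past-directed. -/
lemma IsGeodesicIn.le_tau_or_le_tau {N : Set M} (hN : S.IsNormalNeighbourhood N) {p q : M}
    {σ : ℝ → M} (hσ : S.IsGeodesicIn N σ p q) (hneg : S.signedDist N p q < 0) :
    (∀ s t : ℝ, 0 ≤ s → s ≤ t → t ≤ 1 →
      ENNReal.ofReal ((t - s) * -S.signedDist N p q) ≤ S.tau (σ s) (σ t)) ∨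
    (∀ s t : ℝ, 0 ≤ s → s ≤ t → t ≤ 1 →
      ENNReal.ofReal ((t - s) * -S.signedDist N p q) ≤ S.tau (σ t) (σ s)) := by
  rw [S.signedDist_eq hN hσ] at hneg ⊢
  rw [signedRoot_neg_iff] at hneg
  rw [neg_signedRoot_of_neg hneg]
  rcases lt_or_gt_of_ne (S.metric_timeField_ne_zero hneg) with h | h
  · exact Or.inl fun s t hs hst ht => IsGeodesic.le_tau_of_future S hσ.1 hneg h hs hst ht
  · exact Or.inr fun s t hs hst ht => IsGeodesic.le_tau_of_past S hσ.1 hneg h hs hst ht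

/-- Uniqueness of geodesics identifies the side `σ` with the realizing geodesic, so length,
direction and signed distance pass to `σ`. -/
lemma JoinedByTimelikeSegment.exists_length {U N : Set M} (hN : S.IsNormalNeighbourhood N)
    (hUN : U ⊆ N) {p q : M} (h : S.JoinedByTimelikeSegment U p q) {σ : ℝ → M}
    (hσ : S.IsGeodesicIn N σ p q) :
    ∃ l : ℝ, 0 < l ∧ S.tau p q = ENNReal.ofReal l ∧ S.signedDist N p q = -l ∧
      ∀ s t : ℝ, 0 ≤ s → s ≤ t → t ≤ 1 → ENNReal.ofReal ((t - s) * l) ≤ S.tau (σ s) (σ t) := by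
  obtain ⟨γ, hγ, hf, hl⟩ := h
  have hγN : S.IsGeodesicIn N γ p q := ⟨hγ.1, hγ.2.1.mono_right hUN, hγ.2.2⟩
  have hp : p ∈ N := by rw [← hγN.2.2.1]; exact hγN.2.1 (by simp)
  have hq : q ∈ N := by rw [← hγN.2.2.2]; exact hγN.2.1 (by simp)
  have heq := hN.2.2 p hp q hq _ _ hγN hσ
  have hE : S.energy (γ 0) (velocity γ 0) < 0 := hf.1
  refine ⟨√(-S.energy (γ 0) (velocity γ 0)), Real.sqrt_pos.2 (by linarith), hl, ?_, ?_⟩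
  · rw [S.signedDist_eq hN hγN, ← neg_signedRoot_of_neg hE, neg_neg]
  · intro s t hs hst ht
    rw [← heq (⟨hs, hst.trans ht⟩ : s ∈ Icc (0 : ℝ) 1), ← heq (⟨hs.trans hst, ht⟩ : t ∈ Icc (0 : ℝ) 1)]
    exact IsGeodesic.le_tau_of_future S hγ.1 hE hf.2 hs hst ht

lemma IsGeodesicIn.reverse {N : Set M} {p q : M} {σ : ℝ → M} (hσ : S.IsGeodesicIn N σ q p) :
    S.IsGeodesicIn N (fun r => σ (1 + (-1) * r)) p q := by
  have hm : MapsTo (fun r : ℝ => 1 + (-1) * r) (Icc 0 1) (Icc 0 1) := by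
    intro r hr
    constructor <;> linarith [hr.1, hr.2]
  exact ⟨IsGeodesic.comp_affine S hσ.1 hm, hσ.2.1.comp hm, by simpa using hσ.2.2.2,
    by simpa using hσ.2.2.1⟩

/-- For the timelike sides which the cyclic order of the triangle traverses against time. Reversal
negates the velocity and leaves the energy unchanged. -/
lemma JoinedByTimelikeSegment.exists_length_reverse {U N : Set M}
    (hN : S.IsNormalNeighbourhood N)
    (hUN : U ⊆ N) {p q : M} (h : S.JoinedByTimelikeSegment U p q) {σ : ℝ → M}
    (hσ : S.IsGeodesicIn N σ q p) :
    ∃ l : ℝ, 0 < l ∧ S.tau p q = ENNReal.ofReal l ∧ S.signedDist N q p = -l ∧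
      ∀ s t : ℝ, 0 ≤ s → s ≤ t → t ≤ 1 → ENNReal.ofReal ((t - s) * l) ≤ S.tau (σ t) (σ s) := by
  have hr := IsGeodesicIn.reverse S hσ
  obtain ⟨l, hl, htau, hsd, hle⟩ := JoinedByTimelikeSegment.exists_length S hN hUN h hr
  refine ⟨l, hl, htau, ?_, ?_⟩
  · rw [S.signedDist_eq hN hσ, ← hsd, S.signedDist_eq hN hr]
    congr 1
    have h1 : ContMDiffOn 𝓘(ℝ, ℝ) 𝓘(ℝ, E) 1 σ (Icc 0 1) := hσ.1.1.of_le (by norm_cast)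
    have hv := velocity_comp_affine h1 (a := 1) (b := -1) (fun r hr => by
      constructor <;> linarith [hr.1, hr.2]) (t := 1) (by simp)
    rw [← IsGeodesic.energy_eq S hr.1 (t := 1) (by simp)]
    have hv' : (velocity (fun r => σ (1 + (-1) * r)) 1 : E) = -(velocity σ 0 : E) := by
      rw [hv]
      have : ∀ r : ℝ, r = 0 → ((-1 : ℝ) • (velocity σ r : E)) = -(velocity σ 0 : E) := by
        rintro r rfl; simp
      exact this _ (by norm_num)
    have h0 : σ (1 + (-1) * 1) = σ 0 := by norm_num
    rw [S.energy_congr (w := -(velocity σ 0)) h0 hv']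
    simp [energy]
  · intro s t hs hst ht
    have := hle (1 - t) (1 - s) (by linarith) (by linarith) (by linarith)
    have e1 : 1 + (-1) * (1 - t) = t := by ring
    have e2 : 1 + (-1) * (1 - s) = s := by ring
    simp only [e1, e2] at this
    convert this using 2
    ring

end NormalNeighbourhoods

end Spacetime

/-! ### Generalized trigonometric functions -/

namespace LorentzModel

/-- `cos (√κ s)`, extended analytically to all real `κ`. -/
def cs (κ s : ℝ) : ℝ := genCos (κ * s ^ 2)

/-- `sin (√κ s) / √κ`, extended analytically to all real `κ`. -/
def sn (κ s : ℝ) : ℝ := s * genSinc (κ * s ^ 2)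

/-- `(1 - cos (√κ s)) / κ`, extended analytically to all real `κ`. -/
def ve (κ s : ℝ) : ℝ := 2 * sn κ (s / 2) ^ 2

lemma cs_of_pos {κ : ℝ} (h : 0 < κ) (s : ℝ) : cs κ s = Real.cos (√κ * s) := by
  rw [cs, genCos, if_pos (by positivity), Real.sqrt_mul h.le, Real.sqrt_sq_eq_abs]
  rw [← abs_of_nonneg (Real.sqrt_nonneg κ), ← abs_mul, Real.cos_abs,
    abs_of_nonneg (Real.sqrt_nonneg κ)]

lemma sn_of_pos {κ : ℝ} (h : 0 < κ) (s : ℝ) : sn κ s = Real.sin (√κ * s) / √κ := by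
  rcases eq_or_ne s 0 with rfl | hs
  · simp [sn]
  have hs2 : 0 < κ * s ^ 2 := by positivity
  have hk : √κ ≠ 0 := (Real.sqrt_pos.2 h).ne'
  rw [sn, genSinc, if_pos hs2, Real.sqrt_mul h.le, Real.sqrt_sq_eq_abs]
  rcases abs_choice s with h' | h' <;> rw [h']
  · field_simp
  · rw [mul_neg, Real.sin_neg]; field_simp

lemma cs_of_neg {κ : ℝ} (h : κ < 0) (s : ℝ) : cs κ s = Real.cosh (√(-κ) * s) := by
  rcases eq_or_ne s 0 with rfl | hs
  · simp [cs, genCos]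
  have hs2 : κ * s ^ 2 < 0 := mul_neg_of_neg_of_pos h (by positivity)
  rw [cs, genCos, if_neg hs2.not_ge, ← neg_mul, Real.sqrt_mul (by linarith), Real.sqrt_sq_eq_abs]
  rw [← abs_of_nonneg (Real.sqrt_nonneg (-κ)), ← abs_mul, Real.cosh_abs,
    abs_of_nonneg (Real.sqrt_nonneg (-κ))]

lemma sn_of_neg {κ : ℝ} (h : κ < 0) (s : ℝ) : sn κ s = Real.sinh (√(-κ) * s) / √(-κ) := by
  rcases eq_or_ne s 0 with rfl | hs
  · simp [sn]
  have hs2 : κ * s ^ 2 < 0 := mul_neg_of_neg_of_pos h (by positivity)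
  have hk : √(-κ) ≠ 0 := (Real.sqrt_pos.2 (by linarith)).ne'
  rw [sn, genSinc, if_neg hs2.not_gt, if_pos hs2, ← neg_mul, Real.sqrt_mul (by linarith),
    Real.sqrt_sq_eq_abs]
  rcases abs_choice s with h' | h' <;> rw [h']
  · field_simp
  · rw [mul_neg, Real.sinh_neg]; field_simp

@[simp] lemma cs_zero_left (s : ℝ) : cs 0 s = 1 := by simp [cs, genCos]

@[simp] lemma sn_zero_left (s : ℝ) : sn 0 s = s := by simp [sn, genSinc]

@[simp] lemma cs_zero (κ : ℝ) : cs κ 0 = 1 := by simp [cs, genCos]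

@[simp] lemma sn_zero (κ : ℝ) : sn κ 0 = 0 := by simp [sn]

lemma cs_one (κ : ℝ) : cs κ 1 = genCos κ := by simp [cs]

lemma sn_one (κ : ℝ) : sn κ 1 = genSinc κ := by simp [sn]

@[simp] lemma ve_zero (κ : ℝ) : ve κ 0 = 0 := by simp [ve]

@[simp] lemma cs_neg (κ s : ℝ) : cs κ (-s) = cs κ s := by simp [cs]

@[simp] lemma sn_neg (κ s : ℝ) : sn κ (-s) = -sn κ s := by simp [sn]

@[simp] lemma ve_neg (κ s : ℝ) : ve κ (-s) = ve κ s := by simp [ve, neg_div]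

lemma sn_mul (κ c s : ℝ) : sn κ (c * s) = c * sn (κ * c ^ 2) s := by
  rw [sn, sn, mul_assoc, mul_pow, mul_assoc]

lemma ve_mul (κ c s : ℝ) : ve κ (c * s) = c ^ 2 * ve (κ * c ^ 2) s := by
  rw [ve, ve, mul_div_assoc, sn_mul]; ring

lemma ve_nonneg (κ s : ℝ) : 0 ≤ ve κ s := by unfold ve; positivity

lemma cs_sq_add (κ s : ℝ) : cs κ s ^ 2 + κ * sn κ s ^ 2 = 1 := by
  rcases lt_trichotomy κ 0 with h | rfl | h
  · have hk : √(-κ) ≠ 0 := (Real.sqrt_pos.2 (by linarith)).ne'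
    have hk2 : √(-κ) ^ 2 = -κ := Real.sq_sqrt (by linarith)
    rw [cs_of_neg h, sn_of_neg h, div_pow, hk2]
    have hk0 := h.ne
    rw [Real.cosh_sq]
    field_simp
    ring
  · simp
  · have hk2 : √κ ^ 2 = κ := Real.sq_sqrt h.le
    rw [cs_of_pos h, sn_of_pos h, div_pow, hk2]
    have := Real.sin_sq_add_cos_sq (√κ * s)
    field_simp
    linarith

lemma cs_add (κ s t : ℝ) : cs κ (s + t) = cs κ s * cs κ t - κ * (sn κ s * sn κ t) := by
  rcases lt_trichotomy κ 0 with h | rfl | h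
  · have hk : √(-κ) ≠ 0 := (Real.sqrt_pos.2 (by linarith)).ne'
    have hk2 : √(-κ) ^ 2 = -κ := Real.sq_sqrt (by linarith)
    simp only [cs_of_neg h, sn_of_neg h, mul_add, Real.cosh_add]
    field_simp
    rw [hk2]; ring
  · simp
  · have hk : √κ ≠ 0 := (Real.sqrt_pos.2 h).ne'
    have hk2 : √κ ^ 2 = κ := Real.sq_sqrt h.le
    simp only [cs_of_pos h, sn_of_pos h, mul_add, Real.cos_add]
    field_simp
    rw [hk2]; ring

lemma sn_add (κ s t : ℝ) : sn κ (s + t) = sn κ s * cs κ t + cs κ s * sn κ t := by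
  rcases lt_trichotomy κ 0 with h | rfl | h
  · have hk : √(-κ) ≠ 0 := (Real.sqrt_pos.2 (by linarith)).ne'
    simp only [cs_of_neg h, sn_of_neg h, mul_add, Real.sinh_add]
    field_simp
  · simp
  · have hk : √κ ≠ 0 := (Real.sqrt_pos.2 h).ne'
    simp only [cs_of_pos h, sn_of_pos h, mul_add, Real.sin_add]
    field_simp

lemma sn_sub (κ s t : ℝ) : sn κ (s - t) = sn κ s * cs κ t - cs κ s * sn κ t := by
  rw [sub_eq_add_neg, sn_add]; simp [sub_eq_add_neg]

lemma cs_eq (κ s : ℝ) : cs κ s = 1 - κ * ve κ s := by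
  have h := cs_add κ (s / 2) (s / 2)
  rw [add_halves] at h
  rw [h, ve]
  linear_combination cs_sq_add κ (s / 2)

lemma sn_two_mul (κ s : ℝ) : sn κ (2 * s) = 2 * (sn κ s * cs κ s) := by
  rw [two_mul, sn_add]; ring

lemma sn_sq (κ s : ℝ) : sn κ s ^ 2 = 2 * ve κ s - κ * ve κ s ^ 2 := by
  have h := sn_two_mul κ (s / 2)
  rw [mul_div_cancel₀ _ two_ne_zero] at h
  rw [h, ve]
  linear_combination 4 * sn κ (s / 2) ^ 2 * cs_sq_add κ (s / 2)

lemma ve_add (κ s t : ℝ) :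
    ve κ (s + t) = ve κ s + ve κ t - κ * (ve κ s * ve κ t) + sn κ s * sn κ t := by
  have h1 := cs_sq_add κ (s / 2)
  have h2 := cs_sq_add κ (t / 2)
  have h3 := sn_two_mul κ (s / 2)
  have h4 := sn_two_mul κ (t / 2)
  rw [mul_div_cancel₀ _ two_ne_zero] at h3 h4
  rw [h3, h4, ve, ve, ve, add_div, sn_add]
  linear_combination 2 * sn κ (s / 2) ^ 2 * h2 + 2 * sn κ (t / 2) ^ 2 * h1

/-- The difference formula for cosines divided by the curvature. Its factors are positive before the
conjugate point, which gives strict monotonicity of `ve` without calculus. -/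
lemma ve_sub_ve (κ s t : ℝ) :
    ve κ t - ve κ s = 2 * sn κ ((t - s) / 2) * sn κ ((s + t) / 2) := by
  have h1 := cs_sq_add κ (s / 2)
  have h2 := cs_sq_add κ (t / 2)
  rw [ve, ve, add_div, sub_div, sn_add, sn_sub]
  linear_combination -2 * sn κ (t / 2) ^ 2 * h1 + 2 * sn κ (s / 2) ^ 2 * h2

lemma sn_pos {κ s : ℝ} (hs : 0 < s) (h : κ * s ^ 2 < Real.pi ^ 2) : 0 < sn κ s := by
  rcases lt_trichotomy κ 0 with hk | rfl | hk
  · have hk' : 0 < √(-κ) := Real.sqrt_pos.2 (by linarith)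
    rw [sn_of_neg hk]
    exact div_pos (Real.sinh_pos_iff.2 (by positivity)) hk'
  · simpa
  · have hk' : 0 < √κ := Real.sqrt_pos.2 hk
    rw [sn_of_pos hk]
    refine div_pos (Real.sin_pos_of_pos_of_lt_pi (by positivity) ?_) hk'
    refine lt_of_pow_lt_pow_left₀ 2 Real.pi_pos.le ?_
    rwa [mul_pow, Real.sq_sqrt hk.le]

/-- Shorter geodesics stay before the conjugate point; if `κ ≤ 0` there is no conjugate point at
all. -/
lemma mul_sq_lt {κ s t B : ℝ} (hB : 0 < B) (h : κ * t ^ 2 < B) (hst : |s| ≤ |t|) :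
    κ * s ^ 2 < B := by
  have h2 : s ^ 2 ≤ t ^ 2 := sq_le_sq.2 hst
  rcases le_or_gt κ 0 with hk | hk
  · exact (mul_nonpos_of_nonpos_of_nonneg hk (sq_nonneg s)).trans_lt hB
  · exact (mul_le_mul_of_nonneg_left h2 hk.le).trans_lt h

lemma sn_pos_of_le {κ s t : ℝ} (hs : 0 < s) (hst : s ≤ t) (h : κ * t ^ 2 < Real.pi ^ 2) :
    0 < sn κ s :=
  sn_pos hs (mul_sq_lt (by positivity) h (by rw [abs_of_pos hs, abs_of_pos (hs.trans_le hst)]; exact hst))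

lemma sn_nonneg_of_le {κ s t : ℝ} (hs : 0 ≤ s) (hst : s ≤ t) (h : κ * t ^ 2 < Real.pi ^ 2) :
    0 ≤ sn κ s := by
  rcases hs.eq_or_lt with rfl | hs
  · simp
  · exact (sn_pos_of_le hs hst h).le

lemma ve_lt_ve {κ s t : ℝ} (hs : 0 ≤ s) (hst : s < t) (h : κ * t ^ 2 < Real.pi ^ 2) :
    ve κ s < ve κ t := by
  have h1 : 0 < sn κ ((t - s) / 2) := sn_pos_of_le (t := t) (by linarith) (by linarith) h
  have h2 : 0 < sn κ ((s + t) / 2) := sn_pos_of_le (t := t) (by linarith) (by linarith) h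
  have := ve_sub_ve κ s t
  have : 0 < 2 * sn κ ((t - s) / 2) * sn κ ((s + t) / 2) := by positivity
  linarith

lemma continuous_sn (κ : ℝ) : Continuous (sn κ) := by
  rcases lt_trichotomy κ 0 with hk | rfl | hk
  · rw [show sn κ = _ from funext (sn_of_neg hk)]; fun_prop
  · rw [show sn 0 = _ from funext sn_zero_left]; fun_prop
  · rw [show sn κ = _ from funext (sn_of_pos hk)]; fun_prop

lemma continuous_cs (κ : ℝ) : Continuous (cs κ) := by
  rcases lt_trichotomy κ 0 with hk | rfl | hk
  · rw [show cs κ = _ from funext (cs_of_neg hk)]; fun_prop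
  · rw [show cs 0 = _ from funext cs_zero_left]; fun_prop
  · rw [show cs κ = _ from funext (cs_of_pos hk)]; fun_prop

lemma genSinc_pos {κ : ℝ} (h : κ < Real.pi ^ 2) : 0 < genSinc κ := by
  rw [← sn_one]; exact sn_pos one_pos (by simpa)

lemma genCos_sq_add (κ : ℝ) : genCos κ ^ 2 + κ * genSinc κ ^ 2 = 1 := by
  have := cs_sq_add κ 1
  rwa [cs_one, sn_one] at this

lemma genCos_injOn : InjOn genCos (Iio (Real.pi ^ 2)) := by
  have key : ∀ a b : ℝ, a < 0 → 0 ≤ b → genCos a ≠ genCos b := by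
    intro a b ha hb h
    rw [genCos, genCos, if_neg ha.not_ge, if_pos hb] at h
    have h1 : 1 < Real.cosh √(-a) := Real.one_lt_cosh.2 (Real.sqrt_pos.2 (by linarith)).ne'
    have := Real.cos_le_one √b
    linarith
  intro a ha b hb hab
  rcases lt_or_ge a 0 with h1 | h1 <;> rcases lt_or_ge b 0 with h2 | h2
  · rw [genCos, genCos, if_neg h1.not_ge, if_neg h2.not_ge] at hab
    have := Real.cosh_strictMonoOn.injOn (Real.sqrt_nonneg _) (Real.sqrt_nonneg _) hab
    have := (Real.sqrt_inj (by linarith) (by linarith)).1 this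
    linarith
  · exact absurd hab (key a b h1 h2)
  · exact absurd hab.symm (key b a h2 h1)
  · rw [genCos, genCos, if_pos h1, if_pos h2] at hab
    have hr : ∀ c : ℝ, c < Real.pi ^ 2 → √c ∈ Icc 0 Real.pi := fun c hc =>
      ⟨Real.sqrt_nonneg _, Real.sqrt_le_iff.2 ⟨Real.pi_pos.le, hc.le⟩⟩
    have := Real.injOn_cos (hr a ha) (hr b hb) hab
    exact (Real.sqrt_inj h1 h2).1 this

lemma exists_genCos_eq {c : ℝ} (hc : -1 < c) : ∃ κ < Real.pi ^ 2, genCos κ = c := by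
  rcases le_or_gt c 1 with h | h
  · refine ⟨Real.arccos c ^ 2, ?_, ?_⟩
    · have h1 : Real.arccos c < Real.pi := by
        refine lt_of_le_of_ne (Real.arccos_le_pi c) fun h' => ?_
        rw [Real.arccos_eq_pi] at h'
        linarith
      have h0 := Real.arccos_nonneg c
      nlinarith
    · rw [genCos, if_pos (sq_nonneg _), Real.sqrt_sq (Real.arccos_nonneg c),
        Real.cos_arccos hc.le h]
  · have h0 : 0 < √(c ^ 2 - 1) := Real.sqrt_pos.2 (by nlinarith)
    have h1 : 0 < Real.arsinh √(c ^ 2 - 1) := Real.arsinh_pos_iff.2 h0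
    refine ⟨-Real.arsinh √(c ^ 2 - 1) ^ 2, ?_, ?_⟩
    · have := Real.pi_pos
      nlinarith [sq_nonneg (Real.arsinh √(c ^ 2 - 1))]
    · rw [genCos, if_neg (by simp; positivity), neg_neg, Real.sqrt_sq h1.le, Real.cosh_arsinh,
        Real.sq_sqrt (by nlinarith)]
      simp only [add_sub_cancel]
      exact Real.sqrt_sq (by linarith)

lemma neg_one_lt_genCos {κ : ℝ} (h : κ < Real.pi ^ 2) : -1 < genCos κ := by
  rw [genCos]
  split_ifs with h0
  · have h1 : √κ < Real.pi := (Real.sqrt_lt' Real.pi_pos).2 h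
    rw [← Real.cos_pi]
    exact Real.cos_lt_cos_of_nonneg_of_le_pi (Real.sqrt_nonneg _) le_rfl h1
  · linarith [Real.one_le_cosh √(-κ)]

end LorentzModel

/-! ### Ambient form, chords, geodesics and the cosine law -/

namespace LorentzModel

variable {K : ℝ} {p q r v w u : ℝ × ℝ × ℝ}

/-- The bilinear form of the ambient space of `M_K`. -/
def form (K : ℝ) (v w : ℝ × ℝ × ℝ) : ℝ :=
  -(v.1 * w.1) + v.2.1 * w.2.1 + K⁻¹ * (v.2.2 * w.2.2)

lemma energy_eq_form (K : ℝ) (v : ℝ × ℝ × ℝ) : energy K v = form K v v := by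
  unfold energy form; ring

lemma form_comm (K : ℝ) (v w : ℝ × ℝ × ℝ) : form K v w = form K w v := by unfold form; ring

@[simp] lemma form_add_left (K : ℝ) (u v w : ℝ × ℝ × ℝ) :
    form K (u + v) w = form K u w + form K v w := by simp [form]; ring

@[simp] lemma form_sub_left (K : ℝ) (u v w : ℝ × ℝ × ℝ) :
    form K (u - v) w = form K u w - form K v w := by simp [form]; ring

@[simp] lemma form_smul_left (K c : ℝ) (v w : ℝ × ℝ × ℝ) :
    form K (c • v) w = c * form K v w := by simp [form]; ring

@[simp] lemma form_add_right (K : ℝ) (u v w : ℝ × ℝ × ℝ) :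
    form K u (v + w) = form K u v + form K u w := by simp [form]; ring

@[simp] lemma form_sub_right (K : ℝ) (u v w : ℝ × ℝ × ℝ) :
    form K u (v - w) = form K u v - form K u w := by simp [form]; ring

@[simp] lemma form_smul_right (K c : ℝ) (v w : ℝ × ℝ × ℝ) :
    form K v (c • w) = c * form K v w := by simp [form]; ring

lemma energy_smul (K c : ℝ) (v : ℝ × ℝ × ℝ) : energy K (c • v) = c ^ 2 * energy K v := by
  simp [energy_eq_form]; ring

lemma energy_sub (K : ℝ) (v w : ℝ × ℝ × ℝ) :
    energy K (v - w) = energy K v - 2 * form K v w + energy K w := by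
  simp [energy_eq_form, form_comm K w v]; ring

lemma energy_add (K : ℝ) (v w : ℝ × ℝ × ℝ) :
    energy K (v + w) = energy K v + 2 * form K v w + energy K w := by
  simp [energy_eq_form, form_comm K w v]; ring

/-- Half of the ambient squared distance of two points. -/
def chord (K : ℝ) (p q : ℝ × ℝ × ℝ) : ℝ := energy K (q - p) / 2

lemma chord_comm (K : ℝ) (p q : ℝ × ℝ × ℝ) : chord K p q = chord K q p := by
  simp [chord, energy]; ring

@[simp] lemma chord_self (K : ℝ) (p : ℝ × ℝ × ℝ) : chord K p p = 0 := by simp [chord, energy]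

lemma form_points (hK : K ≠ 0) (hp : p ∈ points K) : form K p p = K⁻¹ := by
  have := hp.1
  unfold form
  field_simp
  linarith

lemma form_tangent (hK : K ≠ 0) (hv : IsTangent K p v) : form K p v = 0 := by
  unfold IsTangent at hv
  unfold form
  field_simp
  linarith

lemma chord_eq (hK : K ≠ 0) (hp : p ∈ points K) (hq : q ∈ points K) :
    chord K p q = K⁻¹ - form K p q := by
  rw [chord, energy_sub, energy_eq_form, energy_eq_form, form_points hK hp, form_points hK hq,
    form_comm K q p]
  ring

lemma IsTangent.eq_zero (hp : p ∈ points 0) (hv : IsTangent 0 p v) : v.2.2 = 0 := by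
  have := hp.2 rfl
  unfold IsTangent at hv
  simpa [this] using hv

lemma IsTangent.smul (hv : IsTangent K p v) (c : ℝ) : IsTangent K p (c • v) := by
  unfold IsTangent at *
  simp only [Prod.smul_fst, Prod.smul_snd, smul_eq_mul]
  linear_combination c * hv

lemma IsTangent.add (hv : IsTangent K p v) (hw : IsTangent K p w) : IsTangent K p (v + w) := by
  unfold IsTangent at *
  simp only [Prod.fst_add, Prod.snd_add]
  linear_combination hv + hw

lemma IsTangent.sub (hv : IsTangent K p v) (hw : IsTangent K p w) : IsTangent K p (v - w) := by
  unfold IsTangent at *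
  simp only [Prod.fst_sub, Prod.snd_sub]
  linear_combination hv - hw

/-- The geodesic with initial point `p` and initial velocity `v`. -/
def line (K : ℝ) (p v : ℝ × ℝ × ℝ) (s : ℝ) : ℝ × ℝ × ℝ :=
  cs (K * energy K v) s • p + sn (K * energy K v) s • v

/-- The velocity of the geodesic with initial point `p` and initial velocity `v`. -/
def vel (K : ℝ) (p v : ℝ × ℝ × ℝ) (s : ℝ) : ℝ × ℝ × ℝ :=
  (-(K * energy K v) * sn (K * energy K v) s) • p + cs (K * energy K v) s • v

lemma exp_smul (K : ℝ) (p v : ℝ × ℝ × ℝ) (s : ℝ) : exp K p (s • v) = line K p v s := by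
  rw [exp, line, energy_smul, cs, sn, smul_smul, mul_comm (genSinc _) s,
    show K * (s ^ 2 * energy K v) = K * energy K v * s ^ 2 by ring]

lemma exp_eq (K : ℝ) (p v : ℝ × ℝ × ℝ) : exp K p v = line K p v 1 := by
  rw [← exp_smul, one_smul]

@[simp] lemma line_zero (K : ℝ) (p v : ℝ × ℝ × ℝ) : line K p v 0 = p := by simp [line]

@[simp] lemma vel_zero (K : ℝ) (p v : ℝ × ℝ × ℝ) : vel K p v 0 = v := by simp [vel]

lemma continuous_line (K : ℝ) (p v : ℝ × ℝ × ℝ) : Continuous (line K p v) := by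
  have := continuous_cs (K * energy K v)
  have := continuous_sn (K * energy K v)
  unfold line; fun_prop

lemma continuous_vel (K : ℝ) (p v : ℝ × ℝ × ℝ) : Continuous (vel K p v) := by
  have := continuous_cs (K * energy K v)
  have := continuous_sn (K * energy K v)
  unfold vel; fun_prop

lemma mul_energy_eq (hp : p ∈ points K) (hv : IsTangent K p v) :
    K * (-v.1 ^ 2 + v.2.1 ^ 2) + v.2.2 ^ 2 = K * energy K v := by
  rcases eq_or_ne K 0 with rfl | hK
  · simp [hv.eq_zero hp]
  · unfold energy; field_simp

lemma line_mem (hp : p ∈ points K) (hv : IsTangent K p v) (s : ℝ) : line K p v s ∈ points K := by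
  refine ⟨?_, ?_⟩
  · have h1 := hp.1
    have h2 := cs_sq_add (K * energy K v) s
    have h3 := mul_energy_eq hp hv
    unfold IsTangent at hv
    simp only [line, Prod.fst_add, Prod.snd_add, Prod.smul_fst, Prod.smul_snd, smul_eq_mul]
    linear_combination cs (K * energy K v) s ^ 2 * h1 + sn (K * energy K v) s ^ 2 * h3 + h2 +
      2 * cs (K * energy K v) s * sn (K * energy K v) s * hv
  · rintro rfl
    simp [line, hv.eq_zero hp, hp.2 rfl]

lemma vel_tangent (hp : p ∈ points K) (hv : IsTangent K p v) (s : ℝ) :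
    IsTangent K (line K p v s) (vel K p v s) := by
  have h1 := hp.1
  have h2 := cs_sq_add (K * energy K v) s
  have h3 := mul_energy_eq hp hv
  unfold IsTangent at *
  simp only [line, vel, Prod.fst_add, Prod.snd_add, Prod.smul_fst, Prod.smul_snd, smul_eq_mul]
  linear_combination
    -(K * energy K v) * sn (K * energy K v) s * cs (K * energy K v) s * h1 +
    cs (K * energy K v) s * sn (K * energy K v) s * h3 +
    (cs (K * energy K v) s ^ 2 - K * energy K v * sn (K * energy K v) s ^ 2) * hv

lemma energy_vel (hp : p ∈ points K) (hv : IsTangent K p v) (s : ℝ) :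
    energy K (vel K p v s) = energy K v := by
  rcases eq_or_ne K 0 with rfl | hK
  · simp [vel]
  · have h2 := cs_sq_add (K * energy K v) s
    have hf : K⁻¹ * K = 1 := inv_mul_cancel₀ hK
    rw [vel, energy_add, energy_smul, energy_smul, energy_eq_form K p, form_points hK hp,
      form_smul_left, form_smul_right, form_tangent hK hv]
    linear_combination energy K v * h2 +
      energy K v ^ 2 * K * sn (K * energy K v) s ^ 2 * hf

lemma line_line (hp : p ∈ points K) (hv : IsTangent K p v) (s t : ℝ) :
    line K (line K p v s) (vel K p v s) t = line K p v (s + t) := by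
  rw [line, energy_vel hp hv]
  simp only [line, vel, cs_add, sn_add]
  module

lemma line_smul (K : ℝ) (p v : ℝ × ℝ × ℝ) (c s : ℝ) : line K p (c • v) s = line K p v (c * s) := by
  rw [← exp_smul, ← exp_smul, smul_smul, mul_comm]

lemma vel_smul (K : ℝ) (p v : ℝ × ℝ × ℝ) (c s : ℝ) :
    vel K p (c • v) s = c • vel K p v (c * s) := by
  rw [vel, vel, energy_smul, sn_mul, show cs (K * (c ^ 2 * energy K v)) s =
    cs (K * energy K v) (c * s) by rw [cs, cs]; ring_nf,
    show K * (c ^ 2 * energy K v) = K * energy K v * c ^ 2 by ring]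
  module

/-- Sum-to-product formulas show that a chord vector is parallel to the velocity at the middle
parameter. -/
lemma line_sub_line (K : ℝ) (p v : ℝ × ℝ × ℝ) (s t : ℝ) :
    line K p v t - line K p v s =
      (2 * sn (K * energy K v) ((t - s) / 2)) • vel K p v ((s + t) / 2) := by
  set κ := K * energy K v with hκ
  have h1 : cs κ t - cs κ s = 2 * sn κ ((t - s) / 2) * (-κ * sn κ ((s + t) / 2)) := by
    rw [cs_eq, cs_eq]
    linear_combination -κ * ve_sub_ve κ s t
  have h2 : sn κ t - sn κ s = 2 * sn κ ((t - s) / 2) * cs κ ((s + t) / 2) := by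
    have e1 : t = (s + t) / 2 + (t - s) / 2 := by ring
    have e2 : s = (s + t) / 2 - (t - s) / 2 := by ring
    have f1 := sn_add κ ((s + t) / 2) ((t - s) / 2)
    have f2 := sn_sub κ ((s + t) / 2) ((t - s) / 2)
    rw [← e1] at f1
    rw [← e2] at f2
    rw [f1, f2]; ring
  rw [line, line, vel, ← hκ, show cs κ t • p + sn κ t • v - (cs κ s • p + sn κ s • v) =
    (cs κ t - cs κ s) • p + (sn κ t - sn κ s) • v by module, h1, h2]
  module

/-- The generalized cosine law. -/
lemma chord_line (hr : r ∈ points K) (hp : p ∈ points K) (hv : IsTangent K p v) (s : ℝ) :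
    chord K r (line K p v s) = cs (K * energy K v) s * chord K r p +
      sn (K * energy K v) s * form K (p - r) v + energy K v * ve (K * energy K v) s := by
  rcases eq_or_ne K 0 with rfl | hK
  · have h : line 0 p v s - r = (p - r) + s • v := by simp [line]; module
    rw [chord, h, chord, energy_add, energy_smul, form_smul_right]
    simp [ve]; ring
  · have hf : K⁻¹ * K = 1 := inv_mul_cancel₀ hK
    rw [chord_eq hK hr (line_mem hp hv s), chord_eq hK hr hp, line, form_add_right, form_smul_right,
      form_smul_right, form_sub_left, form_tangent hK hv, cs_eq]
    linear_combination energy K v * ve (K * energy K v) s * hf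

/-- The right side is the derivative in `s` of the cosine law `chord_line`, so the left side is the
slope of the chord along the geodesic. -/
lemma form_vel (hr : r ∈ points K) (hp : p ∈ points K) (hv : IsTangent K p v) (s : ℝ) :
    form K (line K p v s - r) (vel K p v s) =
      -(K * energy K v) * sn (K * energy K v) s * chord K r p +
      cs (K * energy K v) s * form K (p - r) v + energy K v * sn (K * energy K v) s := by
  rcases eq_or_ne K 0 with rfl | hK
  · have h : line 0 p v s - r = (p - r) + s • v := by simp [line]; module
    rw [h, vel]
    simp [energy_eq_form]; ring
  · have hf : K⁻¹ * K = 1 := inv_mul_cancel₀ hK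
    have h1 := form_tangent hK (vel_tangent hp hv s)
    rw [form_sub_left, h1, vel, form_add_right, form_smul_right, form_smul_right, chord_eq hK hr hp,
      form_sub_left, form_tangent hK hv]
    linear_combination energy K v * sn (K * energy K v) s * hf

lemma chord_line_self (hp : p ∈ points K) (hv : IsTangent K p v) (s : ℝ) :
    chord K p (line K p v s) = energy K v * ve (K * energy K v) s := by
  rw [chord_line hp hp hv]; simp [form]

/-- The derivative of `chord K r` along a geodesic satisfies the linear Jacobi equation. -/
lemma sn_mul_form_vel (hr : r ∈ points K) (hp : p ∈ points K) (hv : IsTangent K p v) (s : ℝ) :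
    sn (K * energy K v) 1 * form K (line K p v s - r) (vel K p v s) =
      sn (K * energy K v) (1 - s) * form K (p - r) v +
      sn (K * energy K v) s * form K (line K p v 1 - r) (vel K p v 1) := by
  rw [form_vel hr hp hv s, form_vel hr hp hv 1, sn_sub]
  ring

/-- Expanding at the middle parameter with the cosine law cancels the even terms. The result is an
exact mean value formula: the sign of the slope at the midpoint decides which chord is larger. -/
lemma chord_line_sub (hr : r ∈ points K) (hp : p ∈ points K) (hv : IsTangent K p v) (s t : ℝ) :
    chord K r (line K p v t) - chord K r (line K p v s) =
      2 * sn (K * energy K v) ((t - s) / 2) *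
        form K (line K p v ((s + t) / 2) - r) (vel K p v ((s + t) / 2)) := by
  have hm : ∀ d, chord K r (line K p v ((s + t) / 2 + d)) =
      cs (K * energy K v) d * chord K r (line K p v ((s + t) / 2)) +
      sn (K * energy K v) d * form K (line K p v ((s + t) / 2) - r) (vel K p v ((s + t) / 2)) +
      energy K v * ve (K * energy K v) d := by
    intro d
    have := chord_line hr (line_mem hp hv ((s + t) / 2)) (vel_tangent hp hv ((s + t) / 2)) d
    rwa [line_line hp hv, energy_vel hp hv] at this
  have h1 := hm ((t - s) / 2)
  have h2 := hm (-((t - s) / 2))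
  rw [show (s + t) / 2 + (t - s) / 2 = t by ring] at h1
  rw [show (s + t) / 2 + -((t - s) / 2) = s by ring, cs_neg, sn_neg, ve_neg] at h2
  rw [h1, h2]; ring

/-! ### Logarithms -/

lemma IsLog.line_one (h : IsLog K p q v) : line K p v 1 = q := by rw [← exp_eq]; exact h.2.2

lemma IsLog.mem (h : IsLog K p q v) (hp : p ∈ points K) : q ∈ points K := by
  rw [← h.line_one]; exact line_mem hp h.1 1

lemma IsLog.chord_eq (h : IsLog K p q v) (hp : p ∈ points K) :
    chord K p q = energy K v * ve (K * energy K v) 1 := by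
  rw [← h.line_one, chord_line_self hp h.1]

lemma ve_pos {κ s : ℝ} (hs : 0 < s) (h : κ * s ^ 2 < Real.pi ^ 2) : 0 < ve κ s := by
  have := sn_pos_of_le (half_pos hs) (half_le_self hs.le) h
  unfold ve; positivity

lemma IsLog.ve_pos (h : IsLog K p q v) : 0 < ve (K * energy K v) 1 :=
  LorentzModel.ve_pos one_pos (by simpa using h.2.1)

lemma IsLog.sn_pos (h : IsLog K p q v) {s : ℝ} (h0 : 0 < s) (h1 : s ≤ 1) :
    0 < sn (K * energy K v) s :=
  sn_pos_of_le h0 h1 (by simpa using h.2.1)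

lemma IsLog.sn_nonneg (h : IsLog K p q v) {s : ℝ} (h0 : 0 ≤ s) (h1 : s ≤ 1) :
    0 ≤ sn (K * energy K v) s :=
  sn_nonneg_of_le h0 h1 (by simpa using h.2.1)

lemma IsLog.energy_neg_iff (h : IsLog K p q v) (hp : p ∈ points K) :
    energy K v < 0 ↔ chord K p q < 0 := by
  rw [h.chord_eq hp]
  have := h.ve_pos
  constructor
  · intro h'; exact mul_neg_of_neg_of_pos h' this
  · intro h'; by_contra hcon; push Not at hcon; exact absurd h' (mul_nonneg hcon this.le).not_gt

lemma IsLog.mul_chord (h : IsLog K p q v) (hp : p ∈ points K) :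
    K * chord K p q = 1 - genCos (K * energy K v) := by
  rw [h.chord_eq hp, ← cs_one, cs_eq]; ring

lemma IsLog.mul_chord_lt (h : IsLog K p q v) (hp : p ∈ points K) : K * chord K p q < 2 := by
  rw [h.mul_chord hp]; linarith [neg_one_lt_genCos h.2.1]

/-- For `K = 0` the chord is half the energy. Otherwise the chord determines `genCos` of `K` times
the energy, and `genCos` is injective before the conjugate point. -/
lemma IsLog.energy_eq {p' q' v' : ℝ × ℝ × ℝ} (h : IsLog K p q v) (hp : p ∈ points K)
    (h' : IsLog K p' q' v') (hp' : p' ∈ points K) (hc : chord K p q = chord K p' q') :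
    energy K v = energy K v' := by
  rcases eq_or_ne K 0 with rfl | hK
  · rw [h.chord_eq hp, h'.chord_eq hp'] at hc
    simp [ve] at hc
    exact hc
  · have h1 := h.mul_chord hp
    rw [hc, h'.mul_chord hp'] at h1
    have := genCos_injOn h.2.1 h'.2.1 (by linarith)
    exact mul_left_cancel₀ hK this

/-- The number `1 - K * chord K p q` must be the cosine along the geodesic, and the hypothesis says
that it exceeds -1. The velocity is the part of `q` orthogonal to `p`, divided by `genSinc`.
Together with the converse this turns `Joined` into an inequality for the chord. -/
lemma exists_isLog (hp : p ∈ points K) (hq : q ∈ points K) (h : K * chord K p q < 2) :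
    ∃ v, IsLog K p q v := by
  obtain ⟨κ, hκ, hc⟩ := exists_genCos_eq (c := 1 - K * chord K p q) (by linarith)
  have hpos := genSinc_pos hκ
  set w : ℝ × ℝ × ℝ := q - (1 - K * chord K p q) • p with hw
  have hwt : IsTangent K p w := by
    have h1 := hp.1
    have h2 : K * (-(p.1 * q.1) + p.2.1 * q.2.1) + p.2.2 * q.2.2 = 1 - K * chord K p q := by
      rcases eq_or_ne K 0 with rfl | hK
      · simp [hp.2 rfl, hq.2 rfl]
      · rw [LorentzModel.chord_eq hK hp hq, form]; field_simp; ring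
    simp only [IsTangent, hw, Prod.fst_sub, Prod.snd_sub, Prod.smul_fst, Prod.smul_snd, smul_eq_mul]
    linear_combination h2 - (1 - K * chord K p q) * h1
  have hE : K * energy K w = 1 - (1 - K * chord K p q) ^ 2 := by
    rcases eq_or_ne K 0 with rfl | hK
    · simp
    · have hf : K⁻¹ * K = 1 := inv_mul_cancel₀ hK
      rw [hw, energy_sub, energy_smul, energy_eq_form, energy_eq_form, form_points hK hp,
        form_points hK hq, form_smul_right, form_comm K q p,
        show form K p q = K⁻¹ - chord K p q by rw [LorentzModel.chord_eq hK hp hq]; ring]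
      linear_combination (1 - 2 * (1 - K * chord K p q) + (1 - K * chord K p q) ^ 2) * hf
  have hk : K * energy K ((genSinc κ)⁻¹ • w) = κ := by
    have := genCos_sq_add κ
    rw [energy_smul]
    field_simp
    rw [hE, ← hc]
    linarith
  refine ⟨(genSinc κ)⁻¹ • w, hwt.smul _, by rwa [hk], ?_⟩
  rw [exp, hk, hc, smul_smul, mul_inv_cancel₀ hpos.ne', one_smul, hw]
  module

lemma joined_iff (hp : p ∈ points K) (hq : q ∈ points K) : Joined K p q ↔ K * chord K p q < 2 :=
  ⟨fun ⟨_, h⟩ => h.mul_chord_lt hp, exists_isLog hp hq⟩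

lemma Joined.isLog (h : Joined K p q) : IsLog K p q (log K p q) := by
  rw [log, dif_pos h]; exact h.choose_spec

lemma seg_eq_line (K : ℝ) (p q : ℝ × ℝ × ℝ) (s : ℝ) : seg K p q s = line K p (log K p q) s := by
  rw [seg, exp_smul]

/-- A description of the geodesic that is symmetric in its endpoints, so that reversing it amounts
to replacing `s` by `1 - s`. -/
lemma IsLog.line_eq (h : IsLog K p q v) (s : ℝ) :
    line K p v s = (sn (K * energy K v) (1 - s) / sn (K * energy K v) 1) • p +
      (sn (K * energy K v) s / sn (K * energy K v) 1) • q := by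
  have h1 := (h.sn_pos one_pos le_rfl).ne'
  rw [← h.line_one, line, line, smul_add, smul_smul, smul_smul, ← add_assoc, ← add_smul,
    div_mul_cancel₀ _ h1]
  congr 2
  rw [sn_sub]; field_simp; ring

lemma IsLog.unique {v' : ℝ × ℝ × ℝ} (h : IsLog K p q v) (h' : IsLog K p q v')
    (hp : p ∈ points K) : v = v' := by
  have he := h.energy_eq hp h' hp rfl
  have h1 := h.line_one
  rw [← h'.line_one, line, line, ← he] at h1
  have h2 := add_left_cancel h1
  exact smul_right_injective _ (h.sn_pos one_pos le_rfl).ne' h2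

lemma log_eq (h : IsLog K p q v) (hp : p ∈ points K) : log K p q = v :=
  (Joined.isLog ⟨v, h⟩).unique h hp

lemma seg_zero (K : ℝ) (p q : ℝ × ℝ × ℝ) : seg K p q 0 = p := by simp [seg_eq_line]

lemma seg_one (h : Joined K p q) : seg K p q 1 = q := by rw [seg_eq_line, h.isLog.line_one]

lemma Joined.symm (hp : p ∈ points K) (hq : q ∈ points K) (h : Joined K p q) : Joined K q p := by
  rw [joined_iff hq hp, chord_comm]; exact (joined_iff hp hq).1 h

lemma seg_comm (hp : p ∈ points K) (hq : q ∈ points K) (h : Joined K p q) (s : ℝ) :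
    seg K q p s = seg K p q (1 - s) := by
  have h' := h.symm hp hq
  have he := h.isLog.energy_eq hp h'.isLog hq (chord_comm K p q)
  rw [seg_eq_line, seg_eq_line, h.isLog.line_eq, h'.isLog.line_eq, he, sub_sub_cancel, add_comm]

lemma seg_mem (hp : p ∈ points K) (h : Joined K p q) (s : ℝ) : seg K p q s ∈ points K := by
  rw [seg_eq_line]; exact line_mem hp h.isLog.1 s

lemma continuous_seg (K : ℝ) (p q : ℝ × ℝ × ℝ) : Continuous (seg K p q) := by
  simp only [funext (seg_eq_line K p q)]; exact continuous_line _ _ _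

lemma continuous_chord (K : ℝ) (p : ℝ × ℝ × ℝ) : Continuous (chord K p) := by
  unfold chord energy; fun_prop

end LorentzModel

/-! ### Time orientation and time separation in the model -/

namespace LorentzModel

variable {K : ℝ} {p q r v w u x b : ℝ × ℝ × ℝ}

/-- A linear functional whose sign gives the time orientation of timelike vectors. -/
def theta (K : ℝ) (p v : ℝ × ℝ × ℝ) : ℝ :=
  if K < 0 then p.2.2 * v.1 - p.1 * v.2.2 else v.1

lemma isFuture_iff : IsFuture K p v ↔ 0 < theta K p v := by
  unfold IsFuture theta; split_ifs <;> rfl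

lemma theta_add (K : ℝ) (p v w : ℝ × ℝ × ℝ) :
    theta K p (v + w) = theta K p v + theta K p w := by
  unfold theta; split_ifs <;> simp; ring

lemma theta_sub (K : ℝ) (p v w : ℝ × ℝ × ℝ) :
    theta K p (v - w) = theta K p v - theta K p w := by
  unfold theta; split_ifs <;> simp; ring

lemma theta_smul (K c : ℝ) (p v : ℝ × ℝ × ℝ) : theta K p (c • v) = c * theta K p v := by
  unfold theta; split_ifs <;> simp; ring

lemma theta_neg (K : ℝ) (p v : ℝ × ℝ × ℝ) : theta K p (-v) = -theta K p v := by
  unfold theta; split_ifs <;> simp; ring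

lemma theta_self (hK : K < 0) (p : ℝ × ℝ × ℝ) : theta K p p = 0 := by
  rw [theta, if_pos hK]; ring

lemma theta_sub_comm (K : ℝ) (p q : ℝ × ℝ × ℝ) : theta K p (q - p) = -theta K q (p - q) := by
  unfold theta; split_ifs <;> simp; ring

lemma continuous_theta_sub (K : ℝ) (r : ℝ × ℝ × ℝ) : Continuous fun q => theta K r (q - r) := by
  unfold theta; split_ifs <;> fun_prop

/-- Up to a negative factor, `theta` is the product with a timelike ambient vector: the direction of
t if `0 ≤ K`, the rotation of the (w, t)-plane at p if `K < 0`. Tangent vectors in its kernel are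
therefore spacelike or zero. -/
lemma energy_nonneg_of_theta (hp : p ∈ points K) (hv : IsTangent K p v) (h : theta K p v = 0) :
    0 ≤ energy K v ∧ (energy K v = 0 → v = 0) := by
  rcases lt_trichotomy K 0 with hK | rfl | hK
  · rw [theta, if_pos hK] at h
    have h1 := hp.1
    have hv' := hv
    unfold IsTangent at hv
    -- Lagrange's identity in the (t, w)-plane. One square on its right side vanishes by `h`, the
    -- other is rewritten with tangency.
    have e1 : (-K * p.1 ^ 2 + p.2.2 ^ 2) * (-K * v.1 ^ 2 + v.2.2 ^ 2) =
        K ^ 2 * p.2.1 ^ 2 * v.2.1 ^ 2 := by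
      have : -K * (p.1 * v.1) + p.2.2 * v.2.2 = -K * (p.2.1 * v.2.1) := by linarith
      linear_combination (-K * (p.1 * v.1) + p.2.2 * v.2.2 + -K * (p.2.1 * v.2.1)) * this +
        (-K * (p.2.2 * v.1 - p.1 * v.2.2)) * h
    have e2 : -K * p.1 ^ 2 + p.2.2 ^ 2 = 1 - K * p.2.1 ^ 2 := by linarith
    have h3 : 0 < 1 - K * p.2.1 ^ 2 := by nlinarith [sq_nonneg p.2.1]
    rw [e2] at e1
    have e3 : -K * energy K v = -K * v.2.1 ^ 2 - (-K * v.1 ^ 2 + v.2.2 ^ 2) := by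
      have hK0 := hK.ne
      unfold energy; field_simp; ring
    have e4 : (1 - K * p.2.1 ^ 2) * energy K v = v.2.1 ^ 2 := by
      have : -K ≠ 0 := by linarith
      apply mul_left_cancel₀ this
      linear_combination (1 - K * p.2.1 ^ 2) * e3 - e1
    refine ⟨?_, fun h0 => ?_⟩
    · by_contra hcon
      push Not at hcon
      nlinarith [sq_nonneg v.2.1]
    · rw [h0] at e4
      have hv2 : v.2.1 = 0 := by simpa using e4.symm
      rw [hv2] at e1
      have h5 : -K * v.1 ^ 2 + v.2.2 ^ 2 = 0 := by
        apply mul_left_cancel₀ h3.ne'; linarith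
      have h6 : v.2.2 ^ 2 = 0 := by nlinarith [sq_nonneg v.1, sq_nonneg v.2.2]
      have h7 : v.1 ^ 2 = 0 := by
        have : -K * v.1 ^ 2 = 0 := by linarith
        rcases mul_eq_zero.1 this with h | h
        · linarith
        · exact h
      ext
      · simpa using h7
      · exact hv2
      · simpa using h6
  · rw [theta, if_neg (lt_irrefl _)] at h
    have h2 := hv.eq_zero hp
    unfold energy
    rw [h, h2]
    refine ⟨by positivity, fun h0 => ?_⟩
    ext
    · exact h
    · simpa using h0
    · exact h2
  · rw [theta, if_neg hK.not_gt] at h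
    unfold energy
    rw [h]
    have : 0 ≤ K⁻¹ * v.2.2 ^ 2 := by positivity
    refine ⟨by simp; positivity, fun h0 => ?_⟩
    have h1 : v.2.1 ^ 2 = 0 := by nlinarith [sq_nonneg v.2.1]
    have h2 : K⁻¹ * v.2.2 ^ 2 = 0 := by nlinarith [sq_nonneg v.2.1]
    have h3 : v.2.2 ^ 2 = 0 := by
      rcases mul_eq_zero.1 h2 with h | h
      · exact absurd h (by positivity)
      · exact h
    ext
    · exact h
    · simpa using h1
    · simpa using h3

lemma theta_ne_zero (hp : p ∈ points K) (hv : IsTangent K p v) (h : energy K v < 0) :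
    theta K p v ≠ 0 :=
  fun h0 => absurd (energy_nonneg_of_theta hp hv h0).1 h.not_ge

/-- A vector orthogonal to a timelike vector is spacelike or zero. -/
lemma energy_nonneg_of_form (hp : p ∈ points K) (hu : IsTangent K p u) (hv : IsTangent K p v)
    (h : energy K u < 0) (h0 : form K u v = 0) :
    0 ≤ energy K v ∧ (energy K v = 0 → v = 0) := by
  have hθ := theta_ne_zero hp hu h
  -- This combination lies in the kernel of `theta`, and orthogonality splits its energy into two
  -- terms.
  have ht : IsTangent K p (theta K p v • u - theta K p u • v) := (hu.smul _).sub (hv.smul _)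
  have h1 := energy_nonneg_of_theta hp ht (by rw [theta_sub, theta_smul, theta_smul]; ring)
  have hE : energy K (theta K p v • u - theta K p u • v) =
      theta K p v ^ 2 * energy K u + theta K p u ^ 2 * energy K v := by
    rw [energy_sub, energy_smul, energy_smul, form_smul_left, form_smul_right, h0]; ring
  rw [hE] at h1
  have h2 : 0 < theta K p u ^ 2 := by positivity
  have h3 : theta K p v ^ 2 * energy K u ≤ 0 :=
    mul_nonpos_of_nonneg_of_nonpos (sq_nonneg _) h.le
  refine ⟨?_, fun hz => ?_⟩
  · by_contra hcon
    push Not at hcon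
    have := mul_neg_of_pos_of_neg h2 hcon
    linarith [h1.1]
  · have h4 : theta K p v ^ 2 * energy K u = 0 := by
      rw [hz] at h1; linarith [h1.1]
    have h5 : theta K p v = 0 := by
      rcases mul_eq_zero.1 h4 with h | h'
      · simpa using h
      · exact absurd h' h.ne
    exact (energy_nonneg_of_theta hp hv h5).2 hz

/-- The component of `v` orthogonal to the timelike vector `u` is not timelike. -/
lemma energy_mul_energy_le (hp : p ∈ points K) (hu : IsTangent K p u) (hv : IsTangent K p v)
    (h : energy K u < 0) : energy K u * energy K v ≤ form K u v ^ 2 := by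
  have h1 := (energy_nonneg_of_form hp hu ((hv.smul (energy K u)).sub (hu.smul (form K u v))) h
    (by simp [energy_eq_form]; ring)).1
  rw [energy_sub, energy_smul, energy_smul, form_smul_left, form_smul_right, form_comm K v u] at h1
  by_contra hcon
  push Not at hcon
  nlinarith [mul_neg_of_neg_of_pos h (sub_pos.2 hcon)]

/-- The combination of `u` and `v` in the kernel of `theta` has nonnegative energy. Expanded, with
both energies negative, this excludes a nonnegative product. -/
lemma form_neg_of_future (hp : p ∈ points K) (hu : IsTangent K p u) (hv : IsTangent K p v)
    (h : energy K u < 0) (h' : energy K v < 0) (hθ : 0 < theta K p u) (hθ' : 0 < theta K p v) :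
    form K u v < 0 := by
  have ht : IsTangent K p (theta K p v • u - theta K p u • v) := (hu.smul _).sub (hv.smul _)
  have h1 := (energy_nonneg_of_theta hp ht (by rw [theta_sub, theta_smul, theta_smul]; ring)).1
  rw [energy_sub, energy_smul, energy_smul, form_smul_left, form_smul_right] at h1
  by_contra hcon
  push Not at hcon
  have h2 : 0 ≤ theta K p v * (theta K p u * form K u v) := by positivity
  have h3 := mul_neg_of_pos_of_neg (pow_pos hθ' 2) h
  have h4 := mul_neg_of_pos_of_neg (pow_pos hθ 2) h'
  linarith

/-- The reverse Cauchy-Schwarz inequality. -/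
lemma form_le_of_future (hp : p ∈ points K) (hu : IsTangent K p u) (hv : IsTangent K p v)
    (h : energy K u < 0) (h' : energy K v < 0) (hθ : 0 < theta K p u) (hθ' : 0 < theta K p v) :
    form K u v ≤ -(√(-energy K u) * √(-energy K v)) := by
  have h1 := form_neg_of_future hp hu hv h h' hθ hθ'
  have h2 := energy_mul_energy_le hp hu hv h
  rw [← Real.sqrt_mul (by linarith), neg_mul_neg]
  rw [le_neg]
  exact Real.sqrt_le_iff.2 ⟨by linarith, by linarith⟩

/-- The equality case of reverse Cauchy-Schwarz: `u - v` is null and orthogonal to the timelike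
vector `u`, hence zero. -/
lemma eq_of_form_eq (hp : p ∈ points K) (hu : IsTangent K p u) (hv : IsTangent K p v)
    (h : energy K u < 0) (h' : energy K v = energy K u) (hf : form K u v = energy K u) :
    u = v := by
  have h1 := (energy_nonneg_of_form hp hu (hu.sub hv) h
    (by rw [form_sub_right, hf, energy_eq_form]; ring)).2 (by rw [energy_sub, hf, h']; ring)
  exact sub_eq_zero.1 h1

/-! ### Orientation of geodesics -/

/-- For `K < 0` the value of `theta` on the velocity is a conserved quantity, the angular momentum
in the (w, t)-plane. For `0 ≤ K` it is continuous in `s` and has no zero. -/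
lemma theta_vel_pos (hp : p ∈ points K) (hv : IsTangent K p v) (h : energy K v < 0)
    (hθ : 0 < theta K p v) (s : ℝ) : 0 < theta K (line K p v s) (vel K p v s) := by
  rcases lt_or_ge K 0 with hK | hK
  · have h2 := cs_sq_add (K * energy K v) s
    rw [theta, if_pos hK] at *
    simp only [line, vel, Prod.fst_add, Prod.snd_add, Prod.smul_fst, Prod.smul_snd, smul_eq_mul]
    convert hθ using 1
    linear_combination (p.2.2 * v.1 - p.1 * v.2.2) * h2
  · have hne : ∀ s, theta K (line K p v s) (vel K p v s) ≠ 0 := fun s =>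
      theta_ne_zero (line_mem hp hv s) (vel_tangent hp hv s) (by rwa [energy_vel hp hv])
    have hθ0 : 0 < theta K (line K p v 0) (vel K p v 0) := by simpa
    simp only [theta, if_neg hK.not_gt] at *
    by_contra hcon
    push Not at hcon
    have hc : Continuous fun s => (vel K p v s).1 := (continuous_vel K p v).fst
    obtain ⟨t, ht⟩ := mem_range_of_exists_le_of_exists_ge hc ⟨s, hcon⟩ ⟨0, hθ0.le⟩
    exact hne t ht

lemma line_neg (K : ℝ) (p v : ℝ × ℝ × ℝ) (s : ℝ) : line K p (-v) s = line K p v (-s) := by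
  have := line_smul K p v (-1) s
  simpa using this

lemma vel_neg (K : ℝ) (p v : ℝ × ℝ × ℝ) (s : ℝ) : vel K p (-v) s = -vel K p v (-s) := by
  have := vel_smul K p v (-1) s
  simpa using this

lemma energy_neg (K : ℝ) (v : ℝ × ℝ × ℝ) : energy K (-v) = energy K v := by
  simp [energy]

lemma IsTangent.neg (hv : IsTangent K p v) : IsTangent K p (-v) := by
  simpa using hv.smul (-1)

lemma IsLog.symm (h : IsLog K p q v) (hp : p ∈ points K) : IsLog K q p (-vel K p v 1) := by
  refine ⟨?_, ?_, ?_⟩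
  · have := (vel_tangent hp h.1 1).neg
    rwa [h.line_one] at this
  · rw [energy_neg, energy_vel hp h.1]; exact h.2.1
  · have := line_line hp h.1 1 (-1)
    rw [exp_eq, line_neg, ← h.line_one, this]; simp

lemma theta_line_sub (hp : p ∈ points K) (hv : IsTangent K p v) (h : energy K v < 0)
    (hθ : 0 < theta K p v) {s : ℝ} (hs : 0 < s) (hs' : K * energy K v * s ^ 2 < Real.pi ^ 2) :
    0 < theta K p (line K p v s - p) := by
  rcases lt_or_ge K 0 with hK | hK
  · rw [line, theta_sub, theta_add, theta_smul, theta_smul, theta_self hK]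
    have := sn_pos hs hs'
    simp; positivity
  · have h1 := line_sub_line K p v 0 s
    rw [line_zero, sub_zero] at h1
    have h2 := sn_pos_of_le (half_pos hs) (half_le_self hs.le) hs'
    have h3 := theta_vel_pos hp hv h hθ ((0 + s) / 2)
    rw [h1, theta_smul]
    rw [theta, if_neg hK.not_gt] at h3 ⊢
    positivity

/-- This reads the time direction of a geodesic off its endpoints. For the forward implication, a
past-directed geodesic is reversed and `theta_line_sub` is applied from the other end. -/
lemma IsLog.theta_iff (h : IsLog K p q v) (hp : p ∈ points K) (he : energy K v < 0) :
    0 < theta K p (q - p) ↔ 0 < theta K p v := by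
  have h2 : K * energy K v * 1 ^ 2 < Real.pi ^ 2 := by simpa using h.2.1
  refine ⟨fun h1 => ?_, fun h1 => ?_⟩
  · by_contra hcon
    have h0 : 0 < theta K p (-v) := by
      rw [theta_neg]
      have := theta_ne_zero hp h.1 he
      push Not at hcon
      have := lt_of_le_of_ne hcon this
      linarith
    have hs := h.symm hp
    have hp' := h.mem hp
    -- the reversed geodesic is future-directed
    have h3 : 0 < theta K q (-vel K p v 1) := by
      have := theta_vel_pos hp h.1.neg (by rwa [energy_neg]) h0 (-1)
      rwa [line_neg, vel_neg, neg_neg, h.line_one] at this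
    have h4 := theta_line_sub hp' hs.1 (by rwa [energy_neg, energy_vel hp h.1]) h3 one_pos
      (by rw [energy_neg, energy_vel hp h.1]; exact h2)
    rw [hs.line_one, theta_sub_comm] at h4
    linarith
  · have := theta_line_sub hp h.1 he h1 one_pos h2
    rwa [h.line_one] at this

/-- `q` lies in the timelike future of `p`, within the range of unique geodesics. -/
def Fut (K : ℝ) (p q : ℝ × ℝ × ℝ) : Prop :=
  chord K p q < 0 ∧ K * chord K p q < 2 ∧ 0 < theta K p (q - p)

lemma Fut.exists_isLog (h : Fut K p q) (hp : p ∈ points K) (hq : q ∈ points K) :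
    ∃ v, IsLog K p q v ∧ energy K v < 0 ∧ 0 < theta K p v := by
  obtain ⟨v, hv⟩ := LorentzModel.exists_isLog hp hq h.2.1
  have he := (hv.energy_neg_iff hp).2 h.1
  exact ⟨v, hv, he, (hv.theta_iff hp he).1 h.2.2⟩

lemma IsLog.fut (h : IsLog K p q v) (hp : p ∈ points K) (he : energy K v < 0)
    (hθ : 0 < theta K p v) : Fut K p q :=
  ⟨(h.energy_neg_iff hp).1 he, h.mul_chord_lt hp, (h.theta_iff hp he).2 hθ⟩

lemma fut_or_fut (hp : p ∈ points K) (hq : q ∈ points K) (h : chord K p q < 0)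
    (h' : K * chord K p q < 2) : Fut K p q ∨ Fut K q p := by
  obtain ⟨v, hv⟩ := LorentzModel.exists_isLog hp hq h'
  have he := (hv.energy_neg_iff hp).2 h
  rcases lt_or_gt_of_ne (theta_ne_zero hp hv.1 he) with h1 | h1
  · right
    refine ⟨by rwa [chord_comm], by rwa [chord_comm], ?_⟩
    by_contra hcon
    push Not at hcon
    rw [theta_sub_comm] at hcon
    rcases (show 0 ≤ theta K p (q - p) by linarith).eq_or_lt with h0 | h0
    · have hs := hv.symm hp
      have hθ' : theta K p (-v) > 0 := by rw [theta_neg]; linarith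
      have := theta_vel_pos hp hv.1.neg (by rwa [energy_neg]) hθ' (-1)
      rw [line_neg, vel_neg, neg_neg, hv.line_one] at this
      have h4 := (hs.theta_iff (hv.mem hp) (by rwa [energy_neg, energy_vel hp hv.1])).2 this
      rw [theta_sub_comm] at h4
      linarith
    · linarith [(hv.theta_iff hp he).1 h0]
  · exact Or.inl (hv.fut hp he h1)

lemma Fut.not_fut (h : Fut K p q) : ¬ Fut K q p := fun h' => by
  have h1 := h.2.2
  have h2 := h'.2.2
  rw [theta_sub_comm] at h1
  linarith

lemma theta_ne_zero_of_chord (hp : p ∈ points K) (hq : q ∈ points K) (h : chord K p q < 0)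
    (h' : K * chord K p q < 2) : theta K p (q - p) ≠ 0 := by
  rcases fut_or_fut hp hq h h' with h1 | h1
  · exact h1.2.2.ne'
  · have := h1.2.2
    rw [theta_sub_comm] at this
    intro h0
    linarith

/-- The time orientation is constant along a path of timelike related points. -/
lemma Fut.of_path {γ : ℝ → ℝ × ℝ × ℝ} {a c : ℝ} (hr : r ∈ points K)
    (hγ : ContinuousOn γ (Icc a c)) (hm : ∀ s ∈ Icc a c, γ s ∈ points K)
    (h1 : ∀ s ∈ Icc a c, chord K r (γ s) < 0) (h2 : ∀ s ∈ Icc a c, K * chord K r (γ s) < 2)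
    {s t : ℝ} (hs : s ∈ Icc a c) (ht : t ∈ Icc a c) (h : Fut K r (γ s)) : Fut K r (γ t) := by
  refine ⟨h1 t ht, h2 t ht, ?_⟩
  have hc : ContinuousOn (fun s => -theta K r (γ s - r)) (Icc a c) :=
    ((continuous_theta_sub K r).comp_continuousOn hγ).neg
  have := Spacetime.neg_of_continuousOn_ne_zero hc
    (fun t ht => neg_ne_zero.2 (theta_ne_zero_of_chord hr (hm t ht) (h1 t ht) (h2 t ht))) hs ht
    (by linarith [h.2.2])
  linarith

/-! ### Time separation -/

lemma tau_eq (h : Fut K p q) (hp : p ∈ points K) (hv : IsLog K p q v) :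
    tau K p q = √(-energy K v) := by
  have hl := log_eq hv hp
  have he := (hv.energy_neg_iff hp).2 h.1
  rw [tau, if_pos ⟨⟨v, hv⟩, by rwa [hl], by rw [hl, isFuture_iff]; exact (hv.theta_iff hp he).1 h.2.2⟩,
    hl]

lemma tau_pos (h : Fut K p q) (hp : p ∈ points K) (hq : q ∈ points K) : 0 < tau K p q := by
  obtain ⟨v, hv, he, -⟩ := h.exists_isLog hp hq
  rw [tau_eq h hp hv]
  exact Real.sqrt_pos.2 (by linarith)

lemma fut_of_tau_pos (hp : p ∈ points K) (h : 0 < tau K p q) : Fut K p q := by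
  unfold tau at h
  split_ifs at h with h'
  · obtain ⟨h1, h2, h3⟩ := h'
    exact h1.isLog.fut hp h2 (isFuture_iff.1 h3)
  · exact absurd h (lt_irrefl _)

lemma tau_nonneg (K : ℝ) (p q : ℝ × ℝ × ℝ) : 0 ≤ tau K p q := by
  unfold tau; split_ifs
  · positivity
  · exact le_rfl

lemma tau_lt (h : Fut K p q) (hp : p ∈ points K) (hq : q ∈ points K) :
    -K * tau K p q ^ 2 < Real.pi ^ 2 := by
  obtain ⟨v, hv, he, -⟩ := h.exists_isLog hp hq
  rw [tau_eq h hp hv, Real.sq_sqrt (by linarith), neg_mul_neg]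
  exact hv.2.1

/-- The chord between points of time separation `T`. -/
def tm (K T : ℝ) : ℝ := -ve (-K) T

lemma energy_mul_ve {e T : ℝ} (h : e = -T ^ 2) (K s : ℝ) :
    e * ve (K * e) s = tm K (T * s) := by
  rw [tm, ve_mul, h]; ring_nf

lemma chord_eq_tm (h : Fut K p q) (hp : p ∈ points K) (hq : q ∈ points K) :
    chord K p q = tm K (tau K p q) := by
  obtain ⟨v, hv, he, -⟩ := h.exists_isLog hp hq
  rw [tau_eq h hp hv, hv.chord_eq hp, energy_mul_ve (T := √(-energy K v)), mul_one]
  rw [Real.sq_sqrt (by linarith)]; ring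

lemma tm_lt_tm {s t : ℝ} (hs : 0 ≤ s) (hst : s < t) (h : -K * t ^ 2 < Real.pi ^ 2) :
    tm K t < tm K s := neg_lt_neg (ve_lt_ve hs hst h)

lemma tm_le_tm {s t : ℝ} (hs : 0 ≤ s) (hst : s ≤ t) (h : -K * t ^ 2 < Real.pi ^ 2) :
    tm K t ≤ tm K s := by
  rcases hst.eq_or_lt with rfl | hst
  · exact le_rfl
  · exact (tm_lt_tm hs hst h).le

lemma le_of_tm_le {s t : ℝ} (hs : 0 ≤ s) (ht : -K * t ^ 2 < Real.pi ^ 2)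
    (h : tm K s ≤ tm K t) : t ≤ s := by
  by_contra hcon
  push Not at hcon
  exact absurd h (tm_lt_tm hs hcon ht).not_ge

lemma tm_add (K s t : ℝ) : tm K (s + t) =
    tm K s + tm K t - K * (tm K s * tm K t) - sn (-K) s * sn (-K) t := by
  rw [tm, ve_add, tm, tm]; ring

lemma sn_sq_eq_tm (K T : ℝ) : sn (-K) T ^ 2 = K * tm K T ^ 2 - 2 * tm K T := by
  rw [sn_sq, tm]; ring

/-- Both sides are compared through `tm`, which is strictly decreasing before the conjugate point.
It is the dictionary that replaces time separations by chords. -/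
lemma chord_le_iff {p' q' : ℝ × ℝ × ℝ} (h : Fut K p q) (hp : p ∈ points K) (hq : q ∈ points K)
    (h' : Fut K p' q') (hp' : p' ∈ points K) (hq' : q' ∈ points K) :
    chord K p q ≤ chord K p' q' ↔ tau K p' q' ≤ tau K p q := by
  rw [chord_eq_tm h hp hq, chord_eq_tm h' hp' hq']
  exact ⟨le_of_tm_le (tau_nonneg _ _ _) (tau_lt h' hp' hq'),
    fun h1 => tm_le_tm (tau_nonneg _ _ _) h1 (tau_lt h hp hq)⟩

lemma sn_tau_pos (h : Fut K p q) (hp : p ∈ points K) (hq : q ∈ points K) :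
    0 < sn (-K) (tau K p q) := sn_pos (tau_pos h hp hq) (tau_lt h hp hq)

lemma sn_sqrt_neg (e K : ℝ) (he : e < 0) : √(-e) * sn (K * e) 1 = sn (-K) √(-e) := by
  have := sn_mul (-K) √(-e) 1
  rw [mul_one, Real.sq_sqrt (by linarith), neg_mul_neg] at this
  exact this.symm

lemma form_neg_left (K : ℝ) (v w : ℝ × ℝ × ℝ) : form K (-v) w = -form K v w := by
  simp [form]; ring

lemma form_sub_line (hp : p ∈ points K) (hv : IsTangent K p v) (hw : IsTangent K p w) (s : ℝ) :
    form K (p - line K p v s) w = -(sn (K * energy K v) s * form K v w) := by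
  rcases eq_or_ne K 0 with rfl | hK
  · simp [line, form_neg_left]
  · rw [form_sub_left, form_tangent hK hw, line, form_add_left, form_smul_left, form_smul_left,
      form_tangent hK hw]
    ring

/-- The vector `q - b` acts on tangent vectors at `q` as a negative multiple of the initial velocity
towards `b`, to which the reverse Cauchy-Schwarz inequality applies. It bounds the slope of the
chord from `b` in the direction `w`. -/
lemma Fut.sn_le_form (h : Fut K q b) (hq : q ∈ points K) (hb : b ∈ points K)
    (hw : IsTangent K q w) (he : energy K w < 0) (hθ : 0 < theta K q w) :
    sn (-K) (tau K q b) * √(-energy K w) ≤ form K (q - b) w := by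
  obtain ⟨v, hv, hev, hθv⟩ := h.exists_isLog hq hb
  have h1 := form_sub_line hq hv.1 hw 1
  rw [hv.line_one] at h1
  have h2 := form_le_of_future hq hv.1 hw hev he hθv hθ
  have h3 := hv.sn_pos one_pos le_rfl
  rw [h1, tau_eq h hq hv, ← sn_sqrt_neg _ _ hev]
  nlinarith

lemma Fut.form_le_sn (h : Fut K x q) (hx : x ∈ points K) (hq : q ∈ points K)
    (hw : IsTangent K q w) (he : energy K w < 0) (hθ : 0 < theta K q w) :
    form K (q - x) w ≤ -(sn (-K) (tau K x q) * √(-energy K w)) := by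
  obtain ⟨v, hv, hev, hθv⟩ := h.exists_isLog hx hq
  have hs := hv.symm hx
  have h1 := form_sub_line hq hs.1 hw 1
  have hvt := vel_tangent hx hv.1 1
  have hθ1 := theta_vel_pos hx hv.1 hev hθv 1
  rw [hv.line_one] at hvt hθ1
  have hE := energy_vel hx hv.1 1
  have h2 := form_le_of_future hq hvt hw (by rwa [hE]) he hθ1 hθ
  have h3 := hv.sn_pos one_pos le_rfl
  rw [hs.line_one, energy_neg, hE, form_neg_left] at h1
  rw [hE] at h2
  rw [h1, tau_eq h hx hv, ← sn_sqrt_neg _ _ hev]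
  nlinarith

lemma Fut.form_pos (h : Fut K q b) (hq : q ∈ points K) (hb : b ∈ points K)
    (hw : IsTangent K q w) (he : energy K w < 0) (hθ : 0 < theta K q w) :
    0 < form K (q - b) w :=
  (mul_pos (sn_tau_pos h hq hb) (Real.sqrt_pos.2 (by linarith))).trans_le
    (h.sn_le_form hq hb hw he hθ)

lemma Fut.form_neg (h : Fut K x q) (hx : x ∈ points K) (hq : q ∈ points K)
    (hw : IsTangent K q w) (he : energy K w < 0) (hθ : 0 < theta K q w) :
    form K (q - x) w < 0 :=
  (h.form_le_sn hx hq hw he hθ).trans_lt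
    (neg_lt_zero.2 (mul_pos (sn_tau_pos h hx hq) (Real.sqrt_pos.2 (by linarith))))

/-! ### Time reversal -/

/-- Time reversal. -/
def rev (p : ℝ × ℝ × ℝ) : ℝ × ℝ × ℝ := (-p.1, p.2.1, p.2.2)

@[simp] lemma rev_rev (p : ℝ × ℝ × ℝ) : rev (rev p) = p := by simp [rev]

lemma rev_sub (p q : ℝ × ℝ × ℝ) : rev (p - q) = rev p - rev q := by
  ext <;> simp [rev]; ring

lemma rev_mem (hp : p ∈ points K) : rev p ∈ points K := by
  simpa [points, rev] using hp

@[simp] lemma energy_rev (K : ℝ) (v : ℝ × ℝ × ℝ) : energy K (rev v) = energy K v := by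
  simp [energy, rev]

@[simp] lemma chord_rev (K : ℝ) (p q : ℝ × ℝ × ℝ) : chord K (rev p) (rev q) = chord K p q := by
  rw [chord, chord, ← rev_sub, energy_rev]

lemma line_rev (K : ℝ) (p v : ℝ × ℝ × ℝ) (s : ℝ) :
    line K (rev p) (rev v) s = rev (line K p v s) := by
  rw [line, line, energy_rev]
  ext <;> simp [rev]; ring

lemma tangent_rev (hv : IsTangent K p v) : IsTangent K (rev p) (rev v) := by
  simpa [IsTangent, rev] using hv

lemma IsLog.rev (h : IsLog K p q v) : IsLog K (rev p) (rev q) (rev v) :=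
  ⟨tangent_rev h.1, by simpa using h.2.1, by rw [exp_eq, line_rev, h.line_one]⟩

lemma Joined.rev (h : Joined K p q) : Joined K (rev p) (rev q) := ⟨_, h.isLog.rev⟩

lemma seg_rev (hp : p ∈ points K) (h : Joined K p q) (s : ℝ) :
    seg K (rev p) (rev q) s = rev (seg K p q s) := by
  rw [seg_eq_line, seg_eq_line, log_eq h.isLog.rev (rev_mem hp), line_rev]

lemma theta_rev (K : ℝ) (p q : ℝ × ℝ × ℝ) :
    theta K (rev q) (rev p - rev q) = theta K p (q - p) := by
  unfold theta rev; split_ifs <;> simp <;> ring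

lemma fut_rev : Fut K (rev q) (rev p) ↔ Fut K p q := by
  rw [Fut, Fut, chord_rev, chord_comm K q p, theta_rev]

lemma tau_rev (hp : p ∈ points K) (hq : q ∈ points K) : tau K (rev q) (rev p) = tau K p q := by
  by_cases h : Fut K p q
  · have h' := fut_rev.2 h
    obtain ⟨v, hv, he, -⟩ := h.exists_isLog hp hq
    rw [tau_eq h hp hv, tau_eq h' (rev_mem hq) (hv.symm hp).rev, energy_rev, energy_neg,
      energy_vel hp hv.1]
  · have h' := fut_rev.not.2 h
    have h1 := (tau_nonneg K p q).antisymm' (not_lt.1 fun h2 => h (fut_of_tau_pos hp h2))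
    have h3 := (tau_nonneg K (rev q) (rev p)).antisymm'
      (not_lt.1 fun h2 => h' (fut_of_tau_pos (rev_mem hq) h2))
    rw [h1, h3]

end LorentzModel

namespace LorentzModel

variable {K : ℝ} {m n p q r v w u x b o a : ℝ × ℝ × ℝ}

/-! ### Stewart's formula and convexity -/

lemma IsLog.sub (h : IsLog K m n v) (hm : m ∈ points K) {s t : ℝ} (hs : s ∈ Icc (0 : ℝ) 1)
    (ht : t ∈ Icc (0 : ℝ) 1) :
    IsLog K (line K m v s) (line K m v t) ((t - s) • vel K m v s) := by
  refine ⟨(vel_tangent hm h.1 s).smul _, ?_, ?_⟩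
  · rw [energy_smul, energy_vel hm h.1, mul_left_comm, mul_comm]
    refine mul_sq_lt (t := 1) (by positivity) (by simpa using h.2.1) ?_
    rw [abs_one, abs_le]
    constructor <;> linarith [hs.1, hs.2, ht.1, ht.2]
  · rw [exp_smul, line_line hm h.1, add_sub_cancel]

lemma Joined.seg (h : Joined K m n) (hm : m ∈ points K) {s t : ℝ} (hs : s ∈ Icc (0 : ℝ) 1)
    (ht : t ∈ Icc (0 : ℝ) 1) : Joined K (seg K m n s) (seg K m n t) := by
  rw [seg_eq_line, seg_eq_line]
  exact ⟨_, h.isLog.sub hm hs ht⟩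

lemma seg_seg (h : Joined K m n) (hm : m ∈ points K) {s t : ℝ} (hs : s ∈ Icc (0 : ℝ) 1)
    (ht : t ∈ Icc (0 : ℝ) 1) (c : ℝ) :
    seg K (seg K m n s) (seg K m n t) c = seg K m n (s + c * (t - s)) := by
  rw [seg_eq_line K m n s, seg_eq_line K m n t, seg_eq_line K m n,
    seg_eq_line, log_eq (h.isLog.sub hm hs ht) (line_mem hm h.isLog.1 s), line_smul,
    line_line hm h.isLog.1, mul_comm]

/-- The cosine law at `s` and at 1, with the initial slope eliminated. -/
lemma stewart (hr : r ∈ points K) (hm : m ∈ points K) (h : IsLog K m n v) (s : ℝ) :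
    sn (K * energy K v) 1 * chord K r (line K m v s) =
      sn (K * energy K v) (1 - s) * chord K r m + sn (K * energy K v) s * chord K r n +
      energy K v * (sn (K * energy K v) 1 * ve (K * energy K v) s -
        sn (K * energy K v) s * ve (K * energy K v) 1) := by
  have h1 := chord_line hr hm h.1 1
  rw [h.line_one] at h1
  rw [chord_line hr hm h.1 s, h1, sn_sub]
  ring

lemma sn_mul_ve_sub (κ s : ℝ) : sn κ 1 * ve κ s - sn κ s * ve κ 1 =
    -(4 * sn κ (s / 2) * sn κ (1 / 2) * sn κ ((1 - s) / 2)) := by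
  have h1 := sn_two_mul κ (1 / 2)
  have h2 := sn_two_mul κ (s / 2)
  rw [mul_div_cancel₀ _ two_ne_zero] at h1 h2
  rw [h1, h2, ve, ve, sub_div, sn_sub]
  ring

/-- Comparison of two cevians in the model: the chord to a point of a side is monotone in the
chords to its endpoints. -/
lemma chord_seg_le {m' n' r' : ℝ × ℝ × ℝ} (hr : r ∈ points K) (hm : m ∈ points K)
    (hn : n ∈ points K) (hr' : r' ∈ points K) (hm' : m' ∈ points K) (hn' : n' ∈ points K)
    (hj : K * chord K m n < 2) (he : chord K m n = chord K m' n')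
    (h0 : chord K r m ≤ chord K r' m') (h1 : chord K r n ≤ chord K r' n') {s : ℝ}
    (hs : s ∈ Icc (0 : ℝ) 1) :
    chord K r (seg K m n s) ≤ chord K r' (seg K m' n' s) := by
  have hl := ((joined_iff hm hn).2 hj).isLog
  have hl' := ((joined_iff hm' hn').2 (he ▸ hj)).isLog
  have hE := hl.energy_eq hm hl' hm' he
  have e1 := stewart hr hm hl s
  have e2 := stewart hr' hm' hl' s
  rw [← hE] at e2
  rw [seg_eq_line, seg_eq_line]
  refine le_of_mul_le_mul_left ?_ (hl.sn_pos one_pos le_rfl)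
  rw [e1, e2]
  have p1 := hl.sn_nonneg (s := 1 - s) (by linarith [hs.2]) (by linarith [hs.1])
  have p2 := hl.sn_nonneg hs.1 hs.2
  have := mul_le_mul_of_nonneg_left h0 p1
  have := mul_le_mul_of_nonneg_left h1 p2
  linarith

/-- Only `K < 0` is a restriction, and there `K * f ≤ K * g`; for `0 ≤ K` the product `K * f` is not
positive. -/
lemma mul_lt_two_of_le {f g : ℝ} (hf : f < 0) (hgf : g ≤ f) (hg : K * g < 2) : K * f < 2 := by
  rcases le_or_gt 0 K with h | h
  · nlinarith
  · nlinarith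

/-- By the linear Jacobi equation, the slope at `s` is a nonnegative combination of the slopes at
the two ends. -/
lemma IsLog.form_vel_neg (h : IsLog K m n v) (hr : r ∈ points K) (hm : m ∈ points K)
    (h0 : form K (m - r) v < 0) (h1 : form K (n - r) (vel K m v 1) ≤ 0) {s : ℝ}
    (hs0 : 0 ≤ s) (hs : s < 1) : form K (line K m v s - r) (vel K m v s) < 0 := by
  have e := sn_mul_form_vel hr hm h.1 s
  rw [h.line_one] at e
  have p1 := h.sn_pos (s := 1 - s) (by linarith) (by linarith)
  have p2 := h.sn_nonneg hs0 hs.le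
  have p3 := h.sn_pos one_pos le_rfl
  by_contra hcon
  push Not at hcon
  nlinarith [mul_neg_of_pos_of_neg p1 h0, mul_nonpos_of_nonneg_of_nonpos p2 h1,
    mul_nonneg p3.le hcon]

lemma IsLog.chord_anti (h : IsLog K m n v) (hr : r ∈ points K) (hm : m ∈ points K)
    {s t : ℝ} (hs : 0 ≤ s) (hst : s ≤ t) (ht : t ≤ 1)
    (hL : ∀ c, 0 ≤ c → c < 1 → form K (line K m v c - r) (vel K m v c) ≤ 0) :
    chord K r (line K m v t) ≤ chord K r (line K m v s) := by
  have e := chord_line_sub hr hm h.1 s t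
  rcases hst.eq_or_lt with rfl | hst
  · exact le_rfl
  have p := h.sn_nonneg (s := (t - s) / 2) (by linarith) (by linarith)
  have := hL ((s + t) / 2) (by linarith) (by linarith)
  nlinarith [mul_nonpos_of_nonneg_of_nonpos p this]

/-- On a future-directed geodesic the slopes of the chord from `r` are negative at both ends, hence
throughout, so the chord decreases. Its initial value keeps it negative and its final value keeps it
in the range of unique geodesics. -/
lemma fut_line_of_future (hr : r ∈ points K) (hm : m ∈ points K) (h : IsLog K m n v)
    (he : energy K v < 0) (hθ : 0 < theta K m v) (h0 : Fut K r m) (h1 : Fut K r n) {s : ℝ}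
    (hs : s ∈ Icc (0 : ℝ) 1) : Fut K r (line K m v s) := by
  have hn := h.mem hm
  have l0 := h0.form_neg hr hm h.1 he hθ
  have ht := vel_tangent hm h.1 1
  have hθ1 := theta_vel_pos hm h.1 he hθ 1
  rw [h.line_one] at ht hθ1
  have l1 := h1.form_neg hr hn ht (by rwa [energy_vel hm h.1]) hθ1
  have hanti : ∀ s t : ℝ, 0 ≤ s → s ≤ t → t ≤ 1 →
      chord K r (line K m v t) ≤ chord K r (line K m v s) := fun s t hs hst ht =>
    h.chord_anti hr hm hs hst ht fun c hc0 hc1 => (h.form_vel_neg hr hm l0 l1.le hc0 hc1).le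
  have hneg : ∀ s ∈ Icc (0 : ℝ) 1, chord K r (line K m v s) < 0 := fun s hs => by
    have := hanti 0 s le_rfl hs.1 hs.2
    rw [line_zero] at this
    exact this.trans_lt h0.1
  refine Fut.of_path (a := 0) (c := 1) (s := 0) hr (continuous_line K m v).continuousOn
    (fun s _ => line_mem hm h.1 s) hneg (fun s hs => ?_) (by simp) hs (by simpa)
  refine mul_lt_two_of_le (hneg s hs) (hanti s 1 hs.1 hs.2 le_rfl) ?_
  rw [h.line_one]; exact h1.2.1

/-- The timelike future of a point is convex along geodesics. -/
lemma Fut.seg_right (hr : r ∈ points K) (hm : m ∈ points K) (hn : n ∈ points K)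
    (hj : Joined K m n) (h0 : Fut K r m) (h1 : Fut K r n) {s : ℝ} (hs : s ∈ Icc (0 : ℝ) 1) :
    Fut K r (seg K m n s) := by
  have hl := hj.isLog
  rcases lt_or_ge (energy K (log K m n)) 0 with he | he
  · rcases lt_or_gt_of_ne (theta_ne_zero hm hl.1 he) with hθ | hθ
    · have hj' := hj.symm hm hn
      have hs' : 1 - s ∈ Icc (0 : ℝ) 1 := ⟨by linarith [hs.2], by linarith [hs.1]⟩
      have hf : Fut K n m := by
        refine (fut_or_fut hn hm ?_ ?_).resolve_right fun hf => ?_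
        · rw [chord_comm]; exact (hl.energy_neg_iff hm).1 he
        · exact hj'.isLog.mul_chord_lt hn
        · linarith [(hl.theta_iff hm he).1 hf.2.2]
      obtain ⟨w, hw, hew, hθw⟩ := hf.exists_isLog hn hm
      have := fut_line_of_future hr hn hw hew hθw h1 h0 hs'
      rwa [← log_eq hw hn, ← seg_eq_line, seg_comm hm hn hj, sub_sub_cancel] at this
    · rw [seg_eq_line]
      exact fut_line_of_future hr hm hl he hθ h0 h1 hs
  · rw [seg_eq_line]
    -- The geodesic is spacelike or null. Stewart's formula then expresses a positive multiple of
    -- the chord as a nonnegative combination of the negative end values, minus a nonnegative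
    -- multiple of the energy.
    have key : ∀ s ∈ Icc (0 : ℝ) 1, chord K r (line K m (log K m n) s) < 0 ∧
        K * chord K r (line K m (log K m n) s) < 2 := by
      intro s hs
      have e := stewart hr hm hl s
      rw [sn_mul_ve_sub] at e
      have e2 := sn_mul_ve_sub (K * energy K (log K m n)) s
      have c1 := cs_sq_add (K * energy K (log K m n)) (s / 2)
      have c2 := cs_sq_add (K * energy K (log K m n)) (1 / 2)
      have t1 := sn_two_mul (K * energy K (log K m n)) (1 / 2)
      have t2 := sn_two_mul (K * energy K (log K m n)) (s / 2)
      rw [mul_div_cancel₀ _ two_ne_zero] at t1 t2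
      have p0 := hl.sn_pos one_pos le_rfl
      have pa := hl.sn_nonneg (s := 1 - s) (by linarith [hs.2]) (by linarith [hs.1])
      have pb := hl.sn_nonneg hs.1 hs.2
      have q1 := hl.sn_nonneg (s := s / 2) (by linarith [hs.1]) (by linarith [hs.2])
      have q2 := hl.sn_nonneg (s := 1 / 2) (by norm_num) (by norm_num)
      have q3 := hl.sn_nonneg (s := (1 - s) / 2) (by linarith [hs.2]) (by linarith [hs.1])
      have hsum : sn (K * energy K (log K m n)) 1 - sn (K * energy K (log K m n)) (1 - s) -
          sn (K * energy K (log K m n)) s = -(K * energy K (log K m n)) *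
          (4 * sn (K * energy K (log K m n)) (s / 2) * sn (K * energy K (log K m n)) (1 / 2) *
            sn (K * energy K (log K m n)) ((1 - s) / 2)) := by
        rw [← mul_neg_one, mul_assoc, neg_one_mul, ← e2, sn_sub, cs_eq, cs_eq]; ring
      set κ := K * energy K (log K m n)
      set D := 4 * sn κ (s / 2) * sn κ (1 / 2) * sn κ ((1 - s) / 2)
      have hD : 0 ≤ D := by positivity
      have hED : 0 ≤ energy K (log K m n) * D := mul_nonneg he hD
      have hab : 0 < sn κ (1 - s) + sn κ s := by
        rcases hs.1.eq_or_lt with h | h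
        · rw [← h]; simpa using p0
        · have := hl.sn_pos h hs.2
          exact add_pos_of_nonneg_of_pos pa this
      have hA : sn κ (1 - s) * chord K r m + sn κ s * chord K r n < 0 := by
        have h0' := h0.1
        have h1' := h1.1
        rcases pa.eq_or_lt with h | h
        · rw [← h] at hab ⊢
          have := mul_neg_of_pos_of_neg (by simpa using hab : 0 < sn κ s) h1'
          linarith
        · have := mul_neg_of_pos_of_neg h h0'
          have := mul_nonpos_of_nonneg_of_nonpos pb h1'.le
          linarith
      have hneg : chord K r (line K m (log K m n) s) < 0 := by
        by_contra hcon
        push Not at hcon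
        nlinarith [mul_nonneg p0.le hcon]
      refine ⟨hneg, ?_⟩
      rcases le_or_gt 0 K with hK | hK
      · nlinarith
      -- In negative curvature the bound 2 must also pass to the interior. By `hsum` the Stewart
      -- coefficients sum to `sn κ 1 + κ * D`, and the error has the right sign since `κ ≤ 0`.
      · by_contra hcon
        push Not at hcon
        have b0 := mul_nonneg pa (sub_nonneg.2 h0.2.1.le)
        have b1 := mul_nonneg pb (sub_nonneg.2 h1.2.1.le)
        have b2 := mul_le_mul_of_nonneg_left hcon p0.le
        have b3 : 0 < sn κ (1 - s) * (2 - K * chord K r m) + sn κ s * (2 - K * chord K r n) := by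
          rcases pa.eq_or_lt with h | h
          · rw [← h] at hab ⊢
            have := mul_pos (by simpa using hab : 0 < sn κ s) (sub_pos.2 h1.2.1)
            linarith
          · have := mul_pos h (sub_pos.2 h0.2.1)
            linarith
        have e' : K * (sn κ 1 * chord K r (line K m (log K m n) s)) =
            K * (sn κ (1 - s) * chord K r m + sn κ s * chord K r n) - κ * D := by
          rw [e]; ring
        have hκD : κ * D ≤ 0 := by
          have : κ ≤ 0 := mul_nonpos_of_nonpos_of_nonneg hK.le he
          exact mul_nonpos_of_nonpos_of_nonneg this hD
        nlinarith
    exact Fut.of_path (a := 0) (c := 1) (s := 0) hr (continuous_line K m _).continuousOn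
      (fun s _ => line_mem hm hl.1 s) (fun s hs => (key s hs).1) (fun s hs => (key s hs).2)
      (by simp) hs (by simpa)

lemma Fut.seg_left (hr : r ∈ points K) (hm : m ∈ points K) (hn : n ∈ points K)
    (hj : Joined K m n) (h0 : Fut K m r) (h1 : Fut K n r) {s : ℝ} (hs : s ∈ Icc (0 : ℝ) 1) :
    Fut K (seg K m n s) r := by
  have := Fut.seg_right (rev_mem hr) (rev_mem hm) (rev_mem hn) hj.rev (fut_rev.2 h0)
    (fut_rev.2 h1) hs
  rw [seg_rev hm hj] at this
  exact fut_rev.1 this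

lemma Fut.seg_right_of_mem (hr : r ∈ points K) (hm : m ∈ points K)
    (hj : Joined K m n) {s t c : ℝ} (hs : s ∈ Icc (0 : ℝ) 1) (ht : t ∈ Icc (0 : ℝ) 1)
    (h0 : Fut K r (seg K m n s)) (h1 : Fut K r (seg K m n t)) (hsc : s ≤ c) (hct : c ≤ t) :
    Fut K r (seg K m n c) := by
  rcases hsc.eq_or_lt with rfl | hsc
  · exact h0
  have hst : 0 < t - s := by linarith
  have := Fut.seg_right hr (seg_mem hm hj s) (seg_mem hm hj t) (hj.seg hm hs ht) h0 h1
    (s := (c - s) / (t - s)) ⟨by apply div_nonneg <;> linarith, by rw [div_le_one hst]; linarith⟩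
  rwa [seg_seg hj hm hs ht, div_mul_cancel₀ _ hst.ne', add_sub_cancel] at this

lemma Fut.seg_left_of_mem (hr : r ∈ points K) (hm : m ∈ points K)
    (hj : Joined K m n) {s t c : ℝ} (hs : s ∈ Icc (0 : ℝ) 1) (ht : t ∈ Icc (0 : ℝ) 1)
    (h0 : Fut K (seg K m n s) r) (h1 : Fut K (seg K m n t) r) (hsc : s ≤ c) (hct : c ≤ t) :
    Fut K (seg K m n c) r := by
  have := Fut.seg_right_of_mem (s := s) (t := t) (c := c) (rev_mem hr) (rev_mem hm) hj.rev hs ht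
    (by rw [seg_rev hm hj]; exact fut_rev.2 h0) (by rw [seg_rev hm hj]; exact fut_rev.2 h1) hsc hct
  rw [seg_rev hm hj] at this
  exact fut_rev.1 this

/-! ### Hinges -/

lemma sn_mul_sqrt (e K s : ℝ) (he : e < 0) : √(-e) * sn (K * e) s = sn (-K) (√(-e) * s) := by
  have := sn_mul (-K) √(-e) s
  rw [Real.sq_sqrt (by linarith), neg_mul_neg] at this
  exact this.symm

/-- The cosine law for the hinge at `q`. Reverse Cauchy-Schwarz bounds its slope by that of the
straight continuation, for which the chord is `tm` of the sum of the lengths. -/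
lemma chord_le_tm_add (hx : x ∈ points K) (hq : q ∈ points K) (h : Fut K x q)
    (hv : IsLog K q b v) (he : energy K v < 0) (hθ : 0 < theta K q v) {s : ℝ}
    (hs : s ∈ Icc (0 : ℝ) 1) :
    chord K x (line K q v s) ≤ tm K (tau K x q + √(-energy K v) * s) := by
  rw [chord_line hx hq hv.1, tm_add, ← chord_eq_tm h hx hq, cs_eq, ← sn_mul_sqrt _ _ _ he]
  have h1 := h.form_le_sn hx hq hv.1 he hθ
  have h2 := energy_mul_ve (e := energy K v) (T := √(-energy K v))
    (by rw [Real.sq_sqrt (by linarith)]; ring) K s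
  rw [← h2]
  have := mul_le_mul_of_nonneg_left h1 (hv.sn_nonneg hs.1 hs.2)
  linarith

lemma tm_neg_of_pos {T : ℝ} (h0 : 0 < T) (h : -K * T ^ 2 < Real.pi ^ 2) : tm K T < 0 := by
  have := tm_lt_tm le_rfl h0 h
  simpa [tm] using this

/-- Some point of the second leg brings the total length to exactly `π / √(-K)`, where `K * tm K`
equals 2. By the hinge estimate the chord there is at most `tm`, and multiplication by `K < 0`
reverses the inequality. -/
lemma exists_two_le (hx : x ∈ points K) (hq : q ∈ points K) (h : Fut K x q)
    (hv : IsLog K q b v) (he : energy K v < 0) (hθ : 0 < theta K q v)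
    (hr : Real.pi ^ 2 ≤ -K * (tau K x q + √(-energy K v)) ^ 2) :
    K < 0 ∧ ∃ s ∈ Icc (0 : ℝ) 1, 2 ≤ K * chord K x (line K q v s) := by
  have hxq0 := tau_pos h hx hq
  have hqb0 : 0 < √(-energy K v) := Real.sqrt_pos.2 (by linarith)
  have hxq1 := tau_lt h hx hq
  have hK : 0 < -K := by
    by_contra hcon
    push Not at hcon
    nlinarith [Real.pi_pos, sq_nonneg (tau K x q + √(-energy K v))]
  have hk : 0 < √(-K) := Real.sqrt_pos.2 hK
  have hk2 : √(-K) ^ 2 = -K := Real.sq_sqrt hK.le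
  set P := Real.pi / √(-K) with hP
  have hPp : √(-K) * P = Real.pi := by rw [hP]; field_simp
  have hle : P ≤ tau K x q + √(-energy K v) := by
    rw [hP, div_le_iff₀ hk]
    refine le_of_sq_le_sq ?_ (by positivity)
    rw [mul_pow, hk2]; linarith
  have hlt : tau K x q < P := by
    rw [hP, lt_div_iff₀ hk]
    refine lt_of_pow_lt_pow_left₀ 2 Real.pi_pos.le ?_
    rw [mul_pow, hk2]; linarith
  have hs : (P - tau K x q) / √(-energy K v) ∈ Icc (0 : ℝ) 1 :=
    ⟨div_nonneg (by linarith) hqb0.le, by rw [div_le_one hqb0]; linarith⟩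
  refine ⟨by linarith, _, hs, ?_⟩
  have h4 := chord_le_tm_add hx hq h hv he hθ hs
  rw [mul_div_cancel₀ _ hqb0.ne', add_sub_cancel] at h4
  have h5 : K * tm K P = 2 := by
    have := cs_eq (-K) P
    rw [cs_of_pos hK, hPp, Real.cos_pi] at this
    rw [tm]; linarith
  nlinarith

/-- The reverse triangle inequality in the model. -/
lemma tau_add_tau_le (hx : x ∈ points K) (hq : q ∈ points K) (hb : b ∈ points K)
    (h1 : Fut K x q) (h2 : Fut K q b) (h3 : Fut K x b) :
    tau K x q + tau K q b ≤ tau K x b := by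
  obtain ⟨v, hv, he, hθ⟩ := h2.exists_isLog hq hb
  have ht := tau_eq h2 hq hv
  rcases lt_or_ge (-K * (tau K x q + √(-energy K v)) ^ 2) (Real.pi ^ 2) with hr | hr
  · have := chord_le_tm_add hx hq h1 hv he hθ (s := 1) (by simp)
    rw [hv.line_one, mul_one, chord_eq_tm h3 hx hb] at this
    rw [ht]
    exact le_of_tm_le (tau_nonneg _ _ _) hr this
  · obtain ⟨-, s, hs, h4⟩ := exists_two_le hx hq h1 hv he hθ hr
    exact absurd (fut_line_of_future hx hq hv he hθ h1 h3 hs).2.1 h4.not_gt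

/-- Transitivity of the timelike future, up to leaving the range of unique geodesics. -/
lemma Fut.trans_or_exists (hx : x ∈ points K) (hq : q ∈ points K) (hb : b ∈ points K)
    (h1 : Fut K x q) (h2 : Fut K q b) :
    Fut K x b ∨ K < 0 ∧ ∃ s ∈ Icc (0 : ℝ) 1, 2 ≤ K * chord K x (seg K q b s) := by
  obtain ⟨v, hv, he, hθ⟩ := h2.exists_isLog hq hb
  simp only [seg_eq_line, log_eq hv hq]
  rcases lt_or_ge (-K * (tau K x q + √(-energy K v)) ^ 2) (Real.pi ^ 2) with hr | hr
  · have hp1 := tau_pos h1 hx hq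
    have hneg : ∀ s ∈ Icc (0 : ℝ) 1, chord K x (line K q v s) < 0 := by
      intro s hs
      refine (chord_le_tm_add hx hq h1 hv he hθ hs).trans_lt ?_
      have h0 : 0 ≤ √(-energy K v) * s := mul_nonneg (Real.sqrt_nonneg _) hs.1
      have h0' := mul_le_of_le_one_right (Real.sqrt_nonneg (-energy K v)) hs.2
      refine tm_neg_of_pos (by linarith) (mul_sq_lt (by positivity) hr ?_)
      rw [abs_of_pos (by linarith), abs_of_pos (by linarith)]
      linarith
    by_cases hcon : ∀ s ∈ Icc (0 : ℝ) 1, K * chord K x (line K q v s) < 2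
    · left
      have := Fut.of_path (a := 0) (c := 1) (s := 0) (t := 1) hx
        (continuous_line K q v).continuousOn (fun s _ => line_mem hq hv.1 s) hneg hcon (by simp)
        (by simp) (by simpa)
      rwa [hv.line_one] at this
    · right
      push Not at hcon
      obtain ⟨s, hs, h3⟩ := hcon
      refine ⟨?_, s, hs, h3⟩
      by_contra hK
      push Not at hK
      nlinarith [hneg s hs]
  · exact Or.inr (exists_two_le hx hq h1 hv he hθ hr)

/-- The hinge estimate at a common past point: the degenerate hinge, with both points on one
geodesic, has the smallest chord. -/
lemma tm_sub_le_chord (hx : x ∈ points K) (hr : r ∈ points K) (hb : b ∈ points K)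
    (h1 : Fut K x r) (h2 : Fut K x b) : tm K (tau K x r - tau K x b) ≤ chord K r b := by
  obtain ⟨v, hv, he, hθ⟩ := h1.exists_isLog hx hr
  have ht := tau_eq h1 hx hv
  have h3 := h2.sn_le_form hx hb hv.1 he hθ
  have h4 := chord_line hb hx hv.1 1
  have h5 := energy_mul_ve (e := energy K v) (T := √(-energy K v))
    (by rw [Real.sq_sqrt (by linarith)]; ring) K 1
  rw [hv.line_one, cs_eq, chord_comm K b x, chord_eq_tm h2 hx hb, chord_comm K b r] at h4
  have h6 := tm_add K (tau K x r) (-tau K x b)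
  rw [sn_neg, show tm K (-tau K x b) = tm K (tau K x b) by simp [tm], ht,
    ← sn_sqrt_neg _ _ he, ← sub_eq_add_neg, ← ht] at h6
  rw [mul_one, ← ht] at h5
  rw [h4, h6]
  rw [← ht] at h3
  have := mul_le_mul_of_nonneg_left h3 (hv.sn_nonneg zero_le_one le_rfl)
  have e : K * energy K v * ve (K * energy K v) 1 = K * tm K (tau K x r) := by rw [← h5]; ring
  rw [e, h5]
  linarith

lemma mul_tm_lt_two {T : ℝ} (h : -K * T ^ 2 < Real.pi ^ 2) : K * tm K T < 2 := by
  have h1 := cs_eq (-K) T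
  have h2 := neg_one_lt_genCos h
  rw [cs] at h1
  rw [tm]; linarith

/-- The difference of two admissible lengths stays below the conjugate bound. This discharges the
range conditions for points with a common timelike past. -/
lemma mul_chord_lt_of_fut (hx : x ∈ points K) (hr : r ∈ points K) (hb : b ∈ points K)
    (h1 : Fut K x r) (h2 : Fut K x b) (h : chord K r b < 0) : K * chord K r b < 2 := by
  have h3 := tm_sub_le_chord hx hr hb h1 h2
  have hp1 := tau_pos h1 hx hr
  have hp2 := tau_pos h2 hx hb
  refine mul_lt_two_of_le h h3 (mul_tm_lt_two ?_)
  rcases le_total (tau K x r) (tau K x b) with h | h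
  · refine mul_sq_lt (by positivity) (tau_lt h2 hx hb) ?_
    rw [abs_of_nonpos (by linarith), abs_of_pos hp2]; linarith
  · refine mul_sq_lt (by positivity) (tau_lt h1 hx hr) ?_
    rw [abs_of_nonneg (by linarith), abs_of_pos hp1]; linarith

lemma mul_chord_lt_of_fut_of_fut (hx : x ∈ points K) (hr : r ∈ points K) (hb : b ∈ points K)
    (h1 : Fut K r x) (h2 : Fut K b x) (h : chord K r b < 0) : K * chord K r b < 2 := by
  have := mul_chord_lt_of_fut (rev_mem hx) (rev_mem hr) (rev_mem hb) (fut_rev.2 h1)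
    (fut_rev.2 h2) (by simpa)
  simpa using this

/-- Transitivity of the timelike future for points with a common timelike past. -/
lemma Fut.trans (ho : o ∈ points K) (hx : x ∈ points K) (hq : q ∈ points K) (hb : b ∈ points K)
    (hox : Fut K o x) (hoq : Fut K o q) (hob : Fut K o b) (hxq : Fut K x q) (hqb : Fut K q b) :
    Fut K x b := by
  obtain ⟨v, hv, he, hθ⟩ := hqb.exists_isLog hq hb
  have ht := tau_eq hqb hq hv
  have hp1 := tau_pos hox ho hx
  have hp2 := tau_pos hxq hx hq
  have hp3 := tau_pos hqb hq hb
  have r1 := tau_add_tau_le ho hx hq hox hxq hoq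
  have r2 := tau_add_tau_le ho hq hb hoq hqb hob
  have hneg : ∀ s ∈ Icc (0 : ℝ) 1, chord K x (line K q v s) < 0 := by
    intro s hs
    refine (chord_le_tm_add hx hq hxq hv he hθ hs).trans_lt ?_
    have h0 : 0 ≤ √(-energy K v) * s := mul_nonneg (Real.sqrt_nonneg _) hs.1
    refine tm_neg_of_pos (by linarith) ?_
    refine mul_sq_lt (by positivity) (tau_lt hob ho hb) ?_
    rw [abs_of_pos (by linarith), abs_of_pos (by linarith)]
    have := mul_le_of_le_one_right (Real.sqrt_nonneg (-energy K v)) hs.2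
    linarith
  have := Fut.of_path (a := 0) (c := 1) (s := 0) (t := 1) hx (continuous_line K q v).continuousOn
    (fun s _ => line_mem hq hv.1 s) hneg (fun s hs => ?_) (by simp) (by simp) (by simpa)
  · rwa [hv.line_one] at this
  · exact mul_chord_lt_of_fut ho hx (line_mem hq hv.1 s) hox
      (fut_line_of_future ho hq hv he hθ hoq hob hs) (hneg s hs)

end LorentzModel

/-! ### Extending geodesics and copying configurations between planes -/

namespace LorentzModel

variable {K : ℝ} {m n p q r v w u x y b o a p₂ y₂ v₂ b' : ℝ × ℝ × ℝ}

lemma Fut.of_nonneg (hp : p ∈ points K) (hq : q ∈ points K) (h : chord K p q < 0)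
    (h' : K * chord K p q < 2) (hθ : 0 ≤ theta K p (q - p)) : Fut K p q :=
  ⟨h, h', lt_of_le_of_ne hθ (theta_ne_zero_of_chord hp hq h h').symm⟩

lemma continuous_chord_uncurry (K : ℝ) :
    Continuous fun z : (ℝ × ℝ × ℝ) × (ℝ × ℝ × ℝ) => chord K z.1 z.2 := by
  unfold chord energy; fun_prop

lemma continuous_theta_uncurry (K : ℝ) :
    Continuous fun z : (ℝ × ℝ × ℝ) × (ℝ × ℝ × ℝ) => theta K z.1 (z.2 - z.1) := by
  unfold theta; split_ifs <;> fun_prop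

lemma isOpen_fut (K : ℝ) : IsOpen {z : (ℝ × ℝ × ℝ) × (ℝ × ℝ × ℝ) | Fut K z.1 z.2} := by
  have h1 := continuous_chord_uncurry K
  have h2 := continuous_theta_uncurry K
  exact (isOpen_lt h1 continuous_const).inter
    ((isOpen_lt (continuous_const.mul h1) continuous_const).inter (isOpen_lt continuous_const h2))

lemma chord_line_add (hr : r ∈ points K) (hp : p ∈ points K) (hv : IsTangent K p v) (s d : ℝ) :
    chord K r (line K p v (s + d)) = cs (K * energy K v) d * chord K r (line K p v s) +
      sn (K * energy K v) d * form K (line K p v s - r) (vel K p v s) +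
      energy K v * ve (K * energy K v) d := by
  have := chord_line hr (line_mem hp hv s) (vel_tangent hp hv s) d
  rwa [line_line hp hv, energy_vel hp hv] at this

lemma form_sub_eq (h : IsLog K p q v) (hp : p ∈ points K) (hw : IsTangent K q w) :
    form K (q - p) w = sn (K * energy K v) 1 * form K (vel K p v 1) w := by
  have hs := h.symm hp
  have h1 := form_sub_line (h.mem hp) hs.1 hw 1
  rw [hs.line_one, energy_neg, energy_vel hp h.1, form_neg_left] at h1
  rw [h1]; ring

lemma energy_eq_neg_tau_sq (h : Fut K p q) (hp : p ∈ points K) (hv : IsLog K p q v) :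
    energy K v = -tau K p q ^ 2 := by
  have he := (hv.energy_neg_iff hp).2 h.1
  rw [tau_eq h hp hv, Real.sq_sqrt (by linarith)]; ring

lemma tau_mul_sn (h : Fut K p q) (hp : p ∈ points K) (hv : IsLog K p q v) :
    tau K p q * sn (K * energy K v) 1 = sn (-K) (tau K p q) := by
  have he := (hv.energy_neg_iff hp).2 h.1
  rw [tau_eq h hp hv, sn_sqrt_neg _ _ he]

lemma IsLog.fut_tau (h : IsLog K p q v) (hp : p ∈ points K) {T : ℝ} (hT : 0 < T)
    (he : energy K v = -T ^ 2) (hθ : 0 < theta K p v) : Fut K p q ∧ tau K p q = T := by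
  have he' : energy K v < 0 := by rw [he]; nlinarith
  have hf := h.fut hp he' hθ
  exact ⟨hf, by rw [tau_eq hf hp h, he, neg_neg, Real.sqrt_sq hT.le]⟩

/-- The straight extension of a timelike geodesic beyond its endpoint. -/
lemma exists_extension (ha : a ∈ points K) (hq : q ∈ points K) (h : Fut K a q) {T : ℝ}
    (hT : 0 < T) (hr : -K * (tau K a q + T) ^ 2 < Real.pi ^ 2) :
    ∃ b ∈ points K, Fut K a b ∧ tau K a b = tau K a q + T ∧ Fut K q b ∧ tau K q b = T ∧
      ∀ w, IsTangent K q w →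
        sn (-K) (tau K a q) * form K (q - b) w = -(sn (-K) T * form K (q - a) w) := by
  obtain ⟨u, hu, he, hθ⟩ := h.exists_isLog ha hq
  have hτ := tau_pos h ha hq
  have hE := energy_eq_neg_tau_sq h ha hu
  have hs := tau_mul_sn h ha hu
  set τ := tau K a q with hτdef
  have ht := vel_tangent ha hu.1 1
  have hθ1 := theta_vel_pos ha hu.1 he hθ 1
  rw [hu.line_one] at ht hθ1
  have hE1 := energy_vel ha hu.1 1
  -- Running the geodesic up to parameter `1 + T / τ` adds `T` to its length.
  have l1 : IsLog K a (line K a u (1 + T / τ)) ((1 + T / τ) • u) := by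
    refine ⟨hu.1.smul _, ?_, exp_smul _ _ _ _⟩
    rw [energy_smul, hE]
    convert hr using 1
    field_simp
  have hEw : energy K ((T / τ) • vel K a u 1) = -T ^ 2 := by
    rw [energy_smul, hE1, hE]; field_simp
  have l2 : IsLog K q (line K a u (1 + T / τ)) ((T / τ) • vel K a u 1) := by
    refine ⟨ht.smul _, ?_, ?_⟩
    · rw [hEw, mul_neg, ← neg_mul]
      refine mul_sq_lt (by positivity) hr ?_
      rw [abs_of_pos hT, abs_of_pos (by linarith)]; linarith
    · rw [exp_smul]
      have := line_line ha hu.1 1 (T / τ)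
      rwa [hu.line_one] at this
  have hb := l1.mem ha
  have c0 : 0 < T / τ := div_pos hT hτ
  have f1 := l1.fut_tau ha (T := τ + T) (by linarith)
    (by rw [energy_smul, hE]; field_simp) (by rw [theta_smul]; positivity)
  have f2 := l2.fut_tau hq hT hEw (by rw [theta_smul]; positivity)
  refine ⟨_, hb, f1.1, f1.2, f2.1, f2.2, fun w hw => ?_⟩
  have e1 := form_sub_eq hu ha hw
  have e2 := form_sub_line hq l2.1 hw 1
  have e3 := tau_mul_sn f2.1 hq l2
  rw [l2.line_one, form_smul_left] at e2
  rw [f2.2] at e3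
  rw [e1, e2, ← hs, ← e3]
  field_simp

/-- The vector is the cross product of `p` and `u` for the ambient form, normalized so that `K = 0`
is included. -/
lemma exists_orthogonal (hp : p ∈ points K) (hu : IsTangent K p u) :
    ∃ n, IsTangent K p n ∧ form K u n = 0 ∧ energy K n = -energy K u := by
  refine ⟨(p.2.1 * u.2.2 - p.2.2 * u.2.1, p.1 * u.2.2 - p.2.2 * u.1,
    K * (p.2.1 * u.1 - p.1 * u.2.1)), ?_, ?_, ?_⟩
  · unfold IsTangent; ring
  · rcases eq_or_ne K 0 with rfl | hK
    · simp only [form, hu.eq_zero hp]; ring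
    · simp only [form]; field_simp; ring
  · rcases eq_or_ne K 0 with rfl | hK
    · simp only [energy, hu.eq_zero hp, hp.2 rfl]; ring
    · have h1 := hp.1
      have hf : K⁻¹ * K = 1 := inv_mul_cancel₀ hK
      unfold IsTangent at hu
      have key : K * (-(p.2.1 * u.2.2 - p.2.2 * u.2.1) ^ 2 + (p.1 * u.2.2 - p.2.2 * u.1) ^ 2 +
          K⁻¹ * (K * (p.2.1 * u.1 - p.1 * u.2.1)) ^ 2) =
          -(K * (-u.1 ^ 2 + u.2.1 ^ 2) + u.2.2 ^ 2) := by
        linear_combination (-(K * (-u.1 ^ 2 + u.2.1 ^ 2) + u.2.2 ^ 2)) * h1 +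
          (K * (-(p.1 * u.1) + p.2.1 * u.2.1) + p.2.2 * u.2.2) * hu +
          K ^ 2 * (p.2.1 * u.1 - p.1 * u.2.1) ^ 2 * hf
      apply mul_left_cancel₀ hK
      unfold energy
      rw [key]; field_simp

/-- A timelike hinge can be copied to any other point and timelike direction. -/
lemma exists_copy_vector (hp : p ∈ points K) (hu : IsTangent K p u) (hq : q ∈ points K)
    (hw : IsTangent K q w) (hv : IsTangent K q v) (he : energy K u < 0)
    (hE : energy K v = energy K u) :
    ∃ w', IsTangent K p w' ∧ energy K w' = energy K w ∧ form K w' u = form K w v := by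
  obtain ⟨n, hn, hn0, hnE⟩ := exists_orthogonal hp hu
  have hne : energy K u ≠ 0 := he.ne
  set α := form K w v / energy K u with hα
  have hαe : α * energy K u = form K w v := by rw [hα]; field_simp
  have h1 := (energy_nonneg_of_form hq hv (hw.sub (hv.smul α)) (by rwa [hE])
    (by rw [form_sub_right, form_smul_right, ← energy_eq_form, hE, hαe, form_comm K v w, sub_self])).1
  rw [energy_sub, energy_smul, hE, form_smul_right, ← hαe] at h1
  have h2 : 0 ≤ (energy K w - α ^ 2 * energy K u) / -energy K u :=
    div_nonneg (by linarith) (by linarith)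
  -- The component along `u` copies that of `w` along `v`. The orthogonal component restores the
  -- energy, and the radicand is nonnegative because the rest of `w` is orthogonal to a timelike
  -- vector.
  refine ⟨α • u + √((energy K w - α ^ 2 * energy K u) / -energy K u) • n,
    (hu.smul _).add (hn.smul _), ?_, ?_⟩
  · rw [energy_add, energy_smul, energy_smul, form_smul_left, form_smul_right, hn0, hnE,
      Real.sq_sqrt h2]
    field_simp; ring
  · rw [form_add_left, form_smul_left, form_smul_left, form_comm K n u, hn0, ← energy_eq_form, hαe]
    ring

lemma theta_vel_pos_iff (hp : p ∈ points K) (hv : IsTangent K p v) (he : energy K v < 0) (s : ℝ) :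
    0 < theta K (line K p v s) (vel K p v s) ↔ 0 < theta K p v := by
  refine ⟨fun h => ?_, fun h => theta_vel_pos hp hv he h s⟩
  by_contra hcon
  have h1 : 0 < theta K p (-v) := by
    rw [theta_neg]
    have := theta_ne_zero hp hv he
    push Not at hcon
    have := lt_of_le_of_ne hcon this
    linarith
  have h2 := theta_vel_pos hp hv.neg (by rwa [energy_neg]) h1 (-s)
  rw [line_neg, vel_neg, neg_neg, theta_neg] at h2
  linarith

lemma IsLog.fut_line_iff (h : IsLog K p y v) (hp : p ∈ points K) (he : energy K v < 0) {s t : ℝ}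
    (hs : s ∈ Icc (0 : ℝ) 1) (ht : t ∈ Icc (0 : ℝ) 1) (hst : s < t) :
    Fut K (line K p v s) (line K p v t) ↔ 0 < theta K p v := by
  have hl := h.sub hp hs ht
  have hE : energy K ((t - s) • vel K p v s) < 0 := by
    rw [energy_smul, energy_vel hp h.1]
    have : 0 < (t - s) ^ 2 := by have := sub_pos.2 hst; positivity
    nlinarith
  rw [← theta_vel_pos_iff hp h.1 he s]
  have hts := sub_pos.2 hst
  constructor
  · intro hf
    have := (hl.theta_iff (line_mem hp h.1 s) hE).1 hf.2.2
    rw [theta_smul] at this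
    exact (mul_pos_iff_of_pos_left hts).1 this
  · intro h'
    exact hl.fut (line_mem hp h.1 s) hE (by rw [theta_smul]; positivity)

/-- Two values of the chord and the cosine law determine the slope. The second parameter is taken at
distance one half from `s`, on the side where it stays in the unit interval. -/
lemma form_vel_eq_of_copy {e : ℝ} (hp : p ∈ points K) (hv : IsLog K p y v) (hp₂ : p₂ ∈ points K)
    (hv₂ : IsLog K p₂ y₂ v₂) (he : energy K v = e) (he₂ : energy K v₂ = e) (hb : b ∈ points K)
    (hb' : b' ∈ points K)
    (hc : ∀ s ∈ Icc (0 : ℝ) 1, chord K b' (line K p v s) = chord K b (line K p₂ v₂ s))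
    {s : ℝ} (hs : s ∈ Icc (0 : ℝ) 1) :
    form K (line K p v s - b') (vel K p v s) = form K (line K p₂ v₂ s - b) (vel K p₂ v₂ s) := by
  have key : ∀ d : ℝ, s + d ∈ Icc (0 : ℝ) 1 →
      sn (K * e) d * form K (line K p v s - b') (vel K p v s) =
      sn (K * e) d * form K (line K p₂ v₂ s - b) (vel K p₂ v₂ s) := by
    intro d hd
    have e1 := chord_line_add hb' hp hv.1 s d
    have e2 := chord_line_add hb hp₂ hv₂.1 s d
    rw [hc _ hd, hc _ hs, he] at e1
    rw [he₂] at e2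
    linarith
  rcases le_or_gt s (1 / 2) with h | h
  · have := key (1 / 2) ⟨by linarith [hs.1], by linarith⟩
    have hpos := hv.sn_pos (s := 1 / 2) (by norm_num) (by norm_num)
    rw [he] at hpos
    exact mul_left_cancel₀ hpos.ne' this
  · have := key (-(1 / 2)) ⟨by linarith [hs.1], by linarith [hs.2]⟩
    have hpos := hv.sn_pos (s := 1 / 2) (by norm_num) (by norm_num)
    rw [he] at hpos
    rw [sn_neg] at this
    exact mul_left_cancel₀ (neg_ne_zero.2 hpos.ne') this

/-- Equal chords leave only the direction of time open. The slopes also agree, and along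
consistently oriented timelike lines the sign of the slope distinguishes past from future. -/
lemma fut_of_copy {e : ℝ} (hp : p ∈ points K) (hv : IsLog K p y v) (hp₂ : p₂ ∈ points K)
    (hv₂ : IsLog K p₂ y₂ v₂) (he : energy K v = e) (he₂ : energy K v₂ = e) (he0 : e < 0)
    (hθ : 0 < theta K p v ↔ 0 < theta K p₂ v₂) (hb : b ∈ points K)
    (hb' : b' ∈ points K)
    (hc : ∀ s ∈ Icc (0 : ℝ) 1, chord K b' (line K p v s) = chord K b (line K p₂ v₂ s))
    {s : ℝ} (hs : s ∈ Icc (0 : ℝ) 1) :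
    (Fut K (line K p₂ v₂ s) b → Fut K (line K p v s) b') ∧
    (Fut K b (line K p₂ v₂ s) → Fut K b' (line K p v s)) := by
  have hq := line_mem hp hv.1 s
  have hq₂ := line_mem hp₂ hv₂.1 s
  have ht := vel_tangent hp hv.1 s
  have ht₂ := vel_tangent hp₂ hv₂.1 s
  have hE := energy_vel hp hv.1 s
  have hE₂ := energy_vel hp₂ hv₂.1 s
  have hL := form_vel_eq_of_copy hp hv hp₂ hv₂ he he₂ hb hb' hc hs
  rw [he] at hE
  rw [he₂] at hE₂
  -- a common orientation of the two lines
  obtain ⟨c, hc1, hc2, hc0⟩ : ∃ c : ℝ, 0 < theta K (line K p v s) (c • vel K p v s) ∧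
      0 < theta K (line K p₂ v₂ s) (c • vel K p₂ v₂ s) ∧ c ≠ 0 := by
    have h1 := theta_vel_pos_iff hp hv.1 (he ▸ he0) s
    have h2 := theta_vel_pos_iff hp₂ hv₂.1 (he₂ ▸ he0) s
    have n1 := theta_ne_zero hq ht (hE ▸ he0)
    have n2 := theta_ne_zero hq₂ ht₂ (hE₂ ▸ he0)
    by_cases h : 0 < theta K p v
    · exact ⟨1, by simpa using h1.2 h, by simpa using h2.2 (hθ.1 h), one_ne_zero⟩
    · refine ⟨-1, ?_, ?_, by norm_num⟩
      · have := lt_of_le_of_ne (not_lt.1 (h1.not.2 h)) n1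
        rw [theta_smul]; linarith
      · have := lt_of_le_of_ne (not_lt.1 (h2.not.2 (hθ.not.1 h))) n2
        rw [theta_smul]; linarith
  have hcE : energy K (c • vel K p v s) < 0 := by
    rw [energy_smul, hE]; exact mul_neg_of_pos_of_neg (by positivity) he0
  have hcE₂ : energy K (c • vel K p₂ v₂ s) < 0 := by
    rw [energy_smul, hE₂]; exact mul_neg_of_pos_of_neg (by positivity) he0
  constructor
  · intro hf
    have f1 := hf.form_pos hq₂ hb (ht₂.smul c) hcE₂ hc2
    refine (fut_or_fut hq hb' ?_ ?_).resolve_right fun hf' => ?_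
    · rw [chord_comm, hc s hs, chord_comm]; exact hf.1
    · rw [chord_comm, hc s hs, chord_comm]; exact hf.2.1
    · have f2 := hf'.form_neg hb' hq (ht.smul c) hcE hc1
      rw [form_smul_right] at f1 f2
      rw [hL] at f2
      linarith
  · intro hf
    have f1 := hf.form_neg hb hq₂ (ht₂.smul c) hcE₂ hc2
    refine (fut_or_fut hb' hq ?_ ?_).resolve_right fun hf' => ?_
    · rw [hc s hs]; exact hf.1
    · rw [hc s hs]; exact hf.2.1
    · have f2 := hf'.form_pos hq hb' (ht.smul c) hcE hc1
      rw [form_smul_right] at f1 f2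
      rw [hL] at f2
      linarith

/-- Points related to one timelike geodesic can be copied to another one. -/
lemma exists_copy {e : ℝ} (hp : p ∈ points K) (hv : IsLog K p y v) (hp₂ : p₂ ∈ points K)
    (hv₂ : IsLog K p₂ y₂ v₂) (he : energy K v = e) (he₂ : energy K v₂ = e) (he0 : e < 0)
    (hb : b ∈ points K) {s : ℝ} (hj : K * chord K (line K p₂ v₂ s) b < 2) :
    ∃ b' ∈ points K, ∀ t, chord K b' (line K p v t) = chord K b (line K p₂ v₂ t) := by
  have hq := line_mem hp hv.1 s
  have hq₂ := line_mem hp₂ hv₂.1 s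
  have ht := vel_tangent hp hv.1 s
  have ht₂ := vel_tangent hp₂ hv₂.1 s
  have hE := energy_vel hp hv.1 s
  have hE₂ := energy_vel hp₂ hv₂.1 s
  obtain ⟨w, hw⟩ := exists_isLog hq₂ hb hj
  obtain ⟨w', hw', hwE, hwf⟩ := exists_copy_vector hq ht hq₂ hw.1 ht₂ (by rw [hE, he]; exact he0)
    (by rw [hE, hE₂, he, he₂])
  have hl : IsLog K (line K p v s) (line K (line K p v s) w' 1) w' :=
    ⟨hw', by rw [hwE]; exact hw.2.1, exp_eq _ _ _⟩
  have hb' := hl.mem hq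
  refine ⟨_, hb', fun t => ?_⟩
  have e1 := chord_line_add hb' hp hv.1 s (t - s)
  have e2 := chord_line_add hb hp₂ hv₂.1 s (t - s)
  have f1 := form_sub_line hq hw' ht 1
  have f2 := form_sub_line hq₂ hw.1 ht₂ 1
  rw [hw.line_one] at f2
  have c1 := hl.chord_eq hq
  have c2 := hw.chord_eq hq₂
  rw [add_sub_cancel] at e1 e2
  rw [e1, e2, f1, f2, hwf, hwE, chord_comm K _ (line K p v s), c1, chord_comm K b, c2, hwE, he, he₂]

end LorentzModel

/-! ### Crossings, unfoldings and the first variation of length -/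

namespace LorentzModel

variable {K T : ℝ} {p q r v w u x y b o a p₂ y₂ v₂ b' : ℝ × ℝ × ℝ}

/-- The points `a` and `b` lie in two copies of `M_K` that contain geodesics from `p` to `y` and
from `p₂` to `y₂` of the same length and orientation, and going from `a` to `b` across these
geodesics takes time at most `T`. -/
structure Crossing (K T : ℝ) (a b p y p₂ y₂ : ℝ × ℝ × ℝ) : Prop where
  ha : a ∈ points K
  hb : b ∈ points K
  hp : p ∈ points K
  hy : y ∈ points K
  hp₂ : p₂ ∈ points K
  hy₂ : y₂ ∈ points K
  hj : K * chord K p y < 2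
  hc : chord K p y = chord K p₂ y₂
  hf : Fut K p y ↔ Fut K p₂ y₂
  hf' : Fut K y p ↔ Fut K y₂ p₂
  hT : -K * T ^ 2 < Real.pi ^ 2
  bound : ∀ s ∈ Icc (0 : ℝ) 1, Fut K a (seg K p y s) → Fut K (seg K p₂ y₂ s) b →
    tau K a (seg K p y s) + tau K (seg K p₂ y₂ s) b ≤ T

/-- The point `b'` is a substitute for `b` in the plane of `a`. -/
structure IsUnfolding (K T : ℝ) (a b p y p₂ y₂ b' : ℝ × ℝ × ℝ) : Prop where
  mem : b' ∈ points K
  fut : Fut K a b'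
  le : tau K a b' ≤ T
  chord_le : ∀ s ∈ Icc (0 : ℝ) 1, chord K b' (seg K p y s) ≤ chord K b (seg K p₂ y₂ s)
  chord_eq : ¬ (Fut K a p ∧ Fut K p₂ b) → ¬ (Fut K a y ∧ Fut K y₂ b) →
    ∀ s ∈ Icc (0 : ℝ) 1, chord K b' (seg K p y s) = chord K b (seg K p₂ y₂ s)
  exists_fut : ∃ s ∈ Icc (0 : ℝ) 1, Fut K a (seg K p y s) ∧ Fut K (seg K p₂ y₂ s) b ∧
    Fut K (seg K p y s) b'

lemma one_sub_mem {s : ℝ} (hs : s ∈ Icc (0 : ℝ) 1) : 1 - s ∈ Icc (0 : ℝ) 1 :=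
  ⟨by linarith [hs.2], by linarith [hs.1]⟩

namespace Crossing

lemma joined (h : Crossing K T a b p y p₂ y₂) : Joined K p y := (joined_iff h.hp h.hy).2 h.hj

lemma joined₂ (h : Crossing K T a b p y p₂ y₂) : Joined K p₂ y₂ :=
  (joined_iff h.hp₂ h.hy₂).2 (h.hc ▸ h.hj)

lemma symm (h : Crossing K T a b p y p₂ y₂) : Crossing K T a b y p y₂ p₂ where
  ha := h.ha
  hb := h.hb
  hp := h.hy
  hy := h.hp
  hp₂ := h.hy₂
  hy₂ := h.hp₂
  hj := by rw [chord_comm]; exact h.hj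
  hc := by rw [chord_comm, h.hc, chord_comm]
  hf := h.hf'
  hf' := h.hf
  hT := h.hT
  bound := fun s hs => by
    rw [seg_comm h.hp h.hy h.joined, seg_comm h.hp₂ h.hy₂ h.joined₂]
    exact h.bound _ (one_sub_mem hs)

lemma energy_eq (h : Crossing K T a b p y p₂ y₂) :
    energy K (log K p₂ y₂) = energy K (log K p y) :=
  h.joined₂.isLog.energy_eq h.hp₂ h.joined.isLog h.hp h.hc.symm

lemma theta_iff (h : Crossing K T a b p y p₂ y₂) (he : energy K (log K p y) < 0) :
    0 < theta K p (log K p y) ↔ 0 < theta K p₂ (log K p₂ y₂) := by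
  have e1 := h.joined.isLog.fut_line_iff (s := 0) (t := 1) h.hp he (by simp) (by simp) one_pos
  have e2 := h.joined₂.isLog.fut_line_iff (s := 0) (t := 1) h.hp₂ (h.energy_eq ▸ he) (by simp)
    (by simp) one_pos
  rw [← e1, ← e2, line_zero, line_zero, h.joined.isLog.line_one, h.joined₂.isLog.line_one]
  exact h.hf

end Crossing

lemma IsUnfolding.symm (h : Crossing K T a b p y p₂ y₂) (h' : IsUnfolding K T a b y p y₂ p₂ b') :
    IsUnfolding K T a b p y p₂ y₂ b' where
  mem := h'.mem
  fut := h'.fut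
  le := h'.le
  chord_le := fun s hs => by
    rw [seg_comm h.hy h.hp h.symm.joined, seg_comm h.hy₂ h.hp₂ h.symm.joined₂]
    exact h'.chord_le _ (one_sub_mem hs)
  chord_eq := fun h1 h2 s hs => by
    rw [seg_comm h.hy h.hp h.symm.joined, seg_comm h.hy₂ h.hp₂ h.symm.joined₂]
    exact h'.chord_eq h2 h1 _ (one_sub_mem hs)
  exists_fut := by
    obtain ⟨s, hs, h1⟩ := h'.exists_fut
    rw [seg_comm h.hp h.hy h.joined, seg_comm h.hp₂ h.hy₂ h.joined₂] at h1
    exact ⟨_, one_sub_mem hs, h1⟩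

/-- The derivative of `chord K a` along the geodesic from `p` to `y`. -/
def slope (K : ℝ) (a p y : ℝ × ℝ × ℝ) (s : ℝ) : ℝ :=
  form K (seg K p y s - a) (vel K p (log K p y) s)

lemma continuous_slope (K : ℝ) (a p y : ℝ × ℝ × ℝ) : Continuous (slope K a p y) := by
  have h1 := continuous_seg K p y
  have h2 := continuous_vel K p (log K p y)
  have h3 : Continuous fun z : (ℝ × ℝ × ℝ) × (ℝ × ℝ × ℝ) => form K z.1 z.2 := by
    unfold form; fun_prop
  exact h3.comp ((h1.sub continuous_const).prodMk h2)

lemma chord_seg_add (ha : a ∈ points K) (hp : p ∈ points K) (h : Joined K p y) (s t : ℝ) :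
    chord K a (seg K p y t) = cs (K * energy K (log K p y)) (t - s) * chord K a (seg K p y s) +
      sn (K * energy K (log K p y)) (t - s) * slope K a p y s +
      energy K (log K p y) * ve (K * energy K (log K p y)) (t - s) := by
  have := chord_line_add ha hp h.isLog.1 s (t - s)
  rw [slope, seg_eq_line, seg_eq_line]
  rwa [add_sub_cancel] at this

lemma chord_seg_sub (ha : a ∈ points K) (hp : p ∈ points K) (h : Joined K p y) (s t : ℝ) :
    chord K a (seg K p y t) - chord K a (seg K p y s) =
      2 * sn (K * energy K (log K p y)) ((t - s) / 2) * slope K a p y ((s + t) / 2) := by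
  have := chord_line_sub ha hp h.isLog.1 s t
  rw [slope, seg_eq_line, seg_eq_line, seg_eq_line]
  exact this

lemma slope_swap (ha : a ∈ points K) (hp : p ∈ points K) (hy : y ∈ points K) (h : Joined K p y)
    (s : ℝ) : slope K a y p (1 - s) = -slope K a p y s := by
  have h' := h.symm hp hy
  have hE := h'.isLog.energy_eq hy h.isLog hp (chord_comm K y p)
  have key : ∀ d : ℝ, sn (K * energy K (log K p y)) d * slope K a y p (1 - s) =
      -(sn (K * energy K (log K p y)) d * slope K a p y s) := by
    intro d
    have e1 := chord_seg_add ha hp h s (s + d)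
    have e2 := chord_seg_add ha hy h' (1 - s) (1 - s - d)
    rw [seg_comm hp hy h, seg_comm hp hy h, hE, sub_sub_cancel,
      show 1 - (1 - s - d) = s + d by ring, show 1 - s - d - (1 - s) = -d by ring, cs_neg, sn_neg,
      ve_neg] at e2
    rw [add_sub_cancel_left] at e1
    linarith
  have hpos := h.isLog.sn_pos one_pos le_rfl
  have := key 1
  apply mul_left_cancel₀ hpos.ne'
  linarith

/-- Written in terms of the chord, this factor of the first variation is continuous on the whole
side, also where points cease to be timelike related. -/
lemma sqrt_chord (h : Fut K p q) (hp : p ∈ points K) (hq : q ∈ points K) :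
    √(K * chord K p q ^ 2 - 2 * chord K p q) = sn (-K) (tau K p q) := by
  rw [chord_eq_tm h hp hq, ← sn_sq_eq_tm, Real.sqrt_sq (sn_tau_pos h hp hq).le]

/-- Up to a positive factor, minus the derivative of the length of the broken geodesics from `a` to
`b` through the point of the geodesics from `p` to `y` and from `p₂` to `y₂` with parameter `s`. -/
def defect (K : ℝ) (a b p y p₂ y₂ : ℝ × ℝ × ℝ) (s : ℝ) : ℝ :=
  √(K * chord K (seg K p₂ y₂ s) b ^ 2 - 2 * chord K (seg K p₂ y₂ s) b) * slope K a p y s +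
  √(K * chord K a (seg K p y s) ^ 2 - 2 * chord K a (seg K p y s)) * slope K b p₂ y₂ s

lemma continuous_defect (K : ℝ) (a b p y p₂ y₂ : ℝ × ℝ × ℝ) :
    Continuous (defect K a b p y p₂ y₂) := by
  have h1 := continuous_seg K p y
  have h2 := continuous_seg K p₂ y₂
  have h3 := continuous_slope K a p y
  have h4 := continuous_slope K b p₂ y₂
  have h5 : Continuous fun s => chord K a (seg K p y s) := (continuous_chord K a).comp h1
  have h6 : Continuous fun s => chord K (seg K p₂ y₂ s) b :=
    (continuous_chord_uncurry K).comp (h2.prodMk continuous_const)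
  unfold defect; fun_prop

namespace Crossing

/-- The candidate `b'` prolongs the geodesic from `a` through the crossing point by the length of
the second leg. Then `b` and `b'` have the same chord to the crossing point, and the cosine law
reduces the difference of their chords to other points of the side to the difference of slopes, a
positive multiple of the defect. It vanishes at a critical parameter and has the right sign in the
two end cases. -/
lemma exists_unfolding_of_defect (h : Crossing K T a b p y p₂ y₂) {s : ℝ} (hs : s ∈ Icc (0 : ℝ) 1)
    (h1 : Fut K a (seg K p y s)) (h2 : Fut K (seg K p₂ y₂ s) b)
    (hk : (s = 0 ∧ 0 ≤ defect K a b p y p₂ y₂ s) ∨ defect K a b p y p₂ y₂ s = 0 ∨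
      (s = 1 ∧ defect K a b p y p₂ y₂ s ≤ 0)) :
    ∃ b', IsUnfolding K T a b p y p₂ y₂ b' := by
  have hq := seg_mem h.hp h.joined s
  have hq₂ := seg_mem h.hp₂ h.joined₂ s
  have hT1 := tau_pos h1 h.ha hq
  have hT2 := tau_pos h2 hq₂ h.hb
  have hle := h.bound s hs h1 h2
  obtain ⟨b', hb', f1, f2, f3, f4, f5⟩ := exists_extension h.ha hq h1 hT2
    (mul_sq_lt (by positivity) h.hT (by
      rw [abs_of_pos (by linarith), abs_of_pos (by linarith)]; exact hle))
  have hchord : chord K b' (seg K p y s) = chord K b (seg K p₂ y₂ s) := by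
    rw [chord_comm, chord_eq_tm f3 hq hb', f4, chord_comm K b, chord_eq_tm h2 hq₂ h.hb]
  have hvt : IsTangent K (seg K p y s) (vel K p (log K p y) s) := by
    rw [seg_eq_line]; exact vel_tangent h.hp h.joined.isLog.1 s
  have hform := f5 _ hvt
  have hsn := sn_tau_pos h1 h.ha hq
  have hdef : defect K a b p y p₂ y₂ s = sn (-K) (tau K a (seg K p y s)) *
      (slope K b p₂ y₂ s - slope K b' p y s) := by
    rw [defect, sqrt_chord h1 h.ha hq, sqrt_chord h2 hq₂ h.hb]
    unfold slope
    linear_combination hform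
  -- Both sides of the cosine law are expanded at the crossing parameter; only the slope terms
  -- differ.
  have hdiff : ∀ t, chord K b (seg K p₂ y₂ t) - chord K b' (seg K p y t) =
      sn (K * energy K (log K p y)) (t - s) * (slope K b p₂ y₂ s - slope K b' p y s) := by
    intro t
    rw [chord_seg_add h.hb h.hp₂ h.joined₂ s t, chord_seg_add hb' h.hp h.joined s t, hchord,
      h.energy_eq]
    ring
  refine ⟨b', hb', f1, f2 ▸ hle, fun t ht => ?_, fun n0 n1 t ht => ?_, s, hs, h1, h2, f3⟩
  · rw [← sub_nonneg, hdiff]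
    rcases hk with ⟨rfl, hk⟩ | hk | ⟨rfl, hk⟩
    · rw [hdef] at hk
      have := nonneg_of_mul_nonneg_right hk hsn
      rw [sub_zero]
      exact mul_nonneg (h.joined.isLog.sn_nonneg ht.1 ht.2) this
    · rw [hdef] at hk
      rcases mul_eq_zero.1 hk with h0 | h0
      · exact absurd h0 hsn.ne'
      · rw [h0, mul_zero]
    · rw [hdef] at hk
      have := nonpos_of_mul_nonpos_right hk hsn
      have e := h.joined.isLog.sn_nonneg (s := 1 - t) (by linarith [ht.2]) (by linarith [ht.1])
      rw [← neg_sub 1 t, sn_neg]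
      nlinarith
  · refine (sub_eq_zero.1 ?_).symm
    rw [hdiff]
    rcases hk with ⟨rfl, hk⟩ | hk | ⟨rfl, hk⟩
    · exact absurd ⟨by rwa [seg_zero] at h1, by rwa [seg_zero] at h2⟩ n0
    · rw [hdef] at hk
      rcases mul_eq_zero.1 hk with h0 | h0
      · exact absurd h0 hsn.ne'
      · rw [h0, mul_zero]
    · exact absurd ⟨by rwa [seg_one h.joined] at h1, by rwa [seg_one h.joined₂] at h2⟩ n1

end Crossing

/-- At the end of an interval on which a geodesic is timelike related to `a`, the derivative of the
chord has a sign, or the geodesic passes through `a`. -/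
lemma slope_neg_or_eq (ha : a ∈ points K) (hp : p ∈ points K) (h : Joined K p y) {s t : ℝ}
    (hs : 0 ≤ s) (hst : s < t) (ht : t ≤ 1) (h0 : chord K a (seg K p y s) = 0)
    (hneg : ∀ c, s < c → c ≤ t → chord K a (seg K p y c) < 0) :
    slope K a p y s < 0 ∨ (energy K (log K p y) < 0 ∧ seg K p y s = a) := by
  have hq := seg_mem hp h s
  -- The midpoint formula makes the slopes shortly after `s` negative, and the slope is continuous.
  have hle : slope K a p y s ≤ 0 := by
    have hc := (continuous_slope K a p y).tendsto s
    refine le_of_tendsto (hc.mono_left (nhdsWithin_le_nhds (s := Ioi s))) ?_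
    have : Iio ((s + t) / 2) ∈ 𝓝[>] s := mem_nhdsWithin_of_mem_nhds (Iio_mem_nhds (by linarith))
    filter_upwards [this, self_mem_nhdsWithin] with c hc1 hc2
    have hc1 : c < (s + t) / 2 := hc1
    have hc2 : s < c := hc2
    have e := chord_seg_sub ha hp h s (2 * c - s)
    rw [h0, show (s + (2 * c - s)) / 2 = c by ring] at e
    have hn := hneg (2 * c - s) (by linarith) (by linarith)
    have hpos := h.isLog.sn_pos (s := (2 * c - s - s) / 2) (by linarith) (by linarith)
    by_contra hcon
    push Not at hcon
    nlinarith [mul_pos hpos hcon]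
  rcases hle.lt_or_eq with hlt | heq
  · exact Or.inl hlt
  right
  have e := chord_seg_add ha hp h s t
  rw [h0, heq] at e
  have hn := hneg t hst le_rfl
  have hv : 0 ≤ ve (K * energy K (log K p y)) (t - s) := ve_nonneg _ _
  have he : energy K (log K p y) < 0 := by
    by_contra hcon
    push Not at hcon
    nlinarith [mul_nonneg hcon hv]
  refine ⟨he, ?_⟩
  rw [chord_comm] at h0
  -- In the critical case the geodesic from the point to `a` is null, and its velocity is orthogonal
  -- to a timelike vector, hence zero.
  obtain ⟨w, hw⟩ := exists_isLog hq ha (by rw [h0]; simp)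
  have hw0 : energy K w = 0 := by
    have := hw.chord_eq hq
    rw [h0] at this
    exact (mul_eq_zero.1 this.symm).resolve_right hw.ve_pos.ne'
  have hvt : IsTangent K (seg K p y s) (vel K p (log K p y) s) := by
    rw [seg_eq_line]; exact vel_tangent hp h.isLog.1 s
  have f1 := form_sub_line hq hw.1 hvt 1
  rw [hw.line_one] at f1
  have f2 : form K w (vel K p (log K p y) s) = 0 := by
    unfold slope at heq
    rw [heq] at f1
    exact (mul_eq_zero.1 (neg_eq_zero.1 f1.symm)).resolve_left (hw.sn_pos one_pos le_rfl).ne'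
  have hwz := (energy_nonneg_of_form hq hvt hw.1 (by rwa [energy_vel hp h.isLog.1])
    (by rw [form_comm]; exact f2)).2 hw0
  rw [← hw.line_one, hwz]
  simp [line, energy]

/-- The condition `0 ≤ theta` survives the limit, and `theta` cannot vanish at a timelike pair
within range. -/
lemma fut_of_tendsto_of_chord (ha : a ∈ points K) (hp : p ∈ points K) (h : Joined K p y) {s t : ℝ}
    (hst : s < t) (hf : ∀ c, s < c → c ≤ t → Fut K a (seg K p y c))
    (h0 : chord K a (seg K p y s) < 0) (h1 : K * chord K a (seg K p y s) < 2) :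
    Fut K a (seg K p y s) := by
  refine Fut.of_nonneg ha (seg_mem hp h s) h0 h1 ?_
  have hc : Continuous fun s => theta K a (seg K p y s - a) :=
    (continuous_theta_sub K a).comp (continuous_seg K p y)
  refine ge_of_tendsto ((hc.tendsto s).mono_left (nhdsWithin_le_nhds (s := Ioi s))) ?_
  filter_upwards [Ioc_mem_nhdsGT hst] with c hc
  exact (hf c hc.1 hc.2).2.2.le

lemma fut_of_tendsto_of_chord_left (hb : b ∈ points K) (hp : p ∈ points K) (h : Joined K p y)
    {s t : ℝ} (hst : s < t) (hf : ∀ c, s < c → c ≤ t → Fut K (seg K p y c) b)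
    (h0 : chord K (seg K p y s) b < 0) (h1 : K * chord K (seg K p y s) b < 2) :
    Fut K (seg K p y s) b := by
  have := fut_of_tendsto_of_chord (rev_mem hb) (rev_mem hp) h.rev hst
    (fun c h1 h2 => by rw [seg_rev hp h]; exact fut_rev.2 (hf c h1 h2))
    (by rwa [seg_rev hp h, chord_rev, chord_comm]) (by rwa [seg_rev hp h, chord_rev, chord_comm])
  rw [seg_rev hp h] at this
  exact fut_rev.1 this

end LorentzModel

/-! ### Existence of unfoldings -/

namespace LorentzModel

variable {K T : ℝ} {p q r v w u x y b o a p₂ y₂ v₂ b' : ℝ × ℝ × ℝ}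

/-- The parameters at which one can cross from the past of `b` to the future of `a`. -/
def crossSet (K : ℝ) (a b p y p₂ y₂ : ℝ × ℝ × ℝ) : Set ℝ :=
  {s | s ∈ Icc (0 : ℝ) 1 ∧ Fut K a (seg K p y s) ∧ Fut K (seg K p₂ y₂ s) b}

lemma theta_neg_vel_pos (hp : p ∈ points K) (hv : IsTangent K p v) (he : energy K v < 0)
    (h : ¬ 0 < theta K p v) (s : ℝ) : 0 < theta K (line K p v s) (-vel K p v s) := by
  have h1 := (theta_vel_pos_iff hp hv he s).not.2 h
  have h2 := theta_ne_zero (line_mem hp hv s) (vel_tangent hp hv s) (by rwa [energy_vel hp hv])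
  rw [theta_neg]
  have := lt_of_le_of_ne (not_lt.1 h1) h2
  linarith

lemma chord_seg_self (hp : p ∈ points K) (h : Joined K p y) (s t : ℝ) :
    chord K (seg K p y s) (seg K p y t) =
      energy K (log K p y) * ve (K * energy K (log K p y)) (t - s) := by
  rw [chord_seg_add (seg_mem hp h s) hp h s t, slope]
  simp [form]

lemma tau_le_of_tm_le (hT0 : 0 ≤ T) (hf : Fut K q r) (hq : q ∈ points K)
    (hr : r ∈ points K) (hle : tm K T ≤ chord K q r) : tau K q r ≤ T := by
  rw [chord_eq_tm hf hq hr] at hle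
  exact le_of_tm_le hT0 (tau_lt hf hq hr) hle

namespace Crossing

/-- Timelike futures and pasts are convex along geodesics, so the crossing parameters form an
interval. -/
lemma ordConnected (h : Crossing K T a b p y p₂ y₂) {s t c : ℝ}
    (hs : s ∈ crossSet K a b p y p₂ y₂) (ht : t ∈ crossSet K a b p y p₂ y₂) (hsc : s ≤ c)
    (hct : c ≤ t) : c ∈ crossSet K a b p y p₂ y₂ :=
  ⟨⟨hs.1.1.trans hsc, hct.trans ht.1.2⟩,
    Fut.seg_right_of_mem h.ha h.hp h.joined hs.1 ht.1 hs.2.1 ht.2.1 hsc hct,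
    Fut.seg_left_of_mem h.hb h.hp₂ h.joined₂ hs.1 ht.1 hs.2.2 ht.2.2 hsc hct⟩

lemma pos (h : Crossing K T a b p y p₂ y₂) {s : ℝ} (hs : s ∈ crossSet K a b p y p₂ y₂) :
    0 < T := by
  have h1 := h.bound s hs.1 hs.2.1 hs.2.2
  have h2 := tau_pos hs.2.1 h.ha (seg_mem h.hp h.joined s)
  have h3 := tau_pos hs.2.2 (seg_mem h.hp₂ h.joined₂ s) h.hb
  linarith

/-- Each leg is shorter than `T`. Unlike the timelike relation itself, these bounds persist at the
boundary of the crossing set, where they supply the range condition. -/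
lemma tm_le (h : Crossing K T a b p y p₂ y₂) {s : ℝ} (hs : s ∈ crossSet K a b p y p₂ y₂) :
    tm K T ≤ chord K a (seg K p y s) ∧ tm K T ≤ chord K (seg K p₂ y₂ s) b := by
  have h1 := h.bound s hs.1 hs.2.1 hs.2.2
  have m1 := seg_mem h.hp h.joined s
  have m2 := seg_mem h.hp₂ h.joined₂ s
  have h2 := tau_pos hs.2.1 h.ha m1
  have h3 := tau_pos hs.2.2 m2 h.hb
  rw [chord_eq_tm hs.2.1 h.ha m1, chord_eq_tm hs.2.2 m2 h.hb]
  exact ⟨tm_le_tm h2.le (by linarith) h.hT, tm_le_tm h3.le (by linarith) h.hT⟩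

lemma range (h : Crossing K T a b p y p₂ y₂) {c : ℝ} (h0 : c ≤ 0) (h1 : tm K T ≤ c) :
    K * c < 2 := by
  have := mul_tm_lt_two h.hT
  rcases le_or_gt 0 K with hK | hK
  · nlinarith
  · nlinarith

/-- A degenerate boundary case: the first leg shrinks to a point, so the common side passes through
`a` and is future-directed timelike. The substitute is then an exact copy of `b` relative to this
line. -/
lemma exists_unfolding_of_eq_left (h : Crossing K T a b p y p₂ y₂) {s t : ℝ} (hs : 0 ≤ s)
    (hst : s < t) (ht : t ≤ 1) (hJ : ∀ c, s < c → c ≤ t → c ∈ crossSet K a b p y p₂ y₂)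
    (he : energy K (log K p y) < 0) (heq : seg K p y s = a)
    (hle : tm K T ≤ chord K (seg K p₂ y₂ s) b) : ∃ b', IsUnfolding K T a b p y p₂ y₂ b' := by
  have hsI : s ∈ Icc (0 : ℝ) 1 := ⟨hs, hst.le.trans ht⟩
  have htI : t ∈ Icc (0 : ℝ) 1 := ⟨hs.trans hst.le, ht⟩
  have htJ := hJ t hst le_rfl
  have l1 := h.joined.isLog
  have l2 := h.joined₂.isLog
  have he₂ : energy K (log K p₂ y₂) < 0 := by rwa [h.energy_eq]
  have hθ : 0 < theta K p (log K p y) := by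
    have := htJ.2.1
    rw [← heq, seg_eq_line, seg_eq_line] at this
    exact (l1.fut_line_iff h.hp he hsI htI hst).1 this
  have hθ₂ := (h.theta_iff he).1 hθ
  have hslope : ∀ c, s < c → c ≤ t → 0 < slope K b p₂ y₂ c := by
    intro c h1 h2
    have h3 := (hJ c h1 h2).2.2
    rw [seg_eq_line] at h3
    rw [slope, seg_eq_line]
    exact h3.form_pos (line_mem h.hp₂ l2.1 c) h.hb (vel_tangent h.hp₂ l2.1 c)
      (by rwa [energy_vel h.hp₂ l2.1]) (theta_vel_pos h.hp₂ l2.1 he₂ hθ₂ c)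
  have hlt : chord K (seg K p₂ y₂ s) b < 0 := by
    have e := chord_seg_sub h.hb h.hp₂ h.joined₂ s t
    have h1 := hslope ((s + t) / 2) (by linarith) (by linarith)
    have h2 := l2.sn_pos (s := (t - s) / 2) (by linarith) (by linarith)
    have h3 := htJ.2.2.1
    rw [chord_comm] at h3 ⊢
    nlinarith [mul_pos h2 h1]
  have hfut := fut_of_tendsto_of_chord_left h.hb h.hp₂ h.joined₂ hst
    (fun c h1 h2 => (hJ c h1 h2).2.2) hlt (h.range hlt.le hle)
  obtain ⟨b', hb', hc⟩ := exists_copy h.hp l1 h.hp₂ l2 rfl h.energy_eq he h.hb (s := s)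
    (by rw [← seg_eq_line]; exact hfut.2.1)
  have hcopy := fun c hc' => fut_of_copy (s := c) h.hp l1 h.hp₂ l2 rfl h.energy_eq he
    (h.theta_iff he) h.hb hb' (fun c _ => hc c) hc'
  simp only [← seg_eq_line] at hc hcopy
  have hfa := (hcopy s hsI).1 hfut
  rw [heq] at hfa
  refine ⟨b', hb', hfa, tau_le_of_tm_le (h.pos htJ).le hfa h.ha hb' ?_, fun c _ => (hc c).le,
    fun _ _ c _ => hc c, t, htI, htJ.2.1, htJ.2.2, (hcopy t htI).1 htJ.2.2⟩
  rw [chord_comm, ← heq, hc, chord_comm]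
  exact hle

/-- In the other degenerate case the second copy of the side passes through `b`, and the substitute
is the point of the first copy with the same parameter. -/
lemma exists_unfolding_of_eq_right (h : Crossing K T a b p y p₂ y₂) {s t : ℝ} (hs : 0 ≤ s)
    (hst : s < t) (ht : t ≤ 1) (hJ : ∀ c, s < c → c ≤ t → c ∈ crossSet K a b p y p₂ y₂)
    (he : energy K (log K p y) < 0) (heq : seg K p₂ y₂ s = b)
    (hle : tm K T ≤ chord K a (seg K p y s)) : ∃ b', IsUnfolding K T a b p y p₂ y₂ b' := by
  have hsI : s ∈ Icc (0 : ℝ) 1 := ⟨hs, hst.le.trans ht⟩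
  have htI : t ∈ Icc (0 : ℝ) 1 := ⟨hs.trans hst.le, ht⟩
  have htJ := hJ t hst le_rfl
  have l1 := h.joined.isLog
  have l2 := h.joined₂.isLog
  have he₂ : energy K (log K p₂ y₂) < 0 := by rwa [h.energy_eq]
  have hθ₂ : ¬ 0 < theta K p₂ (log K p₂ y₂) := by
    have := htJ.2.2
    rw [← heq, seg_eq_line, seg_eq_line] at this
    rw [← l2.fut_line_iff h.hp₂ he₂ hsI htI hst]
    exact this.not_fut
  have hθ := (h.theta_iff he).not.2 hθ₂
  have hslope : ∀ c, s < c → c ≤ t → 0 < slope K a p y c := by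
    intro c h1 h2
    have h3 := (hJ c h1 h2).2.1
    rw [seg_eq_line] at h3
    have := h3.form_neg h.ha (line_mem h.hp l1.1 c) (vel_tangent h.hp l1.1 c).neg
      (by rwa [energy_neg, energy_vel h.hp l1.1]) (theta_neg_vel_pos h.hp l1.1 he hθ c)
    rw [form_comm, form_neg_left, form_comm] at this
    rw [slope, seg_eq_line]
    linarith
  have hlt : chord K a (seg K p y s) < 0 := by
    have e := chord_seg_sub h.ha h.hp h.joined s t
    have h1 := hslope ((s + t) / 2) (by linarith) (by linarith)
    have h2 := l1.sn_pos (s := (t - s) / 2) (by linarith) (by linarith)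
    have h3 := htJ.2.1.1
    nlinarith [mul_pos h2 h1]
  have hfut := fut_of_tendsto_of_chord h.ha h.hp h.joined hst
    (fun c h1 h2 => (hJ c h1 h2).2.1) hlt (h.range hlt.le hle)
  have hq := seg_mem h.hp h.joined s
  have hc : ∀ c, chord K (seg K p y s) (seg K p y c) = chord K b (seg K p₂ y₂ c) := by
    intro c
    rw [← heq, chord_seg_self h.hp h.joined, chord_seg_self h.hp₂ h.joined₂, h.energy_eq]
  have hcopy := fun c hc' => fut_of_copy (s := c) h.hp l1 h.hp₂ l2 rfl h.energy_eq he
    (h.theta_iff he) h.hb hq (fun c _ => by rw [← seg_eq_line, ← seg_eq_line]; exact hc c) hc'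
  simp only [← seg_eq_line] at hcopy
  exact ⟨_, hq, hfut, tau_le_of_tm_le (h.pos htJ).le hfut h.ha hq hle, fun c _ => (hc c).le,
    fun _ _ c _ => hc c, t, htI, htJ.2.1, htJ.2.2, (hcopy t htI).1 htJ.2.2⟩

/-- A study of the left end of the crossing interval. If the interval starts at parameter 0, a
nonnegative defect already allows straightening there. Otherwise one leg becomes null at the left
end; unless it shrinks to a point, the first variation there favours moving into the interval. -/
lemma exists_unfolding_or_defect_neg (h : Crossing K T a b p y p₂ y₂)
    (hne : (crossSet K a b p y p₂ y₂).Nonempty) :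
    (∃ b', IsUnfolding K T a b p y p₂ y₂ b') ∨
      ∃ s ∈ crossSet K a b p y p₂ y₂, defect K a b p y p₂ y₂ s < 0 := by
  obtain ⟨t, ht⟩ := hne
  by_cases h0 : (0 : ℝ) ∈ crossSet K a b p y p₂ y₂
  · rcases le_or_gt 0 (defect K a b p y p₂ y₂ 0) with hd | hd
    · exact Or.inl (h.exists_unfolding_of_defect (by simp) h0.2.1 h0.2.2 (Or.inl ⟨rfl, hd⟩))
    · exact Or.inr ⟨0, h0, hd⟩
  have hbdd : BddBelow (crossSet K a b p y p₂ y₂) := ⟨0, fun s hs => hs.1.1⟩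
  set s := sInf (crossSet K a b p y p₂ y₂) with hs_def
  have hs0 : 0 ≤ s := le_csInf ⟨t, ht⟩ fun c hc => hc.1.1
  have hs1 : s ≤ 1 := (csInf_le hbdd ht).trans ht.1.2
  have c1 : Continuous fun c => chord K a (seg K p y c) :=
    (continuous_chord K a).comp (continuous_seg K p y)
  have c2 : Continuous fun c => chord K (seg K p₂ y₂ c) b :=
    (continuous_chord_uncurry K).comp ((continuous_seg K p₂ y₂).prodMk continuous_const)
  have hJ : ∀ c, s < c → c ≤ t → c ∈ crossSet K a b p y p₂ y₂ := by
    intro c hc hct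
    obtain ⟨d, hd, hdc⟩ := exists_lt_of_csInf_lt ⟨t, ht⟩ hc
    exact h.ordConnected hd ht hdc.le hct
  -- The relation `Fut` is open, so a positive infimum cannot belong to the set.
  have hsJ : s ∉ crossSet K a b p y p₂ y₂ := by
    intro hsJ
    have hpos : 0 < s := lt_of_le_of_ne hs0 fun h' => h0 (h' ▸ hsJ)
    have o1 : ∀ᶠ c in 𝓝 s, Fut K a (seg K p y c) :=
      (continuous_const.prodMk (continuous_seg K p y)).continuousAt.eventually
        ((isOpen_fut K).mem_nhds hsJ.2.1)
    have o2 : ∀ᶠ c in 𝓝 s, Fut K (seg K p₂ y₂ c) b :=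
      ((continuous_seg K p₂ y₂).prodMk continuous_const).continuousAt.eventually
        ((isOpen_fut K).mem_nhds hsJ.2.2)
    have o3 : ∀ᶠ c in 𝓝[<] s, c ∈ crossSet K a b p y p₂ y₂ ∧ c < s := by
      filter_upwards [mem_nhdsWithin_of_mem_nhds o1, mem_nhdsWithin_of_mem_nhds o2,
        Ioo_mem_nhdsLT hpos] with c h1 h2 h3
      exact ⟨⟨⟨h3.1.le, (h3.2.le).trans hs1⟩, h1, h2⟩, h3.2⟩
    obtain ⟨c, hc, hcs⟩ := o3.exists
    exact absurd (csInf_le hbdd hc) hcs.not_ge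
  have hst : s < t := lt_of_le_of_ne (csInf_le hbdd ht) fun h' => hsJ (h' ▸ ht)
  have hev : ∀ᶠ c in 𝓝[>] s, c ∈ crossSet K a b p y p₂ y₂ := by
    filter_upwards [Ioc_mem_nhdsGT hst] with c hc
    exact hJ c hc.1 hc.2
  have t1 := (c1.tendsto s).mono_left (nhdsWithin_le_nhds (s := Ioi s))
  have t2 := (c2.tendsto s).mono_left (nhdsWithin_le_nhds (s := Ioi s))
  have u1 : chord K a (seg K p y s) ≤ 0 := le_of_tendsto t1 (hev.mono fun c hc => hc.2.1.1.le)
  have u2 : chord K (seg K p₂ y₂ s) b ≤ 0 := le_of_tendsto t2 (hev.mono fun c hc => hc.2.2.1.le)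
  have w1 : tm K T ≤ chord K a (seg K p y s) := ge_of_tendsto t1 (hev.mono fun c hc => (h.tm_le hc).1)
  have w2 : tm K T ≤ chord K (seg K p₂ y₂ s) b :=
    ge_of_tendsto t2 (hev.mono fun c hc => (h.tm_le hc).2)
  have n1 : chord K a (seg K p y s) < 0 ∨ slope K a p y s < 0 ∨
      (energy K (log K p y) < 0 ∧ seg K p y s = a) := by
    rcases u1.lt_or_eq with h1 | h1
    · exact Or.inl h1
    · exact Or.inr (slope_neg_or_eq h.ha h.hp h.joined hs0 hst ht.1.2 h1
        fun c hc hct => (hJ c hc hct).2.1.1)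
  have n2 : chord K (seg K p₂ y₂ s) b < 0 ∨ slope K b p₂ y₂ s < 0 ∨
      (energy K (log K p y) < 0 ∧ seg K p₂ y₂ s = b) := by
    rcases u2.lt_or_eq with h1 | h1
    · exact Or.inl h1
    · rw [← h.energy_eq]
      refine Or.inr (slope_neg_or_eq h.hb h.hp₂ h.joined₂ hs0 hst ht.1.2 (by rwa [chord_comm])
        fun c hc hct => ?_)
      rw [chord_comm]; exact (hJ c hc hct).2.2.1
  -- Two timelike legs in the limit would make the infimum a crossing parameter.
  have hnot : ¬ (chord K a (seg K p y s) < 0 ∧ chord K (seg K p₂ y₂ s) b < 0) := fun hn =>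
    hsJ ⟨⟨hs0, hs1⟩,
      fut_of_tendsto_of_chord h.ha h.hp h.joined hst (fun c h1 h2 => (hJ c h1 h2).2.1) hn.1
        (h.range u1 w1),
      fut_of_tendsto_of_chord_left h.hb h.hp₂ h.joined₂ hst (fun c h1 h2 => (hJ c h1 h2).2.2) hn.2
        (h.range u2 w2)⟩
  by_cases d1 : energy K (log K p y) < 0 ∧ seg K p y s = a
  · exact Or.inl (h.exists_unfolding_of_eq_left hs0 hst ht.1.2 hJ d1.1 d1.2 w2)
  by_cases d2 : energy K (log K p y) < 0 ∧ seg K p₂ y₂ s = b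
  · exact Or.inl (h.exists_unfolding_of_eq_right hs0 hst ht.1.2 hJ d2.1 d2.2 w1)
  right
  -- If one limiting leg remains timelike, the defect is already negative in the limit. If both
  -- become null, the defect tends to 0 and its sign is read off shortly after `s`, where both
  -- slopes are negative.
  suffices hd : ∀ᶠ c in 𝓝[>] s, defect K a b p y p₂ y₂ c < 0 by
    obtain ⟨c, hc1, hc2⟩ := (hev.and hd).exists
    exact ⟨c, hc1, hc2⟩
  have hpos : ∀ c : ℝ, c < 0 → K * c < 2 → 0 < √(K * c ^ 2 - 2 * c) := fun c h1 h2 =>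
    Real.sqrt_pos.2 (by nlinarith)
  have hlim : defect K a b p y p₂ y₂ s < 0 → ∀ᶠ c in 𝓝[>] s, defect K a b p y p₂ y₂ c < 0 :=
    fun hd => ((continuous_defect K a b p y p₂ y₂).tendsto s).mono_left nhdsWithin_le_nhds
      |>.eventually_lt_const hd
  rcases n1 with n1 | n1 | n1
  · rcases n2 with n2 | n2 | n2
    · exact absurd ⟨n1, n2⟩ hnot
    · apply hlim
      have hz : chord K (seg K p₂ y₂ s) b = 0 :=
        u2.antisymm (not_lt.1 fun h' => hnot ⟨n1, h'⟩)
      rw [defect, hz]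
      have := mul_neg_of_pos_of_neg (hpos _ n1 (h.range u1 w1)) n2
      simpa using this
    · exact absurd n2 d2
  · rcases n2 with n2 | n2 | n2
    · apply hlim
      have hz : chord K a (seg K p y s) = 0 :=
        u1.antisymm (not_lt.1 fun h' => hnot ⟨h', n2⟩)
      rw [defect, hz]
      have := mul_neg_of_pos_of_neg (hpos _ n2 (h.range u2 w2)) n1
      simpa using this
    · have e1 := ((continuous_slope K a p y).tendsto s).mono_left
        (nhdsWithin_le_nhds (s := Ioi s)) |>.eventually_lt_const n1
      have e2 := ((continuous_slope K b p₂ y₂).tendsto s).mono_left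
        (nhdsWithin_le_nhds (s := Ioi s)) |>.eventually_lt_const n2
      filter_upwards [hev, e1, e2] with c hc h1 h2
      have p1 := mul_neg_of_pos_of_neg (hpos _ hc.2.2.1 hc.2.2.2.1) h1
      have p2 := mul_neg_of_pos_of_neg (hpos _ hc.2.1.1 hc.2.1.2.1) h2
      rw [defect]; linarith
    · exact absurd n2 d2
  · exact absurd n1 d1

lemma defect_swap (h : Crossing K T a b p y p₂ y₂) (s : ℝ) :
    defect K a b y p y₂ p₂ (1 - s) = -defect K a b p y p₂ y₂ s := by
  rw [defect, slope_swap h.ha h.hp h.hy h.joined, slope_swap h.hb h.hp₂ h.hy₂ h.joined₂,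
    seg_comm h.hp h.hy h.joined, seg_comm h.hp₂ h.hy₂ h.joined₂, sub_sub_cancel, defect]
  ring

lemma mem_crossSet_swap (h : Crossing K T a b p y p₂ y₂) {s : ℝ} :
    s ∈ crossSet K a b y p y₂ p₂ ↔ 1 - s ∈ crossSet K a b p y p₂ y₂ := by
  unfold crossSet
  simp only [mem_ofPred_eq, seg_comm h.hp h.hy h.joined, seg_comm h.hp₂ h.hy₂ h.joined₂]
  refine and_congr_left fun _ => ⟨one_sub_mem, fun h' => ?_⟩
  have := one_sub_mem h'
  rwa [sub_sub_cancel] at this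

/-- If neither end of the interval gives an unfolding, the defect is negative at one crossing
parameter and, after exchanging `p` and `y`, positive at another. By the intermediate value theorem
it vanishes in between, still within the crossing interval, and the broken geodesic can be
straightened there. -/
theorem exists_unfolding (h : Crossing K T a b p y p₂ y₂)
    (hne : (crossSet K a b p y p₂ y₂).Nonempty) : ∃ b', IsUnfolding K T a b p y p₂ y₂ b' := by
  rcases h.exists_unfolding_or_defect_neg hne with h1 | ⟨s, hs, hds⟩
  · exact h1
  have hne' : (crossSet K a b y p y₂ p₂).Nonempty := by
    obtain ⟨s, hs⟩ := hne
    exact ⟨1 - s, h.mem_crossSet_swap.2 (by rwa [sub_sub_cancel])⟩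
  rcases h.symm.exists_unfolding_or_defect_neg hne' with ⟨b', hb'⟩ | ⟨t, ht, hdt⟩
  · exact ⟨b', hb'.symm h⟩
  have ht' := h.mem_crossSet_swap.1 ht
  have hdt' : 0 < defect K a b p y p₂ y₂ (1 - t) := by
    have := h.defect_swap (1 - t)
    rw [sub_sub_cancel] at this
    linarith
  have hcont := (continuous_defect K a b p y p₂ y₂).continuousOn (s := uIcc s (1 - t))
  obtain ⟨c, hc, hdc⟩ := intermediate_value_uIcc hcont
    (show (0 : ℝ) ∈ uIcc _ _ from by rw [uIcc_of_le (by linarith)]; exact ⟨hds.le, hdt'.le⟩)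
  have hcJ : c ∈ crossSet K a b p y p₂ y₂ := by
    rcases le_total s (1 - t) with hle | hle
    · rw [uIcc_of_le hle] at hc
      exact h.ordConnected hs ht' hc.1 hc.2
    · rw [uIcc_of_ge hle] at hc
      exact h.ordConnected ht' hs hc.1 hc.2
  exact h.exists_unfolding_of_defect hcJ.1 hcJ.2.1 hcJ.2.2 (Or.inr (Or.inl hdc))

end Crossing

end LorentzModel

/-! ### Comparison along timelike segments -/

namespace LorentzModel

variable {K T c t : ℝ} {m n m' n' p q r v w u x y z b o a p₂ y₂ b' x' y' z' a' : ℝ × ℝ × ℝ}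

lemma Fut.joined (h : Fut K p q) (hp : p ∈ points K) (hq : q ∈ points K) : Joined K p q :=
  (joined_iff hp hq).2 h.2.1

lemma Fut.of_path_left {γ : ℝ → ℝ × ℝ × ℝ} {a c : ℝ} (hr : r ∈ points K)
    (hγ : ContinuousOn γ (Icc a c)) (hm : ∀ s ∈ Icc a c, γ s ∈ points K)
    (h1 : ∀ s ∈ Icc a c, chord K (γ s) r < 0) (h2 : ∀ s ∈ Icc a c, K * chord K (γ s) r < 2)
    {s t : ℝ} (hs : s ∈ Icc a c) (ht : t ∈ Icc a c) (h : Fut K (γ s) r) : Fut K (γ t) r := by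
  have hc : Continuous rev := by unfold rev; fun_prop
  refine fut_rev.1 (Fut.of_path (γ := fun s => rev (γ s)) (rev_mem hr) (hc.comp_continuousOn hγ)
    (fun s hs => rev_mem (hm s hs)) ?_ ?_ hs ht (fut_rev.2 h))
  · intro s hs; rw [chord_rev, chord_comm]; exact h1 s hs
  · intro s hs; rw [chord_rev, chord_comm]; exact h2 s hs

lemma Fut.trans_or_exists_left (hx : x ∈ points K) (hq : q ∈ points K) (hb : b ∈ points K)
    (h1 : Fut K x q) (h2 : Fut K q b) :
    Fut K x b ∨ K < 0 ∧ ∃ s ∈ Icc (0 : ℝ) 1, 2 ≤ K * chord K (seg K x q s) b := by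
  have hj := h1.joined hx hq
  rcases Fut.trans_or_exists (rev_mem hb) (rev_mem hq) (rev_mem hx) (fut_rev.2 h2)
    (fut_rev.2 h1) with h | ⟨hK, s, hs, h⟩
  · exact Or.inl (fut_rev.1 h)
  · rw [seg_rev hq (hj.symm hx hq), chord_rev, chord_comm, seg_comm hx hq hj] at h
    exact Or.inr ⟨hK, 1 - s, one_sub_mem hs, h⟩

lemma tau_seg (hm : m ∈ points K) (hn : n ∈ points K) (h : Fut K m n) {s t : ℝ} (hs : 0 ≤ s)
    (hst : s < t) (ht : t ≤ 1) :
    Fut K (seg K m n s) (seg K m n t) ∧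
      tau K (seg K m n s) (seg K m n t) = (t - s) * tau K m n := by
  obtain ⟨v, hv, he, hθ⟩ := h.exists_isLog hm hn
  simp only [seg_eq_line, log_eq hv hm]
  have hl := hv.sub hm (s := s) (t := t) ⟨hs, hst.le.trans ht⟩ ⟨hs.trans hst.le, ht⟩
  have hts := sub_pos.2 hst
  refine hl.fut_tau (line_mem hm hv.1 s) (mul_pos hts (tau_pos h hm hn)) ?_ ?_
  · rw [energy_smul, energy_vel hm hv.1, energy_eq_neg_tau_sq h hm hv]; ring
  · rw [theta_smul]; exact mul_pos hts (theta_vel_pos hm hv.1 he hθ s)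

lemma tau_seg_zero (hm : m ∈ points K) (hn : n ∈ points K) (h : Fut K m n) {t : ℝ} (h0 : 0 < t)
    (ht : t ≤ 1) : Fut K m (seg K m n t) ∧ tau K m (seg K m n t) = t * tau K m n := by
  have := tau_seg hm hn h le_rfl h0 ht
  rwa [seg_zero, sub_zero] at this

lemma tau_seg_one (hm : m ∈ points K) (hn : n ∈ points K) (h : Fut K m n) {t : ℝ} (h0 : 0 ≤ t)
    (ht : t < 1) : Fut K (seg K m n t) n ∧ tau K (seg K m n t) n = (1 - t) * tau K m n := by
  have := tau_seg hm hn h h0 ht le_rfl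
  rwa [seg_one (h.joined hm hn)] at this

lemma chord_seg_seg (hm : m ∈ points K) (hn : n ∈ points K) (hm' : m' ∈ points K)
    (hn' : n' ∈ points K) (hj : Joined K m n) (hc : chord K m n = chord K m' n') (s t : ℝ) :
    chord K (seg K m n s) (seg K m n t) = chord K (seg K m' n' s) (seg K m' n' t) := by
  have hj' : Joined K m' n' := (joined_iff hm' hn').2 (hc ▸ (joined_iff hm hn).1 hj)
  rw [chord_seg_self hm hj, chord_seg_self hm' hj', hj.isLog.energy_eq hm hj'.isLog hm' hc]

lemma chord_eq_iff (h : Fut K p q) (hp : p ∈ points K) (hq : q ∈ points K)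
    (h' : Fut K x' y') (hp' : x' ∈ points K) (hq' : y' ∈ points K) :
    chord K p q = chord K x' y' ↔ tau K p q = tau K x' y' := by
  refine ⟨fun he => ?_, fun he => ?_⟩
  · exact le_antisymm ((chord_le_iff h' hp' hq' h hp hq).1 he.ge)
      ((chord_le_iff h hp hq h' hp' hq').1 he.le)
  · rw [chord_eq_tm h hp hq, chord_eq_tm h' hp' hq', he]

/-- Comparison of the time separation from a point of a timelike segment to another point, given
the comparison for the endpoints of the segment. -/
lemma chord_seg_le_of_fut (hm : m ∈ points K) (hn : n ∈ points K) (hm' : m' ∈ points K)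
    (hn' : n' ∈ points K) (hb : b ∈ points K) (hb' : b' ∈ points K) (hmn : Fut K m n)
    (hc : chord K m n = chord K m' n') (ht : t ∈ Icc (0 : ℝ) 1) (h1 : Fut K m' b')
    (h2 : Fut K (seg K m' n' t) b') (h3 : Fut K (seg K m n t) b) (h4 : chord K b n ≤ chord K b' n')
    (h5 : Fut K m b → chord K b m ≤ chord K b' m') :
    chord K (seg K m n t) b ≤ chord K (seg K m' n' t) b' := by
  have hj := hmn.joined hm hn
  have hj' : Joined K m' n' := (joined_iff hm' hn').2 (hc ▸ (joined_iff hm hn).1 hj)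
  rcases ht.1.eq_or_lt with rfl | ht0
  · rw [seg_zero] at h3 ⊢
    rw [seg_zero, chord_comm, chord_comm K m']; exact h5 h3
  rcases ht.2.eq_or_lt with rfl | ht1
  · rw [seg_one hj, seg_one hj', chord_comm, chord_comm K n']; exact h4
  have hma := (tau_seg_zero hm hn hmn ht0 ht.2).1
  rw [chord_comm, chord_comm K _ b']
  -- If `m` does not precede `b` within range, then `K < 0` and some earlier point of the segment
  -- has `K` times its chord to `b` at least 2. The corresponding product on the comparison side is
  -- below 2, so the chords already compare at that point, and it replaces `m`.
  rcases Fut.trans_or_exists_left hm (seg_mem hm hj t) hb hma h3 with h | ⟨hK, s, hs, h⟩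
  · exact chord_seg_le hb hm hn hb' hm' hn' ((joined_iff hm hn).1 hj) hc (h5 h) h4 ht
  · have e := seg_seg hj hm (s := 0) (t := t) (by simp) ht s
    rw [seg_zero, sub_zero, zero_add] at e
    rw [e] at h
    have hst : s * t ∈ Icc (0 : ℝ) 1 :=
      ⟨mul_nonneg hs.1 ht.1, mul_le_one₀ hs.2 ht.1 ht.2⟩
    have hst' : s * t ≤ t := mul_le_of_le_one_left ht.1 hs.2
    have h6 := Fut.seg_left_of_mem (s := 0) hb' hm' hj' (by simp) ht (by rwa [seg_zero]) h2 hst.1 hst'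
    have hlt : chord K (seg K m n (s * t)) b ≤ chord K (seg K m' n' (s * t)) b' := by
      have := h6.2.1
      nlinarith
    have hpos : 0 < 1 - s * t := by linarith
    have e1 := seg_seg hj hm hst (t := 1) (by simp) ((t - s * t) / (1 - s * t))
    have e2 := seg_seg hj' hm' hst (t := 1) (by simp) ((t - s * t) / (1 - s * t))
    rw [div_mul_cancel₀ _ hpos.ne', add_sub_cancel, seg_one hj] at e1
    rw [div_mul_cancel₀ _ hpos.ne', add_sub_cancel, seg_one hj'] at e2
    rw [← e1, ← e2]
    have e3 := chord_seg_seg hm hn hm' hn' hj hc (s * t) 1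
    have e4 := hj.seg hm hst (t := 1) (by simp)
    rw [seg_one hj] at e3 e4
    rw [seg_one hj'] at e3
    refine chord_seg_le hb (seg_mem hm hj _) hn hb' (seg_mem hm' hj' _) hn'
      ((joined_iff (seg_mem hm hj _) hn).1 e4) e3 ?_ h4
      ⟨div_nonneg (by linarith) hpos.le, by rw [div_le_one hpos]; linarith⟩
    rwa [chord_comm, chord_comm K b']

/-- Transfer of the timelike relation between points with common timelike past. -/
lemma fut_of_chord_le (hx : x ∈ points K) (ha : a ∈ points K) (hb : b ∈ points K)
    (hx' : x' ∈ points K) (ha' : a' ∈ points K) (hb' : b' ∈ points K) (hxa : Fut K x a)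
    (hxb : Fut K x b) (hxa' : Fut K x' a') (hxb' : Fut K x' b')
    (ea : tau K x a = tau K x' a') (eb : tau K x b = tau K x' b')
    (hc : chord K a b ≤ chord K a' b') (h : Fut K a' b') :
    Fut K a b ∧ tau K a' b' ≤ tau K a b := by
  have hneg := hc.trans_lt h.1
  have hK := mul_chord_lt_of_fut hx ha hb hxa hxb hneg
  have hf : Fut K a b := by
    -- The opposite order would make the separations from `x` to `a` and `b` compare in the opposite
    -- way to those from `x'`.
    refine (fut_or_fut ha hb hneg hK).resolve_right fun hf => ?_
    have r1 := tau_add_tau_le hx hb ha hxb hf hxa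
    have r2 := tau_add_tau_le hx' ha' hb' hxa' h hxb'
    have p1 := tau_pos hf hb ha
    have p2 := tau_pos h ha' hb'
    linarith
  exact ⟨hf, (chord_le_iff hf ha hb h ha' hb').1 hc⟩

/-- The chord bound keeps `b'` timelike related to the side between `s` and a parameter at which the
direction is known. The common past `o` keeps these pairs within range. -/
lemma IsUnfolding.fut_of_fut (h : Crossing K T a b p y p₂ y₂)
    (hu : IsUnfolding K T a b p y p₂ y₂ b') (ho : o ∈ points K)
    (hq : ∀ s ∈ Icc (0 : ℝ) 1, Fut K o (seg K p y s)) (hob : Fut K o b') {s : ℝ}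
    (hs : s ∈ Icc (0 : ℝ) 1) (hf : Fut K (seg K p₂ y₂ s) b) :
    Fut K (seg K p y s) b' ∧ tau K (seg K p₂ y₂ s) b ≤ tau K (seg K p y s) b' := by
  obtain ⟨t, ht, h1, h2, h3⟩ := hu.exists_fut
  have hsub : Icc (min s t) (max s t) ⊆ Icc (0 : ℝ) 1 :=
    Icc_subset_Icc (le_min hs.1 ht.1) (max_le hs.2 ht.2)
  have hf2 : ∀ c ∈ Icc (min s t) (max s t), Fut K (seg K p₂ y₂ c) b := by
    intro c hc
    rcases le_total s t with hst | hst
    · rw [min_eq_left hst, max_eq_right hst] at hc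
      exact Fut.seg_left_of_mem h.hb h.hp₂ h.joined₂ hs ht hf h2 hc.1 hc.2
    · rw [min_eq_right hst, max_eq_left hst] at hc
      exact Fut.seg_left_of_mem h.hb h.hp₂ h.joined₂ ht hs h2 hf hc.1 hc.2
  have hle : ∀ c ∈ Icc (min s t) (max s t),
      chord K (seg K p y c) b' ≤ chord K (seg K p₂ y₂ c) b := fun c hc => by
    rw [chord_comm, chord_comm K _ b]; exact hu.chord_le c (hsub hc)
  have hneg : ∀ c ∈ Icc (min s t) (max s t), chord K (seg K p y c) b' < 0 := fun c hc =>
    (hle c hc).trans_lt (hf2 c hc).1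
  have hs' : s ∈ Icc (min s t) (max s t) := ⟨min_le_left _ _, le_max_left _ _⟩
  have hfut := Fut.of_path_left (a := min s t) (c := max s t) (s := t) (t := s) hu.mem
    (continuous_seg K p y).continuousOn (fun c _ => seg_mem h.hp h.joined c) hneg
    (fun c hc => mul_chord_lt_of_fut ho (seg_mem h.hp h.joined c) hu.mem (hq c (hsub hc)) hob
      (hneg c hc)) ⟨min_le_right _ _, le_max_right _ _⟩ hs' h3
  exact ⟨hfut, (chord_le_iff hfut (seg_mem h.hp h.joined s) hu.mem hf (seg_mem h.hp₂ h.joined₂ s)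
    h.hb).1 (hle s hs')⟩

/-- Equality forces equality in reverse Cauchy-Schwarz at `p`, so the incoming and the outgoing
velocity are proportional and the two geodesics join smoothly. -/
lemma eq_seg_of_tau_eq (hx : x ∈ points K) (hp : p ∈ points K) (hz : z ∈ points K)
    (h1 : Fut K x p) (h2 : Fut K p z) (h3 : Fut K x z)
    (h : tau K x z = tau K x p + tau K p z) : p = seg K x z (tau K x p / tau K x z) := by
  obtain ⟨u, hu, heu, hθu⟩ := h1.exists_isLog hx hp
  obtain ⟨w, hw, hew, hθw⟩ := h2.exists_isLog hp hz
  have p1 := tau_pos h1 hx hp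
  have p2 := tau_pos h2 hp hz
  have e1 := energy_eq_neg_tau_sq h1 hx hu
  have e2 := energy_eq_neg_tau_sq h2 hp hw
  have s1 := tau_mul_sn h1 hx hu
  have s2 := tau_mul_sn h2 hp hw
  have c1 := chord_line hx hp hw.1 1
  have c2 := hw.chord_eq hp
  have c3 := tm_add K (tau K x p) (tau K p z)
  have f1 := form_sub_eq hu hx hw.1
  have q1 := sn_tau_pos h1 hx hp
  have q2 := sn_tau_pos h2 hp hz
  have q3 := hw.sn_pos one_pos le_rfl
  have q4 := hu.sn_pos one_pos le_rfl
  rw [hw.line_one, cs_eq, mul_assoc K, ← c2, chord_eq_tm h3 hx hz, h, c3, ← chord_eq_tm h1 hx hp,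
    ← chord_eq_tm h2 hp hz, f1, ← s1, ← s2] at c1
  set l₁ := tau K x p
  set μ := tau K p z
  have hform : form K (vel K x u 1) w = -(l₁ * μ) := by
    have h0 : sn (K * energy K w) 1 * sn (K * energy K u) 1 ≠ 0 := by positivity
    apply mul_left_cancel₀ h0
    linarith
  have ht := vel_tangent hx hu.1 1
  have hE := energy_vel hx hu.1 1
  rw [hu.line_one] at ht
  have heq : μ • vel K x u 1 = l₁ • w := by
    refine eq_of_form_eq hp (ht.smul μ) (hw.1.smul l₁) ?_ ?_ ?_
    · rw [energy_smul, hE]; exact mul_neg_of_pos_of_neg (by positivity) heu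
    · rw [energy_smul, energy_smul, hE, e1, e2]; ring
    · rw [energy_smul, form_smul_left, form_smul_right, hform, hE, e1]; ring
  have hw' : w = (μ / l₁) • vel K x u 1 := by
    rw [div_eq_inv_mul, mul_smul, heq, smul_smul, inv_mul_cancel₀ p1.ne', one_smul]
  have hl : IsLog K x z ((1 + μ / l₁) • u) := by
    refine ⟨hu.1.smul _, ?_, ?_⟩
    · have := tau_lt h3 hx hz
      rw [h] at this
      rw [energy_smul, e1]
      convert this using 1
      field_simp
    · have hz' := hw.line_one
      rw [hw', line_smul, mul_one] at hz'
      have := line_line hx hu.1 1 (μ / l₁)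
      rw [hu.line_one, hz'] at this
      rw [exp_smul, this]
  rw [seg_eq_line, log_eq hl hx, line_smul, h,
    show (1 + μ / l₁) * (l₁ / (l₁ + μ)) = 1 by field_simp, hu.line_one]

/-! ### Glued comparison triangles -/

/-- The comparison triangles of two triangles that are glued along a common side, and the comparison
triangle of the glued triangle. -/
structure Glued (K : ℝ) (x p y p₂ y₂ z x' y' z' : ℝ × ℝ × ℝ) (c : ℝ) : Prop where
  hx : x ∈ points K
  hp : p ∈ points K
  hy : y ∈ points K
  hp₂ : p₂ ∈ points K
  hy₂ : y₂ ∈ points K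
  hz : z ∈ points K
  hx' : x' ∈ points K
  hy' : y' ∈ points K
  hz' : z' ∈ points K
  hc : c ∈ Ioo (0 : ℝ) 1
  xp : Fut K x p
  xy : Fut K x y
  pz : Fut K p₂ z
  yz : Fut K y₂ z
  xy' : Fut K x' y'
  yz' : Fut K y' z'
  xz' : Fut K x' z'
  exy : chord K x y = chord K x' y'
  eyz : chord K y₂ z = chord K y' z'
  exp : chord K x p = chord K x' (seg K x' z' c)
  epz : chord K p₂ z = chord K (seg K x' z' c) z'
  epy : chord K p y = chord K p₂ y₂
  jpy : K * chord K p y < 2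
  opy : Fut K p y ↔ Fut K p₂ y₂
  oyp : Fut K y p ↔ Fut K y₂ p₂
  le : ∀ s ∈ Icc (0 : ℝ) 1, tau K x (seg K p y s) + tau K (seg K p₂ y₂ s) z ≤ tau K x' z'

namespace Glued

/-- Time reversal exchanges the two small triangles, so comparisons for one of them, and for
crossings based at `x`, have reversed versions. -/
lemma symm (h : Glued K x p y p₂ y₂ z x' y' z' c) :
    Glued K (rev z) (rev p₂) (rev y₂) (rev p) (rev y) (rev x) (rev z') (rev y') (rev x')
      (1 - c) where
  hx := rev_mem h.hz
  hp := rev_mem h.hp₂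
  hy := rev_mem h.hy₂
  hp₂ := rev_mem h.hp
  hy₂ := rev_mem h.hy
  hz := rev_mem h.hx
  hx' := rev_mem h.hz'
  hy' := rev_mem h.hy'
  hz' := rev_mem h.hx'
  hc := ⟨by linarith [h.hc.2], by linarith [h.hc.1]⟩
  xp := fut_rev.2 h.pz
  xy := fut_rev.2 h.yz
  pz := fut_rev.2 h.xp
  yz := fut_rev.2 h.xy
  xy' := fut_rev.2 h.yz'
  yz' := fut_rev.2 h.xy'
  xz' := fut_rev.2 h.xz'
  exy := by rw [chord_rev, chord_rev, chord_comm, h.eyz, chord_comm]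
  eyz := by rw [chord_rev, chord_rev, chord_comm, h.exy, chord_comm]
  exp := by
    have hj := h.xz'.joined h.hx' h.hz'
    rw [seg_rev h.hz' (hj.symm h.hx' h.hz'), chord_rev, chord_rev, seg_comm h.hx' h.hz' hj,
      sub_sub_cancel, chord_comm, h.epz, chord_comm]
  epz := by
    have hj := h.xz'.joined h.hx' h.hz'
    rw [seg_rev h.hz' (hj.symm h.hx' h.hz'), chord_rev, chord_rev, seg_comm h.hx' h.hz' hj,
      sub_sub_cancel, chord_comm, h.exp, chord_comm]
  epy := by rw [chord_rev, chord_rev, h.epy]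
  jpy := by rw [chord_rev, ← h.epy]; exact h.jpy
  opy := by rw [fut_rev, fut_rev]; exact h.oyp.symm
  oyp := by rw [fut_rev, fut_rev]; exact h.opy.symm
  le := fun s hs => by
    have hj : Joined K p y := (joined_iff h.hp h.hy).2 h.jpy
    have hj₂ : Joined K p₂ y₂ := (joined_iff h.hp₂ h.hy₂).2 (h.epy ▸ h.jpy)
    rw [seg_rev h.hp₂ hj₂, seg_rev h.hp hj, tau_rev (seg_mem h.hp₂ hj₂ s) h.hz,
      tau_rev h.hx (seg_mem h.hp hj s), tau_rev h.hx' h.hz', add_comm]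
    exact h.le s hs

variable (h : Glued K x p y p₂ y₂ z x' y' z' c)
include h

lemma jp : Joined K p y := (joined_iff h.hp h.hy).2 h.jpy

lemma jp₂ : Joined K p₂ y₂ := (joined_iff h.hp₂ h.hy₂).2 (h.epy ▸ h.jpy)

lemma jxz' : Joined K x' z' := h.xz'.joined h.hx' h.hz'

lemma hp' : seg K x' z' c ∈ points K := seg_mem h.hx' h.jxz' c

lemma xp' : Fut K x' (seg K x' z' c) := (tau_seg_zero h.hx' h.hz' h.xz' h.hc.1 h.hc.2.le).1

lemma pz' : Fut K (seg K x' z' c) z' := (tau_seg_one h.hx' h.hz' h.xz' h.hc.1.le h.hc.2).1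

lemma tau_xp : tau K x p = tau K x' (seg K x' z' c) :=
  (chord_eq_iff h.xp h.hx h.hp h.xp' h.hx' h.hp').1 h.exp

lemma tau_pz : tau K p₂ z = tau K (seg K x' z' c) z' :=
  (chord_eq_iff h.pz h.hp₂ h.hz h.pz' h.hp' h.hz').1 h.epz

lemma tau_xp_eq : tau K x p = c * tau K x' z' := by
  rw [h.tau_xp, (tau_seg_zero h.hx' h.hz' h.xz' h.hc.1 h.hc.2.le).2]

lemma tau_pz_eq : tau K p₂ z = (1 - c) * tau K x' z' := by
  rw [h.tau_pz, (tau_seg_one h.hx' h.hz' h.xz' h.hc.1.le h.hc.2).2]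

lemma fut_x {s : ℝ} (hs : s ∈ Icc (0 : ℝ) 1) : Fut K x (seg K p y s) :=
  Fut.seg_right h.hx h.hp h.hy h.jp h.xp h.xy hs

lemma fut_z {s : ℝ} (hs : s ∈ Icc (0 : ℝ) 1) : Fut K (seg K p₂ y₂ s) z :=
  Fut.seg_left h.hz h.hp₂ h.hy₂ h.jp₂ h.pz h.yz hs

lemma crossing (ha : a ∈ points K) (hb : b ∈ points K) (hT : -K * T ^ 2 < Real.pi ^ 2)
    (hbound : ∀ s ∈ crossSet K a b p y p₂ y₂,
      tau K a (seg K p y s) + tau K (seg K p₂ y₂ s) b ≤ T) :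
    Crossing K T a b p y p₂ y₂ where
  ha := ha
  hb := hb
  hp := h.hp
  hy := h.hy
  hp₂ := h.hp₂
  hy₂ := h.hy₂
  hj := h.jpy
  hc := h.epy
  hf := h.opy
  hf' := h.oyp
  hT := hT
  bound := fun s hs h1 h2 => hbound s ⟨hs, h1, h2⟩

/-- The comparison of the common side with the corresponding chord of the glued triangle. -/
theorem chord_le : chord K p y ≤ chord K (seg K x' z' c) y' := by
  have hc := h.crossing h.hx h.hz (T := tau K x' z') (tau_lt h.xz' h.hx' h.hz')
    fun s hs => h.le s hs.1
  -- The vertex `z` is brought into the plane of the first triangle, at time at most that between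
  -- `x'` and `z'`.
  obtain ⟨z₁, hu⟩ := hc.exists_unfolding
    ⟨0, by simp, h.fut_x (by simp), h.fut_z (by simp)⟩
  have h1 := hu.fut_of_fut hc h.hx (fun s hs => h.fut_x hs) hu.fut (s := 0) (by simp)
    (h.fut_z (by simp))
  rw [seg_zero, seg_zero] at h1
  have r1 := tau_add_tau_le h.hx h.hp hu.mem h.xp h1.1 hu.fut
  have r2 := h1.2
  have r3 := hu.le
  have e1 := h.tau_xp_eq
  have e2 := h.tau_pz_eq
  -- The path from `x` through `p` to `z₁` already takes this time, so `p` must lie on the straight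
  -- segment.
  have e3 : tau K x z₁ = tau K x' z' := by linarith
  have hpos := tau_pos h.xz' h.hx' h.hz'
  have hseg := eq_seg_of_tau_eq h.hx h.hp hu.mem h.xp h1.1 hu.fut (by linarith)
  rw [e3, e1, mul_div_cancel_right₀ _ hpos.ne'] at hseg
  have hzy := hu.chord_le 1 (by simp)
  rw [seg_one h.jp, seg_one h.jp₂] at hzy
  have key := chord_seg_le h.hy h.hx hu.mem h.hy' h.hx' h.hz' hu.fut.2.1
    ((chord_eq_iff hu.fut h.hx hu.mem h.xz' h.hx' h.hz').2 e3)
    (by rw [chord_comm, h.exy, chord_comm])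
    (by rw [chord_comm, chord_comm K y', chord_comm K z', ← h.eyz, chord_comm K y₂]; exact hzy)
    (s := c) ⟨h.hc.1.le, h.hc.2.le⟩
  rw [← hseg] at key
  rw [chord_comm, chord_comm K _ y']
  exact key

/-- Comparison inside the first triangle. -/
lemma chord_seg_seg_le {s t : ℝ} (hs : s ∈ Icc (0 : ℝ) 1) (ht : t ∈ Icc (0 : ℝ) 1) :
    chord K (seg K x y t) (seg K x p s) ≤
      chord K (seg K x' y' t) (seg K x' (seg K x' z' c) s) := by
  have jxy := h.xy.joined h.hx h.hy
  have jxy' := h.xy'.joined h.hx' h.hy'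
  refine chord_seg_le (seg_mem h.hx jxy t) h.hx h.hp (seg_mem h.hx' jxy' t) h.hx' h.hp' h.xp.2.1
    h.exp ?_ ?_ hs
  · have := chord_seg_seg h.hx h.hy h.hx' h.hy' jxy h.exy t 0
    rw [seg_zero, seg_zero] at this
    exact this.le
  · rw [chord_comm, chord_comm K _ (seg K x' z' c)]
    exact chord_seg_le h.hp h.hx h.hy h.hp' h.hx' h.hy' h.xy.2.1 h.exy
      (by rw [chord_comm, h.exp, chord_comm]) h.chord_le ht

lemma fut_xy_xp {s t : ℝ} (hs : s ∈ Icc (0 : ℝ) 1) (ht : t ∈ Icc (0 : ℝ) 1)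
    (hf : Fut K (seg K x' y' t) (seg K x' (seg K x' z' c) s)) :
    Fut K (seg K x y t) (seg K x p s) ∧
      tau K (seg K x' y' t) (seg K x' (seg K x' z' c) s) ≤ tau K (seg K x y t) (seg K x p s) := by
  have hs0 : 0 < s := by
    rcases hs.1.eq_or_lt with rfl | hs0
    · rw [seg_zero] at hf
      rcases ht.1.eq_or_lt with rfl | ht0
      · rw [seg_zero] at hf; exact absurd hf.1 (by simp)
      · exact absurd (tau_seg_zero h.hx' h.hy' h.xy' ht0 ht.2).1 hf.not_fut
    · exact hs0
  have t1 := tau_seg_zero h.hx h.hp h.xp hs0 hs.2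
  have t1' := tau_seg_zero h.hx' h.hp' h.xp' hs0 hs.2
  rcases ht.1.eq_or_lt with rfl | ht0
  · rw [seg_zero, seg_zero, t1.2, t1'.2, h.tau_xp]
    exact ⟨t1.1, le_rfl⟩
  have t2 := tau_seg_zero h.hx h.hy h.xy ht0 ht.2
  have t2' := tau_seg_zero h.hx' h.hy' h.xy' ht0 ht.2
  have exy := (chord_eq_iff h.xy h.hx h.hy h.xy' h.hx' h.hy').1 h.exy
  exact fut_of_chord_le h.hx (seg_mem h.hx (h.xy.joined h.hx h.hy) t)
    (seg_mem h.hx (h.xp.joined h.hx h.hp) s) h.hx' (seg_mem h.hx' (h.xy'.joined h.hx' h.hy') t)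
    (seg_mem h.hx' (h.xp'.joined h.hx' h.hp') s) t2.1 t1.1 t2'.1 t1'.1
    (by rw [t2.2, t2'.2, exy]) (by rw [t1.2, t1'.2, h.tau_xp]) (h.chord_seg_seg_le hs ht) hf

lemma fut_xp_xy {s t : ℝ} (hs : s ∈ Icc (0 : ℝ) 1) (ht : t ∈ Icc (0 : ℝ) 1)
    (hf : Fut K (seg K x' (seg K x' z' c) s) (seg K x' y' t)) :
    Fut K (seg K x p s) (seg K x y t) ∧
      tau K (seg K x' (seg K x' z' c) s) (seg K x' y' t) ≤ tau K (seg K x p s) (seg K x y t) := by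
  have ht0 : 0 < t := by
    rcases ht.1.eq_or_lt with rfl | ht0
    · rw [seg_zero] at hf
      rcases hs.1.eq_or_lt with rfl | hs0
      · rw [seg_zero] at hf; exact absurd hf.1 (by simp)
      · exact absurd (tau_seg_zero h.hx' h.hp' h.xp' hs0 hs.2).1 hf.not_fut
    · exact ht0
  have exy := (chord_eq_iff h.xy h.hx h.hy h.xy' h.hx' h.hy').1 h.exy
  have t2 := tau_seg_zero h.hx h.hy h.xy ht0 ht.2
  have t2' := tau_seg_zero h.hx' h.hy' h.xy' ht0 ht.2
  rcases hs.1.eq_or_lt with rfl | hs0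
  · rw [seg_zero, seg_zero, t2.2, t2'.2, exy]
    exact ⟨t2.1, le_rfl⟩
  have t1 := tau_seg_zero h.hx h.hp h.xp hs0 hs.2
  have t1' := tau_seg_zero h.hx' h.hp' h.xp' hs0 hs.2
  refine fut_of_chord_le h.hx (seg_mem h.hx (h.xp.joined h.hx h.hp) s)
    (seg_mem h.hx (h.xy.joined h.hx h.hy) t) h.hx' (seg_mem h.hx' (h.xp'.joined h.hx' h.hp') s)
    (seg_mem h.hx' (h.xy'.joined h.hx' h.hy') t) t1.1 t2.1 t1'.1 t2'.1
    (by rw [t1.2, t1'.2, h.tau_xp]) (by rw [t2.2, t2'.2, exy]) ?_ hf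
  rw [chord_comm, chord_comm K _ (seg K x' y' t)]
  exact h.chord_seg_seg_le hs ht

end Glued

end LorentzModel

/-! ### Crossing from the first triangle to the second -/

namespace LorentzModel

variable {K T c t δ : ℝ} {m n m' n' p q r v w u x y z b o a p₂ y₂ b' x' y' z' a' : ℝ × ℝ × ℝ}

/-- The supremum of the lengths of the broken geodesics from `a` to `b` is at least `T`. -/
def CrossLE (K T : ℝ) (a b p y p₂ y₂ : ℝ × ℝ × ℝ) : Prop :=
  ∀ T' < T, ∃ s ∈ crossSet K a b p y p₂ y₂,
    T' ≤ tau K a (seg K p y s) + tau K (seg K p₂ y₂ s) b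

/-- A chord that vanishes on an interval has zero slope and its geodesic has zero energy, so by the
cosine law it also vanishes at parameter 1. In `crossSet_nonempty` this rules out a first leg that
stays null. -/
lemma chord_seg_eq_zero_aux (ha : a ∈ points K) (hp : p ∈ points K) (hj : Joined K p y)
    {s t : ℝ} (hs : 0 ≤ s) (hst : s < t) (ht : t < 1)
    (hz : ∀ c, s ≤ c → c ≤ t → chord K a (seg K p y c) = 0) : chord K a (seg K p y 1) = 0 := by
  have e1 := chord_seg_sub ha hp hj s t
  rw [hz s le_rfl hst.le, hz t hst.le le_rfl] at e1
  have p1 := hj.isLog.sn_pos (s := (t - s) / 2) (by linarith) (by linarith)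
  have hsl : slope K a p y ((s + t) / 2) = 0 := by
    have : 2 * sn (K * energy K (log K p y)) ((t - s) / 2) ≠ 0 := by positivity
    exact (mul_eq_zero.1 (by linarith)).resolve_left this
  have e2 := chord_seg_add ha hp hj ((s + t) / 2) t
  have e3 := chord_seg_add ha hp hj ((s + t) / 2) 1
  have hm := hz ((s + t) / 2) (by linarith) (by linarith)
  rw [hz t hst.le le_rfl, hm, hsl] at e2
  rw [hm, hsl] at e3
  have p2 : 0 < ve (K * energy K (log K p y)) (t - (s + t) / 2) := by
    refine ve_pos (by linarith) (mul_sq_lt (t := 1) (by positivity) (by simpa using hj.isLog.2.1) ?_)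
    rw [abs_one, abs_le]; constructor <;> linarith
  have he : energy K (log K p y) = 0 :=
    (mul_eq_zero.1 (by linarith)).resolve_right p2.ne'
  rw [e3, he]; ring

lemma tendsto_chord {ι : Type*} {l : Filter ι} {f g : ι → ℝ × ℝ × ℝ} (hf : Tendsto f l (𝓝 a))
    (hg : Tendsto g l (𝓝 b)) : Tendsto (fun i => chord K (f i) (g i)) l (𝓝 (chord K a b)) := by
  have h := (continuous_chord_uncurry K).tendsto (a, b)
  exact Tendsto.comp (f := fun i => (f i, g i)) h (hf.prodMk_nhds hg)

lemma tendsto_theta {ι : Type*} {l : Filter ι} {f g : ι → ℝ × ℝ × ℝ} (hf : Tendsto f l (𝓝 a))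
    (hg : Tendsto g l (𝓝 b)) :
    Tendsto (fun i => theta K (f i) (g i - f i)) l (𝓝 (theta K a (b - a))) := by
  have h := (continuous_theta_uncurry K).tendsto (a, b)
  exact Tendsto.comp (f := fun i => (f i, g i)) h (hf.prodMk_nhds hg)

/-- The possibility to cross persists along a path of initial points. -/
lemma crossSet_nonempty {A : ℝ → ℝ × ℝ × ℝ} {t₀ : ℝ} (hA : Continuous A) (ht₀ : 0 ≤ t₀)
    (hAm : ∀ t ∈ Icc 0 t₀, A t ∈ points K) (hp : p ∈ points K) (hj : Joined K p y)
    (hp₂ : p₂ ∈ points K) (hj₂ : Joined K p₂ y₂) (hb : b ∈ points K)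
    (h0 : (crossSet K (A 0) b p y p₂ y₂).Nonempty) (hδ : 0 < δ) (hδ' : -K * δ ^ 2 < Real.pi ^ 2)
    (hprop : ∀ t ∈ Icc 0 t₀, (crossSet K (A t) b p y p₂ y₂).Nonempty →
      ∃ s ∈ crossSet K (A t) b p y p₂ y₂,
        δ ≤ tau K (A t) (seg K p y s) + tau K (seg K p₂ y₂ s) b)
    (hr1 : ∀ t ∈ Icc 0 t₀, ∀ s ∈ Icc (0 : ℝ) 1, chord K (A t) (seg K p y s) < 0 →
      K * chord K (A t) (seg K p y s) < 2)
    (hr2 : ∀ s ∈ Icc (0 : ℝ) 1, chord K (seg K p₂ y₂ s) b < 0 →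
      K * chord K (seg K p₂ y₂ s) b < 2)
    (hend : ∀ t ∈ Icc 0 t₀, Fut K (A t) y) : (crossSet K (A t₀) b p y p₂ y₂).Nonempty := by
  set S : Set ℝ := {t | (crossSet K (A t) b p y p₂ y₂).Nonempty} with hS
  have hq := continuous_seg K p y
  have hq₂ := continuous_seg K p₂ y₂
  -- The limit of crossings can fail to be a crossing only if a leg becomes null. The uniform bound
  -- `δ` prevents both legs from doing so.
  have hclosed : IsClosed (S ∩ Icc 0 t₀) := by
    refine IsSeqClosed.isClosed fun t t₁ htn hlim => ?_
    have ht₁ : t₁ ∈ Icc 0 t₀ := isClosed_Icc.mem_of_tendsto hlim (Eventually.of_forall fun n => (htn n).2)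
    refine ⟨?_, ht₁⟩
    choose s hs hsδ using fun n => hprop (t n) (htn n).2 (htn n).1
    obtain ⟨s₁, hs₁, φ, hφ, hslim⟩ := isCompact_Icc.tendsto_subseq fun n => (hs n).1
    have hlim' : Tendsto (fun n => t (φ n)) atTop (𝓝 t₁) := hlim.comp hφ.tendsto_atTop
    have hAlim : Tendsto (fun n => A (t (φ n))) atTop (𝓝 (A t₁)) := (hA.tendsto t₁).comp hlim'
    have hqlim : Tendsto (fun n => seg K p y (s (φ n))) atTop (𝓝 (seg K p y s₁)) :=
      (hq.tendsto s₁).comp hslim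
    have hqlim₂ : Tendsto (fun n => seg K p₂ y₂ (s (φ n))) atTop (𝓝 (seg K p₂ y₂ s₁)) :=
      (hq₂.tendsto s₁).comp hslim
    have c1 : Tendsto (fun n => chord K (A (t (φ n))) (seg K p y (s (φ n)))) atTop
        (𝓝 (chord K (A t₁) (seg K p y s₁))) :=
      tendsto_chord hAlim hqlim
    have c2 : Tendsto (fun n => chord K (seg K p₂ y₂ (s (φ n))) b) atTop
        (𝓝 (chord K (seg K p₂ y₂ s₁) b)) :=
      tendsto_chord hqlim₂ tendsto_const_nhds
    have d1 : Tendsto (fun n => theta K (A (t (φ n))) (seg K p y (s (φ n)) - A (t (φ n)))) atTop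
        (𝓝 (theta K (A t₁) (seg K p y s₁ - A t₁))) :=
      tendsto_theta hAlim hqlim
    have d2 : Tendsto (fun n => theta K (seg K p₂ y₂ (s (φ n))) (b - seg K p₂ y₂ (s (φ n)))) atTop
        (𝓝 (theta K (seg K p₂ y₂ s₁) (b - seg K p₂ y₂ s₁))) :=
      tendsto_theta hqlim₂ tendsto_const_nhds
    have mq := fun s => seg_mem hp hj s
    have mq₂ := fun s => seg_mem hp₂ hj₂ s
    have hhalf : tm K (δ / 2) < 0 := tm_neg_of_pos (by linarith)
      (mul_sq_lt (by positivity) hδ' (by rw [abs_of_pos hδ, abs_of_pos (by linarith)]; linarith))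
    -- At every stage one of the two legs has length at least `δ / 2`.
    have hmin : min (chord K (A t₁) (seg K p y s₁)) (chord K (seg K p₂ y₂ s₁) b) ≤
        tm K (δ / 2) := by
      refine le_of_tendsto (c1.min c2) (Eventually.of_forall fun n => ?_)
      have hJ := hs (φ n)
      have hd := hsδ (φ n)
      have hm := hAm _ (htn (φ n)).2
      rcases le_total (δ / 2) (tau K (A (t (φ n))) (seg K p y (s (φ n)))) with hle | hle
      · refine (min_le_left _ _).trans ?_
        rw [chord_eq_tm hJ.2.1 hm (mq _)]
        exact tm_le_tm (by linarith) hle (tau_lt hJ.2.1 hm (mq _))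
      · refine (min_le_right _ _).trans ?_
        rw [chord_eq_tm hJ.2.2 (mq₂ _) hb]
        exact tm_le_tm (by linarith) (by linarith) (tau_lt hJ.2.2 (mq₂ _) hb)
    have e1 : chord K (A t₁) (seg K p y s₁) ≤ 0 :=
      le_of_tendsto c1 (Eventually.of_forall fun n => (hs (φ n)).2.1.1.le)
    have e2 : 0 ≤ theta K (A t₁) (seg K p y s₁ - A t₁) :=
      ge_of_tendsto d1 (Eventually.of_forall fun n => (hs (φ n)).2.1.2.2.le)
    have e3 : 0 ≤ theta K (seg K p₂ y₂ s₁) (b - seg K p₂ y₂ s₁) :=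
      ge_of_tendsto d2 (Eventually.of_forall fun n => (hs (φ n)).2.2.2.2.le)
    rcases e1.lt_or_eq with hlt | heq
    · have hf := Fut.of_nonneg (hAm _ ht₁) (mq _) hlt (hr1 _ ht₁ _ hs₁ hlt) e2
      have hev : ∀ᶠ n in atTop, Fut K (A t₁) (seg K p y (s (φ n))) :=
        (tendsto_const_nhds.prodMk_nhds hqlim).eventually ((isOpen_fut K).mem_nhds hf)
      obtain ⟨n, hn⟩ := hev.exists
      exact ⟨s (φ n), (hs (φ n)).1, hn, (hs (φ n)).2.2⟩
    -- The first leg is null in the limit and the second is timelike. Moving the crossing parameter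
    -- slightly towards `y`, which lies in the future of `A t₁`, makes the first leg timelike
    -- without losing the second.
    · have hlt : chord K (seg K p₂ y₂ s₁) b < 0 := by
        rw [heq] at hmin
        rcases min_le_iff.1 hmin with h | h
        · linarith
        · linarith
      have hf := Fut.of_nonneg (mq₂ _) hb hlt (hr2 _ hs₁ hlt) e3
      have hev : ∀ᶠ c in 𝓝 s₁, Fut K (seg K p₂ y₂ c) b :=
        (hq₂.prodMk continuous_const).continuousAt.eventually ((isOpen_fut K).mem_nhds hf)
      have hy := (hend t₁ ht₁).1
      have hs₁1 : s₁ < 1 := by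
        refine lt_of_le_of_ne hs₁.2 fun h => ?_
        rw [h, seg_one hj] at heq
        linarith
      have hfn : ∀ c, s₁ < c → c < 1 → ∀ᶠ n in atTop, Fut K (A (t (φ n))) (seg K p y c) := by
        intro c hc hc1
        filter_upwards [hslim.eventually_lt_const hc] with n hn
        refine Fut.seg_right_of_mem (hAm _ (htn (φ n)).2) hp hj (hs (φ n)).1 (t := 1) (by simp)
          (hs (φ n)).2.1 ?_ hn.le hc1.le
        rw [seg_one hj]; exact hend _ (htn (φ n)).2
      have hle : ∀ c, s₁ < c → c < 1 → chord K (A t₁) (seg K p y c) ≤ 0 ∧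
          0 ≤ theta K (A t₁) (seg K p y c - A t₁) := by
        intro c hc hc1
        have k1 : Tendsto (fun n => chord K (A (t (φ n))) (seg K p y c)) atTop
            (𝓝 (chord K (A t₁) (seg K p y c))) :=
          tendsto_chord hAlim tendsto_const_nhds
        have k2 : Tendsto (fun n => theta K (A (t (φ n))) (seg K p y c - A (t (φ n)))) atTop
            (𝓝 (theta K (A t₁) (seg K p y c - A t₁))) :=
          tendsto_theta hAlim tendsto_const_nhds
        exact ⟨le_of_tendsto k1 ((hfn c hc hc1).mono fun n hn => hn.1.le),
          ge_of_tendsto k2 ((hfn c hc hc1).mono fun n hn => hn.2.2.le)⟩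
      have hex : ∃ᶠ c in 𝓝[>] s₁, chord K (A t₁) (seg K p y c) < 0 := by
        intro hcon
        obtain ⟨d, hd, hd'⟩ := (mem_nhdsGT_iff_exists_Ioc_subset (a := s₁)).1
          (hcon.and (Ioo_mem_nhdsGT hs₁1))
        have hd0 : s₁ < d := hd
        have hd1 : d < 1 := (hd' ⟨hd0, le_rfl⟩).2.2
        have := chord_seg_eq_zero_aux (hAm _ ht₁) hp hj hs₁.1 hd0 hd1 fun c hc hcd => by
          rcases hc.eq_or_lt with rfl | hc
          · exact heq
          · exact (hle c hc (hcd.trans_lt hd1)).1.antisymm (not_lt.1 (hd' ⟨hc, hcd⟩).1)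
        rw [seg_one hj] at this
        linarith
      have hev' : ∀ᶠ c in 𝓝[>] s₁, Fut K (seg K p₂ y₂ c) b := mem_nhdsWithin_of_mem_nhds hev
      obtain ⟨c, hc1, hc2, hc3⟩ := (hex.and_eventually (hev'.and (Ioo_mem_nhdsGT hs₁1))).exists
      have hcI : c ∈ Icc (0 : ℝ) 1 := ⟨hs₁.1.trans hc3.1.le, hc3.2.le⟩
      exact ⟨c, hcI, Fut.of_nonneg (hAm _ ht₁) (mq _) hc1 (hr1 _ ht₁ _ hcI hc1)
        (hle c hc3.1 hc3.2).2, hc2⟩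
  suffices t₀ ∈ S from this
  -- Openness: for a fixed crossing parameter the first leg remains timelike for nearby initial
  -- points.
  refine IsClosed.mem_of_ge_of_forall_exists_gt hclosed h0 ht₀ ?_
  rintro t ⟨⟨s, hs⟩, ht⟩
  have hev : ∀ᶠ c in 𝓝 t, Fut K (A c) (seg K p y s) :=
    (hA.prodMk continuous_const).continuousAt.eventually ((isOpen_fut K).mem_nhds hs.2.1)
  have hev' : ∀ᶠ c in 𝓝[>] t, Fut K (A c) (seg K p y s) := mem_nhdsWithin_of_mem_nhds hev
  obtain ⟨c, hc1, hc2⟩ := (hev'.and (Ioc_mem_nhdsGT ht.2)).exists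
  exact ⟨c, ⟨s, hs.1, hc1, hs.2.2⟩, hc2⟩

lemma crossSet_rev (hp : p ∈ points K) (hj : Joined K p y) (hp₂ : p₂ ∈ points K)
    (hj₂ : Joined K p₂ y₂) :
    crossSet K (rev b) (rev a) (rev p₂) (rev y₂) (rev p) (rev y) = crossSet K a b p y p₂ y₂ := by
  ext s
  simp only [crossSet, mem_ofPred_eq, seg_rev hp hj, seg_rev hp₂ hj₂, fut_rev]
  tauto

lemma CrossLE.of_rev (ha : a ∈ points K) (hb : b ∈ points K) (hp : p ∈ points K)
    (hj : Joined K p y) (hp₂ : p₂ ∈ points K) (hj₂ : Joined K p₂ y₂)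
    (h : CrossLE K T (rev b) (rev a) (rev p₂) (rev y₂) (rev p) (rev y)) :
    CrossLE K T a b p y p₂ y₂ := by
  intro T' hT'
  obtain ⟨s, hs, hle⟩ := h T' hT'
  rw [crossSet_rev hp hj hp₂ hj₂] at hs
  rw [seg_rev hp hj, seg_rev hp₂ hj₂, tau_rev (seg_mem hp₂ hj₂ s) hb,
    tau_rev ha (seg_mem hp hj s), add_comm] at hle
  exact ⟨s, hs, hle⟩

namespace Glued

variable (h : Glued K x p y p₂ y₂ z x' y' z' c)
include h

lemma crossing_swap (ha : a ∈ points K) (hb : b ∈ points K) (hT : -K * T ^ 2 < Real.pi ^ 2)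
    (hbound : ∀ s ∈ crossSet K a b p₂ y₂ p y,
      tau K a (seg K p₂ y₂ s) + tau K (seg K p y s) b ≤ T) :
    Crossing K T a b p₂ y₂ p y where
  ha := ha
  hb := hb
  hp := h.hp₂
  hy := h.hy₂
  hp₂ := h.hp
  hy₂ := h.hy
  hj := h.epy ▸ h.jpy
  hc := h.epy.symm
  hf := h.opy.symm
  hf' := h.oyp.symm
  hT := hT
  bound := fun s hs h1 h2 => hbound s ⟨hs, h1, h2⟩

/-- If the supremum were smaller, an unfolding would give `b₁` at time at most `T` from the point
`a` of the side. But `b₁` is at least as far in time from `x` as `b'` is from `x'`, by the assumed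
crossings from `x`, and its chord to `y` is controlled by the unfolding; comparison along the side
then puts `b₁` too far from `a`. -/
lemma crossLE_of_vertex (ht : t ∈ Ico (0 : ℝ) 1) (hb : b ∈ points K) (hb' : b' ∈ points K)
    (hab : Fut K (seg K x' y' t) b') (hxb : Fut K x' b') (hyb : chord K b y₂ ≤ chord K b' y')
    (hx : ∀ T < tau K x' b', ∃ s ∈ Icc (0 : ℝ) 1, Fut K (seg K p₂ y₂ s) b ∧
      T ≤ tau K x (seg K p y s) + tau K (seg K p₂ y₂ s) b)
    (hne : (crossSet K (seg K x y t) b p y p₂ y₂).Nonempty) :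
    CrossLE K (tau K (seg K x' y' t) b') (seg K x y t) b p y p₂ y₂ := by
  intro T hT
  have jxy := h.xy.joined h.hx h.hy
  have jxy' := h.xy'.joined h.hx' h.hy'
  rcases le_or_gt T 0 with hT0 | hT0
  · obtain ⟨s, hs⟩ := hne
    exact ⟨s, hs, hT0.trans (add_nonneg (tau_nonneg _ _ _) (tau_nonneg _ _ _))⟩
  by_contra hcon
  push Not at hcon
  have ha := seg_mem h.hx jxy t
  have ha' := seg_mem h.hx' jxy' t
  have hC := h.crossing ha hb (T := T) (mul_sq_lt (by positivity) (tau_lt hab ha' hb')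
    (by rw [abs_of_pos hT0, abs_of_pos (hT0.trans hT)]; exact hT.le)) fun s hs => (hcon s hs).le
  obtain ⟨b₁, hu⟩ := hC.exists_unfolding hne
  have key := chord_seg_le_of_fut h.hx h.hy h.hx' h.hy' hu.mem hb' h.xy h.exy ⟨ht.1, ht.2.le⟩ hxb
    hab hu.fut ?_ fun hf => ?_
  · have := (chord_le_iff hu.fut ha hu.mem hab ha' hb').1 key
    linarith [hu.le]
  · have := hu.chord_le 1 (by simp)
    rw [seg_one h.jp, seg_one h.jp₂] at this
    exact this.trans hyb
  · rw [chord_comm, chord_comm K b', chord_le_iff hf h.hx hu.mem hxb h.hx' hb']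
    -- The second leg of each crossing from `x` is replaced by a leg to `b₁` that is at least as
    -- long, and the reverse triangle inequality applies in the plane of `x`.
    refine le_of_forall_lt_imp_le_of_dense fun T' hT' => ?_
    obtain ⟨s, hs, h1, h2⟩ := hx T' hT'
    have h3 := hu.fut_of_fut hC h.hx (fun s hs => h.fut_x hs) hf hs h1
    have h4 := tau_add_tau_le h.hx (seg_mem h.hp h.jp s) hu.mem (h.fut_x hs) h3.1 hf
    linarith [h3.2]

lemma seg_pz' {r : ℝ} : seg K (seg K x' z' c) z' r = seg K x' z' (c + r * (1 - c)) := by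
  have := seg_seg h.jxz' h.hx' (s := c) (t := 1) ⟨h.hc.1.le, h.hc.2.le⟩ (by simp) r
  rwa [seg_one h.jxz'] at this

lemma seg_xp' {r : ℝ} : seg K x' (seg K x' z' c) r = seg K x' z' (r * c) := by
  have := seg_seg h.jxz' h.hx' (s := 0) (t := c) (by simp) ⟨h.hc.1.le, h.hc.2.le⟩ r
  rwa [seg_zero, zero_add, sub_zero] at this

lemma tau_x_pz' {r : ℝ} (hr : r ∈ Icc (0 : ℝ) 1) :
    Fut K x' (seg K (seg K x' z' c) z' r) ∧
      tau K x' (seg K (seg K x' z' c) z' r) = (c + r * (1 - c)) * tau K x' z' := by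
  rw [h.seg_pz']
  have h1 := h.hc.1
  have h2 := h.hc.2
  have h3 : 0 ≤ r * (1 - c) := mul_nonneg hr.1 (by linarith)
  have h4 : r * (1 - c) ≤ 1 - c := mul_le_of_le_one_left (by linarith) hr.2
  exact tau_seg_zero h.hx' h.hz' h.xz' (by linarith) (by linarith)

lemma joins : Joined K x y ∧ Joined K x p ∧ Joined K p₂ z ∧ Joined K y₂ z ∧ Joined K x' y' ∧
    Joined K y' z' ∧ Joined K x' (seg K x' z' c) ∧ Joined K (seg K x' z' c) z' :=
  ⟨h.xy.joined h.hx h.hy, h.xp.joined h.hx h.hp, h.pz.joined h.hp₂ h.hz, h.yz.joined h.hy₂ h.hz,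
    h.xy'.joined h.hx' h.hy', h.yz'.joined h.hy' h.hz', h.xp'.joined h.hx' h.hp',
    h.pz'.joined h.hp' h.hz'⟩

lemma seg_rev_zy (t : ℝ) : seg K (rev z) (rev y₂) t = rev (seg K y₂ z (1 - t)) := by
  obtain ⟨-, -, -, j, -⟩ := h.joins
  rw [seg_rev h.hz (j.symm h.hy₂ h.hz), seg_comm h.hy₂ h.hz j]

lemma seg_rev_zp (t : ℝ) : seg K (rev z) (rev p₂) t = rev (seg K p₂ z (1 - t)) := by
  obtain ⟨-, -, j, -⟩ := h.joins
  rw [seg_rev h.hz (j.symm h.hp₂ h.hz), seg_comm h.hp₂ h.hz j]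

lemma seg_rev_px (t : ℝ) : seg K (rev p) (rev x) t = rev (seg K x p (1 - t)) := by
  obtain ⟨-, j, -⟩ := h.joins
  rw [seg_rev h.hp (j.symm h.hx h.hp), seg_comm h.hx h.hp j]

lemma seg_rev_zy' (t : ℝ) : seg K (rev z') (rev y') t = rev (seg K y' z' (1 - t)) := by
  obtain ⟨-, -, -, -, -, j, -⟩ := h.joins
  rw [seg_rev h.hz' (j.symm h.hy' h.hz'), seg_comm h.hy' h.hz' j]

lemma rev_p' : seg K (rev z') (rev x') (1 - c) = rev (seg K x' z' c) := by
  rw [seg_rev h.hz' (h.jxz'.symm h.hx' h.hz'), seg_comm h.hx' h.hz' h.jxz', sub_sub_cancel]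

lemma seg_rev_zp' (t : ℝ) : seg K (rev z') (rev (seg K x' z' c)) t =
    rev (seg K (seg K x' z' c) z' (1 - t)) := by
  obtain ⟨-, -, -, -, -, -, -, j⟩ := h.joins
  rw [seg_rev h.hz' (j.symm h.hp' h.hz'), seg_comm h.hp' h.hz' j]

lemma seg_rev_px' (t : ℝ) : seg K (rev (seg K x' z' c)) (rev x') t =
    rev (seg K x' (seg K x' z' c) (1 - t)) := by
  obtain ⟨-, -, -, -, -, -, j, -⟩ := h.joins
  rw [seg_rev h.hp' (j.symm h.hx' h.hp'), seg_comm h.hx' h.hp' j]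

/-- Comparison inside the second triangle. -/
lemma chord_seg_seg_le₂ {s t : ℝ} (hs : s ∈ Icc (0 : ℝ) 1) (ht : t ∈ Icc (0 : ℝ) 1) :
    chord K (seg K y₂ z t) (seg K p₂ z s) ≤
      chord K (seg K y' z' t) (seg K (seg K x' z' c) z' s) := by
  have := h.symm.chord_seg_seg_le (one_sub_mem hs) (one_sub_mem ht)
  rwa [h.rev_p', h.seg_rev_zy, h.seg_rev_zp, h.seg_rev_zy', h.seg_rev_zp', sub_sub_cancel,
    sub_sub_cancel, chord_rev, chord_rev] at this

lemma fut_pz_yz {s t : ℝ} (hs : s ∈ Icc (0 : ℝ) 1) (ht : t ∈ Icc (0 : ℝ) 1)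
    (hf : Fut K (seg K (seg K x' z' c) z' s) (seg K y' z' t)) :
    Fut K (seg K p₂ z s) (seg K y₂ z t) ∧
      tau K (seg K (seg K x' z' c) z' s) (seg K y' z' t) ≤
        tau K (seg K p₂ z s) (seg K y₂ z t) := by
  obtain ⟨-, -, j1, j2, -, j3, -, j4⟩ := h.joins
  have := h.symm.fut_xy_xp (one_sub_mem hs) (one_sub_mem ht)
  rw [h.rev_p', h.seg_rev_zy, h.seg_rev_zp, h.seg_rev_zy', h.seg_rev_zp', sub_sub_cancel,
    sub_sub_cancel, fut_rev, fut_rev, tau_rev (seg_mem h.hp' j4 s) (seg_mem h.hy' j3 t),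
    tau_rev (seg_mem h.hp₂ j1 s) (seg_mem h.hy₂ j2 t)] at this
  exact this hf

lemma fut_yz_pz {s t : ℝ} (hs : s ∈ Icc (0 : ℝ) 1) (ht : t ∈ Icc (0 : ℝ) 1)
    (hf : Fut K (seg K y' z' t) (seg K (seg K x' z' c) z' s)) :
    Fut K (seg K y₂ z t) (seg K p₂ z s) ∧
      tau K (seg K y' z' t) (seg K (seg K x' z' c) z' s) ≤
        tau K (seg K y₂ z t) (seg K p₂ z s) := by
  obtain ⟨-, -, j1, j2, -, j3, -, j4⟩ := h.joins
  have := h.symm.fut_xp_xy (one_sub_mem hs) (one_sub_mem ht)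
  rw [h.rev_p', h.seg_rev_zy, h.seg_rev_zp, h.seg_rev_zy', h.seg_rev_zp', sub_sub_cancel,
    sub_sub_cancel, fut_rev, fut_rev, tau_rev (seg_mem h.hy' j3 t) (seg_mem h.hp' j4 s),
    tau_rev (seg_mem h.hy₂ j2 t) (seg_mem h.hp₂ j1 s)] at this
  exact this hf

/-- From `x`, crossing at `p` already realizes the straight length along the side from `x'` to `z'`.
The existence of crossings is carried from `x` along the side to the given point. -/
theorem crossLE_xy_pz {r : ℝ} (ht : t ∈ Ico (0 : ℝ) 1) (hr : r ∈ Ioc (0 : ℝ) 1)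
    (hf : Fut K (seg K x' y' t) (seg K (seg K x' z' c) z' r)) :
    CrossLE K (tau K (seg K x' y' t) (seg K (seg K x' z' c) z' r)) (seg K x y t) (seg K p₂ z r)
      p y p₂ y₂ := by
  obtain ⟨jxy, jxp, jpz, jyz, jxy', jyz', jxp', jpz'⟩ := h.joins
  have hrI : r ∈ Icc (0 : ℝ) 1 := ⟨hr.1.le, hr.2⟩
  have hb := seg_mem h.hp₂ jpz r
  have hb' := seg_mem h.hp' jpz' r
  have hxb := h.tau_x_pz' hrI
  have hpb := tau_seg_zero h.hp₂ h.hz h.pz hr.1 hr.2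
  have hyb : chord K (seg K p₂ z r) y₂ ≤ chord K (seg K (seg K x' z' c) z' r) y' := by
    have := h.chord_seg_seg_le₂ hrI (t := 0) (by simp)
    rwa [seg_zero, seg_zero, chord_comm, chord_comm K y'] at this
  have hx : ∀ T < tau K x' (seg K (seg K x' z' c) z' r), ∃ s ∈ Icc (0 : ℝ) 1,
      Fut K (seg K p₂ y₂ s) (seg K p₂ z r) ∧
      T ≤ tau K x (seg K p y s) + tau K (seg K p₂ y₂ s) (seg K p₂ z r) := by
    intro T hT
    refine ⟨0, by simp, by rw [seg_zero]; exact hpb.1, ?_⟩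
    rw [seg_zero, seg_zero, hpb.2, h.tau_xp_eq, h.tau_pz_eq]
    rw [hxb.2] at hT
    linarith
  have hfut : ∀ c ∈ Icc 0 t, Fut K (seg K x' y' c) (seg K (seg K x' z' _) z' r) := fun c hc =>
    Fut.seg_left_of_mem hb' h.hx' jxy' (s := 0) (by simp) ⟨ht.1, ht.2.le⟩
      (by rw [seg_zero]; exact hxb.1) hf hc.1 hc.2
  have hmain : ∀ c ∈ Icc 0 t, (crossSet K (seg K x y c) (seg K p₂ z r) p y p₂ y₂).Nonempty →
      CrossLE K (tau K (seg K x' y' c) (seg K (seg K x' z' _) z' r)) (seg K x y c) (seg K p₂ z r)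
        p y p₂ y₂ := fun c hc hne =>
    h.crossLE_of_vertex ⟨hc.1, hc.2.trans_lt ht.2⟩ hb hb' (hfut c hc) hxb.1 hyb hx hne
  have hτ := tau_pos hf (seg_mem h.hx' jxy' t) hb'
  -- Along the side the model separation to the target is smallest at the last point, so half of
  -- that value is a uniform lower bound.
  refine hmain t ⟨ht.1, le_rfl⟩ (crossSet_nonempty
    (δ := tau K (seg K x' y' t) (seg K (seg K x' z' _) z' r) / 2)
    (continuous_seg K x y) ht.1 (fun c _ => seg_mem h.hx jxy c) h.hp h.jp h.hp₂ h.jp₂ hb ?_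
    (half_pos hτ) ?_ ?_ ?_ ?_ ?_)
  · refine ⟨0, by simp, ?_, ?_⟩
    · rw [seg_zero, seg_zero]; exact h.xp
    · rw [seg_zero]; exact hpb.1
  · refine mul_sq_lt (by positivity) (tau_lt hf (seg_mem h.hx' jxy' t) hb') ?_
    rw [abs_of_pos hτ, abs_of_pos (half_pos hτ)]; linarith
  · intro c hc hne
    refine hmain c hc hne _ ?_
    rcases hc.2.eq_or_lt with rfl | hlt
    · linarith
    · have h1 := (tau_seg h.hx' h.hy' h.xy' hc.1 hlt ht.2.le).1
      have h2 := tau_add_tau_le (seg_mem h.hx' jxy' c) (seg_mem h.hx' jxy' t) hb' h1 hf (hfut c hc)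
      have h3 := tau_pos h1 (seg_mem h.hx' jxy' c) (seg_mem h.hx' jxy' t)
      linarith
  · intro c hc s hs hneg
    rcases hc.1.eq_or_lt with rfl | hpos
    · rw [seg_zero]; exact (h.fut_x hs).2.1
    · exact mul_chord_lt_of_fut h.hx (seg_mem h.hx jxy c) (seg_mem h.hp h.jp s)
        (tau_seg_zero h.hx h.hy h.xy hpos (hc.2.trans ht.2.le)).1 (h.fut_x hs) hneg
  · intro s hs hneg
    rcases hr.2.eq_or_lt with rfl | hlt
    · rw [seg_one jpz]; exact (h.fut_z hs).2.1
    · exact mul_chord_lt_of_fut_of_fut h.hz (seg_mem h.hp₂ h.jp₂ s) hb (h.fut_z hs)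
        (tau_seg_one h.hp₂ h.hz h.pz hr.1.le hlt).1 hneg
  · intro c hc
    exact (tau_seg_one h.hx h.hy h.xy hc.1 (hc.2.trans_lt ht.2)).1

/-- The time reversal of `crossLE_xy_pz`. -/
theorem crossLE_xp_yz {s r : ℝ} (hs : s ∈ Ico (0 : ℝ) 1) (hr : r ∈ Ioc (0 : ℝ) 1)
    (hf : Fut K (seg K x' (seg K x' z' c) s) (seg K y' z' r)) :
    CrossLE K (tau K (seg K x' (seg K x' z' c) s) (seg K y' z' r)) (seg K x p s) (seg K y₂ z r)
      p y p₂ y₂ := by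
  obtain ⟨jxy, jxp, jpz, jyz, jxy', jyz', jxp', jpz'⟩ := h.joins
  have := h.symm.crossLE_xy_pz (t := 1 - r) (r := 1 - s) ⟨by linarith [hr.2], by linarith [hr.1]⟩
    ⟨by linarith [hs.2], by linarith [hs.1]⟩
  rw [h.rev_p', h.seg_rev_zy, h.seg_rev_px, h.seg_rev_zy', h.seg_rev_px', sub_sub_cancel,
    sub_sub_cancel, fut_rev, tau_rev (seg_mem h.hx' jxp' s) (seg_mem h.hy' jyz' r)] at this
  exact (this hf).of_rev (seg_mem h.hx jxp s) (seg_mem h.hy₂ jyz r) h.hp h.jp h.hp₂ h.jp₂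

/-- The crossings from `x` come from `crossLE_xp_yz` at parameter 0, and crossing at `y` is always
possible. -/
theorem crossLE_xy_yz {r : ℝ} (ht : t ∈ Ico (0 : ℝ) 1) (hr : r ∈ Ioc (0 : ℝ) 1)
    (hf : Fut K (seg K x' y' t) (seg K y' z' r)) :
    CrossLE K (tau K (seg K x' y' t) (seg K y' z' r)) (seg K x y t) (seg K y₂ z r)
      p y p₂ y₂ := by
  obtain ⟨jxy, jxp, jpz, jyz, jxy', jyz', jxp', jpz'⟩ := h.joins
  have hxb : Fut K x' (seg K y' z' r) :=
    Fut.seg_right h.hx' h.hy' h.hz' jyz' h.xy' h.xz' ⟨hr.1.le, hr.2⟩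
  refine h.crossLE_of_vertex ht (seg_mem h.hy₂ jyz r) (seg_mem h.hy' jyz' r) hf hxb ?_ ?_ ?_
  · have := chord_seg_seg h.hy₂ h.hz h.hy' h.hz' jyz h.eyz r 0
    rw [seg_zero, seg_zero] at this
    exact this.le
  · intro T hT
    have h1 := h.crossLE_xp_yz (s := 0) (by simp) hr (by rw [seg_zero]; exact hxb)
    rw [seg_zero, seg_zero] at h1
    obtain ⟨s, hs, h2⟩ := h1 T hT
    exact ⟨s, hs.1, hs.2.2, h2⟩
  · refine ⟨1, by simp, ?_, ?_⟩
    · rw [seg_one h.jp]; exact (tau_seg_one h.hx h.hy h.xy ht.1 ht.2).1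
    · rw [seg_one h.jp₂]; exact (tau_seg_zero h.hy₂ h.hz h.yz hr.1 hr.2).1

end Glued

end LorentzModel

/-! ### Crossing from the second triangle back to the first -/

namespace LorentzModel

variable {K T c t r : ℝ} {p x y z a b p₂ y₂ x' y' z' : ℝ × ℝ × ℝ}

namespace Glued

variable (h : Glued K x p y p₂ y₂ z x' y' z' c)
include h

/-- Transitivity propagates such a relation until `p` precedes `y`, so the common side is
future-directed timelike. Transitivity in the model needs a common past, here `x'` or `x`. -/
lemma fut_of_fut_pz_xy (ht : t ∈ Icc (0 : ℝ) 1) (hr : r ∈ Ico (0 : ℝ) 1)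
    (hf : Fut K (seg K (seg K x' z' c) z' t) (seg K x' y' r)) :
    0 < r ∧ t < 1 ∧ Fut K x' (seg K x' y' r) ∧ Fut K (seg K x' y' r) y' ∧
      Fut K (seg K x' y' r) z' ∧ Fut K (seg K x' z' c) (seg K x' y' r) ∧
      Fut K p (seg K x y r) ∧ Fut K p y := by
  obtain ⟨jxy, jxp, jpz, jyz, jxy', jyz', jxp', jpz'⟩ := h.joins
  have ha' := seg_mem h.hp' jpz' t
  have hb' := seg_mem h.hx' jxy' r
  have hxa := (h.tau_x_pz' ht).1
  have hr0 : 0 < r := by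
    rcases hr.1.eq_or_lt with rfl | hr0
    · rw [seg_zero] at hf; exact absurd hxa hf.not_fut
    · exact hr0
  have hxb := (tau_seg_zero h.hx' h.hy' h.xy' hr0 hr.2.le).1
  have hby := (tau_seg_one h.hx' h.hy' h.xy' hr.1 hr.2).1
  have hbz := Fut.trans h.hx' hb' h.hy' h.hz' hxb h.xy' h.xz' hby h.yz'
  have ht1 : t < 1 := by
    refine lt_of_le_of_ne ht.2 fun e => ?_
    rw [e, seg_one jpz'] at hf
    exact hf.not_fut hbz
  have hpb : Fut K (seg K x' z' c) (seg K x' y' r) := by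
    rcases ht.1.eq_or_lt with rfl | ht0
    · rwa [seg_zero] at hf
    · exact Fut.trans h.hx' h.hp' ha' hb' h.xp' hxa hxb
        (tau_seg_zero h.hp' h.hz' h.pz' ht0 ht.2).1 hf
  have hpb₁ : Fut K p (seg K x y r) := by
    have := (h.fut_xp_xy (s := 1) (by simp) ⟨hr.1, hr.2.le⟩ (by rwa [seg_one jxp'])).1
    rwa [seg_one jxp] at this
  exact ⟨hr0, ht1, hxb, hby, hbz, hpb, hpb₁, Fut.trans h.hx h.hp (seg_mem h.hx jxy r) h.hy h.xp
    (tau_seg_zero h.hx h.hy h.xy hr0 hr.2.le).1 h.xy hpb₁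
    (tau_seg_one h.hx h.hy h.xy hr.1 hr.2).1⟩

/-- No crossing takes place at an end of the common side: `p` does not follow a point of its own
future and `y` does not precede a point of its own past. The unfolding therefore preserves chords,
so `b₁` is an exact copy of `b` next to the second triangle, where comparison along the side from
`p₂` to `z` contradicts a small supremum. -/
lemma crossLE_pz_xy_of_nonempty (ht : t ∈ Icc (0 : ℝ) 1) (hr : r ∈ Ico (0 : ℝ) 1)
    (hf : Fut K (seg K (seg K x' z' c) z' t) (seg K x' y' r))
    (hne : (crossSet K (seg K p₂ z t) (seg K x y r) p₂ y₂ p y).Nonempty) :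
    CrossLE K (tau K (seg K (seg K x' z' c) z' t) (seg K x' y' r)) (seg K p₂ z t) (seg K x y r)
      p₂ y₂ p y := by
  obtain ⟨hr0, ht1, hxb', hby', hbz', hpb', hpb, hpy⟩ := h.fut_of_fut_pz_xy ht hr hf
  obtain ⟨jxy, jxp, jpz, jyz, jxy', jyz', jxp', jpz'⟩ := h.joins
  have ha := seg_mem h.hp₂ jpz t
  have ha' := seg_mem h.hp' jpz' t
  have hb := seg_mem h.hx jxy r
  have hb' := seg_mem h.hx' jxy' r
  intro T hT
  rcases le_or_gt T 0 with hT0 | hT0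
  · obtain ⟨s, hs⟩ := hne
    exact ⟨s, hs, hT0.trans (add_nonneg (tau_nonneg _ _ _) (tau_nonneg _ _ _))⟩
  by_contra hcon
  push Not at hcon
  have hC := h.crossing_swap ha hb (T := T) (mul_sq_lt (by positivity) (tau_lt hf ha' hb')
    (by rw [abs_of_pos hT0, abs_of_pos (hT0.trans hT)]; exact hT.le)) fun s hs => (hcon s hs).le
  obtain ⟨b₁, hu⟩ := hC.exists_unfolding hne
  have heq : ∀ s ∈ Icc (0 : ℝ) 1, chord K b₁ (seg K p₂ y₂ s) = chord K (seg K x y r) (seg K p y s) := by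
    refine hu.chord_eq (fun hh => ?_) fun hh => ?_
    · rcases ht.1.eq_or_lt with rfl | ht0
      · rw [seg_zero] at hh; exact absurd hh.1.1 (by simp)
      · exact hh.1.not_fut (tau_seg_zero h.hp₂ h.hz h.pz ht0 ht.2).1
    · exact hh.2.not_fut (tau_seg_one h.hx h.hy h.xy hr.1 hr.2).1
  have he : energy K (log K p₂ y₂) < 0 := (h.jp₂.isLog.energy_neg_iff h.hp₂).2 (h.opy.1 hpy).1
  have hcopy := fun s (hs : s ∈ Icc (0 : ℝ) 1) => fut_of_copy h.hp₂ h.jp₂.isLog h.hp h.jp.isLog rfl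
    hC.energy_eq he (hC.theta_iff he) hb hu.mem
    (fun s hs => by simpa only [seg_eq_line] using heq s hs) (s := s) hs
  simp only [← seg_eq_line] at hcopy
  have hpb₁ : Fut K p₂ b₁ := by
    have := (hcopy 0 (by simp)).1
    rw [seg_zero, seg_zero] at this
    exact this hpb
  have hcross := h.crossLE_xy_pz ⟨hr0.le, hr.2⟩ (r := 1) (by simp)
    (by rw [seg_one jpz']; exact hbz')
  rw [seg_one jpz, seg_one jpz'] at hcross
  -- Crossings from `b` to `z` are copied into the plane of the second triangle. There the broken
  -- path is an ordinary one, and `p₂` is the common past needed for transitivity.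
  have hz : ∀ T < tau K (seg K x' y' r) z', Fut K b₁ z ∧ T ≤ tau K b₁ z := by
    intro T hT
    obtain ⟨s, ⟨hs, h1, h2⟩, h3⟩ := hcross T hT
    have hs0 : 0 < s := by
      rcases hs.1.eq_or_lt with rfl | hs0
      · rw [seg_zero] at h1; exact absurd hpb h1.not_fut
      · exact hs0
    have hq := seg_mem h.hp₂ h.jp₂ s
    have h4 := (hcopy s hs).2 h1
    have h5 := Fut.trans h.hp₂ hu.mem hq h.hz hpb₁
      (tau_seg_zero h.hp₂ h.hy₂ (h.opy.1 hpy) hs0 hs.2).1 h.pz h4 h2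
    have h6 := (chord_eq_iff h4 hu.mem hq h1 hb (seg_mem h.hp h.jp s)).1 (heq s hs)
    exact ⟨h5, h3.trans (by rw [← h6]; exact tau_add_tau_le hu.mem hq h.hz h4 h2 h5)⟩
  have hbz : Fut K b₁ z := (hz _ (sub_one_lt _)).1
  have key := chord_seg_le_of_fut h.hp₂ h.hz h.hp' h.hz' hu.mem hb' h.pz h.epz ht hpb' hf hu.fut
    ((chord_le_iff hbz hu.mem h.hz hbz' hb' h.hz').2
      (le_of_forall_lt_imp_le_of_dense fun T hT => (hz T hT).2)) fun _ => by
        have h1 := heq 0 (by simp)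
        have h2 := h.chord_seg_seg_le (s := 1) (by simp) (t := r) ⟨hr.1, hr.2.le⟩
        rw [seg_zero, seg_zero] at h1
        rw [seg_one jxp, seg_one jxp'] at h2
        exact h1.le.trans h2
  have := (chord_le_iff hu.fut ha hu.mem hf ha' hb').1 key
  linarith [hu.le]

/-- Crossings are followed along the side from `p₂` to `z`, now starting at `p₂`. -/
theorem crossLE_pz_xy (ht : t ∈ Icc (0 : ℝ) 1) (hr : r ∈ Ico (0 : ℝ) 1)
    (hf : Fut K (seg K (seg K x' z' c) z' t) (seg K x' y' r)) :
    CrossLE K (tau K (seg K (seg K x' z' c) z' t) (seg K x' y' r)) (seg K p₂ z t) (seg K x y r)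
      p₂ y₂ p y := by
  obtain ⟨hr0, ht1, hxb', hby', hbz', hpb', hpb, hpy⟩ := h.fut_of_fut_pz_xy ht hr hf
  obtain ⟨jxy, jxp, jpz, jyz, jxy', jyz', jxp', jpz'⟩ := h.joins
  have hb := seg_mem h.hx jxy r
  have hb' := seg_mem h.hx' jxy' r
  have hfut : ∀ d ∈ Icc 0 t, Fut K (seg K (seg K x' z' c) z' d) (seg K x' y' r) := fun d hd =>
    Fut.seg_left_of_mem hb' h.hp' jpz' (s := 0) (by simp) ht (by rw [seg_zero]; exact hpb') hf
      hd.1 hd.2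
  have hmain := fun d (hd : d ∈ Icc 0 t) =>
    h.crossLE_pz_xy_of_nonempty ⟨hd.1, hd.2.trans ht.2⟩ hr (hfut d hd)
  have hτ := tau_pos hf (seg_mem h.hp' jpz' t) hb'
  refine hmain t ⟨ht.1, le_rfl⟩ (crossSet_nonempty
    (δ := tau K (seg K (seg K x' z' c) z' t) (seg K x' y' r) / 2)
    (continuous_seg K p₂ z) ht.1 (fun d _ => seg_mem h.hp₂ jpz d) h.hp₂ h.jp₂ h.hp h.jp hb ?_
    (half_pos hτ) ?_ ?_ ?_ ?_ ?_)
  -- Crossing at `p` itself would give a first leg of length zero. By openness a small positive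
  -- parameter keeps the second leg timelike and makes the first one timelike.
  · have h0 : Fut K (seg K p y 0) (seg K x y r) := by rwa [seg_zero]
    have hev : ∀ᶠ d in 𝓝 (0 : ℝ), Fut K (seg K p y d) (seg K x y r) :=
      ((continuous_seg K p y).prodMk continuous_const).continuousAt.eventually
        ((isOpen_fut K).mem_nhds h0)
    have hev' : ∀ᶠ d in 𝓝[>] (0 : ℝ), Fut K (seg K p y d) (seg K x y r) :=
      mem_nhdsWithin_of_mem_nhds hev
    obtain ⟨d, hd, hd'⟩ := (hev'.and (Ioo_mem_nhdsGT one_pos)).exists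
    rw [seg_zero]
    exact ⟨d, ⟨hd'.1.le, hd'.2.le⟩, (tau_seg_zero h.hp₂ h.hy₂ (h.opy.1 hpy) hd'.1 hd'.2.le).1, hd⟩
  · refine mul_sq_lt (by positivity) (tau_lt hf (seg_mem h.hp' jpz' t) hb') ?_
    rw [abs_of_pos hτ, abs_of_pos (half_pos hτ)]; linarith
  · intro d hd hne
    refine hmain d hd hne _ ?_
    rcases hd.2.eq_or_lt with rfl | hlt
    · linarith
    · have h1 := (tau_seg h.hp' h.hz' h.pz' hd.1 hlt ht.2).1
      have h2 := tau_add_tau_le (seg_mem h.hp' jpz' d) (seg_mem h.hp' jpz' t) hb' h1 hf (hfut d hd)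
      have h3 := tau_pos h1 (seg_mem h.hp' jpz' d) (seg_mem h.hp' jpz' t)
      linarith
  · intro d hd s hs hneg
    exact mul_chord_lt_of_fut_of_fut h.hz (seg_mem h.hp₂ jpz d) (seg_mem h.hp₂ h.jp₂ s)
      (tau_seg_one h.hp₂ h.hz h.pz hd.1 (hd.2.trans_lt ht1)).1 (h.fut_z hs) hneg
  · intro s hs hneg
    exact mul_chord_lt_of_fut h.hx (seg_mem h.hp h.jp s) hb (h.fut_x hs)
      (tau_seg_zero h.hx h.hy h.xy hr0 hr.2.le).1 hneg
  · intro d hd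
    have hdI : d ∈ Icc (0 : ℝ) 1 := ⟨hd.1, hd.2.trans ht.2⟩
    have := (h.fut_pz_yz hdI (t := 0) (by simp) ?_).1
    · rwa [seg_zero K y₂] at this
    · rw [seg_zero K y']
      exact Fut.trans h.hx' (seg_mem h.hp' jpz' d) hb' h.hy' (h.tau_x_pz' hdI).1 hxb' h.xy'
        (hfut d hd) hby'

theorem crossLE_yz_xp {s : ℝ} (ht : t ∈ Ioc (0 : ℝ) 1) (hs : s ∈ Icc (0 : ℝ) 1)
    (hf : Fut K (seg K y' z' t) (seg K x' (seg K x' z' c) s)) :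
    CrossLE K (tau K (seg K y' z' t) (seg K x' (seg K x' z' c) s)) (seg K y₂ z t) (seg K x p s)
      p₂ y₂ p y := by
  obtain ⟨jxy, jxp, jpz, jyz, jxy', jyz', jxp', jpz'⟩ := h.joins
  have := h.symm.crossLE_pz_xy (t := 1 - s) (r := 1 - t) (one_sub_mem hs)
    ⟨by linarith [ht.2], by linarith [ht.1]⟩
  rw [h.rev_p', h.seg_rev_zy, h.seg_rev_px, h.seg_rev_zy', h.seg_rev_px', sub_sub_cancel,
    sub_sub_cancel, fut_rev, tau_rev (seg_mem h.hy' jyz' t) (seg_mem h.hx' jxp' s)] at this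
  exact (this hf).of_rev (seg_mem h.hy₂ jyz t) (seg_mem h.hx jxp s) h.hp₂ h.jp₂ h.hp h.jp

/-- Transitivity, with `x'` as common past, would place `y'` in the future of a point that equals or
follows it. -/
lemma not_fut_yz_xy {s : ℝ} (ht : t ∈ Icc (0 : ℝ) 1) (hs : s ∈ Icc (0 : ℝ) 1) :
    ¬ Fut K (seg K y' z' t) (seg K x' y' s) := by
  obtain ⟨jxy, jxp, jpz, jyz, jxy', jyz', jxp', jpz'⟩ := h.joins
  intro hf
  have hxb := Fut.seg_right h.hx' h.hy' h.hz' jyz' h.xy' h.xz' ht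
  have hs0 : 0 < s := by
    rcases hs.1.eq_or_lt with rfl | hs0
    · rw [seg_zero] at hf; exact absurd hxb hf.not_fut
    · exact hs0
  have hxa := (tau_seg_zero h.hx' h.hy' h.xy' hs0 hs.2).1
  have hyy : Fut K (seg K y' z' t) y' := by
    rcases hs.2.eq_or_lt with rfl | hs1
    · rwa [seg_one jxy'] at hf
    · exact Fut.trans h.hx' (seg_mem h.hy' jyz' t) (seg_mem h.hx' jxy' s) h.hy' hxb hxa h.xy' hf
        (tau_seg_one h.hx' h.hy' h.xy' hs.1 hs1).1
  rcases ht.1.eq_or_lt with rfl | ht0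
  · rw [seg_zero] at hyy; exact absurd hyy.1 (by simp)
  · exact hyy.not_fut (tau_seg_zero h.hy' h.hz' h.yz' ht0 ht.2).1

end Glued

end LorentzModel

/-! ### Time separation regardless of direction -/

namespace LorentzModel

variable {K : ℝ} {p q : ℝ × ℝ × ℝ}

lemma tau_eq_zero (hp : p ∈ points K) (h : ¬ Fut K p q) : tau K p q = 0 :=
  (tau_nonneg K p q).antisymm' (not_lt.1 fun h' => h (fut_of_tau_pos hp h'))

/-- The length of the timelike geodesic between two points, regardless of its direction. -/
def sep (K : ℝ) (p q : ℝ × ℝ × ℝ) : ℝ := tau K p q + tau K q p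

lemma sep_comm (K : ℝ) (p q : ℝ × ℝ × ℝ) : sep K p q = sep K q p := add_comm _ _

lemma sep_rev (hp : p ∈ points K) (hq : q ∈ points K) : sep K (rev p) (rev q) = sep K p q := by
  rw [sep, sep, tau_rev hq hp, tau_rev hp hq, add_comm]

lemma Fut.sep_eq (h : Fut K p q) (hq : q ∈ points K) : sep K p q = tau K p q := by
  rw [sep, tau_eq_zero hq h.not_fut, add_zero]

lemma Fut.sep_eq' (h : Fut K p q) (hq : q ∈ points K) : sep K q p = tau K p q := by
  rw [sep_comm, h.sep_eq hq]

lemma fut_of_sep_pos (hp : p ∈ points K) (hq : q ∈ points K) (h : 0 < sep K p q) :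
    Fut K p q ∨ Fut K q p := by
  by_contra hcon
  push Not at hcon
  rw [sep, tau_eq_zero hp hcon.1, tau_eq_zero hq hcon.2] at h
  simp at h

lemma signedRoot_neg_sq {T : ℝ} (h : 0 < T) : signedRoot (-T ^ 2) = -T := by
  have h1 : -T ^ 2 < 0 := by nlinarith
  have := neg_signedRoot_of_neg h1
  rw [neg_neg, Real.sqrt_sq h.le] at this
  linarith

lemma Fut.signedDist_eq (h : Fut K p q) (hp : p ∈ points K) (hq : q ∈ points K) :
    signedDist K p q = -tau K p q ∧ signedDist K q p = -tau K p q := by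
  have hj := h.joined hp hq
  have hj' := hj.symm hp hq
  have h1 := energy_eq_neg_tau_sq h hp hj.isLog
  have h2 := hj'.isLog.energy_eq hq hj.isLog hp (chord_comm K q p)
  unfold signedDist
  rw [h2, h1, signedRoot_neg_sq (tau_pos h hp hq)]
  exact ⟨rfl, rfl⟩

lemma signedDist_of_sep_pos (hp : p ∈ points K) (hq : q ∈ points K) (h : 0 < sep K p q) :
    signedDist K p q = -sep K p q := by
  rcases fut_of_sep_pos hp hq h with hf | hf
  · rw [hf.sep_eq hq, (hf.signedDist_eq hp hq).1]
  · rw [hf.sep_eq' hp, (hf.signedDist_eq hq hp).2]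

lemma sep_of_signedDist_neg (hp : p ∈ points K) (hq : q ∈ points K) (h : signedDist K p q < 0) :
    sep K p q = -signedDist K p q := by
  have he : energy K (log K p q) < 0 := signedRoot_neg_iff.1 h
  have hj : Joined K p q := by
    -- Without a geodesic, `log` takes the default value 0, whose energy is not negative.
    by_contra hj
    rw [log, dif_neg hj] at he
    simp [energy] at he
  have hc := (hj.isLog.energy_neg_iff hp).1 he
  rcases fut_or_fut hp hq hc (hj.isLog.mul_chord_lt hp) with hf | hf
  · rw [hf.sep_eq hq, (hf.signedDist_eq hp hq).1, neg_neg]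
  · rw [hf.sep_eq' hp, (hf.signedDist_eq hq hp).2, neg_neg]

end LorentzModel

/-! ### Time-reversed spaces and timelike rays -/

namespace LorentzianPreLengthSpace

open LorentzModel

variable {X : Type*} [MetricSpace X] (L : LorentzianPreLengthSpace X)

/-- The space with the opposite time orientation. -/
def reverse : LorentzianPreLengthSpace X where
  ll a b := L.ll b a
  le a b := L.le b a
  tau a b := L.tau b a
  le_refl := L.le_refl
  le_trans a b c h h' := L.le_trans c b a h' h
  ll_trans a b c h h' := L.ll_trans c b a h' h
  le_of_ll a b := L.le_of_ll b a
  lowerSemicontinuous_tau := L.lowerSemicontinuous_tau.comp continuous_swap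
  reverse_triangle a b c h h' := by rw [add_comm]; exact L.reverse_triangle c b a h' h
  tau_pos_iff a b := L.tau_pos_iff b a

variable {L}

lemma le_of_ofReal_le {a b : X} {r : ℝ} (hr : 0 < r) (h : ENNReal.ofReal r ≤ L.tau a b) :
    L.le a b :=
  L.le_of_ll _ _ ((L.tau_pos_iff _ _).1 ((ENNReal.ofReal_pos.2 hr).trans_le h))

lemma ofReal_add_le {a b c : X} {r s : ℝ} (hr : 0 < r) (hs : 0 < s)
    (h : ENNReal.ofReal r ≤ L.tau a b) (h' : ENNReal.ofReal s ≤ L.tau b c) :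
    ENNReal.ofReal (r + s) ≤ L.tau a c := by
  rw [ENNReal.ofReal_add hr.le hs.le]
  exact (add_le_add h h').trans
    (L.reverse_triangle a b c (le_of_ofReal_le hr h) (le_of_ofReal_le hs h'))

/-- `A` is a `τ`-realizing curve with length `l`, parametrized proportionally to length. -/
structure IsRay (L : LorentzianPreLengthSpace X) (A : ℝ → X) (l : ℝ) : Prop where
  pos : 0 < l
  le : ∀ s t, 0 ≤ s → s ≤ t → t ≤ 1 → ENNReal.ofReal ((t - s) * l) ≤ L.tau (A s) (A t)
  eq : L.tau (A 0) (A 1) = ENNReal.ofReal l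

namespace IsRay

variable {A : ℝ → X} {l : ℝ} (h : IsRay L A l)
include h

lemma causal {s t : ℝ} (hs : 0 ≤ s) (hst : s ≤ t) (ht : t ≤ 1) : L.le (A s) (A t) := by
  rcases hst.eq_or_lt with rfl | hlt
  · exact L.le_refl _
  · exact le_of_ofReal_le (mul_pos (by linarith) h.pos) (h.le s t hs hst ht)

/-- The lower bounds for the three pieces add up to the total length, so the reverse triangle
inequality leaves no room for a larger value. -/
lemma tau_eq {s t : ℝ} (hs : 0 ≤ s) (hst : s ≤ t) (ht : t ≤ 1) :
    L.tau (A s) (A t) = ENNReal.ofReal ((t - s) * l) := by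
  refine le_antisymm ?_ (h.le s t hs hst ht)
  have h1 := L.reverse_triangle _ _ _ (h.causal le_rfl hs (hst.trans ht)) (h.causal hs hst ht)
  have h2 := L.reverse_triangle _ _ _ (h.causal le_rfl (hs.trans hst) ht)
    (h.causal (hs.trans hst) ht le_rfl)
  have h3 := h.le 0 s le_rfl hs (hst.trans ht)
  have h4 := h.le t 1 (hs.trans hst) ht le_rfl
  have h5 : ENNReal.ofReal ((s - 0) * l) + L.tau (A s) (A t) + ENNReal.ofReal ((1 - t) * l) ≤
      ENNReal.ofReal l := by
    rw [← h.eq]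
    exact (add_le_add ((add_le_add h3 le_rfl).trans h1) h4).trans h2
  have h6 : L.tau (A s) (A t) ≠ ⊤ := by
    intro htop
    rw [htop] at h5
    simp at h5
  have hl := h.pos
  have e1 : 0 ≤ (s - 0) * l := mul_nonneg (by linarith) hl.le
  have e2 : 0 ≤ (1 - t) * l := mul_nonneg (by linarith) hl.le
  rw [← ENNReal.ofReal_toReal h6, ← ENNReal.ofReal_add e1 ENNReal.toReal_nonneg,
    ← ENNReal.ofReal_add (by positivity) e2, ENNReal.ofReal_le_ofReal_iff hl.le] at h5
  rw [← ENNReal.ofReal_toReal h6]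
  exact ENNReal.ofReal_le_ofReal (by linarith)

lemma tau_zero {t : ℝ} (ht0 : 0 ≤ t) (ht : t ≤ 1) :
    L.tau (A 0) (A t) = ENNReal.ofReal (t * l) := by
  rw [h.tau_eq le_rfl ht0 ht, sub_zero]

end IsRay

end LorentzianPreLengthSpace

/-! ### Recovering the time orientation of a comparison triangle -/

namespace LorentzianPreLengthSpace

open LorentzModel

variable {X : Type*} [MetricSpace X] {L : LorentzianPreLengthSpace X} {K l m : ℝ}
  {A B C : ℝ → X} {x' p' y' a' b' : ℝ × ℝ × ℝ} {a b : X}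

/-- `a` on a triangle with sides `A` from `x`, `B` from `x` and `C` from `A 1` to `B 1`
corresponds to `a'` on the triangle `Δ(x', p', y')`. -/
def Corr (K : ℝ) (A B C : ℝ → X) (x' p' y' : ℝ × ℝ × ℝ) (a : X) (a' : ℝ × ℝ × ℝ) : Prop :=
  ∃ s ∈ Icc (0 : ℝ) 1, (a = A s ∧ a' = seg K x' p' s) ∨ (a = B s ∧ a' = seg K x' y' s) ∨
    (a = C s ∧ a' = seg K p' y' s)

/-- The triangle `Δ(x', p', y')` is a comparison triangle for the triangle with timelike sides
`A` and `B` and third side `C`, with bounds for the time separation from below by the lengths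
in the comparison triangle, up to the direction of time. -/
structure Comparable (L : LorentzianPreLengthSpace X) (K : ℝ) (A B C : ℝ → X)
    (x' p' y' : ℝ × ℝ × ℝ) (l m : ℝ) : Prop where
  hx : x' ∈ points K
  hp : p' ∈ points K
  hy : y' ∈ points K
  jxp : Joined K x' p'
  jxy : Joined K x' y'
  jpy : Joined K p' y'
  rayA : IsRay L A l
  rayB : IsRay L B m
  AB : A 0 = B 0
  AC : A 1 = C 0
  BC : B 1 = C 1
  sepA : sep K x' p' = l
  sepB : sep K x' y' = m
  le_tau : ∀ {a b : X} {a' b' : ℝ × ℝ × ℝ}, Corr K A B C x' p' y' a a' →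
    Corr K A B C x' p' y' b b' → 0 < sep K a' b' →
    ENNReal.ofReal (sep K a' b') ≤ L.tau a b ∨ ENNReal.ofReal (sep K a' b') ≤ L.tau b a
  apex : (∀ s ∈ Icc (0 : ℝ) 1, 0 < sep K x' (seg K p' y' s)) →
    (∀ s ∈ Icc (0 : ℝ) 1, ENNReal.ofReal (sep K x' (seg K p' y' s)) ≤ L.tau (A 0) (C s)) ∨
    (∀ s ∈ Icc (0 : ℝ) 1, ENNReal.ofReal (sep K x' (seg K p' y' s)) ≤ L.tau (C s) (A 0))
  side : 0 < sep K p' y' →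
    (∀ s t : ℝ, 0 ≤ s → s ≤ t → t ≤ 1 →
      ENNReal.ofReal ((t - s) * sep K p' y') ≤ L.tau (C s) (C t)) ∨
    (∀ s t : ℝ, 0 ≤ s → s ≤ t → t ≤ 1 →
      ENNReal.ofReal ((t - s) * sep K p' y') ≤ L.tau (C t) (C s))

namespace Comparable

variable (h : Comparable L K A B C x' p' y' l m)
include h

lemma corrA {s : ℝ} (hs : s ∈ Icc (0 : ℝ) 1) : Corr K A B C x' p' y' (A s) (seg K x' p' s) :=
  ⟨s, hs, Or.inl ⟨rfl, rfl⟩⟩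

lemma corrB {s : ℝ} (hs : s ∈ Icc (0 : ℝ) 1) : Corr K A B C x' p' y' (B s) (seg K x' y' s) :=
  ⟨s, hs, Or.inr (Or.inl ⟨rfl, rfl⟩)⟩

lemma corrC {s : ℝ} (hs : s ∈ Icc (0 : ℝ) 1) : Corr K A B C x' p' y' (C s) (seg K p' y' s) :=
  ⟨s, hs, Or.inr (Or.inr ⟨rfl, rfl⟩)⟩

lemma corr_mem (ha : Corr K A B C x' p' y' a a') : a' ∈ points K := by
  obtain ⟨s, -, ⟨-, rfl⟩ | ⟨-, rfl⟩ | ⟨-, rfl⟩⟩ := ha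
  · exact seg_mem h.hx h.jxp s
  · exact seg_mem h.hx h.jxy s
  · exact seg_mem h.hp h.jpy s

lemma corr_swap (ha : Corr K B A (fun s => C (1 - s)) x' y' p' a a') :
    Corr K A B C x' p' y' a a' := by
  obtain ⟨s, hs, ⟨ha, ha'⟩ | ⟨ha, ha'⟩ | ⟨ha, ha'⟩⟩ := ha
  · exact ⟨s, hs, Or.inr (Or.inl ⟨ha, ha'⟩)⟩
  · exact ⟨s, hs, Or.inl ⟨ha, ha'⟩⟩
  · exact ⟨1 - s, one_sub_mem hs, Or.inr (Or.inr ⟨ha, by rw [ha', seg_comm h.hp h.hy h.jpy]⟩)⟩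

lemma swap : Comparable L K B A (fun s => C (1 - s)) x' y' p' m l where
  hx := h.hx
  hp := h.hy
  hy := h.hp
  jxp := h.jxy
  jxy := h.jxp
  jpy := h.jpy.symm h.hp h.hy
  rayA := h.rayB
  rayB := h.rayA
  AB := h.AB.symm
  AC := by simpa using h.BC
  BC := by simpa using h.AC
  sepA := h.sepB
  sepB := h.sepA
  le_tau := fun ha hb => h.le_tau (h.corr_swap ha) (h.corr_swap hb)
  apex := fun hs => by
    simp only [seg_comm h.hp h.hy h.jpy, ← h.AB] at hs ⊢
    refine (h.apex fun s hs' => ?_).imp (fun hh s hs' => hh _ (one_sub_mem hs'))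
      fun hh s hs' => hh _ (one_sub_mem hs')
    have := hs (1 - s) (one_sub_mem hs')
    rwa [sub_sub_cancel] at this
  side := fun hs => by
    rw [sep_comm] at hs ⊢
    refine (h.side hs).symm.imp (fun hh s t h0 h1 h2 => ?_) fun hh s t h0 h1 h2 => ?_
    all_goals
      have := hh (1 - t) (1 - s) (by linarith) (by linarith) (by linarith)
      rwa [sub_sub_sub_cancel_left] at this

lemma corr_rev (ha : Corr K A B C (rev x') (rev p') (rev y') a a') :
    Corr K A B C x' p' y' a (rev a') := by
  obtain ⟨s, hs, ⟨ha, ha'⟩ | ⟨ha, ha'⟩ | ⟨ha, ha'⟩⟩ := ha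
  · exact ⟨s, hs, Or.inl ⟨ha, by rw [ha', seg_rev h.hx h.jxp, rev_rev]⟩⟩
  · exact ⟨s, hs, Or.inr (Or.inl ⟨ha, by rw [ha', seg_rev h.hx h.jxy, rev_rev]⟩)⟩
  · exact ⟨s, hs, Or.inr (Or.inr ⟨ha, by rw [ha', seg_rev h.hp h.jpy, rev_rev]⟩)⟩

lemma rev : Comparable L K A B C (rev x') (rev p') (rev y') l m where
  hx := rev_mem h.hx
  hp := rev_mem h.hp
  hy := rev_mem h.hy
  jxp := h.jxp.rev
  jxy := h.jxy.rev
  jpy := h.jpy.rev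
  rayA := h.rayA
  rayB := h.rayB
  AB := h.AB
  AC := h.AC
  BC := h.BC
  sepA := by rw [sep_rev h.hx h.hp, h.sepA]
  sepB := by rw [sep_rev h.hx h.hy, h.sepB]
  le_tau := fun ha hb => by
    have h1 := h.corr_rev ha
    have h2 := h.corr_rev hb
    have := h.le_tau h1 h2
    rwa [← sep_rev (h.corr_mem h1) (h.corr_mem h2), rev_rev, rev_rev] at this
  apex := by
    have e : ∀ s, sep K (LorentzModel.rev x') (seg K (LorentzModel.rev p') (LorentzModel.rev y') s)
        = sep K x' (seg K p' y' s) := fun s => by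
      rw [seg_rev h.hp h.jpy, sep_rev h.hx (seg_mem h.hp h.jpy s)]
    simpa only [e] using h.apex
  side := by
    rw [sep_rev h.hp h.hy]
    exact h.side

/-- If `x'` lay between `p'` and `y'` in time, points at parameter s on the two sides would be
separated by at least `s * (l + m)`. In `X` both points lie in the future of the common apex, at
times `s * l` and `s * m`, and such a separation in either direction violates the reverse triangle
inequality. -/
lemma not_opposite (hpx : Fut K p' x') (hxy : Fut K x' y') : False := by
  have hcont : Continuous fun u : ℝ × ℝ => K * chord K (seg K x' p' u.1) (seg K x' y' u.2) :=
    continuous_const.mul ((continuous_chord_uncurry K).comp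
      (((continuous_seg K x' p').comp continuous_fst).prodMk
        ((continuous_seg K x' y').comp continuous_snd)))
  -- Points close to `x'` are taken so that transitivity in the model stays within range.
  have h0 : ∀ᶠ u in 𝓝 ((0 : ℝ), (0 : ℝ)), K * chord K (seg K x' p' u.1) (seg K x' y' u.2) < 2 :=
    hcont.continuousAt.eventually_lt_const (by simp [seg_zero])
  obtain ⟨ε, hε, hball⟩ := Metric.eventually_nhds_iff.1 h0
  obtain ⟨s, hs0, hs⟩ := exists_between (lt_min hε one_pos)
  have hs1 : s < 1 := hs.trans_le (min_le_right _ _)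
  have hsε : s < ε := hs.trans_le (min_le_left _ _)
  have hsI : s ∈ Icc (0 : ℝ) 1 := ⟨hs0.le, hs1.le⟩
  have e1 := tau_seg_one h.hp h.hx hpx (t := 1 - s) (by linarith) (by linarith)
  rw [seg_comm h.hx h.hp h.jxp, sub_sub_cancel] at e1
  have e2 := tau_seg_zero h.hx h.hy hxy hs0 hs1.le
  have m1 := seg_mem h.hx h.jxp s
  have m2 := seg_mem h.hx h.jxy s
  have hl : LorentzModel.tau K p' x' = l := by rw [← h.sepA, hpx.sep_eq' h.hx]
  have hm : LorentzModel.tau K x' y' = m := by rw [← h.sepB, hxy.sep_eq h.hy]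
  have hf : Fut K (seg K x' p' s) (seg K x' y' s) := by
    refine (Fut.trans_or_exists m1 h.hx m2 e1.1 e2.1).resolve_right ?_
    rintro ⟨-, r, hr, h2⟩
    have e3 := seg_seg h.jxy h.hx (s := 0) (t := s) (by simp) hsI r
    rw [seg_zero, zero_add, sub_zero] at e3
    rw [e3] at h2
    have : dist (s, r * s) ((0 : ℝ), (0 : ℝ)) < ε := by
      rw [Prod.dist_eq, max_lt_iff, Real.dist_0_eq_abs, Real.dist_0_eq_abs, abs_of_pos hs0,
        abs_of_nonneg (mul_nonneg hr.1 hs0.le)]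
      exact ⟨hsε, (mul_le_of_le_one_left hs0.le hr.2).trans_lt hsε⟩
    exact absurd (hball this) (not_lt.2 h2)
  have h3 := tau_add_tau_le m1 h.hx m2 e1.1 e2.1 hf
  rw [e1.2, e2.2, hl, hm] at h3
  have hl0 := mul_pos hs0 h.rayA.pos
  have hm0 := mul_pos hs0 h.rayB.pos
  have hd := tau_pos hf m1 m2
  have tA := h.rayA.tau_zero hs0.le hs1.le
  have tB := h.rayB.tau_zero hs0.le hs1.le
  rw [← h.AB] at tB
  have h4 := h.le_tau (h.corrA hsI) (h.corrB hsI) (by rw [hf.sep_eq m2]; exact hd)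
  rw [hf.sep_eq m2] at h4
  rcases h4 with h4 | h4
  · have := ofReal_add_le hl0 hd tA.ge h4
    rw [tB, ENNReal.ofReal_le_ofReal_iff hm0.le] at this
    linarith
  · have := ofReal_add_le hm0 hd tB.ge h4
    rw [tA, ENNReal.ofReal_le_ofReal_iff hl0.le] at this
    linarith

end Comparable

/-- A comparison triangle with the right time orientation. -/
structure Oriented (L : LorentzianPreLengthSpace X) (K : ℝ) (A B C : ℝ → X)
    (x' p' y' : ℝ × ℝ × ℝ) (l m : ℝ) : Prop extends Comparable L K A B C x' p' y' l m where
  xp : Fut K x' p'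
  xy : Fut K x' y'

/-- Both sides leave `x'` in the same time direction. If this is the past, time reversal of the
model corrects it and preserves the chord of the third side. -/
lemma Comparable.exists_oriented (h : Comparable L K A B C x' p' y' l m) :
    ∃ x₀ p₀ y₀, Oriented L K A B C x₀ p₀ y₀ l m ∧ chord K p₀ y₀ = chord K p' y' := by
  have h1 := fut_of_sep_pos h.hx h.hp (h.sepA ▸ h.rayA.pos)
  have h2 := fut_of_sep_pos h.hx h.hy (h.sepB ▸ h.rayB.pos)
  rcases h1 with h1 | h1 <;> rcases h2 with h2 | h2
  · exact ⟨x', p', y', ⟨h, h1, h2⟩, rfl⟩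
  · exact (h.swap.not_opposite h2 h1).elim
  · exact (h.not_opposite h1 h2).elim
  · exact ⟨_, _, _, ⟨h.rev, fut_rev.2 h1, fut_rev.2 h2⟩, chord_rev _ _ _⟩

namespace Oriented

variable (h : Oriented L K A B C x' p' y' l m)
include h

lemma swap : Oriented L K B A (fun s => C (1 - s)) x' y' p' m l :=
  ⟨h.toComparable.swap, h.xy, h.xp⟩

lemma tauA : LorentzModel.tau K x' p' = l := by rw [← h.sepA, h.xp.sep_eq h.hp]

lemma tauB : LorentzModel.tau K x' y' = m := by rw [← h.sepB, h.xy.sep_eq h.hy]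

lemma futC {s : ℝ} (hs : s ∈ Icc (0 : ℝ) 1) : Fut K x' (seg K p' y' s) :=
  Fut.seg_right h.hx h.hp h.hy h.jpy h.xp h.xy hs

/-- The field `apex` gives one direction for the whole third side. At its first point, the end of a
ray from the apex, the wrong direction would close a timelike loop and lengthen the ray. -/
lemma le_tau_apex {s : ℝ} (hs : s ∈ Icc (0 : ℝ) 1) :
    ENNReal.ofReal (LorentzModel.tau K x' (seg K p' y' s)) ≤ L.tau (A 0) (C s) := by
  have e : ∀ s ∈ Icc (0 : ℝ) 1, sep K x' (seg K p' y' s) =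
      LorentzModel.tau K x' (seg K p' y' s) := fun s hs =>
    (h.futC hs).sep_eq (seg_mem h.hp h.jpy s)
  have h1 := h.apex fun s hs => by
    rw [e s hs]; exact tau_pos (h.futC hs) h.hx (seg_mem h.hp h.jpy s)
  rw [← e s hs]
  refine h1.elim (fun h1 => h1 s hs) fun h1 => ?_
  have h2 := h1 0 (by simp)
  rw [e 0 (by simp), seg_zero, h.tauA, ← h.AC] at h2
  have h3 := ofReal_add_le h.rayA.pos h.rayA.pos h.rayA.eq.ge h2
  have h4 := ofReal_add_le (add_pos h.rayA.pos h.rayA.pos) h.rayA.pos h3 h.rayA.eq.ge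
  rw [h.rayA.eq, ENNReal.ofReal_le_ofReal_iff h.rayA.pos.le] at h4
  linarith [h.rayA.pos]

lemma tau_apexA {s : ℝ} (hs : s ∈ Icc (0 : ℝ) 1) :
    L.tau (A 0) (A s) = ENNReal.ofReal (LorentzModel.tau K x' (seg K x' p' s)) := by
  rw [h.rayA.tau_zero hs.1 hs.2]
  rcases hs.1.eq_or_lt with rfl | h0
  · rw [seg_zero, tau_eq_zero h.hx fun hh => by simpa using hh.1, zero_mul]
  · rw [(tau_seg_zero h.hx h.hp h.xp h0 hs.2).2, h.tauA]

lemma tau_apexB {s : ℝ} (hs : s ∈ Icc (0 : ℝ) 1) :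
    L.tau (A 0) (B s) = ENNReal.ofReal (LorentzModel.tau K x' (seg K x' y' s)) := by
  rw [h.AB]
  exact h.swap.tau_apexA hs

lemma eq_or_le_tau_apex (ha : Corr K A B C x' p' y' a a') :
    a' = x' ∨ Fut K x' a' ∧ ENNReal.ofReal (LorentzModel.tau K x' a') ≤ L.tau (A 0) a := by
  obtain ⟨s, hs, ⟨rfl, rfl⟩ | ⟨rfl, rfl⟩ | ⟨rfl, rfl⟩⟩ := ha
  · rcases hs.1.eq_or_lt with rfl | h0
    · exact Or.inl (seg_zero _ _ _)
    · exact Or.inr ⟨(tau_seg_zero h.hx h.hp h.xp h0 hs.2).1, (h.tau_apexA hs).ge⟩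
  · rcases hs.1.eq_or_lt with rfl | h0
    · exact Or.inl (seg_zero _ _ _)
    · exact Or.inr ⟨(tau_seg_zero h.hx h.hy h.xy h0 hs.2).1, (h.tau_apexB hs).ge⟩
  · exact Or.inr ⟨h.futC hs, h.le_tau_apex hs⟩

/-- The bound from below with the right direction of time, for an initial point on a timelike
side. -/
lemma le_tau_of_side (ha : Corr K A B C x' p' y' a a') (hb : Corr K A B C x' p' y' b b')
    (hxa : L.tau (A 0) a ≤ ENNReal.ofReal (LorentzModel.tau K x' a')) (hf : Fut K a' b') :
    ENNReal.ofReal (LorentzModel.tau K a' b') ≤ L.tau a b := by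
  have ma := h.corr_mem ha
  have mb := h.corr_mem hb
  have hd := tau_pos hf ma mb
  have h1 := h.le_tau ha hb (by rwa [hf.sep_eq mb])
  rw [hf.sep_eq mb] at h1
  refine h1.elim id fun h1 => ?_
  -- With the wrong direction, the path from the apex through `b` to `a` would be longer than the
  -- separation of the apex and `a`.
  exfalso
  rcases h.eq_or_le_tau_apex hb with rfl | ⟨hxb, h2⟩
  · rcases h.eq_or_le_tau_apex ha with rfl | ⟨hxa, -⟩
    · simpa using hf.1
    · exact hf.not_fut hxa
  · have h3 := (ofReal_add_le (tau_pos hxb h.hx mb) hd h2 h1).trans hxa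
    rw [ENNReal.ofReal_le_ofReal_iff (tau_nonneg _ _ _)] at h3
    have hb0 := tau_pos hxb h.hx mb
    rcases h.eq_or_le_tau_apex ha with rfl | ⟨hxa', -⟩
    · rw [tau_eq_zero (q := a') ma fun hh => by simpa using hh.1] at h3
      linarith
    · linarith [tau_add_tau_le h.hx ma mb hxa' hf hxb]

lemma le_tau_A {s : ℝ} (hs : s ∈ Icc (0 : ℝ) 1) (hb : Corr K A B C x' p' y' b b')
    (hf : Fut K (seg K x' p' s) b') :
    ENNReal.ofReal (LorentzModel.tau K (seg K x' p' s) b') ≤ L.tau (A s) b :=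
  h.le_tau_of_side (h.corrA hs) hb (h.tau_apexA hs).le hf

lemma le_tau_B {s : ℝ} (hs : s ∈ Icc (0 : ℝ) 1) (hb : Corr K A B C x' p' y' b b')
    (hf : Fut K (seg K x' y' s) b') :
    ENNReal.ofReal (LorentzModel.tau K (seg K x' y' s) b') ≤ L.tau (B s) b :=
  h.le_tau_of_side (h.corrB hs) hb (h.tau_apexB hs).le hf

lemma le_tau_C (hf : Fut K p' y') :
    ENNReal.ofReal (LorentzModel.tau K p' y') ≤ L.tau (C 0) (C 1) := by
  have := h.le_tau_A (s := 1) (by simp) (h.corrB (s := 1) (by simp))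
    (by rwa [seg_one h.jxp, seg_one h.jxy])
  rwa [seg_one h.jxp, seg_one h.jxy, h.AC, h.BC] at this

/-- For an initial point on the third side the separation from the apex is bounded only from below,
so the direction is decided at the other end. The point precedes `y'`, which makes the third side
future-directed timelike. A reversed relation would give a detour along `B` and back to the third
side that reaches the end of `B` later than its length allows. -/
lemma le_tau_CB {s t : ℝ} (hs : s ∈ Icc (0 : ℝ) 1) (ht : t ∈ Icc (0 : ℝ) 1)
    (hf : Fut K (seg K p' y' s) (seg K x' y' t)) :
    ENNReal.ofReal (LorentzModel.tau K (seg K p' y' s) (seg K x' y' t)) ≤ L.tau (C s) (B t) := by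
  have mq := seg_mem h.hp h.jpy s
  have mb := seg_mem h.hx h.jxy t
  have hd := tau_pos hf mq mb
  have hxq := h.futC hs
  have ht0 : 0 < t := by
    rcases ht.1.eq_or_lt with rfl | h0
    · rw [seg_zero] at hf; exact absurd hxq hf.not_fut
    · exact h0
  have hxb := tau_seg_zero h.hx h.hy h.xy ht0 ht.2
  have hqy : Fut K (seg K p' y' s) y' ∧
      LorentzModel.tau K (seg K p' y' s) (seg K x' y' t) + (1 - t) * m ≤
        LorentzModel.tau K (seg K p' y' s) y' := by
    rcases ht.2.eq_or_lt with rfl | h1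
    · rw [seg_one h.jxy] at hf ⊢
      exact ⟨hf, by simp⟩
    · have hby := tau_seg_one h.hx h.hy h.xy ht.1 h1
      have hqy := Fut.trans h.hx mq mb h.hy hxq hxb.1 h.xy hf hby.1
      refine ⟨hqy, ?_⟩
      have := tau_add_tau_le mq mb h.hy hf hby.1 hqy
      rwa [hby.2, h.tauB] at this
  have hs1 : s < 1 := by
    refine lt_of_le_of_ne hs.2 fun e => ?_
    rw [e, seg_one h.jpy] at hqy
    simpa using hqy.1.1
  have he : energy K (LorentzModel.log K p' y') < 0 := by
    have h1 := chord_seg_self h.hp h.jpy s 1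
    rw [seg_one h.jpy] at h1
    have h2 : 0 < ve (K * energy K (LorentzModel.log K p' y')) (1 - s) := by
      refine ve_pos (by linarith) (mul_sq_lt (t := 1) (by positivity)
        (by simpa using h.jpy.isLog.2.1) ?_)
      rw [abs_one, abs_le]; constructor <;> linarith [hs.1]
    have h3 := h1 ▸ hqy.1.1
    exact neg_of_mul_neg_left h3 h2.le
  have hpy : Fut K p' y' := by
    have h1 := h.jpy.isLog.fut_line_iff h.hp he hs (t := 1) (by simp) hs1
    have h2 := h.jpy.isLog.fut_line_iff h.hp he (s := 0) (t := 1) (by simp) (by simp) one_pos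
    rw [← seg_eq_line, ← seg_eq_line, seg_one h.jpy] at h1 h2
    rw [seg_zero] at h2
    exact h2.2 (h1.1 hqy.1)
  have hτ := tau_pos hpy h.hp h.hy
  have hside := h.side (by rwa [hpy.sep_eq h.hy])
  rw [hpy.sep_eq h.hy] at hside
  have hside' : ENNReal.ofReal ((1 - s) * LorentzModel.tau K p' y') ≤ L.tau (C s) (C 1) := by
    refine hside.elim (fun hh => hh s 1 hs.1 hs.2 le_rfl) fun hh => ?_
    have h1 := hh 0 1 le_rfl zero_le_one le_rfl
    rw [sub_zero, one_mul] at h1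
    have h2 := ofReal_add_le hτ hτ (h.le_tau_C hpy) h1
    rw [← h.AC] at h2
    have h3 := ofReal_add_le h.rayA.pos (add_pos hτ hτ) h.rayA.eq.ge h2
    rw [h.rayA.eq, ENNReal.ofReal_le_ofReal_iff h.rayA.pos.le] at h3
    linarith
  have hqy' := tau_seg_one h.hp h.hy hpy hs.1 hs1
  have h1 := h.le_tau (h.corrC hs) (h.corrB ht) (by rwa [hf.sep_eq mb])
  rw [hf.sep_eq mb] at h1
  refine h1.elim id fun h1 => ?_
  have hb0 := mul_pos ht0 h.rayB.pos
  have h2 := ofReal_add_le hb0 hd (h.rayB.tau_zero ht.1 ht.2).ge h1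
  have h3 := ofReal_add_le (add_pos hb0 hd) (mul_pos (by linarith) hτ) h2 hside'
  rw [← h.BC, h.rayB.eq, ENNReal.ofReal_le_ofReal_iff h.rayB.pos.le, ← hqy'.2] at h3
  linarith [hqy.2]

lemma le_tau_CA {s t : ℝ} (hs : s ∈ Icc (0 : ℝ) 1) (ht : t ∈ Icc (0 : ℝ) 1)
    (hf : Fut K (seg K p' y' s) (seg K x' p' t)) :
    ENNReal.ofReal (LorentzModel.tau K (seg K p' y' s) (seg K x' p' t)) ≤ L.tau (C s) (A t) := by
  have := h.swap.le_tau_CB (one_sub_mem hs) ht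
  rw [seg_comm h.hp h.hy h.jpy, sub_sub_cancel] at this
  exact this hf

end Oriented

end LorentzianPreLengthSpace

/-! ### Gluing two oriented triangles, the second based at z in the reversed space -/

namespace LorentzianPreLengthSpace

open LorentzModel

variable {X : Type*} [MetricSpace X] {L : LorentzianPreLengthSpace X} {K T l m l₁ m₁ l₂ m₂ c : ℝ}
  {A B C A₁ B₁ A₂ B₂ : ℝ → X} {x p y p₂ y₂ z x' p' y' z' a' b' : ℝ × ℝ × ℝ} {a b : X}

/-- `a` on the sides `A`, `B` of a triangle corresponds to `a'` on the triangle `Δ(x', p', y')`. -/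
def SideCorr (K : ℝ) (A B : ℝ → X) (x' p' y' : ℝ × ℝ × ℝ) (a : X) (a' : ℝ × ℝ × ℝ) : Prop :=
  ∃ s ∈ Icc (0 : ℝ) 1, (a = A s ∧ a' = seg K x' p' s) ∨ (a = B s ∧ a' = seg K x' y' s)

namespace Oriented

variable (h : Oriented L K A B C x' p' y' l m)
include h

lemma le_tau_of_sideCorr (ha : SideCorr K A B x' p' y' a a') (hb : Corr K A B C x' p' y' b b')
    (hf : Fut K a' b') : ENNReal.ofReal (LorentzModel.tau K a' b') ≤ L.tau a b := by
  obtain ⟨s, hs, ⟨rfl, rfl⟩ | ⟨rfl, rfl⟩⟩ := ha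
  · exact h.le_tau_A hs hb hf
  · exact h.le_tau_B hs hb hf

lemma le_tau_C_sideCorr {s : ℝ} (hs : s ∈ Icc (0 : ℝ) 1) (hb : SideCorr K A B x' p' y' b b')
    (hf : Fut K (seg K p' y' s) b') :
    ENNReal.ofReal (LorentzModel.tau K (seg K p' y' s) b') ≤ L.tau (C s) b := by
  obtain ⟨t, ht, ⟨rfl, rfl⟩ | ⟨rfl, rfl⟩⟩ := hb
  · exact h.le_tau_CA hs ht hf
  · exact h.le_tau_CB hs ht hf

lemma sideCorr_mem (ha : SideCorr K A B x' p' y' a a') : a' ∈ points K := by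
  obtain ⟨s, -, ⟨-, rfl⟩ | ⟨-, rfl⟩⟩ := ha
  · exact seg_mem h.hx h.jxp s
  · exact seg_mem h.hx h.jxy s

end Oriented

lemma SideCorr.corr (ha : SideCorr K A B x' p' y' a a') : Corr K A B C x' p' y' a a' := by
  obtain ⟨s, hs, ha | ha⟩ := ha
  · exact ⟨s, hs, Or.inl ha⟩
  · exact ⟨s, hs, Or.inr (Or.inl ha)⟩

lemma ofReal_le_of_forall_lt {e : ℝ≥0∞} (h : ∀ T' < T, ENNReal.ofReal T' ≤ e) :
    ENNReal.ofReal T ≤ e := by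
  by_contra! hcon
  have he : e ≠ ⊤ := ne_top_of_lt hcon
  rw [← ENNReal.ofReal_toReal he] at hcon h
  have h1 := (ENNReal.ofReal_lt_ofReal_iff_of_nonneg ENNReal.toReal_nonneg).1 hcon
  obtain ⟨r, hr, hr'⟩ := exists_between h1
  have := (ENNReal.ofReal_le_ofReal_iff ENNReal.toReal_nonneg).1 (h r hr')
  linarith

namespace IsRay

lemma of_reverse (h : IsRay L.reverse A l) : IsRay L (fun s => A (1 - s)) l where
  pos := h.pos
  le := fun s t hs hst ht => by
    have := h.le (1 - t) (1 - s) (by linarith) (by linarith) (by linarith)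
    rwa [sub_sub_sub_cancel_left] at this
  eq := by
    have := h.eq
    rwa [sub_zero, sub_self]

lemma le_tau (h : IsRay L A l) (hx : x' ∈ points K) (hy : y' ∈ points K) (hxy : Fut K x' y')
    (hl : LorentzModel.tau K x' y' = l) {s t : ℝ} (hs : s ∈ Icc (0 : ℝ) 1)
    (ht : t ∈ Icc (0 : ℝ) 1) (hf : Fut K (seg K x' y' s) (seg K x' y' t)) :
    ENNReal.ofReal (LorentzModel.tau K (seg K x' y' s) (seg K x' y' t)) ≤ L.tau (A s) (A t) := by
  rcases lt_trichotomy s t with hst | rfl | hst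
  · rw [(tau_seg hx hy hxy hs.1 hst ht.2).2, hl]
    exact h.le s t hs.1 hst.le ht.2
  · simpa using hf.1
  · exact absurd (tau_seg hx hy hxy ht.1 hst hs.2).1 hf.not_fut

end IsRay

section Gluing

variable (h₁ : Oriented L K A₁ B₁ C x p y l₁ m₁)
  (h₂ : Oriented L.reverse K A₂ B₂ C (rev z) (rev p₂) (rev y₂) l₂ m₂)
include h₁ h₂

lemma seg_rev_common (s : ℝ) : seg K (rev p₂) (rev y₂) s = rev (seg K p₂ y₂ s) := by
  have hp : p₂ ∈ points K := by simpa using rev_mem h₂.hp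
  exact seg_rev hp (by simpa using h₂.jpy.rev) s

lemma common_mem (s : ℝ) : seg K p₂ y₂ s ∈ points K := by
  have hp : p₂ ∈ points K := by simpa using rev_mem h₂.hp
  exact seg_mem hp (by simpa using h₂.jpy.rev) s

/-- Both legs of a broken geodesic bound time separations in `X` to the same point of `C`, so the
reverse triangle inequality adds them; then the length tends to the supremum. -/
lemma le_tau_of_crossLE (ha : SideCorr K A₁ B₁ x p y a a')
    (hb : SideCorr K A₂ B₂ (rev z) (rev p₂) (rev y₂) b (rev b'))
    (h : CrossLE K T a' b' p y p₂ y₂) : ENNReal.ofReal T ≤ L.tau a b := by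
  refine ofReal_le_of_forall_lt fun T' hT' => ?_
  obtain ⟨s, ⟨hs, h1, h2⟩, h3⟩ := h T' hT'
  have mb : b' ∈ points K := by simpa using rev_mem (h₂.sideCorr_mem hb)
  have mq := common_mem h₁ h₂ s
  have e1 := h₁.le_tau_of_sideCorr ha (h₁.corrC hs) h1
  have e2 := h₂.le_tau_of_sideCorr hb (h₂.corrC hs)
    (by rw [seg_rev_common h₁ h₂, fut_rev]; exact h2)
  rw [seg_rev_common h₁ h₂, tau_rev mq mb] at e2
  exact (ENNReal.ofReal_le_ofReal h3).trans (ofReal_add_le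
    (tau_pos h1 (h₁.sideCorr_mem ha) (seg_mem h₁.hp h₁.jpy s)) (tau_pos h2 mq mb) e1 e2)

lemma le_tau_of_crossLE_swap (ha : SideCorr K A₂ B₂ (rev z) (rev p₂) (rev y₂) a (rev a'))
    (hb : SideCorr K A₁ B₁ x p y b b') (h : CrossLE K T a' b' p₂ y₂ p y) :
    ENNReal.ofReal T ≤ L.tau a b := by
  refine ofReal_le_of_forall_lt fun T' hT' => ?_
  obtain ⟨s, ⟨hs, h1, h2⟩, h3⟩ := h T' hT'
  have ma : a' ∈ points K := by simpa using rev_mem (h₂.sideCorr_mem ha)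
  have mq := common_mem h₁ h₂ s
  have e1 := h₁.le_tau_C_sideCorr hs hb h2
  have e2 := h₂.le_tau_C_sideCorr hs ha (by rw [seg_rev_common h₁ h₂, fut_rev]; exact h1)
  rw [seg_rev_common h₁ h₂, tau_rev ma mq] at e2
  exact (ENNReal.ofReal_le_ofReal h3).trans (ofReal_add_le
    (tau_pos h1 ma mq) (tau_pos h2 (seg_mem h₁.hp h₁.jpy s) (h₁.sideCorr_mem hb)) e2 e1)

/-- `a` on the glued triangle corresponds to `a'` on the triangle `Δ(x', y', z')`, where `p'`
corresponds to `p`. -/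
def GluedCorr (K : ℝ) (A₁ B₁ A₂ B₂ : ℝ → X) (x' y' z' p' : ℝ × ℝ × ℝ) (a : X)
    (a' : ℝ × ℝ × ℝ) : Prop :=
  ∃ s ∈ Icc (0 : ℝ) 1, (a = B₁ s ∧ a' = seg K x' y' s) ∨ (a = A₁ s ∧ a' = seg K x' p' s) ∨
    (a = A₂ (1 - s) ∧ a' = seg K p' z' s) ∨ (a = B₂ (1 - s) ∧ a' = seg K y' z' s)

variable (h : Glued K x p y p₂ y₂ z x' y' z' c)
include h

lemma sideCorr_pz {r : ℝ} (hr : r ∈ Icc (0 : ℝ) 1) :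
    SideCorr K A₂ B₂ (rev z) (rev p₂) (rev y₂) (A₂ (1 - r)) (rev (seg K p₂ z r)) :=
  ⟨1 - r, one_sub_mem hr, Or.inl ⟨rfl, by rw [h.seg_rev_zp, sub_sub_cancel]⟩⟩

lemma sideCorr_yz {r : ℝ} (hr : r ∈ Icc (0 : ℝ) 1) :
    SideCorr K A₂ B₂ (rev z) (rev p₂) (rev y₂) (B₂ (1 - r)) (rev (seg K y₂ z r)) :=
  ⟨1 - r, one_sub_mem hr, Or.inr ⟨rfl, by rw [h.seg_rev_zy, sub_sub_cancel]⟩⟩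

lemma sideCorr_xp {r : ℝ} (hr : r ∈ Icc (0 : ℝ) 1) :
    SideCorr K A₁ B₁ x p y (A₁ r) (seg K x p r) := ⟨r, hr, Or.inl ⟨rfl, rfl⟩⟩

lemma sideCorr_xy {r : ℝ} (hr : r ∈ Icc (0 : ℝ) 1) :
    SideCorr K A₁ B₁ x p y (B₁ r) (seg K x y r) := ⟨r, hr, Or.inr ⟨rfl, rfl⟩⟩

lemma le_tau_second (ha : SideCorr K A₂ B₂ (rev z) (rev p₂) (rev y₂) a (rev a'))
    (hb : SideCorr K A₂ B₂ (rev z) (rev p₂) (rev y₂) b (rev b')) (hf : Fut K a' b') :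
    ENNReal.ofReal (LorentzModel.tau K a' b') ≤ L.tau a b := by
  have ma : a' ∈ points K := by simpa using rev_mem (h₂.sideCorr_mem ha)
  have mb : b' ∈ points K := by simpa using rev_mem (h₂.sideCorr_mem hb)
  have := h₂.le_tau_of_sideCorr hb ha.corr (fut_rev.2 hf)
  rwa [tau_rev ma mb] at this

lemma le_tau_xy_xy {s t : ℝ} (hs : s ∈ Icc (0 : ℝ) 1) (ht : t ∈ Icc (0 : ℝ) 1)
    (hf : Fut K (seg K x' y' s) (seg K x' y' t)) :
    ENNReal.ofReal (LorentzModel.tau K (seg K x' y' s) (seg K x' y' t)) ≤ L.tau (B₁ s) (B₁ t) :=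
  h₁.rayB.le_tau h.hx' h.hy' h.xy'
    (((chord_eq_iff h.xy h.hx h.hy h.xy' h.hx' h.hy').1 h.exy).symm.trans h₁.tauB) hs ht hf

lemma le_tau_xp_xp {s t : ℝ} (hs : s ∈ Icc (0 : ℝ) 1) (ht : t ∈ Icc (0 : ℝ) 1)
    (hf : Fut K (seg K x' (seg K x' z' c) s) (seg K x' (seg K x' z' c) t)) :
    ENNReal.ofReal (LorentzModel.tau K (seg K x' (seg K x' z' c) s) (seg K x' (seg K x' z' c) t))
      ≤ L.tau (A₁ s) (A₁ t) :=
  h₁.rayA.le_tau h.hx' h.hp' h.xp' (h.tau_xp.symm.trans h₁.tauA) hs ht hf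

lemma tau_pz_ray : LorentzModel.tau K (seg K x' z' c) z' = l₂ := by
  rw [← h.tau_pz, ← tau_rev h.hp₂ h.hz, h₂.tauA]

lemma le_tau_pz_pz {s t : ℝ} (hs : s ∈ Icc (0 : ℝ) 1) (ht : t ∈ Icc (0 : ℝ) 1)
    (hf : Fut K (seg K (seg K x' z' c) z' s) (seg K (seg K x' z' c) z' t)) :
    ENNReal.ofReal (LorentzModel.tau K (seg K (seg K x' z' c) z' s) (seg K (seg K x' z' c) z' t))
      ≤ L.tau (A₂ (1 - s)) (A₂ (1 - t)) :=
  h₂.rayA.of_reverse.le_tau h.hp' h.hz' h.pz' (tau_pz_ray h₁ h₂ h) hs ht hf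

lemma le_tau_yz_yz {s t : ℝ} (hs : s ∈ Icc (0 : ℝ) 1) (ht : t ∈ Icc (0 : ℝ) 1)
    (hf : Fut K (seg K y' z' s) (seg K y' z' t)) :
    ENNReal.ofReal (LorentzModel.tau K (seg K y' z' s) (seg K y' z' t))
      ≤ L.tau (B₂ (1 - s)) (B₂ (1 - t)) := by
  refine h₂.rayB.of_reverse.le_tau h.hy' h.hz' h.yz' ?_ hs ht hf
  rw [← (chord_eq_iff h.yz h.hy₂ h.hz h.yz' h.hy' h.hz').1 h.eyz, ← tau_rev h.hy₂ h.hz, h₂.tauB]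

/-- Both comparison points lie on one geodesic through the point of parameter `c`, and in `X` the
two rays meet there, so lengths add on both sides. -/
lemma le_tau_xp_pz {s t : ℝ} (hs : s ∈ Icc (0 : ℝ) 1) (ht : t ∈ Icc (0 : ℝ) 1)
    (hf : Fut K (seg K x' (seg K x' z' c) s) (seg K (seg K x' z' c) z' t)) :
    ENNReal.ofReal (LorentzModel.tau K (seg K x' (seg K x' z' c) s) (seg K (seg K x' z' c) z' t))
      ≤ L.tau (A₁ s) (A₂ (1 - t)) := by
  obtain ⟨jxy, jxp, jpz, jyz, jxy', jyz', jxp', jpz'⟩ := h.joins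
  have hA : A₂ 1 = A₁ 1 := h₂.AC.trans h₁.AC.symm
  rcases hs.2.eq_or_lt with rfl | hs1
  · have := le_tau_pz_pz h₁ h₂ h (s := 0) (by simp) ht
    rw [seg_zero, sub_zero, hA] at this
    rw [seg_one jxp'] at hf ⊢
    exact this hf
  rcases ht.1.eq_or_lt with rfl | ht0
  · rw [sub_zero, hA]
    have := le_tau_xp_xp h₁ h₂ h (t := 1) hs (by simp)
    rw [seg_one jxp'] at this
    rw [seg_zero] at hf ⊢
    exact this hf
  have h1 := h₁.rayA.le s 1 hs.1 hs.2 le_rfl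
  have h2 := h₂.rayA.of_reverse.le 0 t le_rfl ht.1 ht.2
  rw [sub_zero, sub_zero, hA] at h2
  have hl₁ := h₁.rayA.pos
  have hl₂ := h₂.rayA.pos
  refine _root_.le_trans (ENNReal.ofReal_le_ofReal ?_) (ofReal_add_le (mul_pos (by linarith) hl₁)
    (mul_pos ht0 hl₂) h1 h2)
  have e1 := h.tau_xp_eq
  have e2 := h.tau_pz_eq
  rw [h₁.tauA] at e1
  rw [h.tau_pz, tau_pz_ray h₁ h₂ h] at e2
  have c0 := h.hc.1
  have c1 := h.hc.2
  have g1 : s * c < c := mul_lt_of_lt_one_left c0 hs1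
  have g2 : 0 < t * (1 - c) := mul_pos ht0 (by linarith)
  have g3 : t * (1 - c) ≤ 1 - c := mul_le_of_le_one_left (by linarith) ht.2
  rw [h.seg_xp', h.seg_pz', (tau_seg h.hx' h.hz' h.xz' (mul_nonneg hs.1 c0.le) (by linarith)
    (by linarith)).2, e1, e2]
  exact le_of_eq (by ring)

lemma le_tau_xy_xp {s t : ℝ} (hs : s ∈ Icc (0 : ℝ) 1) (ht : t ∈ Icc (0 : ℝ) 1)
    (hf : Fut K (seg K x' y' s) (seg K x' (seg K x' z' c) t)) :
    ENNReal.ofReal (LorentzModel.tau K (seg K x' y' s) (seg K x' (seg K x' z' c) t))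
      ≤ L.tau (B₁ s) (A₁ t) := by
  obtain ⟨h1, h2⟩ := h.fut_xy_xp ht hs hf
  exact (ENNReal.ofReal_le_ofReal h2).trans (h₁.le_tau_B hs (h₁.corrA ht) h1)

lemma le_tau_xp_xy {s t : ℝ} (hs : s ∈ Icc (0 : ℝ) 1) (ht : t ∈ Icc (0 : ℝ) 1)
    (hf : Fut K (seg K x' (seg K x' z' c) s) (seg K x' y' t)) :
    ENNReal.ofReal (LorentzModel.tau K (seg K x' (seg K x' z' c) s) (seg K x' y' t))
      ≤ L.tau (A₁ s) (B₁ t) := by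
  obtain ⟨h1, h2⟩ := h.fut_xp_xy hs ht hf
  exact (ENNReal.ofReal_le_ofReal h2).trans (h₁.le_tau_A hs (h₁.corrB ht) h1)

lemma le_tau_pz_yz {s t : ℝ} (hs : s ∈ Icc (0 : ℝ) 1) (ht : t ∈ Icc (0 : ℝ) 1)
    (hf : Fut K (seg K (seg K x' z' c) z' s) (seg K y' z' t)) :
    ENNReal.ofReal (LorentzModel.tau K (seg K (seg K x' z' c) z' s) (seg K y' z' t))
      ≤ L.tau (A₂ (1 - s)) (B₂ (1 - t)) := by
  obtain ⟨h1, h2⟩ := h.fut_pz_yz hs ht hf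
  exact (ENNReal.ofReal_le_ofReal h2).trans
    (le_tau_second h₁ h₂ h (sideCorr_pz h₁ h₂ h hs) (sideCorr_yz h₁ h₂ h ht) h1)

lemma le_tau_yz_pz {s t : ℝ} (hs : s ∈ Icc (0 : ℝ) 1) (ht : t ∈ Icc (0 : ℝ) 1)
    (hf : Fut K (seg K y' z' s) (seg K (seg K x' z' c) z' t)) :
    ENNReal.ofReal (LorentzModel.tau K (seg K y' z' s) (seg K (seg K x' z' c) z' t))
      ≤ L.tau (B₂ (1 - s)) (A₂ (1 - t)) := by
  obtain ⟨h1, h2⟩ := h.fut_yz_pz ht hs hf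
  exact (ENNReal.ofReal_le_ofReal h2).trans
    (le_tau_second h₁ h₂ h (sideCorr_yz h₁ h₂ h hs) (sideCorr_pz h₁ h₂ h ht) h1)

/-- At a vertex shared by the two triangles the comparison within one of them suffices; elsewhere
the crossing estimate applies. The other mixed pairs are treated alike. -/
lemma le_tau_xy_pz {s t : ℝ} (hs : s ∈ Icc (0 : ℝ) 1) (ht : t ∈ Icc (0 : ℝ) 1)
    (hf : Fut K (seg K x' y' s) (seg K (seg K x' z' c) z' t)) :
    ENNReal.ofReal (LorentzModel.tau K (seg K x' y' s) (seg K (seg K x' z' c) z' t))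
      ≤ L.tau (B₁ s) (A₂ (1 - t)) := by
  obtain ⟨jxy, jxp, jpz, jyz, jxy', jyz', jxp', jpz'⟩ := h.joins
  rcases hs.2.eq_or_lt with rfl | hs1
  · have := le_tau_yz_pz h₁ h₂ h (s := 0) (by simp) ht
    rw [seg_zero, sub_zero, h₂.BC, ← h₁.BC] at this
    rw [seg_one jxy'] at hf ⊢
    exact this hf
  rcases ht.1.eq_or_lt with rfl | ht0
  · have := le_tau_xy_xp h₁ h₂ h (t := 1) hs (by simp)
    rw [seg_one jxp', h₁.AC, ← h₂.AC] at this
    rw [seg_zero] at hf ⊢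
    rw [sub_zero]
    exact this hf
  exact le_tau_of_crossLE h₁ h₂ (sideCorr_xy h₁ h₂ h hs) (sideCorr_pz h₁ h₂ h ht)
    (h.crossLE_xy_pz ⟨hs.1, hs1⟩ ⟨ht0, ht.2⟩ hf)

lemma le_tau_xp_yz {s t : ℝ} (hs : s ∈ Icc (0 : ℝ) 1) (ht : t ∈ Icc (0 : ℝ) 1)
    (hf : Fut K (seg K x' (seg K x' z' c) s) (seg K y' z' t)) :
    ENNReal.ofReal (LorentzModel.tau K (seg K x' (seg K x' z' c) s) (seg K y' z' t))
      ≤ L.tau (A₁ s) (B₂ (1 - t)) := by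
  obtain ⟨jxy, jxp, jpz, jyz, jxy', jyz', jxp', jpz'⟩ := h.joins
  rcases hs.2.eq_or_lt with rfl | hs1
  · have := le_tau_pz_yz h₁ h₂ h (s := 0) (by simp) ht
    rw [seg_zero, sub_zero, h₂.AC, ← h₁.AC] at this
    rw [seg_one jxp'] at hf ⊢
    exact this hf
  rcases ht.1.eq_or_lt with rfl | ht0
  · have := le_tau_xp_xy h₁ h₂ h (t := 1) hs (by simp)
    rw [seg_one jxy', h₁.BC, ← h₂.BC] at this
    rw [seg_zero K y'] at hf ⊢
    rw [sub_zero]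
    exact this hf
  exact le_tau_of_crossLE h₁ h₂ (sideCorr_xp h₁ h₂ h hs) (sideCorr_yz h₁ h₂ h ht)
    (h.crossLE_xp_yz ⟨hs.1, hs1⟩ ⟨ht0, ht.2⟩ hf)

lemma le_tau_xy_yz {s t : ℝ} (hs : s ∈ Icc (0 : ℝ) 1) (ht : t ∈ Icc (0 : ℝ) 1)
    (hf : Fut K (seg K x' y' s) (seg K y' z' t)) :
    ENNReal.ofReal (LorentzModel.tau K (seg K x' y' s) (seg K y' z' t))
      ≤ L.tau (B₁ s) (B₂ (1 - t)) := by
  obtain ⟨jxy, jxp, jpz, jyz, jxy', jyz', jxp', jpz'⟩ := h.joins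
  rcases hs.2.eq_or_lt with rfl | hs1
  · have := le_tau_yz_yz h₁ h₂ h (s := 0) (by simp) ht
    rw [seg_zero, sub_zero, h₂.BC, ← h₁.BC] at this
    rw [seg_one jxy'] at hf ⊢
    exact this hf
  rcases ht.1.eq_or_lt with rfl | ht0
  · have := le_tau_xy_xy h₁ h₂ h (t := 1) hs (by simp)
    rw [seg_one jxy', h₁.BC, ← h₂.BC] at this
    rw [seg_zero K y'] at hf ⊢
    rw [sub_zero]
    exact this hf
  exact le_tau_of_crossLE h₁ h₂ (sideCorr_xy h₁ h₂ h hs) (sideCorr_yz h₁ h₂ h ht)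
    (h.crossLE_xy_yz ⟨hs.1, hs1⟩ ⟨ht0, ht.2⟩ hf)

lemma le_tau_pz_xy {s t : ℝ} (hs : s ∈ Icc (0 : ℝ) 1) (ht : t ∈ Icc (0 : ℝ) 1)
    (hf : Fut K (seg K (seg K x' z' c) z' s) (seg K x' y' t)) :
    ENNReal.ofReal (LorentzModel.tau K (seg K (seg K x' z' c) z' s) (seg K x' y' t))
      ≤ L.tau (A₂ (1 - s)) (B₁ t) := by
  obtain ⟨jxy, jxp, jpz, jyz, jxy', jyz', jxp', jpz'⟩ := h.joins
  rcases ht.2.eq_or_lt with rfl | ht1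
  · have := le_tau_pz_yz h₁ h₂ h (t := 0) hs (by simp)
    rw [seg_zero K y', sub_zero, h₂.BC, ← h₁.BC] at this
    rw [seg_one jxy'] at hf ⊢
    exact this hf
  exact le_tau_of_crossLE_swap h₁ h₂ (sideCorr_pz h₁ h₂ h hs) (sideCorr_xy h₁ h₂ h ht)
    (h.crossLE_pz_xy hs ⟨ht.1, ht1⟩ hf)

lemma le_tau_yz_xp {s t : ℝ} (hs : s ∈ Icc (0 : ℝ) 1) (ht : t ∈ Icc (0 : ℝ) 1)
    (hf : Fut K (seg K y' z' s) (seg K x' (seg K x' z' c) t)) :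
    ENNReal.ofReal (LorentzModel.tau K (seg K y' z' s) (seg K x' (seg K x' z' c) t))
      ≤ L.tau (B₂ (1 - s)) (A₁ t) := by
  obtain ⟨jxy, jxp, jpz, jyz, jxy', jyz', jxp', jpz'⟩ := h.joins
  rcases hs.1.eq_or_lt with rfl | hs0
  · have := le_tau_xy_xp h₁ h₂ h (s := 1) (by simp) ht
    rw [seg_one jxy', h₁.BC, ← h₂.BC] at this
    rw [seg_zero K y'] at hf ⊢
    rw [sub_zero]
    exact this hf
  exact le_tau_of_crossLE_swap h₁ h₂ (sideCorr_yz h₁ h₂ h hs) (sideCorr_xp h₁ h₂ h ht)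
    (h.crossLE_yz_xp ⟨hs0, hs.2⟩ ht hf)

lemma not_fut_pz_xp {s t : ℝ} (hs : s ∈ Icc (0 : ℝ) 1) (ht : t ∈ Icc (0 : ℝ) 1) :
    ¬ Fut K (seg K (seg K x' z' c) z' s) (seg K x' (seg K x' z' c) t) := by
  intro hf
  have c0 := h.hc.1
  have c1 := h.hc.2
  have g1 : t * c ≤ c := mul_le_of_le_one_left c0.le ht.2
  have g2 : 0 ≤ s * (1 - c) := mul_nonneg hs.1 (by linarith)
  have g3 : s * (1 - c) ≤ 1 - c := mul_le_of_le_one_left (by linarith) hs.2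
  rw [h.seg_xp', h.seg_pz'] at hf
  rcases (show t * c ≤ c + s * (1 - c) by linarith).eq_or_lt with e | hlt
  · rw [e] at hf
    simpa using hf.1
  · exact hf.not_fut (tau_seg h.hx' h.hz' h.xz' (mul_nonneg ht.1 c0.le) hlt (by linarith)).1

/-- The curvature bound for the glued triangle. -/
theorem le_tau_of_gluedCorr (ha : GluedCorr K A₁ B₁ A₂ B₂ x' y' z' (seg K x' z' c) a a')
    (hb : GluedCorr K A₁ B₁ A₂ B₂ x' y' z' (seg K x' z' c) b b') (hf : Fut K a' b') :
    ENNReal.ofReal (LorentzModel.tau K a' b') ≤ L.tau a b := by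
  obtain ⟨s, hs, ⟨rfl, rfl⟩ | ⟨rfl, rfl⟩ | ⟨rfl, rfl⟩ | ⟨rfl, rfl⟩⟩ := ha <;>
  obtain ⟨t, ht, ⟨rfl, rfl⟩ | ⟨rfl, rfl⟩ | ⟨rfl, rfl⟩ | ⟨rfl, rfl⟩⟩ := hb
  · exact le_tau_xy_xy h₁ h₂ h hs ht hf
  · exact le_tau_xy_xp h₁ h₂ h hs ht hf
  · exact le_tau_xy_pz h₁ h₂ h hs ht hf
  · exact le_tau_xy_yz h₁ h₂ h hs ht hf
  · exact le_tau_xp_xy h₁ h₂ h hs ht hf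
  · exact le_tau_xp_xp h₁ h₂ h hs ht hf
  · exact le_tau_xp_pz h₁ h₂ h hs ht hf
  · exact le_tau_xp_yz h₁ h₂ h hs ht hf
  · exact le_tau_pz_xy h₁ h₂ h hs ht hf
  · exact absurd hf (not_fut_pz_xp h₁ h₂ h hs ht)
  · exact le_tau_pz_pz h₁ h₂ h hs ht hf
  · exact le_tau_pz_yz h₁ h₂ h hs ht hf
  · exact absurd hf (h.not_fut_yz_xy hs ht)
  · exact le_tau_yz_xp h₁ h₂ h hs ht hf
  · exact le_tau_yz_pz h₁ h₂ h hs ht hf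
  · exact le_tau_yz_yz h₁ h₂ h hs ht hf

end Gluing

end LorentzianPreLengthSpace

/-! ### From the Alexander-Bishop bound to comparable triangles -/

namespace Spacetime

open LorentzModel LorentzianPreLengthSpace

variable {E : Type*} [NormedAddCommGroup E] [NormedSpace ℝ E] [FiniteDimensional ℝ E]
  {M : Type*} [TopologicalSpace M] [ChartedSpace E M] [IsManifold 𝓘(ℝ, E) ∞ M]
  (S : Spacetime E M) {X : Type*} [MetricSpace X] {L : LorentzianPreLengthSpace X}

lemma mem_trianglePoints {σ : Fin 3 → ℝ → M} (j : Fin 3) {s : ℝ} (hs : s ∈ Icc (0 : ℝ) 1) :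
    σ j s ∈ trianglePoints σ := mem_iUnion.2 ⟨j, s, hs, rfl⟩

/-- A timelike pair in the model has negative signed distance, so the curvature bound makes the
signed distance in the spacetime at least as negative, and this becomes time separation in one
direction. The map `φ` transports it to `X`; the second alternative in `hφ` serves the reversed
space. The index `i` selects the apex, and `B` runs backwards along its side so that `A` and `B`
both start there. -/
theorem comparable {N : Set M} (hN : S.IsNormalNeighbourhood N) {σ : Fin 3 → ℝ → M}
    (hσ : ∀ j, S.IsGeodesicIn N (σ j) (σ j 0) (σ j 1)) (hcyc : ∀ j, σ j 1 = σ (j + 1) 0)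
    {φ : M → X}
    (hφ : (∀ a ∈ trianglePoints σ, ∀ b ∈ trianglePoints σ, S.tau a b ≤ L.tau (φ a) (φ b)) ∨
      (∀ a ∈ trianglePoints σ, ∀ b ∈ trianglePoints σ, S.tau a b ≤ L.tau (φ b) (φ a)))
    {K : ℝ} {v : Fin 3 → ℝ × ℝ × ℝ}
    (hv : ∀ i, v i ∈ LorentzModel.points K ∧ LorentzModel.Joined K (v i) (v (i + 1)) ∧
      S.signedDist N (σ i 0) (σ i 1) = LorentzModel.signedDist K (v i) (v (i + 1)))
    (hle : ∀ i j, ∀ s ∈ Icc (0 : ℝ) 1, ∀ t ∈ Icc (0 : ℝ) 1,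
      S.signedDist N (σ i s) (σ j t) ≤
        LorentzModel.signedDist K (LorentzModel.seg K (v i) (v (i + 1)) s)
          (LorentzModel.seg K (v j) (v (j + 1)) t))
    (i : Fin 3) {A B C : ℝ → X} (hA : ∀ s ∈ Icc (0 : ℝ) 1, A s = φ (σ i s))
    (hB : ∀ s ∈ Icc (0 : ℝ) 1, B s = φ (σ (i + 2) (1 - s)))
    (hC : ∀ s ∈ Icc (0 : ℝ) 1, C s = φ (σ (i + 1) s)) {l m : ℝ}
    (rayA : IsRay L A l) (rayB : IsRay L B m) (dA : S.signedDist N (σ i 0) (σ i 1) = -l)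
    (dB : S.signedDist N (σ (i + 2) 0) (σ (i + 2) 1) = -m) :
    Comparable L K A B C (v i) (v (i + 1)) (v (i + 2)) l m := by
  have e1 : i + 1 + 1 = i + 2 := (by decide : ∀ j : Fin 3, j + 1 + 1 = j + 2) i
  have e2 : i + 2 + 1 = i := (by decide : ∀ j : Fin 3, j + 2 + 1 = j) i
  have h0 : (0 : ℝ) ∈ Icc (0 : ℝ) 1 := by simp
  have h1 : (1 : ℝ) ∈ Icc (0 : ℝ) 1 := by simp
  have hmem : ∀ j, ∀ s ∈ Icc (0 : ℝ) 1, seg K (v j) (v (j + 1)) s ∈ points K := fun j s _ =>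
    seg_mem (hv j).1 (hv j).2.1 s
  have hj := (hv (i + 2)).2
  rw [e2] at hj
  have hj₁ := (hv (i + 1)).2
  rw [e1] at hj₁
  have hcorr : ∀ {a a'}, Corr K A B C (v i) (v (i + 1)) (v (i + 2)) a a' →
      ∃ j, ∃ s ∈ Icc (0 : ℝ) 1, a = φ (σ j s) ∧ a' = seg K (v j) (v (j + 1)) s := by
    rintro a a' ⟨s, hs, ⟨rfl, rfl⟩ | ⟨rfl, rfl⟩ | ⟨rfl, rfl⟩⟩
    · exact ⟨i, s, hs, hA s hs, rfl⟩
    · exact ⟨i + 2, 1 - s, one_sub_mem hs, hB s hs, by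
        rw [e2, seg_comm (hv _).1 (hv i).1 hj.1]⟩
    · exact ⟨i + 1, s, hs, hC s hs, by rw [e1]⟩
  have hsep : ∀ j k, ∀ s ∈ Icc (0 : ℝ) 1, ∀ t ∈ Icc (0 : ℝ) 1,
      0 < sep K (seg K (v j) (v (j + 1)) s) (seg K (v k) (v (k + 1)) t) →
      S.signedDist N (σ j s) (σ k t) ≤
        -sep K (seg K (v j) (v (j + 1)) s) (seg K (v k) (v (k + 1)) t) := by
    intro j k s hs t ht hpos
    rw [← signedDist_of_sep_pos (hmem j s hs) (hmem k t ht) hpos]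
    exact hle j k s hs t ht
  refine ⟨(hv i).1, (hv (i + 1)).1, (hv (i + 2)).1, (hv i).2.1, hj.1.symm (hv _).1 (hv i).1,
    hj₁.1, rayA, rayB, ?_, ?_, ?_, ?_, ?_, ?_, ?_, ?_⟩
  · rw [hA 0 h0, hB 0 h0, sub_zero, hcyc, e2]
  · rw [hA 1 h1, hC 0 h0, hcyc]
  · rw [hC 1 h1, hB 1 h1, sub_self, hcyc, e1]
  · have h := (hv i).2.2
    rw [dA] at h
    rw [sep_of_signedDist_neg (hv i).1 (hv _).1 (by rw [← h]; linarith [rayA.pos]), ← h, neg_neg]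
  · have h := hj.2
    rw [dB] at h
    rw [sep_comm, sep_of_signedDist_neg (hv _).1 (hv i).1 (by rw [← h]; linarith [rayB.pos]), ← h,
      neg_neg]
  · intro a b a' b' ha hb hpos
    obtain ⟨j, s, hs, rfl, rfl⟩ := hcorr ha
    obtain ⟨k, t, ht, rfl, rfl⟩ := hcorr hb
    have hd := hsep j k s hs t ht hpos
    -- A single pair is treated as a constant family.
    have h := S.le_tau_or_le_tau hN ((hσ j).2.1 hs) (q := fun _ => σ k t) continuousOn_const
      (fun _ _ => (hσ k).2.1 ht) fun _ _ => by linarith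
    have hr := ENNReal.ofReal_le_ofReal (le_neg_of_le_neg hd)
    have hj := mem_trianglePoints (σ := σ) j hs
    have hk := mem_trianglePoints (σ := σ) k ht
    rcases h with h | h <;> rcases hφ with hφ | hφ
    · exact Or.inl (hr.trans ((h 0 h0).trans (hφ _ hj _ hk)))
    · exact Or.inr (hr.trans ((h 0 h0).trans (hφ _ hj _ hk)))
    · exact Or.inr (hr.trans ((h 0 h0).trans (hφ _ hk _ hj)))
    · exact Or.inl (hr.trans ((h 0 h0).trans (hφ _ hk _ hj)))
  · intro hpos
    have hd : ∀ s ∈ Icc (0 : ℝ) 1, S.signedDist N (σ i 0) (σ (i + 1) s) ≤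
        -sep K (v i) (seg K (v (i + 1)) (v (i + 2)) s) := fun s hs => by
      have := hsep i (i + 1) 0 h0 s hs
      rw [seg_zero, e1] at this
      exact this (hpos s hs)
    have h := S.le_tau_or_le_tau hN ((hσ i).2.1 h0) (hσ (i + 1)).1.1.continuousOn
      (hσ (i + 1)).2.1 fun s hs => by linarith [hd s hs, hpos s hs]
    have hr := fun s hs => ENNReal.ofReal_le_ofReal (le_neg_of_le_neg (hd s hs))
    have hi := mem_trianglePoints (σ := σ) i h0
    have hk := fun s hs => mem_trianglePoints (σ := σ) (i + 1) (s := s) hs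
    rw [hA 0 h0]
    rcases h with h | h <;> rcases hφ with hφ | hφ
    · exact Or.inl fun s hs => hC s hs ▸ (hr s hs).trans ((h s hs).trans (hφ _ hi _ (hk s hs)))
    · exact Or.inr fun s hs => hC s hs ▸ (hr s hs).trans ((h s hs).trans (hφ _ hi _ (hk s hs)))
    · exact Or.inr fun s hs => hC s hs ▸ (hr s hs).trans ((h s hs).trans (hφ _ (hk s hs) _ hi))
    · exact Or.inl fun s hs => hC s hs ▸ (hr s hs).trans ((h s hs).trans (hφ _ (hk s hs) _ hi))
  · intro hpos
    have hd := hj₁.2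
    rw [signedDist_of_sep_pos (hv _).1 (hv _).1 hpos] at hd
    have h := IsGeodesicIn.le_tau_or_le_tau S hN (hσ (i + 1)) (by linarith)
    rw [hd, neg_neg] at h
    have hk := fun s hs => mem_trianglePoints (σ := σ) (i + 1) (s := s) hs
    have hI : ∀ {s t : ℝ}, 0 ≤ s → s ≤ t → t ≤ 1 → s ∈ Icc (0 : ℝ) 1 ∧ t ∈ Icc (0 : ℝ) 1 :=
      fun hs hst ht => ⟨⟨hs, hst.trans ht⟩, hs.trans hst, ht⟩
    rcases h with h | h <;> rcases hφ with hφ | hφ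
    · refine Or.inl fun s t hs hst ht => ?_
      obtain ⟨is, it⟩ := hI hs hst ht
      rw [hC s is, hC t it]
      exact (h s t hs hst ht).trans (hφ _ (hk s is) _ (hk t it))
    · refine Or.inr fun s t hs hst ht => ?_
      obtain ⟨is, it⟩ := hI hs hst ht
      rw [hC s is, hC t it]
      exact (h s t hs hst ht).trans (hφ _ (hk s is) _ (hk t it))
    · refine Or.inr fun s t hs hst ht => ?_
      obtain ⟨is, it⟩ := hI hs hst ht
      rw [hC s is, hC t it]
      exact (h s t hs hst ht).trans (hφ _ (hk t it) _ (hk s is))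
    · refine Or.inl fun s t hs hst ht => ?_
      obtain ⟨is, it⟩ := hI hs hst ht
      rw [hC s is, hC t it]
      exact (h s t hs hst ht).trans (hφ _ (hk t it) _ (hk s is))

end Spacetime

/-! ### The glued model configuration and its comparison points -/

namespace LorentzianPreLengthSpace

open LorentzModel

variable {X : Type*} [MetricSpace X] {L : LorentzianPreLengthSpace X} {K l m l₁ m₁ l₂ m₂ : ℝ}
  {A B C A₁ B₁ A₂ B₂ : ℝ → X} {x p y p₂ y₂ z x' p' y' z' a' : ℝ × ℝ × ℝ} {a : X}

lemma IsRay.not_le_le (h : IsRay L A l) {b c : X} (hA : A 1 = b) {r s : ℝ} (hr : 0 < r)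
    (hs : 0 < s) (h1 : ENNReal.ofReal r ≤ L.tau b c) (h2 : ENNReal.ofReal s ≤ L.tau c b) :
    False := by
  have h3 := ofReal_add_le h.pos (add_pos hr hs) h.eq.ge (hA ▸ ofReal_add_le hr hs h1 h2)
  rw [h.eq, ENNReal.ofReal_le_ofReal_iff h.pos.le] at h3
  linarith

/-- The parameter of a comparison point. -/
lemma IsRay.eq_of_tau_eq (h : IsRay L A l) (hx : x' ∈ points K) (hy : y' ∈ points K)
    (hxy : Fut K x' y') (hl : LorentzModel.tau K x' y' = l) {s t : ℝ} (hs : s ∈ Icc (0 : ℝ) 1)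
    (ht : t ∈ Icc (0 : ℝ) 1)
    (he : ENNReal.ofReal (LorentzModel.tau K x' (seg K x' y' s)) = L.tau (A 0) (A t)) : s = t := by
  have h1 : LorentzModel.tau K x' (seg K x' y' s) = s * l := by
    rcases hs.1.eq_or_lt with rfl | h0
    · rw [seg_zero, tau_eq_zero hx fun hh => by simpa using hh.1, zero_mul]
    · rw [(tau_seg_zero hx hy hxy h0 hs.2).2, hl]
  rw [h1, h.tau_zero ht.1 ht.2, ENNReal.ofReal_eq_ofReal_iff (mul_nonneg hs.1 h.pos.le)
    (mul_nonneg ht.1 h.pos.le)] at he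
  exact mul_right_cancel₀ h.pos.ne' he

section Gluing

variable (h₁ : Oriented L K A₁ B₁ C x p y l₁ m₁)
  (h₂ : Oriented L.reverse K A₂ B₂ C (rev z) (rev p₂) (rev y₂) l₂ m₂)
  (hx' : x' ∈ points K) (hy' : y' ∈ points K) (hz' : z' ∈ points K)
  (txy : LorentzModel.tau K x' y' = m₁) (tyz : LorentzModel.tau K y' z' = m₂)
  (txz : LorentzModel.tau K x' z' = l₁ + l₂)
  (hxz : L.tau (A₁ 0) (A₂ 0) = ENNReal.ofReal (l₁ + l₂))
include h₁ h₂ hx' hy' hz' txy tyz txz hxz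

/-- In each plane the time orientation of the common side is witnessed by a time separation between
the ends of `C`, and `X` cannot have both directions; so the orientations agree. The crossing bound
is the reverse triangle inequality in `X` through a point of `C`, together with the exact separation
of the outer vertices. -/
lemma glued (hc : chord K p y = chord K p₂ y₂) :
    Glued K x p y p₂ y₂ z x' y' z' (l₁ / (l₁ + l₂)) := by
  have l₁0 := h₁.rayA.pos
  have l₂0 := h₂.rayA.pos
  have hp₂ : p₂ ∈ points K := by simpa using rev_mem h₂.hp
  have hy₂ : y₂ ∈ points K := by simpa using rev_mem h₂.hy
  have hz : z ∈ points K := by simpa using rev_mem h₂.hx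
  have fxy := fut_of_tau_pos hx' (txy ▸ h₁.rayB.pos)
  have fyz := fut_of_tau_pos hy' (tyz ▸ h₂.rayB.pos)
  have fxz := fut_of_tau_pos hx' (txz ▸ add_pos l₁0 l₂0)
  have hcI : l₁ / (l₁ + l₂) ∈ Ioo (0 : ℝ) 1 :=
    ⟨by positivity, (div_lt_one (by positivity)).2 (by linarith)⟩
  have jxz := fxz.joined hx' hz'
  have s1 := tau_seg_zero hx' hz' fxz hcI.1 hcI.2.le
  have s2 := tau_seg_one hx' hz' fxz hcI.1.le hcI.2
  have pz := fut_rev.1 h₂.xp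
  have yz := fut_rev.1 h₂.xy
  have tp := h₂.tauA
  have ty := h₂.tauB
  rw [tau_rev hp₂ hz] at tp
  rw [tau_rev hy₂ hz] at ty
  have jpy : K * chord K p y < 2 := (joined_iff h₁.hp h₁.hy).1 h₁.jpy
  -- Each of the four possible timelike orientations gives a positive separation in `X` in the
  -- corresponding direction.
  have f1 : Fut K p y → ∃ r > 0, ENNReal.ofReal r ≤ L.tau (C 0) (C 1) := fun hf =>
    ⟨_, tau_pos hf h₁.hp h₁.hy, h₁.le_tau_C hf⟩
  have f2 : Fut K y p → ∃ r > 0, ENNReal.ofReal r ≤ L.tau (C 1) (C 0) := fun hf =>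
    ⟨_, tau_pos hf h₁.hy h₁.hp, by simpa using h₁.swap.le_tau_C hf⟩
  have f3 : Fut K y₂ p₂ → ∃ r > 0, ENNReal.ofReal r ≤ L.tau (C 1) (C 0) := fun hf =>
    ⟨_, tau_pos (fut_rev.2 hf) h₂.hp h₂.hy, h₂.le_tau_C (fut_rev.2 hf)⟩
  have f4 : Fut K p₂ y₂ → ∃ r > 0, ENNReal.ofReal r ≤ L.tau (C 0) (C 1) := fun hf =>
    ⟨_, tau_pos (fut_rev.2 hf) h₂.hy h₂.hp, by
      have := h₂.swap.le_tau_C (fut_rev.2 hf)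
      rwa [sub_zero, sub_self] at this⟩
  have hnot : (∃ r > 0, ENNReal.ofReal r ≤ L.tau (C 0) (C 1)) →
      ¬ ∃ r > 0, ENNReal.ofReal r ≤ L.tau (C 1) (C 0) := by
    rintro ⟨r, hr, h1⟩ ⟨s, hs, h2⟩
    exact h₁.rayA.not_le_le h₁.AC hr hs h1 h2
  have alt : ∀ {q r q' r'}, q ∈ points K → r ∈ points K → chord K q r = chord K q' r' →
      K * chord K q r < 2 → Fut K q' r' → Fut K q r ∨ Fut K r q := fun hq hr he hk hf =>
    fut_or_fut hq hr (he ▸ hf.1) hk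
  refine ⟨h₁.hx, h₁.hp, h₁.hy, hp₂, hy₂, hz, hx', hy', hz', hcI, h₁.xp, h₁.xy, pz, yz, fxy, fyz,
    fxz, ?_, ?_, ?_, ?_, hc, jpy, ⟨fun hf => ?_, fun hf => ?_⟩, ⟨fun hf => ?_, fun hf => ?_⟩, ?_⟩
  · rw [chord_eq_iff h₁.xy h₁.hx h₁.hy fxy hx' hy', h₁.tauB, txy]
  · rw [chord_eq_iff yz hy₂ hz fyz hy' hz', ty, tyz]
  · rw [chord_eq_iff h₁.xp h₁.hx h₁.hp s1.1 hx' (seg_mem hx' jxz _), h₁.tauA, s1.2, txz]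
    field_simp
  · rw [chord_eq_iff pz hp₂ hz s2.1 (seg_mem hx' jxz _) hz', tp, s2.2, txz]
    field_simp
    ring
  · exact (alt hp₂ hy₂ hc.symm (hc ▸ jpy) hf).resolve_right fun hf' => hnot (f1 hf) (f3 hf')
  · exact (alt h₁.hp h₁.hy hc jpy hf).resolve_right fun hf' => hnot (f4 hf) (f2 hf')
  · exact (alt hy₂ hp₂ (by rw [chord_comm, ← hc, chord_comm]) (by rw [chord_comm, ← hc]; exact jpy)
      hf).resolve_right fun hf' => hnot (f4 hf') (f2 hf)
  · exact (alt h₁.hy h₁.hp (by rw [chord_comm, hc, chord_comm]) (by rw [chord_comm]; exact jpy)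
      hf).resolve_right fun hf' => hnot (f1 hf') (f3 hf)
  · intro s hs
    have mq := common_mem h₁ h₂ s
    have e1 := h₁.le_tau_apex hs
    have e2 := h₂.le_tau_apex hs
    have g1 := tau_pos (h₁.futC hs) h₁.hx (seg_mem h₁.hp h₁.jpy s)
    have g2 := tau_pos (h₂.futC hs) h₂.hx (seg_mem h₂.hp h₂.jpy s)
    have e3 := ofReal_add_le g1 g2 e1 e2
    rw [hxz, ENNReal.ofReal_le_ofReal_iff (by linarith), seg_rev_common h₁ h₂, tau_rev mq hz] at e3
    rw [txz]
    exact e3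

lemma gluedCorr_of_xy {s t : ℝ} (hs : s ∈ Icc (0 : ℝ) 1) (ht : t ∈ Icc (0 : ℝ) 1)
    (he : ENNReal.ofReal (LorentzModel.tau K x' (seg K x' y' s)) = L.tau (B₁ 0) (B₁ t)) :
    GluedCorr K A₁ B₁ A₂ B₂ x' y' z' p' (B₁ t) (seg K x' y' s) := by
  have fxy := fut_of_tau_pos hx' (txy ▸ h₁.rayB.pos)
  exact ⟨t, ht, Or.inl ⟨rfl, by rw [h₁.rayB.eq_of_tau_eq hx' hy' fxy txy hs ht he]⟩⟩

lemma gluedCorr_of_yz {s t : ℝ} (hs : s ∈ Icc (0 : ℝ) 1) (ht : t ∈ Icc (0 : ℝ) 1)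
    (he : ENNReal.ofReal (LorentzModel.tau K y' (seg K y' z' s)) = L.tau (B₂ 1) (B₂ (1 - t))) :
    GluedCorr K A₁ B₁ A₂ B₂ x' y' z' p' (B₂ (1 - t)) (seg K y' z' s) := by
  have fyz := fut_of_tau_pos hy' (tyz ▸ h₂.rayB.pos)
  have := h₂.rayB.of_reverse.eq_of_tau_eq hy' hz' fyz tyz hs ht (by rw [he, sub_zero])
  exact ⟨t, ht, Or.inr (Or.inr (Or.inr ⟨rfl, by rw [this]⟩))⟩

lemma tau_seg_xz {s : ℝ} (hs : s ∈ Icc (0 : ℝ) 1) :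
    LorentzModel.tau K x' (seg K x' z' s) = s * (l₁ + l₂) := by
  have fxz := fut_of_tau_pos hx' (txz ▸ add_pos h₁.rayA.pos h₂.rayA.pos)
  rcases hs.1.eq_or_lt with rfl | h0
  · rw [seg_zero, tau_eq_zero hx' fun hh => by simpa using hh.1, zero_mul]
  · rw [(tau_seg_zero hx' hz' fxz h0 hs.2).2, txz]

lemma gluedCorr_of_xp (h : Glued K x p y p₂ y₂ z x' y' z' (l₁ / (l₁ + l₂)))
    {s t : ℝ} (hs : s ∈ Icc (0 : ℝ) 1) (ht : t ∈ Icc (0 : ℝ) 1)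
    (he : ENNReal.ofReal (LorentzModel.tau K x' (seg K x' z' s)) = L.tau (A₁ 0) (A₁ t)) :
    GluedCorr K A₁ B₁ A₂ B₂ x' y' z' (seg K x' z' (l₁ / (l₁ + l₂))) (A₁ t) (seg K x' z' s) := by
  have l₁0 := h₁.rayA.pos
  have l₂0 := h₂.rayA.pos
  refine ⟨t, ht, Or.inr (Or.inl ⟨rfl, ?_⟩)⟩
  rw [tau_seg_xz h₁ h₂ hx' hy' hz' txy tyz txz hxz hs, h₁.rayA.tau_zero ht.1 ht.2,
    ENNReal.ofReal_eq_ofReal_iff (mul_nonneg hs.1 (by linarith)) (mul_nonneg ht.1 l₁0.le)] at he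
  have : s = t * (l₁ / (l₁ + l₂)) := by field_simp; exact he
  rw [h.seg_xp', this]

/-- Here the separation from x is only bounded from below by the sum along the two rays. Since the
total separation of x and z equals the total length, the remaining piece forces equality and hence
fixes the parameter. -/
lemma gluedCorr_of_pz (h : Glued K x p y p₂ y₂ z x' y' z' (l₁ / (l₁ + l₂)))
    {s t : ℝ} (hs : s ∈ Icc (0 : ℝ) 1) (ht : t ∈ Icc (0 : ℝ) 1)
    (he : ENNReal.ofReal (LorentzModel.tau K x' (seg K x' z' s)) = L.tau (A₁ 0) (A₂ (1 - t))) :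
    GluedCorr K A₁ B₁ A₂ B₂ x' y' z' (seg K x' z' (l₁ / (l₁ + l₂))) (A₂ (1 - t))
      (seg K x' z' s) := by
  have l₁0 := h₁.rayA.pos
  have l₂0 := h₂.rayA.pos
  refine ⟨t, ht, Or.inr (Or.inr (Or.inl ⟨rfl, ?_⟩))⟩
  have ray := h₂.rayA.of_reverse
  have hA : A₁ 1 = A₂ (1 - 0) := by rw [sub_zero, h₁.AC, ← h₂.AC]
  have c1 : L.le (A₁ 0) (A₁ 1) := h₁.rayA.causal le_rfl zero_le_one le_rfl
  have c2 : L.le (A₁ 1) (A₂ (1 - t)) := hA ▸ ray.causal le_rfl ht.1 ht.2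
  have c3 : L.le (A₂ (1 - t)) (A₂ (1 - 1)) := ray.causal ht.1 ht.2 le_rfl
  have r1 := L.reverse_triangle _ _ _ c1 c2
  have r2 := L.reverse_triangle _ _ _ (L.le_trans _ _ _ c1 c2) c3
  have t1 := ray.tau_zero ht.1 ht.2
  have t2 := ray.tau_eq ht.1 ht.2 le_rfl
  have k1 : 0 ≤ s * (l₁ + l₂) := mul_nonneg hs.1 (by linarith)
  have k2 : 0 ≤ t * l₂ := mul_nonneg ht.1 l₂0.le
  have k3 : 0 ≤ (1 - t) * l₂ := mul_nonneg (by linarith [ht.2]) l₂0.le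
  rw [tau_seg_xz h₁ h₂ hx' hy' hz' txy tyz txz hxz hs] at he
  rw [← hA] at t1
  rw [← he, h₁.rayA.eq, t1, ← ENNReal.ofReal_add l₁0.le k2, ENNReal.ofReal_le_ofReal_iff k1] at r1
  rw [← he, t2, sub_self, hxz, ← ENNReal.ofReal_add k1 k3,
    ENNReal.ofReal_le_ofReal_iff (by linarith)] at r2
  have : s = l₁ / (l₁ + l₂) + t * (1 - l₁ / (l₁ + l₂)) := by
    have : s * (l₁ + l₂) = l₁ + t * l₂ := by linarith
    field_simp
    linarith
  rw [h.seg_pz', this]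

end Gluing

/-- The partition with the single interior point `c` bounds the length of the curve from above; the
other inequality is the reverse triangle inequality. -/
lemma IsRealizingCurve.tau_add_tau {U : Set X} {γ : ℝ → X} {x z : X}
    (h : L.IsRealizingCurve U γ x z) {c : ℝ} (hc : c ∈ Ioo (0 : ℝ) 1) :
    L.tau x z = L.tau x (γ c) + L.tau (γ c) z := by
  obtain ⟨⟨-, hle⟩, -, rfl, rfl, hτ⟩ := h
  have hcI : c ∈ Icc (0 : ℝ) 1 := ⟨hc.1.le, hc.2.le⟩
  refine le_antisymm ?_ (L.reverse_triangle _ _ _ (hle 0 (by simp) c hcI hc.1)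
    (hle c hcI 1 (by simp) hc.2))
  rw [← hτ]
  -- Only indices up to 2 matter, so the constant value beyond them does no harm to strict
  -- monotonicity.
  refine iInf_le_of_le 1 (iInf_le_of_le (fun i => if i = 0 then 0 else if i = 1 then c else 1)
    (iInf_le_of_le ⟨by simp, by simp, ?_⟩ ?_))
  · intro i hi j hj hij
    have hj2 : j ≤ 2 := hj
    have h0 := hc.1
    have h1 := hc.2
    interval_cases j <;> interval_cases i <;> simp_all
  · simp [Finset.sum_range_succ]

end LorentzianPreLengthSpace

end

/-! ### Assembly of the gluing theorem -/

theorem mainTheorem5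
    {X : Type*} [MetricSpace X] (L : LorentzianPreLengthSpace X)
    {E₁ : Type*} [NormedAddCommGroup E₁] [NormedSpace ℝ E₁] [FiniteDimensional ℝ E₁]
    {X₁ : Type*} [TopologicalSpace X₁] [T2Space X₁] [SecondCountableTopology X₁]
    [ChartedSpace E₁ X₁] [IsManifold 𝓘(ℝ, E₁) ∞ X₁] (S₁ : Spacetime E₁ X₁)
    {E₂ : Type*} [NormedAddCommGroup E₂] [NormedSpace ℝ E₂] [FiniteDimensional ℝ E₂]
    {X₂ : Type*} [TopologicalSpace X₂] [T2Space X₂] [SecondCountableTopology X₂]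
    [ChartedSpace E₂ X₂] [IsManifold 𝓘(ℝ, E₂) ∞ X₂] (S₂ : Spacetime E₂ X₂)
    (hS₁ : S₁.IsStronglyCausal) (hS₂ : S₂.IsStronglyCausal) (K : ℝ)
    -- the sets in which the triangles lie
    (U : Set X) (hU : L.IsTimelikeGeodesicSet U)
    (U₁ N₁ : Set X₁) (hU₁ : S₁.IsTimelikeGeodesicSet U₁)
    (hN₁ : S₁.IsNormalNeighbourhood N₁) (hUN₁ : U₁ ⊆ N₁)
    (U₂ N₂ : Set X₂) (hU₂ : S₂.IsTimelikeGeodesicSet U₂)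
    (hN₂ : S₂.IsNormalNeighbourhood N₂) (hUN₂ : U₂ ⊆ N₂)
    -- the timelike triangle `Δ(x, y, z)`, with size bounds, and the point `p = γxz c` on `[x, z]`
    (x y z p : X) (γxy γyz γxz : ℝ → X) (c : ℝ)
    (hT : L.IsTimelikeTriangle U x y z γxy γyz γxz)
    (hsize : K < 0 → L.tau x z < ENNReal.ofReal (Real.pi / √(-K)))
    (hc : c ∈ Icc (0 : ℝ) 1) (hp : γxz c = p) (hxp : L.ll x p) (hpz : L.ll p z)
    -- the geodesic triangles `Δ(x₁, p₁, y₁)` and `Δ(p₂, y₂, z₂)`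
    (x₁ p₁ y₁ : X₁) (σ₁ : Fin 3 → ℝ → X₁) (hT₁ : S₁.IsGeodesicTriangle U₁ x₁ p₁ y₁ σ₁)
    (hxp₁ : S₁.JoinedByTimelikeSegment U₁ x₁ p₁) (hxy₁ : S₁.JoinedByTimelikeSegment U₁ x₁ y₁)
    (p₂ y₂ z₂ : X₂) (σ₂ : Fin 3 → ℝ → X₂) (hT₂ : S₂.IsGeodesicTriangle U₂ p₂ y₂ z₂ σ₂)
    (hpz₂ : S₂.JoinedByTimelikeSegment U₂ p₂ z₂) (hyz₂ : S₂.JoinedByTimelikeSegment U₂ y₂ z₂)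
    -- equality of the side lengths
    (htxp : S₁.tau x₁ p₁ = L.tau x p) (htxy : S₁.tau x₁ y₁ = L.tau x y)
    (htpz : S₂.tau p₂ z₂ = L.tau p z) (htyz : S₂.tau y₂ z₂ = L.tau y z)
    (hpy : S₁.signedDist N₁ p₁ y₁ = S₂.signedDist N₂ p₂ y₂)
    -- `Δ(x, y, z)` is glued from the two triangles along `[p₁, y₁]` and `[p₂, y₂]`
    (φ₁ : X₁ → X) (φ₂ : X₂ → X)
    (hφ₁ : ∀ a ∈ Spacetime.trianglePoints σ₁, ∀ b ∈ Spacetime.trianglePoints σ₁,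
      (S₁.le a b → L.le (φ₁ a) (φ₁ b)) ∧ S₁.tau a b ≤ L.tau (φ₁ a) (φ₁ b))
    (hφ₂ : ∀ a ∈ Spacetime.trianglePoints σ₂, ∀ b ∈ Spacetime.trianglePoints σ₂,
      (S₂.le a b → L.le (φ₂ a) (φ₂ b)) ∧ S₂.tau a b ≤ L.tau (φ₂ a) (φ₂ b))
    (hφx : φ₁ x₁ = x) (hφp₁ : φ₁ p₁ = p) (hφy₁ : φ₁ y₁ = y)
    (hφp₂ : φ₂ p₂ = p) (hφy₂ : φ₂ y₂ = y) (hφz : φ₂ z₂ = z)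
    (hφxp : φ₁ '' (σ₁ 0 '' Icc 0 1) = γxz '' Icc 0 c)
    (hφxy : φ₁ '' (σ₁ 2 '' Icc 0 1) = γxy '' Icc 0 1)
    (hφpz : φ₂ '' (σ₂ 2 '' Icc 0 1) = γxz '' Icc c 1)
    (hφyz : φ₂ '' (σ₂ 1 '' Icc 0 1) = γyz '' Icc 0 1)
    (hφpy : ∀ s ∈ Icc (0 : ℝ) 1, φ₁ (σ₁ 1 s) = φ₂ (σ₂ 0 s))
    -- the curvature bounds for the two triangles
    (hK₁ : S₁.SatisfiesCurvatureBoundAbove K N₁ σ₁)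
    (hK₂ : S₂.SatisfiesCurvatureBoundAbove K N₂ σ₂) :
    L.TriangleCurvatureBoundedAbove K x y z γxy γyz γxz := by
  intro x' y' z' hcomp a b a' b' ha hb
  obtain ⟨hx', hy', hz', txy, tyz, txz⟩ := hcomp
  obtain ⟨-, -, rxy, ryz, rxz⟩ := hT
  obtain ⟨⟨q₁0, n₁0, i₁0, j₁0⟩, ⟨q₁1, n₁1, i₁1, j₁1⟩, ⟨q₁2, n₁2, i₁2, j₁2⟩⟩ := hT₁
  obtain ⟨⟨q₂0, n₂0, i₂0, j₂0⟩, ⟨q₂1, n₂1, i₂1, j₂1⟩, ⟨q₂2, n₂2, i₂2, j₂2⟩⟩ := hT₂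
  have g₁ : ∀ j, S₁.IsGeodesicIn N₁ (σ₁ j) (σ₁ j 0) (σ₁ j 1) := by
    intro j
    fin_cases j
    exacts [⟨q₁0, n₁0.mono_right hUN₁, rfl, rfl⟩, ⟨q₁1, n₁1.mono_right hUN₁, rfl, rfl⟩,
      ⟨q₁2, n₁2.mono_right hUN₁, rfl, rfl⟩]
  have g₂ : ∀ j, S₂.IsGeodesicIn N₂ (σ₂ j) (σ₂ j 0) (σ₂ j 1) := by
    intro j
    fin_cases j
    exacts [⟨q₂0, n₂0.mono_right hUN₂, rfl, rfl⟩, ⟨q₂1, n₂1.mono_right hUN₂, rfl, rfl⟩,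
      ⟨q₂2, n₂2.mono_right hUN₂, rfl, rfl⟩]
  have cyc₁ : ∀ j, σ₁ j 1 = σ₁ (j + 1) 0 := by
    intro j
    fin_cases j
    exacts [j₁0.trans i₁1.symm, j₁1.trans i₁2.symm, j₁2.trans i₁0.symm]
  have cyc₂ : ∀ j, σ₂ j 1 = σ₂ (j + 1) 0 := by
    intro j
    fin_cases j
    exacts [j₂0.trans i₂1.symm, j₂1.trans i₂2.symm, j₂2.trans i₂0.symm]
  have k₁0 := g₁ 0
  have k₁2 := g₁ 2
  have k₂1 := g₂ 1
  have k₂2 := g₂ 2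
  rw [i₁0, j₁0] at k₁0
  rw [i₁2, j₁2] at k₁2
  rw [i₂1, j₂1] at k₂1
  rw [i₂2, j₂2] at k₂2
  obtain ⟨l₁, l₁0, tl₁, dl₁, ul₁⟩ := hxp₁.exists_length S₁ hN₁ hUN₁ k₁0
  obtain ⟨m₁, m₁0, tm₁, dm₁, um₁⟩ := hxy₁.exists_length_reverse S₁ hN₁ hUN₁ k₁2
  obtain ⟨l₂, l₂0, tl₂, dl₂, ul₂⟩ := hpz₂.exists_length_reverse S₂ hN₂ hUN₂ k₂2
  obtain ⟨m₂, m₂0, tm₂, dm₂, um₂⟩ := hyz₂.exists_length S₂ hN₂ hUN₂ k₂1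
  have hI : ∀ {s t : ℝ}, 0 ≤ s → s ≤ t → t ≤ 1 → s ∈ Icc (0 : ℝ) 1 ∧ t ∈ Icc (0 : ℝ) 1 :=
    fun hs hst ht => ⟨⟨hs, hst.trans ht⟩, hs.trans hst, ht⟩
  have mem₁ := fun j s hs => Spacetime.mem_trianglePoints (σ := σ₁) j (s := s) hs
  have mem₂ := fun j s hs => Spacetime.mem_trianglePoints (σ := σ₂) j (s := s) hs
  have rayA₁ : L.IsRay (fun s => φ₁ (σ₁ 0 s)) l₁ := by
    refine ⟨l₁0, fun s t hs hst ht => ?_, ?_⟩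
    · obtain ⟨is, it⟩ := hI hs hst ht
      exact (ul₁ s t hs hst ht).trans (hφ₁ _ (mem₁ 0 s is) _ (mem₁ 0 t it)).2
    · simp only [i₁0, j₁0, hφx, hφp₁, ← htxp, tl₁]
  have rayB₁ : L.IsRay (fun s => φ₁ (σ₁ 2 (1 - s))) m₁ := by
    refine ⟨m₁0, fun s t hs hst ht => ?_, ?_⟩
    · obtain ⟨is, it⟩ := hI hs hst ht
      have := um₁ (1 - t) (1 - s) (by linarith) (by linarith) (by linarith)
      rw [sub_sub_sub_cancel_left] at this
      exact this.trans (hφ₁ _ (mem₁ 2 _ (LorentzModel.one_sub_mem is)) _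
        (mem₁ 2 _ (LorentzModel.one_sub_mem it))).2
    · simp only [sub_zero, sub_self, i₁2, j₁2, hφx, hφy₁, ← htxy, tm₁]
  have rayA₂ : L.reverse.IsRay (fun s => φ₂ (σ₂ 2 s)) l₂ := by
    refine ⟨l₂0, fun s t hs hst ht => ?_, ?_⟩
    · obtain ⟨is, it⟩ := hI hs hst ht
      exact (ul₂ s t hs hst ht).trans (hφ₂ _ (mem₂ 2 t it) _ (mem₂ 2 s is)).2
    · change L.tau (φ₂ (σ₂ 2 1)) (φ₂ (σ₂ 2 0)) = _
      rw [i₂2, j₂2, hφp₂, hφz, ← htpz, tl₂]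
  have rayB₂ : L.reverse.IsRay (fun s => φ₂ (σ₂ 1 (1 - s))) m₂ := by
    refine ⟨m₂0, fun s t hs hst ht => ?_, ?_⟩
    · obtain ⟨is, it⟩ := hI hs hst ht
      have := um₂ (1 - t) (1 - s) (by linarith) (by linarith) (by linarith)
      rw [sub_sub_sub_cancel_left] at this
      exact this.trans (hφ₂ _ (mem₂ 1 _ (LorentzModel.one_sub_mem it)) _
        (mem₂ 1 _ (LorentzModel.one_sub_mem is))).2
    · change L.tau (φ₂ (σ₂ 1 (1 - 1))) (φ₂ (σ₂ 1 (1 - 0))) = _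
      rw [sub_self, sub_zero, i₂1, j₂1, hφy₂, hφz, ← htyz, tm₂]
  obtain ⟨v₁, hv₁, hle₁⟩ := hK₁
  obtain ⟨v₂, hv₂, hle₂⟩ := hK₂
  -- The first triangle is based at x, the vertex with index 0.
  have comp₁ := S₁.comparable (A := fun s => φ₁ (σ₁ 0 s)) (B := fun s => φ₁ (σ₁ 2 (1 - s)))
    hN₁ g₁ cyc₁ (Or.inl fun a ha b hb => (hφ₁ a ha b hb).2) hv₁ hle₁ 0
    (fun s _ => rfl) (fun s _ => rfl) (fun s _ => rfl) rayA₁ rayB₁ (by rw [i₁0, j₁0]; exact dl₁)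
    (by rw [zero_add, i₁2, j₁2]; exact dm₁)
  -- The second triangle is based at z, the vertex with index 2, in the reversed space. Its third
  -- side is written with the first gluing map, so that both triangles share the same curve in `X`.
  have comp₂ := S₂.comparable (L := L.reverse) (A := fun s => φ₂ (σ₂ 2 s))
    (B := fun s => φ₂ (σ₂ 1 (1 - s))) (C := fun s => φ₁ (σ₁ 1 s)) hN₂ g₂ cyc₂
    (Or.inr fun a ha b hb => (hφ₂ a ha b hb).2) hv₂ hle₂ 2
    (fun s _ => rfl) (fun s _ => rfl) (fun s hs => hφpy s hs) rayA₂ rayB₂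
    (by rw [i₂2, j₂2]; exact dl₂)
    (by change S₂.signedDist N₂ (σ₂ 1 0) (σ₂ 1 1) = -m₂; rw [i₂1, j₂1]; exact dm₂)
  -- Equal signed lengths give equal energies, as the signed root is injective, and the energy
  -- determines the chord.
  have hchord : LorentzModel.chord K (v₁ 1) (v₁ 2) = LorentzModel.chord K (v₂ 0) (v₂ 1) := by
    obtain ⟨w₁, ww₁, www₁⟩ := hv₁ 1
    obtain ⟨w₂, ww₂, www₂⟩ := hv₂ 0
    rw [i₁1, j₁1, hpy] at www₁
    rw [i₂0, j₂0, www₁] at www₂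
    have he := signedRoot_strictMono.injective www₂
    exact (ww₁.isLog.chord_eq w₁).trans (by rw [he]; exact (ww₂.isLog.chord_eq w₂).symm)
  obtain ⟨x₀, p₀, y₀, or₁, hc₁⟩ := comp₁.exists_oriented
  obtain ⟨z₀, q₀, r₀, or₂, hc₂⟩ := comp₂.exists_oriented
  -- The triangle oriented in the reversed space is written as the reversal of one in the original
  -- orientation.
  rw [← LorentzModel.rev_rev z₀, ← LorentzModel.rev_rev q₀, ← LorentzModel.rev_rev r₀] at or₂
  have hc₀ : LorentzModel.chord K p₀ y₀ =
      LorentzModel.chord K (LorentzModel.rev q₀) (LorentzModel.rev r₀) := by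
    rw [LorentzModel.chord_rev, hc₁, hc₂]
    exact hchord
  have tauxp : L.tau x p = ENNReal.ofReal l₁ := htxp ▸ tl₁
  have taupz : L.tau p z = ENNReal.ofReal l₂ := htpz ▸ tl₂
  -- If `c` were an endpoint, p would coincide with x or z and precede itself; adding this loop to a
  -- finite time separation contradicts the reverse triangle inequality.
  have hcI : c ∈ Ioo (0 : ℝ) 1 := by
    obtain ⟨-, -, rx, rz, -⟩ := rxz
    have irr : ∀ {u w : X} {l : ℝ}, L.ll u u → L.tau u w = ENNReal.ofReal l → 0 < l → False := by
      intro u w l hu hl l0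
      have h1 := L.reverse_triangle u u w (L.le_refl u)
        (LorentzianPreLengthSpace.le_of_ofReal_le l0 hl.ge)
      rw [hl] at h1
      exact (ENNReal.lt_add_right ENNReal.ofReal_ne_top ((L.tau_pos_iff _ _).2 hu).ne').not_ge
        (add_comm _ (L.tau u u) ▸ h1)
    refine ⟨lt_of_le_of_ne hc.1 fun e => ?_, lt_of_le_of_ne hc.2 fun e => ?_⟩
    · rw [← e, rx] at hp
      exact irr (hp ▸ hxp) tauxp l₁0
    · rw [e, rz] at hp
      exact irr (hp ▸ hpz) taupz l₂0
  have hxz : L.tau x z = ENNReal.ofReal (l₁ + l₂) := by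
    rw [rxz.tau_add_tau hcI, hp, tauxp, taupz, ENNReal.ofReal_add l₁0.le l₂0.le]
  have toReal_eq : ∀ {u l : ℝ}, 0 < l → ENNReal.ofReal u = ENNReal.ofReal l → u = l := by
    intro u l hl h
    have hu : 0 < u := ENNReal.ofReal_pos.1 (h ▸ ENNReal.ofReal_pos.2 hl)
    exact (ENNReal.ofReal_eq_ofReal_iff hu.le hl.le).1 h
  have txy' := toReal_eq m₁0 (txy.trans (htxy.symm.trans tm₁))
  have tyz' := toReal_eq m₂0 (tyz.trans (htyz.symm.trans tm₂))
  have txz' := toReal_eq (add_pos l₁0 l₂0) (txz.trans hxz)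
  have hxz' : L.tau (φ₁ (σ₁ 0 0)) (φ₂ (σ₂ 2 0)) = ENNReal.ofReal (l₁ + l₂) := by
    rw [i₁0, i₂2, hφx, hφz, hxz]
  have hglued := LorentzianPreLengthSpace.glued or₁ or₂ hx' hy' hz' txy' tyz' txz' hxz' hc₀
  have corr : ∀ {a a'}, (L.IsComparisonPoint K γxy x' y' a a' ∨
      L.IsComparisonPoint K γyz y' z' a a' ∨ L.IsComparisonPoint K γxz x' z' a a') →
      LorentzianPreLengthSpace.GluedCorr K (fun s => φ₁ (σ₁ 0 s)) (fun s => φ₁ (σ₁ 2 (1 - s)))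
        (fun s => φ₂ (σ₂ 2 s)) (fun s => φ₂ (σ₂ 1 (1 - s))) x' y' z'
        (LorentzModel.seg K x' z' (l₁ / (l₁ + l₂))) a a' := by
    rintro a a' (⟨ha, ⟨s, hs, rfl⟩, he⟩ | ⟨ha, ⟨s, hs, rfl⟩, he⟩ | ⟨ha, ⟨s, hs, rfl⟩, he⟩)
    · rw [← hφxy] at ha
      obtain ⟨-, ⟨t, ht, rfl⟩, rfl⟩ := ha
      rw [rxy.2.2.1] at he
      have := LorentzianPreLengthSpace.gluedCorr_of_xy
        (p' := LorentzModel.seg K x' z' (l₁ / (l₁ + l₂))) or₁ or₂ hx' hy' hz' txy' tyz' txz' hxz' hs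
        (LorentzModel.one_sub_mem ht) (by simpa only [sub_zero, sub_sub_cancel, j₁2, hφx] using he)
      simpa only [sub_sub_cancel] using this
    · rw [← hφyz] at ha
      obtain ⟨-, ⟨t, ht, rfl⟩, rfl⟩ := ha
      rw [ryz.2.2.1] at he
      have := LorentzianPreLengthSpace.gluedCorr_of_yz
        (p' := LorentzModel.seg K x' z' (l₁ / (l₁ + l₂))) or₁ or₂ hx' hy' hz' txy' tyz' txz' hxz' hs
        ht (by simpa only [sub_self, sub_sub_cancel, i₂1, hφy₂] using he)
      simpa only [sub_sub_cancel] using this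
    · rw [rxz.2.2.1] at he
      obtain ⟨t, ht, rfl⟩ := ha
      -- A point of the long side belongs to the image of one small triangle or the other, according
      -- to its position relative to p.
      rcases le_total t c with htc | htc
      · have ha : γxz t ∈ γxz '' Icc 0 c := ⟨t, ⟨ht.1, htc⟩, rfl⟩
        rw [← hφxp] at ha
        obtain ⟨-, ⟨r, hr, rfl⟩, hra⟩ := ha
        rw [← hra] at he ⊢
        exact LorentzianPreLengthSpace.gluedCorr_of_xp or₁ or₂ hx' hy' hz' txy' tyz' txz' hxz'
          hglued hs hr (by rw [he, i₁0, hφx])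
      · have ha : γxz t ∈ γxz '' Icc c 1 := ⟨t, ⟨htc, ht.2⟩, rfl⟩
        rw [← hφpz] at ha
        obtain ⟨-, ⟨r, hr, rfl⟩, hra⟩ := ha
        rw [← hra] at he ⊢
        have := LorentzianPreLengthSpace.gluedCorr_of_pz or₁ or₂ hx' hy' hz' txy' tyz' txz' hxz'
          hglued hs (LorentzModel.one_sub_mem hr) (by rw [he, i₁0, hφx, sub_sub_cancel])
        simpa only [sub_sub_cancel] using this
  -- If the comparison points are not related, the model separation is 0 and nothing is claimed.
  by_cases hf : LorentzModel.Fut K a' b'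
  · exact LorentzianPreLengthSpace.le_tau_of_gluedCorr or₁ or₂ hglued (corr ha) (corr hb) hf
  · have ma : a' ∈ LorentzModel.points K := by
      rcases ha with ⟨-, ⟨s, -, rfl⟩, -⟩ | ⟨-, ⟨s, -, rfl⟩, -⟩ | ⟨-, ⟨s, -, rfl⟩, -⟩
      · exact LorentzModel.seg_mem hx' (hglued.xy'.joined hx' hy') s
      · exact LorentzModel.seg_mem hy' (hglued.yz'.joined hy' hz') s
      · exact LorentzModel.seg_mem hx' hglued.jxz' s
    rw [LorentzModel.tau_eq_zero ma hf, ENNReal.ofReal_zero]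
    exact bot_le
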